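/- **Proposition 5.4 (some negative regularity).** Let $d\ge 9$ and $F(z)=|z|^{\frac{8}{d-4}}z$. Write $\hat f(\xi)=(2\pi)^{-d/2}\int_{\mathbb R^d} e^{-ix\cdot\xi}f(x)\,dx$ and $\|f\|_{\dot H^\sigma}=\||\xi|^\sigma\hat f\|_{L^2}$. Let $\varphi$ be a smooth radial function on $\mathbb R^d$ supported in $|\xi|\le\frac{11}{10}$ and equal to $1$ on $|\xi|\le1$, let $\widehat{P_Nf}(\xi)=(\varphi(\xi/N)-\varphi(2\xi/N))\hat f(\xi)$, and let $$\|f\|_{\dot\Lambda_s^{r,\infty}}=\sup_{N\in 2^{\mathbb Z}}N^s\|P_Nf\|_{L^r}.$$ Let $u:\mathbb R\times\mathbb R^d\to\mathbb C$ be a global solution of $iu_t+\Delta^2u=-F(u)$, that is, $u\in C_t^0\dot H_x^2(K\times\mathbb R^d)\cap L_{t,x}^{\frac{2(d+4)}{d-4}}(K\times\mathbb R^d)$ for all compact $K\subset\mathbb R$ and, for some initial time $t_0$ and all $t\in\mathbb R$, $$u(t)=e^{i(t-t_0)\Delta^2}u(t_0)+i\int_{t_0}^te^{i(t-\tau)\Delta^2}F(u(\tau))\,d\tau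 .$$ Suppose that its energy $E(u)=\frac12\int|\Delta u|^2dx+\frac{d-4}{2d}\int|u|^{\frac{2d}{d-4}}dx$ is finite, and that $u$ is almost periodic modulo symmetries with frequency scale function $N(t)\ge1$: there are functions $N:\mathbb R\to[1,\infty)$, $x:\mathbb R\to\mathbb R^d$ and $C:(0,\infty)\to(0,\infty)$ such that for all $t\in\mathbb R$ and $\eta>0$ $$\int_{|x-x(t)|\ge C(\eta)/N(t)}|\Delta u(t,x)|^2dx\le\eta,\qquad \int_{|\xi|\ge C(\eta)N(t)}|\xi|^4|\hat u(t,\xi)|^2d\xi\le\eta .$$ Assume further that $F(u)\in L_t^\infty\dot\Lambda_s^{r,\infty}(\mathbb R\times\mathbb R^d)$ for some $r$ with $$\frac{2d(d+4)(d-4)}{d^3+8d^2-16d-64}\le r<\frac{2d}{d+8}$$ and some $0\le s\le2$. Then $s_0:=\frac dr-\frac{d+8}2>0$ and, for every $\varepsilon>0$ with $s-s_0+\varepsilon\le2$, $$\sup_{t\in\mathbb R}\|u(t)\|_{\dot H^{s-s_0+\varepsilon}}<\infty,$$ that is, $u\in L_t^\infty\dot H^{s-s_0+}$. -/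

import Mathlib

open MeasureTheory Filter Topology Set
open scoped SchwartzMap FourierTransform Laplacian ENNReal

namespace FourthOrderNLS

noncomputable section

/-- Euclidean space `ℝ^d`. -/
abbrev Space (d : ℕ) := EuclideanSpace ℝ (Fin d)

variable {d : ℕ}

/-! ### Functions as tempered distributions -/

/-- The tempered distribution `T` is (integration against) the function `f`. For a given `f` there
is at most one such `T`, and for a given `T` such an `f` is unique almost everywhere. -/
def Represents (f : Space d → ℂ) (T : 𝓢'(Space d, ℂ)) : Prop :=
  ∀ ψ : 𝓢(Space d, ℂ), Integrable (fun x => ψ x * f x) ∧ T ψ = ∫ x, ψ x * f x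

/-- The identity `A f = g` in the sense of tempered distributions, for functions `f`, `g` and an
operator `A` on tempered distributions. -/
def ActsAs (A : 𝓢'(Space d, ℂ) → 𝓢'(Space d, ℂ)) (f g : Space d → ℂ) : Prop :=
  ∃ T : 𝓢'(Space d, ℂ), Represents f T ∧ Represents g (A T)

/-- `g` is the Fourier transform of `f` in the normalization
`g(ξ) = (2π)^(-d/2) ∫ exp(-i x·ξ) f(x) dx`, in the sense of tempered distributions. Mathlib's
transform `∫ exp(-2πi x·η) f(x) dx` is then `(2π)^(d/2) g(2πη)`. -/
def HasFourier (f g : Space d → ℂ) : Prop :=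
  ActsAs (fun T => 𝓕 T) f
    (fun η => (((2 * Real.pi) ^ ((d : ℝ) / 2) : ℝ) : ℂ) * g ((2 * Real.pi) • η))

/-- The operator with `(A f)^(ξ) = m(ξ) f^(ξ)` for the transform normalized as in `HasFourier`;
it is used only for smooth symbols `m` with derivatives of polynomial growth. -/
def multiplier (m : Space d → ℂ) : 𝓢'(Space d, ℂ) →L[ℂ] 𝓢'(Space d, ℂ) :=
  TemperedDistribution.fourierMultiplierCLM ℂ (fun η => m ((2 * Real.pi) • η))

/-- The free propagator `e^{itΔ²}`, with symbol `e^{it|ξ|⁴}`. -/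
def propagator (t : ℝ) : 𝓢'(Space d, ℂ) →L[ℂ] 𝓢'(Space d, ℂ) :=
  multiplier (fun ξ => Complex.exp (Complex.I * ((t * ‖ξ‖ ^ 4 : ℝ) : ℂ)))

/-! ### Homogeneous Sobolev and Besov norms -/

/-- The norm of `f` in the homogeneous Sobolev space `Ḣ^s`, i.e. the `L²` norm of `|ξ|^s f^(ξ)`.
It is `∞` if `f` is not a tempered distribution or if the Fourier transform of `f` is not a
function; otherwise the transform is unique up to null sets and the infimum is over equal
values. -/
def hdotNorm (s : ℝ) (f : Space d → ℂ) : ℝ≥0∞ :=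
  ⨅ (g : Space d → ℂ) (_ : HasFourier f g),
    (∫⁻ ξ, ENNReal.ofReal (‖ξ‖ ^ (2 * s)) * ‖g ξ‖ₑ ^ 2) ^ (1 / 2 : ℝ)

/-- The `L^r` norm of `A f`; it is `∞` if `A f` is not a function. -/
def opNorm (A : 𝓢'(Space d, ℂ) → 𝓢'(Space d, ℂ)) (r : ℝ≥0∞) (f : Space d → ℂ) : ℝ≥0∞ :=
  ⨅ (g : Space d → ℂ) (_ : ActsAs A f g), eLpNorm g r volume

/-- A radial bump function supported in `|ξ| ≤ 11/10` and equal to `1` on `|ξ| ≤ 1`. -/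
structure IsBump (φ : Space d → ℝ) : Prop where
  smooth : ContDiff ℝ (⊤ : ℕ∞) φ
  radial : ∀ ξ ξ' : Space d, ‖ξ‖ = ‖ξ'‖ → φ ξ = φ ξ'
  support : ∀ ξ : Space d, 11 / 10 < ‖ξ‖ → φ ξ = 0
  one : ∀ ξ : Space d, ‖ξ‖ ≤ 1 → φ ξ = 1

/-- The Littlewood–Paley operator `P_N`, with symbol `φ(ξ/N) - φ(2ξ/N)`. -/
def lpProj (φ : Space d → ℝ) (N : ℝ) : 𝓢'(Space d, ℂ) →L[ℂ] 𝓢'(Space d, ℂ) :=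
  multiplier (fun ξ => ((φ (N⁻¹ • ξ) - φ ((2 / N) • ξ) : ℝ) : ℂ))

/-- The norm `sup_N N^s ‖P_N f‖_{L^r}`, `N` dyadic, of the homogeneous Besov (Lipschitz) space
`Λ̇_s^{r,∞}`. -/
def besovNorm (φ : Space d → ℝ) (s r : ℝ) (f : Space d → ℂ) : ℝ≥0∞ :=
  ⨆ k : ℤ, ENNReal.ofReal (((2 : ℝ) ^ k) ^ s) *
    opNorm (lpProj φ ((2 : ℝ) ^ k)) (ENNReal.ofReal r) f

/-! ### The equation `i u_t + Δ² u = -|u|^{8/(d-4)} u` -/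

/-- The nonlinearity `F(z) = |z|^{8/(d-4)} z`. -/
def nonlin (d : ℕ) (z : ℂ) : ℂ := ((‖z‖ ^ (8 / ((d : ℝ) - 4)) : ℝ) : ℂ) * z

/-- The energy `½ ∫ |Δf|² + (d-4)/(2d) ∫ |f|^{2d/(d-4)}`. -/
def energy (f : Space d → ℂ) : ℝ≥0∞ :=
  ENNReal.ofReal (1 / 2) * opNorm (fun T => Δ T) 2 f ^ 2 +
    ENNReal.ofReal (((d : ℝ) - 4) / (2 * d)) *
      ∫⁻ x, ‖f x‖ₑ ^ (2 * (d : ℝ) / ((d : ℝ) - 4))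

/-- `u` is a global solution with initial time `t₀`: it lies in
`C_t Ḣ²_x(K × ℝ^d) ∩ L_{t,x}^{2(d+4)/(d-4)}(K × ℝ^d)` for all compact `K ⊂ ℝ` and satisfies
`u(t) = e^{i(t-t₀)Δ²} u(t₀) + i ∫_{t₀}^t e^{i(t-τ)Δ²} F(u(τ)) dτ` for all `t`, an identity of
tempered distributions with the integral taken in the weak sense. -/
structure IsGlobalSolution (t₀ : ℝ) (u : ℝ → Space d → ℂ) : Prop where
  mem_hdot : ∀ t, hdotNorm 2 (u t) < ∞
  continuous_hdot : ∀ t, Tendsto (fun t' => hdotNorm 2 (u t' - u t)) (𝓝 t) (𝓝 0)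
  memLp : ∀ K : Set ℝ, IsCompact K →
    MemLp (Function.uncurry u) (ENNReal.ofReal (2 * ((d : ℝ) + 4) / ((d : ℝ) - 4)))
      ((volume : Measure (ℝ × Space d)).restrict (K ×ˢ univ))
  duhamel : ∃ U V : ℝ → 𝓢'(Space d, ℂ),
    (∀ t, Represents (u t) (U t)) ∧
    (∀ t, Represents (fun x => nonlin d (u t x)) (V t)) ∧
    ∀ (t : ℝ) (ψ : 𝓢(Space d, ℂ)),
      IntervalIntegrable (fun τ => propagator (t - τ) (V τ) ψ) volume t₀ t ∧
      U t ψ = propagator (t - t₀) (U t₀) ψ +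
        Complex.I * ∫ τ in t₀..t, propagator (t - τ) (V τ) ψ

/-- `u`, defined on `ℝ × ℝ^d`, is almost periodic modulo symmetries with frequency scale
function `N`, spatial center function `x` and compactness modulus function `C`. Here `v` is
`Δu(t)` and `w` is the Fourier transform of `u(t)`. -/
structure IsAlmostPeriodic (u : ℝ → Space d → ℂ) (N : ℝ → ℝ) (x : ℝ → Space d) (C : ℝ → ℝ) :
    Prop where
  scale_pos : ∀ t, 0 < N t
  modulus_pos : ∀ η, 0 < η → 0 < C η
  compactness : ∀ t, ∃ v w : Space d → ℂ,
    ActsAs (fun T => Δ T) (u t) v ∧ HasFourier (u t) w ∧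
    ∀ η : ℝ, 0 < η →
      ∫⁻ y in {y | C η / N t ≤ ‖y - x t‖}, ‖v y‖ₑ ^ 2 ≤ ENNReal.ofReal η ∧
      ∫⁻ ξ in {ξ | C η * N t ≤ ‖ξ‖}, ENNReal.ofReal (‖ξ‖ ^ 4) * ‖w ξ‖ₑ ^ 2 ≤ ENNReal.ofReal η

end

end FourthOrderNLS

/-!
Why low frequencies of an almost periodic solution gain regularity.

Write `Φ(t) = F(u(t))` and let `D(t)` be minus the Laplacian of `u(t)`, an `L²`-valued function of
time (`exists_isL2Solution`). The argument has three parts.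

*Decay of the free flow.* The dispersive bound `|t|^{-d/4}` from `L¹` to `L^∞`
(`norm_integral_dispersive_le`) follows from that of the Schrödinger group: a Gaussian integral in
`σ` writes `e^{it|ξ|⁴}` as a superposition of the symbols `e^{iσ|ξ|²}`. Their bounds `|σ|^{-d/2}` are
not integrable at `σ = 0`, so the Gaussian weight is cut off there (`cutGaussian`); what the cutoff
removes is a sum of symbols that decay like Gaussians in `ξ`. Interpolation with `L²`, done here by
the three lines theorem on simple functions (`norm_inner_le_of_interpolation`), bounds pairings
`⟨g, e^{itΔ²} f⟩` by `|t|^{-(d/4)(2/r-1)} ‖f‖_r ‖g‖_r` (`norm_inner_flow_le`).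

*Double Duhamel.* `D(t)` is bounded in `L²` and localized to balls of fixed radius about `x(t)`, so
the dispersive bound makes `e^{-iTΔ²} D(T)` converge weakly to zero as `|T| → ∞`
(`tendsto_inner_flow`). Hence the piece `P_N u(t)` is the weak limit of Duhamel integrals, both from
the past and towards the future, and
`‖P_N u(t)‖² ≤ ∫_{τ<t} ∫_{τ'>t} |⟨P_N Φ(τ'), e^{i(τ'-τ)Δ²} P_N Φ(τ)⟩| dτ' dτ`
(`norm_le_of_tendsto_duhamelInt`). For `|τ'-τ| ≥ N^{-4}` the integrand is estimated by decay, for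
shorter times by Bernstein's inequality (`norm_inner_flow_fourierMulL_le`). The double integral
converges because `(d/4)(2/r-1) > 2`, which is the condition `s₀ > 0`, and scaling gives
`‖P_N u(t)‖ ≤ C N^{s₀-s}` (`IsL2Solution.norm_fourierMulL_le`). Summing `N^{2σ} ‖P_N u(t)‖²` over
dyadic `N ≤ 1` with `σ = s - s₀ + ε` is a geometric series; frequencies above one are controlled by
`sup_t ‖D(t)‖`, since `σ ≤ 2` (`exists_hdot_bound`).

*Boundedness in time.* The supremum of `‖D(t)‖` is finite since the energy is conserved, but only an
upper bound by the energy on one unit of time is needed (`IsL2Solution.exists_norm_le`). It is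
derived without regularizing the equation: the time averages `∫_t^{t+h} D` are differentiable in `t`,
and their energy identity (`IsL2Solution.energy_identity`) has as its right-hand side the work
`∫ Re ⟨∫_t^{t+h} Φ, u(t+h) - u(t)⟩ dt`. This work is `h` times the increment of the averaged potential
energy up to an error bounded by `∫∫ |u|^{8/(d-4)} |u(t+σ) - u(t)|²`. The Strichartz estimate
(`norm_integral_inner_le_strichartz`, from fractional integration in time and a duality argument)
bounds the increments on short intervals by their initial values, which are `o(√h)` in `L²`; so the
error is `o(h²)` (`IsL2Solution.eventually_abs_work_sub_le`), and division by `h²` gives the bound in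
the limit `h → 0`.
-/

namespace FourthOrderNLS

noncomputable section

variable {d : ℕ}

/-! ### Oscillatory integrals and the dispersive estimate -/

/-- `∫ 𝓕 f * g = ∫ f * 𝓕 g` for integrable functions. -/
theorem integral_fourier_mul_eq {f g : Space d → ℂ} (hf : Integrable f) (hg : Integrable g) :
    ∫ ξ, 𝓕 f ξ * g ξ = ∫ x, f x * 𝓕 g x := by
  have h := VectorFourier.integral_fourierIntegral_smul_eq_flip (L := innerₗ (Space d))
    Real.continuous_fourierChar continuous_inner hf hg
  rw [flip_innerₗ] at h
  exact h

theorem continuous_fourier {f : Space d → ℂ} (hf : Integrable f) : Continuous (𝓕 f) :=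
  VectorFourier.fourierIntegral_continuous Real.continuous_fourierChar
    (by exact continuous_inner) hf

theorem norm_fourier_le (f : Space d → ℂ) (ξ : Space d) : ‖𝓕 f ξ‖ ≤ ∫ x, ‖f x‖ :=
  VectorFourier.norm_fourierIntegral_le_integral_norm _ _ _ f ξ

theorem integrable_mul_fourier {m g : Space d → ℂ} (hm : Integrable m) (hg : Integrable g) :
    Integrable (fun ξ => m ξ * 𝓕 g ξ) :=
  hm.mul_bdd (c := ∫ x, ‖g x‖) (continuous_fourier hg).aestronglyMeasurable
    (Eventually.of_forall fun ξ => norm_fourier_le g ξ)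

/-- The multiplier with symbol `m` maps `L¹` to `L^∞` with norm at most the supremum of its
kernel. -/
theorem norm_integral_mul_fourier_mul_fourier_le {m : Space d → ℂ} (hm : Integrable m) {K : ℝ}
    (hK : ∀ x, ‖𝓕 m x‖ ≤ K) {f g : Space d → ℂ} (hf : Integrable f) (hg : Integrable g) :
    ‖∫ ξ, m ξ * (𝓕 f ξ * 𝓕 g ξ)‖ ≤ K * (∫ x, ‖f x‖) * ∫ x, ‖g x‖ := by
  have key : ∀ x, ‖𝓕 (fun ξ => m ξ * 𝓕 g ξ) x‖ ≤ K * ∫ y, ‖g y‖ := by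
    intro x
    have hmx : Integrable (fun v => Real.fourierChar (-inner ℝ v x) • m v) :=
      (Real.fourierIntegral_convergent_iff x).2 hm
    have h1 : 𝓕 (fun ξ => m ξ * 𝓕 g ξ) x
        = ∫ y, g y * 𝓕 (fun v => Real.fourierChar (-inner ℝ v x) • m v) y := by
      rw [← integral_fourier_mul_eq hg hmx, Real.fourier_eq]
      refine integral_congr_ae (Eventually.of_forall fun v => ?_)
      simp only [Circle.smul_def, smul_eq_mul]
      ring
    have h2 : ∀ y, 𝓕 (fun v => Real.fourierChar (-inner ℝ v x) • m v) y = 𝓕 m (x + y) := by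
      intro y
      rw [Real.fourier_eq, Real.fourier_eq]
      refine integral_congr_ae (Eventually.of_forall fun v => ?_)
      simp only [inner_add_right, neg_add, AddChar.map_add_eq_mul, Circle.smul_def, smul_eq_mul,
        Circle.coe_mul]
      ring
    rw [h1]
    refine (norm_integral_le_integral_norm _).trans ?_
    rw [← integral_const_mul]
    refine integral_mono_of_nonneg (Eventually.of_forall fun _ => norm_nonneg _)
      (hg.norm.const_mul K) (Eventually.of_forall fun y => ?_)
    simp only [norm_mul, h2]
    rw [mul_comm]
    exact mul_le_mul_of_nonneg_right (hK _) (norm_nonneg _)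
  have h3 : ∫ ξ, m ξ * (𝓕 f ξ * 𝓕 g ξ) = ∫ x, f x * 𝓕 (fun ξ => m ξ * 𝓕 g ξ) x := by
    rw [← integral_fourier_mul_eq hf (integrable_mul_fourier hm hg)]
    exact integral_congr_ae (Eventually.of_forall fun v => by ring)
  rw [h3]
  refine (norm_integral_le_integral_norm _).trans ?_
  calc ∫ x, ‖f x * 𝓕 (fun ξ => m ξ * 𝓕 g ξ) x‖
      ≤ ∫ x, (K * ∫ y, ‖g y‖) * ‖f x‖ := by
        refine integral_mono_of_nonneg (Eventually.of_forall fun _ => norm_nonneg _)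
          (hf.norm.const_mul _) (Eventually.of_forall fun y => ?_)
        simp only [norm_mul]
        rw [mul_comm]
        exact mul_le_mul_of_nonneg_right (key _) (norm_nonneg _)
    _ = _ := by rw [integral_const_mul]; ring

theorem norm_integral_symbol_mul_fourier_mul_fourier_le {m : Space d → ℂ} (hm : Integrable m)
    {f g : Space d → ℂ} (hf : Integrable f) (hg : Integrable g) :
    ‖∫ ξ, m ξ * (𝓕 f ξ * 𝓕 g ξ)‖ ≤ (∫ ξ, ‖m ξ‖) * (∫ x, ‖f x‖) * ∫ x, ‖g x‖ :=
  norm_integral_mul_fourier_mul_fourier_le hm (norm_fourier_le m) hf hg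

theorem integrable_gaussian {b : ℂ} (hb : 0 < b.re) :
    Integrable (fun ξ : Space d => Complex.exp (-b * ‖ξ‖ ^ 2)) := by
  simpa using GaussianFourier.integrable_cexp_neg_mul_sq_norm_add hb 0 (0 : Space d)

/-- Dispersive estimate for the second order Schrödinger group. -/
theorem norm_integral_schrodinger_le {σ : ℝ} (hσ : σ ≠ 0) {f g : Space d → ℂ}
    (hf : Integrable f) (hg : Integrable g) (hfg : Integrable (fun ξ => 𝓕 f ξ * 𝓕 g ξ)) :
    ‖∫ ξ, Complex.exp (Complex.I * ((σ * ‖ξ‖ ^ 2 : ℝ) : ℂ)) * (𝓕 f ξ * 𝓕 g ξ)‖ ≤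
      (Real.pi / |σ|) ^ ((d : ℝ) / 2) * (∫ x, ‖f x‖) * ∫ x, ‖g x‖ := by
  -- regularize the symbol by a Gaussian of width `δ⁻¹`
  have hlim : Tendsto (fun δ : ℝ => ∫ ξ, Complex.exp (-((δ : ℂ) - Complex.I * σ) * ‖ξ‖ ^ 2) *
      (𝓕 f ξ * 𝓕 g ξ)) (𝓝[>] 0)
      (𝓝 (∫ ξ, Complex.exp (Complex.I * ((σ * ‖ξ‖ ^ 2 : ℝ) : ℂ)) * (𝓕 f ξ * 𝓕 g ξ))) := by
    refine tendsto_integral_filter_of_dominated_convergence (fun ξ => ‖𝓕 f ξ * 𝓕 g ξ‖) ?_ ?_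
      hfg.norm ?_
    · exact Eventually.of_forall fun δ =>
        (by fun_prop : Continuous fun ξ : Space d =>
          Complex.exp (-((δ : ℂ) - Complex.I * σ) * ‖ξ‖ ^ 2)).aestronglyMeasurable.mul
          hfg.aestronglyMeasurable
    · filter_upwards [self_mem_nhdsWithin] with δ hδ
      refine Eventually.of_forall fun ξ => ?_
      rw [norm_mul]
      refine mul_le_of_le_one_left (norm_nonneg _) ?_
      rw [Complex.norm_exp, Real.exp_le_one_iff]
      have : (-((δ : ℂ) - Complex.I * σ) * (‖ξ‖ : ℂ) ^ 2).re = -δ * ‖ξ‖ ^ 2 := by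
        rw [← Complex.ofReal_pow, Complex.re_mul_ofReal]; simp
      rw [this]
      have : 0 < δ := hδ
      nlinarith [sq_nonneg ‖ξ‖]
    · refine Eventually.of_forall fun ξ => ?_
      refine Tendsto.mul_const _ (Tendsto.mono_left ?_ nhdsWithin_le_nhds)
      have : Continuous fun δ : ℝ => Complex.exp (-((δ : ℂ) - Complex.I * σ) * ‖ξ‖ ^ 2) := by
        fun_prop
      convert this.tendsto 0 using 2
      push_cast
      ring_nf
  refine le_of_tendsto hlim.norm ?_
  filter_upwards [self_mem_nhdsWithin] with δ hδ
  have hδ' : 0 < δ := hδ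
  have hre : 0 < ((δ : ℂ) - Complex.I * σ).re := by simpa using hδ'
  refine norm_integral_mul_fourier_mul_fourier_le (integrable_gaussian hre) (fun x => ?_) hf hg
  rw [fourier_gaussian_innerProductSpace hre, norm_mul]
  have hσle : |σ| ≤ ‖(δ : ℂ) - Complex.I * σ‖ := by
    simpa using Complex.abs_im_le_norm ((δ : ℂ) - Complex.I * σ)
  have hne : (δ : ℂ) - Complex.I * σ ≠ 0 := by
    intro h; rw [h] at hre; simp at hre
  have h1 : ‖((Real.pi : ℂ) / (δ - Complex.I * σ)) ^ ((Module.finrank ℝ (Space d) : ℂ) / 2)‖ ≤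
      (Real.pi / |σ|) ^ ((d : ℝ) / 2) := by
    have : ((Module.finrank ℝ (Space d) : ℂ) / 2) = (((d : ℝ) / 2 : ℝ) : ℂ) := by simp
    rw [this, Complex.norm_cpow_real, norm_div, Complex.norm_real, Real.norm_of_nonneg Real.pi_pos.le]
    have := abs_pos.2 hσ
    have := Real.pi_pos
    gcongr
  have h2 : ‖Complex.exp (-(Real.pi : ℂ) ^ 2 * ‖x‖ ^ 2 / (δ - Complex.I * σ))‖ ≤ 1 := by
    rw [Complex.norm_exp, Real.exp_le_one_iff]
    have : (-(Real.pi : ℂ) ^ 2 * ‖x‖ ^ 2 / (δ - Complex.I * σ)).re =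
        -(Real.pi ^ 2 * ‖x‖ ^ 2) * (δ / Complex.normSq (δ - Complex.I * σ)) := by
      have : (-(Real.pi : ℂ) ^ 2 * ‖x‖ ^ 2 / (δ - Complex.I * σ)) =
        ((-(Real.pi ^ 2 * ‖x‖ ^ 2) : ℝ) : ℂ) * (δ - Complex.I * σ)⁻¹ := by
          push_cast; rw [div_eq_mul_inv]; ring
      rw [this, Complex.re_ofReal_mul, Complex.inv_re]
      simp
    rw [this]
    have : 0 ≤ δ / Complex.normSq (δ - Complex.I * σ) :=
      div_nonneg hδ'.le (Complex.normSq_nonneg _)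
    have : 0 ≤ Real.pi ^ 2 * ‖x‖ ^ 2 := by positivity
    nlinarith
  calc _ ≤ (Real.pi / |σ|) ^ ((d : ℝ) / 2) * 1 := by
        gcongr
    _ = _ := mul_one _

theorem integral_gaussian_mul_exp {c : ℂ} (hc : 0 < c.re) (ρ : ℝ) :
    ∫ σ : ℝ, Complex.exp (Complex.I * ((σ * ρ : ℝ) : ℂ)) * Complex.exp (-c * σ ^ 2) =
      (Real.pi / c) ^ (1 / 2 : ℂ) * Complex.exp (-(ρ : ℂ) ^ 2 / (4 * c)) := by
  rw [← fourierIntegral_gaussian hc ρ]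
  refine integral_congr_ae (Eventually.of_forall fun σ => ?_)
  simp only [Complex.ofReal_mul]
  ring_nf

/-- The Gaussian `e^{-bσ²}` with its mass near `σ = 0` removed by the factor
`(1 - e^{-lσ²})^k`. -/
def cutGaussian (b : ℂ) (l : ℝ) (k : ℕ) (σ : ℝ) : ℂ :=
  Complex.exp (-b * σ ^ 2) * ((1 - Real.exp (-l * σ ^ 2) : ℝ) : ℂ) ^ k

theorem cutGaussian_eq_sum (b : ℂ) (l : ℝ) (k : ℕ) (σ : ℝ) :
    cutGaussian b l k σ = ∑ j ∈ Finset.range (k + 1),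
      ((-1) ^ j * (k.choose j : ℂ)) * Complex.exp (-(b + j * l) * σ ^ 2) := by
  unfold cutGaussian
  rw [show ((1 - Real.exp (-l * σ ^ 2) : ℝ) : ℂ) = -Complex.exp (-l * σ ^ 2) + 1 by
    push_cast; ring, add_pow, Finset.mul_sum]
  refine Finset.sum_congr rfl fun j _ => ?_
  rw [neg_pow, ← Complex.exp_nat_mul, one_pow, mul_one, show -(b + j * l) * (σ : ℂ) ^ 2 =
    -b * σ ^ 2 + j * (-l * σ ^ 2) by ring, Complex.exp_add]
  ring

theorem norm_cutGaussian_le {b : ℂ} (hb : 0 < b.re) {l : ℝ} (hl : 0 < l) (k : ℕ) (σ : ℝ) :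
    ‖cutGaussian b l k σ‖ ≤ (1 - Real.exp (-l * σ ^ 2)) ^ k := by
  have h0 : 0 ≤ 1 - Real.exp (-l * σ ^ 2) := by
    rw [sub_nonneg, Real.exp_le_one_iff]; nlinarith [sq_nonneg σ]
  unfold cutGaussian
  rw [norm_mul, norm_pow, Complex.norm_real, Real.norm_of_nonneg h0]
  refine mul_le_of_le_one_left (pow_nonneg h0 k) ?_
  rw [Complex.norm_exp, Real.exp_le_one_iff, ← Complex.ofReal_pow, Complex.re_mul_ofReal]
  simp only [Complex.neg_re]
  nlinarith [sq_nonneg σ]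

theorem re_add_nat_mul_pos {b : ℂ} (hb : 0 < b.re) {l : ℝ} (hl : 0 < l) (j : ℕ) :
    0 < (b + j * l).re := by
  have : (b + j * l).re = b.re + j * l := by simp
  rw [this]
  positivity

theorem integrable_cutGaussian {b : ℂ} (hb : 0 < b.re) {l : ℝ} (hl : 0 < l) (k : ℕ) :
    Integrable (cutGaussian b l k) := by
  have : cutGaussian b l k = fun σ : ℝ => ∑ j ∈ Finset.range (k + 1),
      ((-1) ^ j * (k.choose j : ℂ)) * Complex.exp (-(b + j * l) * σ ^ 2) :=
    funext (cutGaussian_eq_sum b l k)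
  rw [this]
  exact integrable_finsetSum _ fun j _ =>
    (integrable_cexp_neg_mul_sq (re_add_nat_mul_pos hb hl j)).const_mul _

theorem integral_exp_mul_cutGaussian {b : ℂ} (hb : 0 < b.re) {l : ℝ} (hl : 0 < l) (k : ℕ)
    (ρ : ℝ) :
    ∫ σ : ℝ, Complex.exp (Complex.I * ((σ * ρ : ℝ) : ℂ)) * cutGaussian b l k σ =
      ∑ j ∈ Finset.range (k + 1), ((-1) ^ j * (k.choose j : ℂ)) *
        ((Real.pi / (b + j * l)) ^ (1 / 2 : ℂ) * Complex.exp (-(ρ : ℂ) ^ 2 / (4 * (b + j * l)))) := by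
  simp_rw [cutGaussian_eq_sum, Finset.mul_sum]
  rw [integral_finsetSum]
  · refine Finset.sum_congr rfl fun j _ => ?_
    rw [← integral_gaussian_mul_exp (re_add_nat_mul_pos hb hl j), ← integral_const_mul]
    refine integral_congr_ae (Eventually.of_forall fun σ => ?_)
    simp only
    ring
  · intro j _
    have h := (integrable_cexp_neg_mul_sq (re_add_nat_mul_pos hb hl j)).const_mul
      ((-1) ^ j * (k.choose j : ℂ))
    refine h.bdd_mul (c := 1) (by fun_prop) (Eventually.of_forall fun σ => ?_)
    rw [mul_comm, Complex.norm_exp_ofReal_mul_I]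

theorem integrable_exp_neg_pow_four {c : ℝ} (hc : 0 < c) :
    Integrable (fun ξ : Space d => Real.exp (-c * ‖ξ‖ ^ 4)) := by
  have h : Integrable (fun ξ : Space d => Real.exp c * ‖Complex.exp (-((2 * c : ℝ) : ℂ) * ‖ξ‖ ^ 2)‖) :=
    ((integrable_gaussian (b := ((2 * c : ℝ) : ℂ)) (by simpa using hc)).norm).const_mul _
  refine h.mono' (by fun_prop) (Eventually.of_forall fun ξ => ?_)
  rw [Real.norm_of_nonneg (Real.exp_pos _).le, Complex.norm_exp, ← Real.exp_add, Real.exp_le_exp,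
    ← Complex.ofReal_pow, Complex.re_mul_ofReal]
  simp only [Complex.neg_re, Complex.ofReal_re]
  nlinarith [sq_nonneg (‖ξ‖ ^ 2 - 1), mul_nonneg hc.le (sq_nonneg (‖ξ‖ ^ 2 - 1))]

theorem integral_exp_neg_pow_four {c : ℝ} (hc : 0 < c) :
    ∫ ξ : Space d, Real.exp (-c * ‖ξ‖ ^ 4) =
      c ^ (-(d : ℝ) / 4) * ∫ ξ : Space d, Real.exp (-‖ξ‖ ^ 4) := by
  have h := Measure.integral_comp_smul (volume : Measure (Space d))
    (fun ξ => Real.exp (-‖ξ‖ ^ 4)) (c ^ (1 / 4 : ℝ))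
  have hc4 : (c ^ (1 / 4 : ℝ)) ^ 4 = c := by
    rw [← Real.rpow_natCast, ← Real.rpow_mul hc.le]; norm_num
  have hpos : 0 < c ^ (1 / 4 : ℝ) := Real.rpow_pos_of_pos hc _
  simp only [norm_smul, mul_pow, Real.norm_of_nonneg hpos.le, hc4, smul_eq_mul] at h
  simp only [neg_mul]
  rw [h, abs_of_nonneg (by positivity), finrank_euclideanSpace_fin, ← Real.rpow_natCast,
    ← Real.rpow_mul hc.le, ← Real.rpow_neg hc.le]
  congr 2
  ring

/-- The weight that dominates the part of the Fresnel integral away from `σ = 0`. -/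
theorem integrable_cut_weight (hd : 3 ≤ d) :
    Integrable (fun s : ℝ => (1 - Real.exp (-s ^ 2)) ^ d * |s| ^ (-(d : ℝ) / 2)) := by
  have hd' : (3 : ℝ) ≤ d := by exact_mod_cast hd
  have h : Integrable (fun s : ℝ => (2 : ℝ) ^ ((d : ℝ) / 2) * (1 + ‖s‖) ^ (-((d : ℝ) / 2))) :=
    (integrable_one_add_norm (by simp; linarith)).const_mul _
  refine h.mono' (by fun_prop) (Eventually.of_forall fun s => ?_)
  have h0 : 0 ≤ 1 - Real.exp (-s ^ 2) := by
    rw [sub_nonneg, Real.exp_le_one_iff]; nlinarith [sq_nonneg s]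
  have h1 : 1 - Real.exp (-s ^ 2) ≤ 1 := by linarith [Real.exp_pos (-s ^ 2)]
  have h2 : 1 - Real.exp (-s ^ 2) ≤ |s| ^ 2 := by
    rw [sq_abs]; linarith [Real.add_one_le_exp (-s ^ 2)]
  rw [Real.norm_of_nonneg (mul_nonneg (pow_nonneg h0 _) (Real.rpow_nonneg (abs_nonneg s) _)),
    Real.norm_eq_abs, neg_div]
  have hw : (2 : ℝ) ^ ((d : ℝ) / 2) * (1 + |s|) ^ (-((d : ℝ) / 2)) =
      ((1 + |s|) / 2) ^ (-((d : ℝ) / 2)) := by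
    rw [Real.div_rpow (by positivity) (by norm_num), Real.rpow_neg (by norm_num : (0:ℝ) ≤ 2),
      div_inv_eq_mul, mul_comm]
  rw [hw]
  rcases le_total |s| 1 with hs | hs
  · have hle : (1 : ℝ) ≤ ((1 + |s|) / 2) ^ (-((d : ℝ) / 2)) := by
      apply Real.one_le_rpow_of_pos_of_le_one_of_nonpos (by positivity) (by linarith)
      linarith
    refine le_trans ?_ hle
    rcases eq_or_ne s 0 with rfl | hs0
    · simp [zero_pow (show d ≠ 0 by omega)]
    have hsp : 0 < |s| := abs_pos.2 hs0
    calc (1 - Real.exp (-s ^ 2)) ^ d * |s| ^ (-((d : ℝ) / 2))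
        ≤ (|s| ^ 2) ^ d * |s| ^ (-((d : ℝ) / 2)) := by gcongr
      _ = |s| ^ ((2 * d : ℕ) - (d : ℝ) / 2) := by
          rw [← pow_mul, ← Real.rpow_natCast, ← Real.rpow_add hsp]; congr 1
      _ ≤ 1 := Real.rpow_le_one hsp.le hs (by push_cast; linarith)
  · calc (1 - Real.exp (-s ^ 2)) ^ d * |s| ^ (-((d : ℝ) / 2))
        ≤ 1 * |s| ^ (-((d : ℝ) / 2)) := by
          gcongr
          exact pow_le_one₀ h0 h1
      _ ≤ ((1 + |s|) / 2) ^ (-((d : ℝ) / 2)) := by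
          rw [one_mul]
          exact Real.rpow_le_rpow_of_nonpos (by positivity) (by linarith) (by linarith)

theorem integral_cut_weight {l : ℝ} (hl : 0 < l) :
    ∫ σ : ℝ, (1 - Real.exp (-l * σ ^ 2)) ^ d * (Real.pi / |σ|) ^ ((d : ℝ) / 2) =
      Real.pi ^ ((d : ℝ) / 2) * l ^ ((d : ℝ) / 4 - 1 / 2) *
        ∫ s : ℝ, (1 - Real.exp (-s ^ 2)) ^ d * |s| ^ (-(d : ℝ) / 2) := by
  have h := Measure.integral_comp_mul_left
    (fun s : ℝ => (1 - Real.exp (-s ^ 2)) ^ d * |s| ^ (-(d : ℝ) / 2)) (l ^ (1 / 2 : ℝ))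
  have hpos : 0 < l ^ (1 / 2 : ℝ) := Real.rpow_pos_of_pos hl _
  have hl2 : (l ^ (1 / 2 : ℝ)) ^ 2 = l := by
    rw [← Real.rpow_natCast, ← Real.rpow_mul hl.le]; norm_num
  simp only [mul_pow, hl2, abs_mul, abs_of_pos hpos, smul_eq_mul,
    Real.mul_rpow hpos.le (abs_nonneg _), ← Real.rpow_mul hl.le] at h
  have h3 : ∫ s : ℝ, (1 - Real.exp (-s ^ 2)) ^ d * |s| ^ (-(d : ℝ) / 2) =
      l ^ (1 / 2 - (d : ℝ) / 4) *
        ∫ σ : ℝ, (1 - Real.exp (-l * σ ^ 2)) ^ d * |σ| ^ (-(d : ℝ) / 2) := by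
    have h4 : (∫ σ : ℝ, (1 - Real.exp (-(l * σ ^ 2))) ^ d *
        (l ^ (1 / 2 * (-(d : ℝ) / 2)) * |σ| ^ (-(d : ℝ) / 2))) =
        l ^ (1 / 2 * (-(d : ℝ) / 2)) *
        ∫ σ : ℝ, (1 - Real.exp (-l * σ ^ 2)) ^ d * |σ| ^ (-(d : ℝ) / 2) := by
      rw [← integral_const_mul]
      refine integral_congr_ae (Eventually.of_forall fun σ => ?_)
      simp only [neg_mul]; ring
    rw [h4, abs_of_nonneg (by positivity)] at h
    have h5 : l ^ (1 / 2 - (d : ℝ) / 4) = l ^ (1 / 2 : ℝ) * l ^ (1 / 2 * (-(d : ℝ) / 2)) := by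
      rw [← Real.rpow_add hl]; congr 1; ring
    rw [h5, mul_assoc, h, ← mul_assoc, mul_inv_cancel₀ hpos.ne', one_mul]
  rw [h3, ← mul_assoc, mul_assoc (Real.pi ^ _), ← Real.rpow_add hl,
    show (d : ℝ) / 4 - 1 / 2 + (1 / 2 - (d : ℝ) / 4) = 0 by ring, Real.rpow_zero, mul_one,
    ← integral_const_mul]
  refine integral_congr_ae (Eventually.of_forall fun σ => ?_)
  simp only
  rw [Real.div_rpow Real.pi_pos.le (abs_nonneg σ), neg_div, Real.rpow_neg (abs_nonneg σ)]
  ring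

/-- The part of the Fresnel integral away from `σ = 0`, estimated by superposing the second order
Schrödinger groups `e^{iσ|ξ|²}`. -/
theorem norm_integral_cutGaussian_le (hd : 3 ≤ d) {b : ℂ} (hb : 0 < b.re) {l : ℝ} (hl : 0 < l)
    {f g : Space d → ℂ} (hf : Integrable f) (hg : Integrable g)
    (hfg : Integrable (fun ξ => 𝓕 f ξ * 𝓕 g ξ)) :
    ‖∫ ξ : Space d, (∫ σ : ℝ, Complex.exp (Complex.I * ((σ * ‖ξ‖ ^ 2 : ℝ) : ℂ)) *
      cutGaussian b l d σ) * (𝓕 f ξ * 𝓕 g ξ)‖ ≤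
      (Real.pi ^ ((d : ℝ) / 2) * l ^ ((d : ℝ) / 4 - 1 / 2) *
        ∫ s : ℝ, (1 - Real.exp (-s ^ 2)) ^ d * |s| ^ (-(d : ℝ) / 2)) *
        ((∫ x, ‖f x‖) * ∫ x, ‖g x‖) := by
  have hQ := integrable_cutGaussian hb hl d
  have hswap : ∫ ξ : Space d, (∫ σ : ℝ, Complex.exp (Complex.I * ((σ * ‖ξ‖ ^ 2 : ℝ) : ℂ)) *
      cutGaussian b l d σ) * (𝓕 f ξ * 𝓕 g ξ) =
      ∫ σ : ℝ, cutGaussian b l d σ *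
        ∫ ξ : Space d, Complex.exp (Complex.I * ((σ * ‖ξ‖ ^ 2 : ℝ) : ℂ)) * (𝓕 f ξ * 𝓕 g ξ) := by
    simp_rw [← integral_mul_const, ← integral_const_mul]
    rw [integral_integral_swap]
    · refine integral_congr_ae (Eventually.of_forall fun σ => ?_)
      refine integral_congr_ae (Eventually.of_forall fun ξ => ?_)
      simp only; ring
    · have h := (hfg.mul_prod hQ).bdd_mul (c := 1)
        (f := fun z : Space d × ℝ => Complex.exp (Complex.I * ((z.2 * ‖z.1‖ ^ 2 : ℝ) : ℂ)))
        (Continuous.aestronglyMeasurable (by fun_prop)) (Eventually.of_forall fun z => by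
          rw [mul_comm, Complex.norm_exp_ofReal_mul_I])
      refine h.congr (Eventually.of_forall fun z => ?_)
      simp only [Function.uncurry]; ring
  rw [hswap, ← integral_cut_weight hl, ← integral_mul_const]
  refine (norm_integral_le_integral_norm _).trans ?_
  have hint : Integrable (fun σ : ℝ => (1 - Real.exp (-l * σ ^ 2)) ^ d *
      (Real.pi / |σ|) ^ ((d : ℝ) / 2)) := by
    have h := ((integrable_cut_weight hd).comp_mul_left'
      (R := l ^ (1 / 2 : ℝ)) (Real.rpow_pos_of_pos hl _).ne').const_mul
      (Real.pi ^ ((d : ℝ) / 2) * l ^ ((d : ℝ) / 4))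
    refine h.congr (Eventually.of_forall fun σ => ?_)
    have hl2 : (l ^ (1 / 2 : ℝ)) ^ 2 = l := by
      rw [← Real.rpow_natCast, ← Real.rpow_mul hl.le]; norm_num
    have hl3 : l ^ ((d : ℝ) / 4) * l ^ (1 / 2 * (-(d : ℝ) / 2)) = 1 := by
      rw [← Real.rpow_add hl, show (d : ℝ) / 4 + 1 / 2 * (-(d : ℝ) / 2) = 0 by ring, Real.rpow_zero]
    simp only [mul_pow, neg_mul, hl2, abs_mul, abs_of_pos (Real.rpow_pos_of_pos hl _),
      Real.mul_rpow (Real.rpow_nonneg hl.le _) (abs_nonneg _), ← Real.rpow_mul hl.le]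
    rw [Real.div_rpow Real.pi_pos.le (abs_nonneg σ), neg_div (2 : ℝ) (d : ℝ),
      Real.rpow_neg (abs_nonneg σ), ← neg_div]
    linear_combination (1 - Real.exp (-(l * σ ^ 2))) ^ d * Real.pi ^ ((d : ℝ) / 2) *
      (|σ| ^ ((d : ℝ) / 2))⁻¹ * hl3
  refine integral_mono_of_nonneg (Eventually.of_forall fun _ => norm_nonneg _)
    (hint.mul_const _) ?_
  have h0 : ∀ᵐ σ : ℝ, σ ≠ 0 := by simp [ae_iff, measure_singleton]
  filter_upwards [h0] with σ hσ
  rw [norm_mul, mul_assoc]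
  have h1 := norm_integral_schrodinger_le hσ hf hg hfg
  rw [mul_assoc] at h1
  have h2 := norm_cutGaussian_le hb hl d σ
  exact mul_le_mul h2 h1 (norm_nonneg _) ((norm_nonneg _).trans h2)

/-- The Gaussian terms that restore the part of the Fresnel integral near `σ = 0`. -/
theorem norm_integral_exp_neg_le {c : ℂ} {κ : ℝ} (hκ : 0 < κ) (hc : κ ≤ (1 / (4 * c)).re)
    {f g : Space d → ℂ} (hf : Integrable f) (hg : Integrable g) :
    ‖∫ ξ : Space d, Complex.exp (-((‖ξ‖ ^ 2 : ℝ) : ℂ) ^ 2 / (4 * c)) * (𝓕 f ξ * 𝓕 g ξ)‖ ≤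
      (κ ^ (-(d : ℝ) / 4) * ∫ ξ : Space d, Real.exp (-‖ξ‖ ^ 4)) *
        ((∫ x, ‖f x‖) * ∫ x, ‖g x‖) := by
  have hle : ∀ ξ : Space d, ‖Complex.exp (-((‖ξ‖ ^ 2 : ℝ) : ℂ) ^ 2 / (4 * c))‖ ≤
      Real.exp (-κ * ‖ξ‖ ^ 4) := by
    intro ξ
    have : (-((‖ξ‖ ^ 2 : ℝ) : ℂ) ^ 2 / (4 * c)) = ((-‖ξ‖ ^ 4 : ℝ) : ℂ) * (1 / (4 * c)) := by
      push_cast; ring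
    rw [Complex.norm_exp, Real.exp_le_exp, this, Complex.re_ofReal_mul]
    have : 0 ≤ ‖ξ‖ ^ 4 := by positivity
    nlinarith
  have hint : Integrable (fun ξ : Space d => Complex.exp (-((‖ξ‖ ^ 2 : ℝ) : ℂ) ^ 2 / (4 * c))) :=
    (integrable_exp_neg_pow_four hκ).mono' (Continuous.aestronglyMeasurable (by fun_prop))
      (Eventually.of_forall hle)
  refine (norm_integral_symbol_mul_fourier_mul_fourier_le hint hf hg).trans ?_
  rw [mul_assoc, ← integral_exp_neg_pow_four hκ]
  have := integral_mono hint.norm (integrable_exp_neg_pow_four hκ) hle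
  gcongr

/-- The constant of the dispersive estimate. -/
def dispersiveConst (d : ℕ) : ℝ :=
  (Real.pi ^ ((d : ℝ) / 2) * ∫ s : ℝ, (1 - Real.exp (-s ^ 2)) ^ d * |s| ^ (-(d : ℝ) / 2)) +
    2 ^ d * ((4 * ((d : ℝ) + 1) ^ 2) ^ ((d : ℝ) / 4) * ∫ ξ : Space d, Real.exp (-‖ξ‖ ^ 4))

theorem dispersive_gaussian (hd : 3 ≤ d) {b : ℂ} (hb : 0 < b.re) {t : ℝ} (ht : t ≠ 0)
    (hbt : ‖b‖ ≤ 1 / (4 * |t|)) {f g : Space d → ℂ} (hf : Integrable f) (hg : Integrable g)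
    (hfg : Integrable (fun ξ => 𝓕 f ξ * 𝓕 g ξ)) :
    ‖∫ ξ : Space d, Complex.exp (-((‖ξ‖ ^ 2 : ℝ) : ℂ) ^ 2 / (4 * b)) * (𝓕 f ξ * 𝓕 g ξ)‖ ≤
      dispersiveConst d * |t| ^ (-(d : ℝ) / 4) * ((∫ x, ‖f x‖) * ∫ x, ‖g x‖) := by
  set P : ℝ := (∫ x, ‖f x‖) * ∫ x, ‖g x‖
  have hP : 0 ≤ P := mul_nonneg (integral_nonneg fun _ => norm_nonneg _)
    (integral_nonneg fun _ => norm_nonneg _)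
  have htp : 0 < |t| := abs_pos.2 ht
  set l : ℝ := 1 / |t|
  have hl : 0 < l := by positivity
  have hbne : b ≠ 0 := by rintro rfl; simp at hb
  have hbpos : 0 < ‖b‖ := norm_pos_iff.2 hbne
  set J : ℕ → ℂ := fun j => ∫ ξ : Space d,
    Complex.exp (-((‖ξ‖ ^ 2 : ℝ) : ℂ) ^ 2 / (4 * (b + j * l))) * (𝓕 f ξ * 𝓕 g ξ) with hJ
  set w : ℕ → ℂ := fun j => (-1) ^ j * (d.choose j : ℂ) *
    (Real.pi / (b + j * l)) ^ (1 / 2 : ℂ) with hw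
  -- integrability of each Gaussian term
  have hI : ∀ j : ℕ, Integrable fun ξ : Space d =>
      Complex.exp (-((‖ξ‖ ^ 2 : ℝ) : ℂ) ^ 2 / (4 * (b + j * l))) * (𝓕 f ξ * 𝓕 g ξ) := by
    intro j
    refine hfg.bdd_mul (c := 1) (Continuous.aestronglyMeasurable (by fun_prop))
      (Eventually.of_forall fun ξ => ?_)
    have hre := re_add_nat_mul_pos hb hl j
    have : (-((‖ξ‖ ^ 2 : ℝ) : ℂ) ^ 2 / (4 * (b + j * l))) =
        ((-(‖ξ‖ ^ 4 / 4) : ℝ) : ℂ) * (b + j * l)⁻¹ := by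
      push_cast; field_simp
    rw [Complex.norm_exp, Real.exp_le_one_iff, this, Complex.re_ofReal_mul, Complex.inv_re]
    have h1 : 0 ≤ (b + j * l).re / Complex.normSq (b + j * l) :=
      div_nonneg hre.le (Complex.normSq_nonneg _)
    have h2 : 0 ≤ ‖ξ‖ ^ 4 / 4 := by positivity
    nlinarith
  have hsum : ∫ ξ : Space d, (∫ σ : ℝ, Complex.exp (Complex.I * ((σ * ‖ξ‖ ^ 2 : ℝ) : ℂ)) *
      cutGaussian b l d σ) * (𝓕 f ξ * 𝓕 g ξ) = ∑ j ∈ Finset.range (d + 1), w j * J j := by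
    simp_rw [integral_exp_mul_cutGaussian hb hl, Finset.sum_mul]
    rw [integral_finsetSum]
    · refine Finset.sum_congr rfl fun j _ => ?_
      simp only [hw, hJ]
      rw [← integral_const_mul]
      refine integral_congr_ae (Eventually.of_forall fun ξ => ?_)
      simp only; ring
    · intro j _
      refine ((hI j).const_mul (w j)).congr (Eventually.of_forall fun ξ => ?_)
      simp only [hw]; ring
  have hmain := norm_integral_cutGaussian_le hd hb hl hf hg hfg
  rw [hsum, Finset.sum_range_succ'] at hmain
  -- the Gaussian terms with `j ≥ 1`
  have hratio : ∀ j : ℕ, ‖(Real.pi / (b + j * l) : ℂ) ^ (1 / 2 : ℂ)‖ ≤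
      (Real.pi / ‖b‖) ^ (1 / 2 : ℝ) := by
    intro j
    rw [show (1 / 2 : ℂ) = ((1 / 2 : ℝ) : ℂ) by norm_num, Complex.norm_cpow_real, norm_div,
      Complex.norm_real, Real.norm_of_nonneg Real.pi_pos.le]
    have : ‖b‖ ≤ ‖b + j * l‖ := by
      rw [← sq_le_sq₀ (norm_nonneg _) (norm_nonneg _), Complex.sq_norm, Complex.sq_norm,
        Complex.normSq_apply, Complex.normSq_apply]
      simp only [Complex.add_re, Complex.mul_re, Complex.natCast_re, Complex.ofReal_re,
        Complex.natCast_im, Complex.ofReal_im, Complex.add_im, Complex.mul_im]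
      have : 0 ≤ (j : ℝ) * l := by positivity
      nlinarith
    have := Real.pi_pos
    gcongr
  have hJle : ∀ j ∈ Finset.range d, ‖J (j + 1)‖ ≤
      ((|t| / (4 * ((d : ℝ) + 1) ^ 2)) ^ (-(d : ℝ) / 4) *
        ∫ ξ : Space d, Real.exp (-‖ξ‖ ^ 4)) * P := by
    intro j hj
    refine norm_integral_exp_neg_le (by positivity) ?_ hf hg
    have hj' : ((j + 1 : ℕ) : ℝ) ≤ d := by
      have := Finset.mem_range.1 hj
      exact_mod_cast this
    have hj1 : (1 : ℝ) ≤ ((j + 1 : ℕ) : ℝ) := by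
      push_cast; linarith [Nat.cast_nonneg (α := ℝ) j]
    set n : ℝ := ((j + 1 : ℕ) : ℝ) with hn
    set c : ℂ := b + ((j + 1 : ℕ) : ℂ) * l with hcdef
    have hcre : c.re = b.re + n * l := by
      simp only [hcdef, Complex.add_re, Complex.mul_re, Complex.natCast_re, Complex.ofReal_re,
        Complex.natCast_im, Complex.ofReal_im]
      simp [hn]
    have hcn : ‖c‖ ≤ (d + 1) * l := by
      calc ‖c‖ ≤ ‖b‖ + ‖((j + 1 : ℕ) : ℂ) * l‖ := norm_add_le _ _
        _ ≤ 1 / (4 * |t|) + n * l := by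
            rw [norm_mul, Complex.norm_natCast, Complex.norm_real, Real.norm_of_nonneg hl.le]
            gcongr
        _ ≤ l + d * l := by
            have : 1 / (4 * |t|) ≤ l := by
              apply one_div_le_one_div_of_le htp; linarith
            gcongr
        _ = _ := by ring
    have hcre' : l ≤ c.re := by rw [hcre]; nlinarith
    have hcpos : 0 < Complex.normSq c := by
      rw [Complex.normSq_pos]; intro h; rw [h] at hcre'; simp at hcre'; linarith
    have hsq : Complex.normSq c ≤ ((d + 1) * l) ^ 2 := by
      rw [← Complex.sq_norm]; gcongr
    have : (1 / (4 * c)).re = c.re / Complex.normSq c / 4 := by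
      rw [show (1 / (4 * c)) = ((1 / 4 : ℝ) : ℂ) * c⁻¹ by push_cast; rw [one_div, mul_inv]; ring,
        Complex.re_ofReal_mul, Complex.inv_re]
      ring
    rw [this]
    calc |t| / (4 * ((d : ℝ) + 1) ^ 2) = l / ((d + 1) * l) ^ 2 / 4 := by
          simp only [l]; field_simp
      _ ≤ c.re / Complex.normSq c / 4 := by
          have := hl.le.trans hcre'
          gcongr
  set A : ℝ := ∫ s : ℝ, (1 - Real.exp (-s ^ 2)) ^ d * |s| ^ (-(d : ℝ) / 2) with hA
  set B : ℝ := ∫ ξ : Space d, Real.exp (-‖ξ‖ ^ 4) with hB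
  have hA0 : 0 ≤ A := integral_nonneg fun s => mul_nonneg (pow_nonneg (by
    rw [sub_nonneg, Real.exp_le_one_iff]; nlinarith [sq_nonneg s]) _)
    (Real.rpow_nonneg (abs_nonneg _) _)
  have hB0 : 0 ≤ B := integral_nonneg fun s => (Real.exp_pos _).le
  have hw0 : ‖w 0‖ = (Real.pi / ‖b‖) ^ (1 / 2 : ℝ) := by
    simp only [hw, pow_zero, Nat.choose_zero_right, Nat.cast_one, Nat.cast_zero, zero_mul,
      add_zero, one_mul]
    rw [show (1 / 2 : ℂ) = ((1 / 2 : ℝ) : ℂ) by norm_num, Complex.norm_cpow_real, norm_div,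
      Complex.norm_real, Real.norm_of_nonneg Real.pi_pos.le]
  set W : ℝ := (Real.pi / ‖b‖) ^ (1 / 2 : ℝ) with hW
  have hWpos : 0 < W := Real.rpow_pos_of_pos (div_pos Real.pi_pos hbpos) _
  have hrest : ‖∑ j ∈ Finset.range d, w (j + 1) * J (j + 1)‖ ≤
      W * (2 ^ d * (((|t| / (4 * ((d : ℝ) + 1) ^ 2)) ^ (-(d : ℝ) / 4) * B) * P)) := by
    refine (norm_sum_le _ _).trans ?_
    have h2 : (∑ j ∈ Finset.range d, (d.choose (j + 1) : ℝ)) ≤ 2 ^ d := by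
      have := Nat.sum_range_choose d
      rw [Finset.sum_range_succ'] at this
      have h3 : ∑ j ∈ Finset.range d, d.choose (j + 1) ≤ 2 ^ d := by omega
      exact_mod_cast h3
    calc ∑ j ∈ Finset.range d, ‖w (j + 1) * J (j + 1)‖
        ≤ ∑ j ∈ Finset.range d, (d.choose (j + 1) : ℝ) *
          (W * (((|t| / (4 * ((d : ℝ) + 1) ^ 2)) ^ (-(d : ℝ) / 4) * B) * P)) := by
          refine Finset.sum_le_sum fun j hj => ?_
          rw [norm_mul]
          have h1 : ‖w (j + 1)‖ ≤ (d.choose (j + 1) : ℝ) * W := by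
            simp only [hw, norm_mul, norm_pow, norm_neg, norm_one, one_pow, one_mul,
              Complex.norm_natCast]
            exact mul_le_mul_of_nonneg_left (hratio (j + 1)) (Nat.cast_nonneg _)
          calc ‖w (j + 1)‖ * ‖J (j + 1)‖ ≤ ((d.choose (j + 1) : ℝ) * W) * _ :=
                mul_le_mul h1 (hJle j hj) (norm_nonneg _) (by positivity)
            _ = _ := by ring
      _ ≤ _ := by
          rw [← Finset.sum_mul]
          calc _ ≤ (2 : ℝ) ^ d * (W * (((|t| / (4 * ((d : ℝ) + 1) ^ 2)) ^ (-(d : ℝ) / 4) * B) * P)) := by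
                gcongr
            _ = _ := by ring
  have hJ0 : J 0 = ∫ ξ : Space d,
      Complex.exp (-((‖ξ‖ ^ 2 : ℝ) : ℂ) ^ 2 / (4 * b)) * (𝓕 f ξ * 𝓕 g ξ) := by
    simp [hJ]
  rw [← hJ0]
  have htot : W * ‖J 0‖ ≤ Real.pi ^ ((d : ℝ) / 2) * l ^ ((d : ℝ) / 4 - 1 / 2) * A * P +
      W * (2 ^ d * (((|t| / (4 * ((d : ℝ) + 1) ^ 2)) ^ (-(d : ℝ) / 4) * B) * P)) := by
    rw [← hw0, ← norm_mul]
    calc ‖w 0 * J 0‖ = ‖(∑ j ∈ Finset.range d, w (j + 1) * J (j + 1) + w 0 * J 0) -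
          ∑ j ∈ Finset.range d, w (j + 1) * J (j + 1)‖ := by congr 1; ring
      _ ≤ _ := (norm_sub_le _ _).trans (add_le_add hmain (by rw [hw0]; exact hrest))
  -- `W ≥ l^{-1/2}`
  have hWl : 1 ≤ W * l ^ (1 / 2 : ℝ) := by
    rw [hW, ← Real.mul_rpow (by positivity) hl.le]
    apply Real.one_le_rpow _ (by norm_num)
    rw [div_mul_eq_mul_div, le_div_iff₀ hbpos, one_mul]
    have h4 : ‖b‖ ≤ l := hbt.trans (by apply one_div_le_one_div_of_le htp; linarith)
    have := Real.pi_gt_three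
    nlinarith
  have hl4 : l ^ ((d : ℝ) / 4) = |t| ^ (-(d : ℝ) / 4) := by
    simp only [l]
    rw [one_div, Real.inv_rpow htp.le, ← Real.rpow_neg htp.le, neg_div]
  have hsplit : l ^ ((d : ℝ) / 4 - 1 / 2) * l ^ (1 / 2 : ℝ) = |t| ^ (-(d : ℝ) / 4) := by
    rw [← Real.rpow_add hl, ← hl4]; congr 1; ring
  have hdiv : (|t| / (4 * ((d : ℝ) + 1) ^ 2)) ^ (-(d : ℝ) / 4) =
      |t| ^ (-(d : ℝ) / 4) * (4 * ((d : ℝ) + 1) ^ 2) ^ ((d : ℝ) / 4) := by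
    rw [Real.div_rpow htp.le (by positivity), neg_div, Real.rpow_neg (x := 4 * ((d : ℝ) + 1) ^ 2)
      (by positivity), div_inv_eq_mul]
  rw [hdiv] at htot
  have hfin : W * ‖J 0‖ ≤ W * (dispersiveConst d * |t| ^ (-(d : ℝ) / 4) * P) := by
    refine htot.trans ?_
    have h5 : Real.pi ^ ((d : ℝ) / 2) * l ^ ((d : ℝ) / 4 - 1 / 2) * A * P ≤
        W * (Real.pi ^ ((d : ℝ) / 2) * |t| ^ (-(d : ℝ) / 4) * A * P) := by
      rw [← hsplit]
      have h6 : 0 ≤ Real.pi ^ ((d : ℝ) / 2) * l ^ ((d : ℝ) / 4 - 1 / 2) * A * P := by positivity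
      nlinarith
    calc _ ≤ W * (Real.pi ^ ((d : ℝ) / 2) * |t| ^ (-(d : ℝ) / 4) * A * P) + _ :=
          add_le_add h5 le_rfl
      _ = _ := by unfold dispersiveConst; rw [← hA, ← hB]; ring
  exact le_of_mul_le_mul_left hfin hWpos

/-- Dispersive estimate for the fourth order group: the kernel of `e^{it|ξ|⁴}` is
`O(|t|^{-d/4})`. -/
theorem norm_integral_dispersive_le (hd : 3 ≤ d) {t : ℝ} (ht : t ≠ 0) {f g : Space d → ℂ}
    (hf : Integrable f) (hg : Integrable g) (hfg : Integrable (fun ξ => 𝓕 f ξ * 𝓕 g ξ)) :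
    ‖∫ ξ : Space d, Complex.exp (Complex.I * ((t * ‖ξ‖ ^ 4 : ℝ) : ℂ)) * (𝓕 f ξ * 𝓕 g ξ)‖ ≤
      dispersiveConst d * |t| ^ (-(d : ℝ) / 4) * ((∫ x, ‖f x‖) * ∫ x, ‖g x‖) := by
  have hlim : Tendsto (fun δ : ℝ => ∫ ξ : Space d,
      Complex.exp (-((δ : ℂ) - Complex.I * t) * ((‖ξ‖ ^ 4 : ℝ) : ℂ)) *
      (𝓕 f ξ * 𝓕 g ξ)) (𝓝[>] 0)
      (𝓝 (∫ ξ : Space d, Complex.exp (Complex.I * ((t * ‖ξ‖ ^ 4 : ℝ) : ℂ)) *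
        (𝓕 f ξ * 𝓕 g ξ))) := by
    refine tendsto_integral_filter_of_dominated_convergence (fun ξ => ‖𝓕 f ξ * 𝓕 g ξ‖) ?_ ?_
      hfg.norm ?_
    · exact Eventually.of_forall fun δ =>
        (by fun_prop : Continuous fun ξ : Space d =>
          Complex.exp (-((δ : ℂ) - Complex.I * t) * ((‖ξ‖ ^ 4 : ℝ) : ℂ))).aestronglyMeasurable.mul
          hfg.aestronglyMeasurable
    · filter_upwards [self_mem_nhdsWithin] with δ hδ
      refine Eventually.of_forall fun ξ => ?_
      rw [norm_mul]
      refine mul_le_of_le_one_left (norm_nonneg _) ?_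
      rw [Complex.norm_exp, Real.exp_le_one_iff, Complex.re_mul_ofReal]
      have h1 : 0 < δ := hδ
      have h2 : 0 ≤ ‖ξ‖ ^ 4 := by positivity
      simp
      positivity
    · refine Eventually.of_forall fun ξ => ?_
      refine Tendsto.mul_const _ (Tendsto.mono_left ?_ nhdsWithin_le_nhds)
      have : Continuous fun δ : ℝ =>
          Complex.exp (-((δ : ℂ) - Complex.I * t) * ((‖ξ‖ ^ 4 : ℝ) : ℂ)) := by
        fun_prop
      convert this.tendsto 0 using 2
      push_cast
      ring_nf
  refine le_of_tendsto hlim.norm ?_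
  filter_upwards [self_mem_nhdsWithin] with δ hδ
  have hδ' : 0 < δ := hδ
  set z : ℂ := (δ : ℂ) - Complex.I * t with hz
  have hzre : z.re = δ := by simp [hz]
  have hzt : |t| ≤ ‖z‖ := by simpa [hz] using Complex.abs_im_le_norm z
  have hz0 : z ≠ 0 := by intro h; rw [h] at hzre; simp at hzre; linarith
  have hbre : 0 < (1 / (4 * z)).re := by
    rw [show (1 / (4 * z)) = ((1 / 4 : ℝ) : ℂ) * z⁻¹ by push_cast; rw [one_div, mul_inv]; ring,
      Complex.re_ofReal_mul, Complex.inv_re, hzre]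
    have := Complex.normSq_pos.2 hz0
    positivity
  have hbn : ‖1 / (4 * z)‖ ≤ 1 / (4 * |t|) := by
    rw [norm_div, norm_mul, norm_one, Complex.norm_ofNat]
    have := abs_pos.2 ht
    gcongr
  have h := dispersive_gaussian hd hbre ht hbn hf hg hfg
  have hsymb : ∀ ξ : Space d, -((‖ξ‖ ^ 2 : ℝ) : ℂ) ^ 2 / (4 * (1 / (4 * z))) =
      -z * ((‖ξ‖ ^ 4 : ℝ) : ℂ) := by
    intro ξ
    push_cast
    field_simp
  simpa only [hsymb] using h

/-! ### Interpolation between `L¹ → L^∞` and `L² → L²` -/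

section Interpolation

variable {X : Type*} [MeasurableSpace X] {μ : Measure X}

theorem norm_sq_eq_integral (f : Lp ℂ 2 μ) : ‖f‖ ^ 2 = ∫ x, ‖f x‖ ^ 2 ∂μ := by
  have h : ‖f‖ ^ 2 = RCLike.re (inner ℂ f f) := (inner_self_eq_norm_sq (𝕜 := ℂ) f).symm
  rw [h, L2.inner_def, ← integral_re (L2.integrable_inner f f)]
  exact integral_congr_ae (Eventually.of_forall fun x => inner_self_eq_norm_sq (𝕜 := ℂ) (f x))

/-- The indicator of a level set of a simple function, as an element of `L²`; it is `0` if the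
level set has infinite measure. -/
def levelIndicator (μ : Measure X) (f : SimpleFunc X ℂ) (y : ℂ) : Lp ℂ 2 μ := by
  classical
  exact if h : μ (f ⁻¹' {y}) ≠ ∞ then indicatorConstLp 2 (f.measurableSet_fiber y) h 1 else 0

theorem coeFn_sum_smul_levelIndicator (f : SimpleFunc X ℂ) (hf : Integrable f μ) (c : ℂ → ℂ)
    (hc : c 0 = 0) :
    ⇑(∑ y ∈ f.range, c y • levelIndicator μ f y) =ᵐ[μ] fun x => c (f x) := by
  classical
  have h1 : ∀ y, ∀ᵐ x ∂μ, c y * levelIndicator μ f y x = c y * if f x = y then 1 else 0 := by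
    intro y
    rcases eq_or_ne y 0 with rfl | hy
    · simp [hc]
    have hfin : μ (f ⁻¹' {y}) ≠ ∞ := (SimpleFunc.integrable_iff.1 hf y hy).ne
    have : levelIndicator μ f y = indicatorConstLp 2 (f.measurableSet_fiber y) hfin 1 := by
      simp only [levelIndicator, dif_pos hfin]
    rw [this]
    filter_upwards [indicatorConstLp_coeFn (p := 2) (hs := f.measurableSet_fiber y)
      (hμs := hfin) (c := (1 : ℂ))] with x hx
    rw [hx]
    simp [indicator]
  have h2 : ∀ s : Finset ℂ, ⇑(∑ y ∈ s, c y • levelIndicator μ f y) =ᵐ[μ]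
      fun x => ∑ y ∈ s, c y * levelIndicator μ f y x := by
    intro s
    induction s using Finset.induction_on with
    | empty => simpa using! Lp.coeFn_zero ℂ 2 μ
    | insert a s ha ih =>
      rw [Finset.sum_insert ha]
      filter_upwards [Lp.coeFn_add (c a • levelIndicator μ f a)
        (∑ y ∈ s, c y • levelIndicator μ f y), ih, Lp.coeFn_smul (c a) (levelIndicator μ f a)]
        with x h3 h4 h5
      rw [h3, Pi.add_apply, h4, h5, Finset.sum_insert ha, Pi.smul_apply, smul_eq_mul]
  have h3 : ∀ᵐ x ∂μ, ∀ y ∈ f.range, c y * levelIndicator μ f y x =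
      c y * if f x = y then 1 else 0 :=
    (ae_ball_iff (Finset.countable_toSet f.range)).2 fun y _ => h1 y
  filter_upwards [h2 f.range, h3] with x hx hx'
  rw [hx, Finset.sum_congr rfl hx', Finset.sum_eq_single (f x)]
  · simp
  · intro y _ hy; simp [Ne.symm hy]
  · intro h; exact absurd (SimpleFunc.mem_range_self f x) h

/-- The phase of `y` times `|y|^w`. -/
def phasePow (w y : ℂ) : ℂ := y / ‖y‖ * (‖y‖ : ℂ) ^ w

theorem phasePow_zero (w : ℂ) : phasePow w 0 = 0 := by simp [phasePow]

theorem phasePow_one (y : ℂ) : phasePow 1 y = y := by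
  rcases eq_or_ne y 0 with rfl | hy
  · simp [phasePow]
  · have : (‖y‖ : ℂ) ≠ 0 := by simpa using hy
    simp only [phasePow, Complex.cpow_one]
    field_simp

theorem norm_phasePow {w : ℂ} (hw : 0 < w.re) (y : ℂ) : ‖phasePow w y‖ = ‖y‖ ^ w.re := by
  rcases eq_or_ne y 0 with rfl | hy
  · simp [phasePow, Real.zero_rpow hw.ne']
  · have : 0 < ‖y‖ := norm_pos_iff.2 hy
    rw [phasePow, norm_mul, norm_div, Complex.norm_real, norm_norm, div_self this.ne', one_mul,
      Complex.norm_cpow_eq_rpow_re_of_pos this]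

theorem differentiable_phasePow (y : ℂ) : Differentiable ℂ fun w => phasePow w y := by
  rcases eq_or_ne y 0 with rfl | hy
  · simp [phasePow]
  · have : (‖y‖ : ℂ) ≠ 0 := by simpa using hy
    intro w
    unfold phasePow
    exact (differentiableAt_const _).mul
      ((differentiableAt_id).const_cpow (Or.inl this))

theorem conj_phasePow (w y : ℂ) :
    (starRingEnd ℂ) (phasePow w y) = phasePow ((starRingEnd ℂ) w) ((starRingEnd ℂ) y) := by
  unfold phasePow
  rw [map_mul, map_div₀, Complex.conj_ofReal, RCLike.norm_conj]
  congr 1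
  rcases eq_or_ne y 0 with rfl | hy
  · rcases eq_or_ne w 0 with rfl | hw
    · simp
    · simp [Complex.zero_cpow, hw]
  · rw [Complex.cpow_conj _ _ (by
      rw [Complex.arg_ofReal_of_nonneg (norm_nonneg y)]; exact Real.pi_pos.ne),
      Complex.conj_ofReal]

theorem simpleFunc_integrable_rpow (f : SimpleFunc X ℂ) (hf : Integrable f μ) {r : ℝ}
    (hr : 0 < r) : Integrable (fun x => ‖f x‖ ^ r) μ := by
  have := (SimpleFunc.memLp_iff_integrable (μ := μ) (f := f) (p := ENNReal.ofReal r)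
    (by simpa using hr) (by simp)).2 hf
  simpa [ENNReal.toReal_ofReal hr.le] using this.integrable_norm_rpow (by simpa using hr) (by simp)

/-- Riesz–Thorin interpolation for simple functions. -/
theorem norm_inner_simpleFunc_le (T : Lp ℂ 2 μ →L[ℂ] Lp ℂ 2 μ) (hT : ∀ f, ‖T f‖ ≤ ‖f‖) {A : ℝ}
    (hA : 0 < A)
    (hT1 : ∀ f g : Lp ℂ 2 μ, Integrable f μ → Integrable g μ →
      ‖inner ℂ g (T f)‖ ≤ A * ((∫ x, ‖f x‖ ∂μ) * ∫ x, ‖g x‖ ∂μ))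
    {r : ℝ} (hr1 : 1 < r) (hr2 : r < 2) (f g : SimpleFunc X ℂ) (hf : Integrable f μ)
    (hg : Integrable g μ) (f' g' : Lp ℂ 2 μ) (hff : f' =ᵐ[μ] f) (hgg : g' =ᵐ[μ] g) :
    ‖inner ℂ g' (T f')‖ ≤ A ^ (2 / r - 1) *
      ((∫ x, ‖f x‖ ^ r ∂μ) ^ (1 / r) * (∫ x, ‖g x‖ ^ r ∂μ) ^ (1 / r)) := by
  set Nf := ∫ x, ‖f x‖ ^ r ∂μ
  set Ng := ∫ x, ‖g x‖ ^ r ∂μ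
  have hr0 : 0 < r := by linarith
  have hNf : 0 ≤ Nf := integral_nonneg fun x => Real.rpow_nonneg (norm_nonneg _) _
  have hNg : 0 ≤ Ng := integral_nonneg fun x => Real.rpow_nonneg (norm_nonneg _) _
  -- the analytic family, `w = r (1 + z) / 2`
  let L : SimpleFunc X ℂ → ℂ → Lp ℂ 2 μ := fun h w =>
    ∑ y ∈ h.range, phasePow w y • levelIndicator μ h y
  have hL : ∀ (h : SimpleFunc X ℂ), Integrable h μ → ∀ w, ⇑(L h w) =ᵐ[μ] fun x => phasePow w (h x) :=
    fun h hh w => coeFn_sum_smul_levelIndicator h hh (phasePow w) (phasePow_zero w)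
  let W : ℂ → ℂ := fun z => r * (1 + z) / 2
  let F : ℂ → ℂ := fun z => inner ℂ (L g (W ((starRingEnd ℂ) z))) (T (L f (W z)))
  have hWre : ∀ z, (W z).re = r * (1 + z.re) / 2 := by
    intro z
    have : W z = ((r / 2 : ℝ) : ℂ) * (1 + z) := by simp only [W]; push_cast; ring
    rw [this, Complex.re_ofReal_mul]; simp; ring
  have hWconj : ∀ z, (starRingEnd ℂ) (W ((starRingEnd ℂ) z)) = W z := by
    intro z
    have h2 : (starRingEnd ℂ) 2 = 2 := Complex.conj_ofNat 2
    simp [W, h2]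
  have hFeq : ∀ z, F z = ∑ y' ∈ g.range, ∑ y ∈ f.range,
      phasePow (W z) ((starRingEnd ℂ) y') * (phasePow (W z) y *
        inner ℂ (levelIndicator μ g y') (T (levelIndicator μ f y))) := by
    intro z
    simp only [F, L, map_sum, map_smul, sum_inner, inner_sum, inner_smul_left, inner_smul_right,
      conj_phasePow, hWconj]
    simp only [Finset.mul_sum]
    rw [Finset.sum_comm]
    refine Finset.sum_congr rfl fun y' _ => Finset.sum_congr rfl fun y _ => ?_
    ring
  have hdiffW : Differentiable ℂ W := by
    intro z; simp only [W]; fun_prop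
  have hdiff : Differentiable ℂ F := by
    rw [show F = _ from funext hFeq]
    refine Differentiable.fun_sum fun y' _ => Differentiable.fun_sum fun y _ => ?_
    exact ((differentiable_phasePow _).comp hdiffW).mul
      (((differentiable_phasePow _).comp hdiffW).mul_const _)
  have hstrip : ∀ z ∈ Complex.HadamardThreeLines.verticalClosedStrip 0 1, ∀ y : ℂ,
      ‖phasePow (W z) y‖ ≤ (1 + ‖y‖) ^ r := by
    intro z hz y
    have hz' : 0 ≤ z.re ∧ z.re ≤ 1 := hz
    have h1 : 0 < (W z).re := by rw [hWre]; nlinarith [hz'.1]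
    rw [norm_phasePow h1]
    calc ‖y‖ ^ (W z).re ≤ (1 + ‖y‖) ^ (W z).re := by
          apply Real.rpow_le_rpow (norm_nonneg _) (by linarith [norm_nonneg y]) h1.le
      _ ≤ (1 + ‖y‖) ^ r := by
          apply Real.rpow_le_rpow_of_exponent_le (by linarith [norm_nonneg y])
          rw [hWre]; nlinarith [hz'.2]
  have hB : BddAbove ((norm ∘ F) '' Complex.HadamardThreeLines.verticalClosedStrip 0 1) := by
    refine ⟨∑ y' ∈ g.range, ∑ y ∈ f.range, (1 + ‖y'‖) ^ r * ((1 + ‖y‖) ^ r *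
      ‖inner ℂ (levelIndicator μ g y') (T (levelIndicator μ f y))‖), ?_⟩
    rintro _ ⟨z, hz, rfl⟩
    simp only [Function.comp, hFeq]
    refine (norm_sum_le _ _).trans (Finset.sum_le_sum fun y' _ => ?_)
    refine (norm_sum_le _ _).trans (Finset.sum_le_sum fun y _ => ?_)
    rw [norm_mul, norm_mul]
    have h1 := hstrip z hz ((starRingEnd ℂ) y')
    rw [RCLike.norm_conj] at h1
    have h2 := hstrip z hz y
    gcongr
  have hWc : ∀ z : ℂ, (W ((starRingEnd ℂ) z)).re = (W z).re := by
    intro z; rw [hWre, hWre, Complex.conj_re]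
  have hL2 : ∀ (h : SimpleFunc X ℂ), Integrable h μ → ∀ w : ℂ, w.re = r / 2 →
      ‖L h w‖ = (∫ x, ‖h x‖ ^ r ∂μ) ^ (1 / 2 : ℝ) := by
    intro h hh w hw
    have : ‖L h w‖ ^ 2 = ∫ x, ‖h x‖ ^ r ∂μ := by
      rw [norm_sq_eq_integral]
      refine integral_congr_ae ?_
      filter_upwards [hL h hh w] with x hx
      rw [hx, norm_phasePow (by rw [hw]; linarith), hw, ← Real.rpow_natCast, ← Real.rpow_mul
        (norm_nonneg _)]
      congr 1; push_cast; ring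
    rw [← this, ← Real.rpow_natCast, ← Real.rpow_mul (norm_nonneg _)]
    norm_num
  have hL1 : ∀ (h : SimpleFunc X ℂ), Integrable h μ → ∀ w : ℂ, w.re = r →
      Integrable (L h w) μ ∧ ∫ x, ‖L h w x‖ ∂μ = ∫ x, ‖h x‖ ^ r ∂μ := by
    intro h hh w hw
    have h1 : (fun x => ‖L h w x‖) =ᵐ[μ] fun x => ‖h x‖ ^ r := by
      filter_upwards [hL h hh w] with x hx
      rw [hx, norm_phasePow (by rw [hw]; linarith), hw]
    refine ⟨?_, integral_congr_ae h1⟩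
    rw [← integrable_norm_iff (Lp.aestronglyMeasurable _)]
    exact (simpleFunc_integrable_rpow h hh hr0).congr h1.symm
  have ha : ∀ z ∈ Complex.re ⁻¹' {(0 : ℝ)}, ‖F z‖ ≤ Nf ^ (1 / 2 : ℝ) * Ng ^ (1 / 2 : ℝ) := by
    intro z hz
    have hz' : z.re = 0 := hz
    have h1 : (W z).re = r / 2 := by rw [hWre, hz']; ring
    calc ‖F z‖ ≤ ‖L g (W ((starRingEnd ℂ) z))‖ * ‖T (L f (W z))‖ := norm_inner_le_norm _ _
      _ ≤ ‖L g (W ((starRingEnd ℂ) z))‖ * ‖L f (W z)‖ :=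
          mul_le_mul_of_nonneg_left (hT _) (norm_nonneg _)
      _ = _ := by rw [hL2 g hg _ ((hWc z).trans h1), hL2 f hf _ h1, mul_comm]
  have hb : ∀ z ∈ Complex.re ⁻¹' {(1 : ℝ)}, ‖F z‖ ≤ A * (Nf * Ng) := by
    intro z hz
    have hz' : z.re = 1 := hz
    have h1 : (W z).re = r := by rw [hWre, hz']; ring
    have h2 := hL1 f hf _ h1
    have h3 := hL1 g hg _ ((hWc z).trans h1)
    have := hT1 _ _ h2.1 h3.1
    rwa [h2.2, h3.2] at this
  have hθ : 0 ≤ 2 / r - 1 ∧ 2 / r - 1 ≤ 1 := by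
    constructor
    · rw [sub_nonneg, le_div_iff₀ hr0]; linarith
    · rw [sub_le_iff_le_add, div_le_iff₀ hr0]; linarith
  have hW1 : ∀ z : ℂ, z = ((2 / r - 1 : ℝ) : ℂ) → W z = 1 := by
    rintro z rfl
    have : (r : ℂ) ≠ 0 := by exact_mod_cast hr0.ne'
    simp only [W]; push_cast; field_simp; ring
  have hmain := Complex.HadamardThreeLines.norm_le_interp_of_mem_verticalClosedStrip₀₁' F
    (z := ((2 / r - 1 : ℝ) : ℂ)) (by
      simpa [Complex.HadamardThreeLines.verticalClosedStrip] using hθ) hdiff.diffContOnCl hB ha hb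
  have hFz : F ((2 / r - 1 : ℝ) : ℂ) = inner ℂ g' (T f') := by
    simp only [F]
    rw [Complex.conj_ofReal, hW1 _ rfl]
    congr 1
    · refine Lp.ext ((hL g hg 1).trans (EventuallyEq.trans ?_ hgg.symm))
      exact Eventually.of_forall fun x => phasePow_one _
    · congr 1
      refine Lp.ext ((hL f hf 1).trans (EventuallyEq.trans ?_ hff.symm))
      exact Eventually.of_forall fun x => phasePow_one _
  rw [hFz] at hmain
  refine hmain.trans (le_of_eq ?_)
  rw [Complex.ofReal_re, Real.mul_rpow (Real.rpow_nonneg hNf _) (Real.rpow_nonneg hNg _),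
    Real.mul_rpow hA.le (mul_nonneg hNf hNg), Real.mul_rpow hNf hNg, ← Real.rpow_mul hNf,
    ← Real.rpow_mul hNg]
  have hsplit : ∀ x : ℝ, 0 ≤ x →
      x ^ (1 / r) = x ^ (1 / 2 * (1 - (2 / r - 1))) * x ^ (2 / r - 1) := by
    intro x hx
    rw [← Real.rpow_add' hx]
    · congr 1; field_simp; ring
    · have h5 : 1 / 2 * (1 - (2 / r - 1)) + (2 / r - 1) = 1 / r := by field_simp; ring
      rw [h5]; positivity
  rw [hsplit Nf hNf, hsplit Ng hNg]
  ring

/-- The real `L^r` norm. -/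
def rNorm (μ : Measure X) (r : ℝ) (f : X → ℂ) : ℝ := (eLpNorm f (ENNReal.ofReal r) μ).toReal

theorem rNorm_nonneg (r : ℝ) (f : X → ℂ) : 0 ≤ rNorm μ r f := ENNReal.toReal_nonneg

theorem rNorm_eq_integral {r : ℝ} (hr : 0 < r) {f : X → ℂ}
    (hf : MemLp f (ENNReal.ofReal r) μ) : rNorm μ r f = (∫ x, ‖f x‖ ^ r ∂μ) ^ (1 / r) := by
  rw [rNorm, hf.eLpNorm_eq_integral_rpow_norm (by simpa using hr) (by simp),
    ENNReal.toReal_ofReal hr.le, ENNReal.toReal_ofReal, one_div]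
  exact Real.rpow_nonneg (integral_nonneg fun x => Real.rpow_nonneg (norm_nonneg _) _) _

/-- Riesz–Thorin interpolation between `L² → L²` and `L¹ → L^∞`. -/
theorem norm_inner_le_of_interpolation (T : Lp ℂ 2 μ →L[ℂ] Lp ℂ 2 μ) (hT : ∀ f, ‖T f‖ ≤ ‖f‖)
    {A : ℝ} (hA : 0 < A)
    (hT1 : ∀ f g : Lp ℂ 2 μ, Integrable f μ → Integrable g μ →
      ‖inner ℂ g (T f)‖ ≤ A * ((∫ x, ‖f x‖ ∂μ) * ∫ x, ‖g x‖ ∂μ))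
    {r : ℝ} (hr1 : 1 < r) (hr2 : r < 2) (f g : Lp ℂ 2 μ)
    (hf : MemLp f (ENNReal.ofReal r) μ) (hg : MemLp g (ENNReal.ofReal r) μ) :
    ‖inner ℂ g (T f)‖ ≤ A ^ (2 / r - 1) * (rNorm μ r f * rNorm μ r g) := by
  have hr0 : 0 < r := by linarith
  have : Fact (1 ≤ ENNReal.ofReal r) := ⟨by simpa using hr1.le⟩
  -- simple functions approximating `h` in both norms
  have happ : ∀ h : Lp ℂ 2 μ, MemLp h (ENNReal.ofReal r) μ →
      ∃ (s : ℕ → SimpleFunc X ℂ) (s2 : ℕ → Lp ℂ 2 μ), (∀ n, Integrable (s n) μ) ∧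
        (∀ n, s2 n =ᵐ[μ] s n) ∧ Tendsto s2 atTop (𝓝 h) ∧
        Tendsto (fun n => (∫ x, ‖s n x‖ ^ r ∂μ) ^ (1 / r)) atTop (𝓝 (rNorm μ r h)) := by
    intro h hh
    have hm : Measurable h := (Lp.stronglyMeasurable h).measurable
    have h2 : MemLp h 2 μ := Lp.memLp h
    let s : ℕ → SimpleFunc X ℂ := SimpleFunc.approxOn h hm (range h ∪ {0}) 0 (by simp)
    have hs2 : ∀ n, MemLp (s n) 2 μ := SimpleFunc.memLp_approxOn_range hm h2
    have hsr : ∀ n, MemLp (s n) (ENNReal.ofReal r) μ := SimpleFunc.memLp_approxOn_range hm hh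
    refine ⟨s, fun n => (hs2 n).toLp, fun n => ?_, fun n => (hs2 n).coeFn_toLp, ?_, ?_⟩
    · exact (SimpleFunc.memLp_iff_integrable (by simp) (by simp)).1 (hs2 n)
    · have := SimpleFunc.tendsto_approxOn_range_Lp (by simp) hm h2
      rwa [Lp.toLp_coeFn] at this
    · have h3 := (SimpleFunc.tendsto_approxOn_range_Lp (by simp) hm hh).norm
      simp only [Lp.norm_toLp] at h3
      refine h3.congr fun n => ?_
      rw [← rNorm_eq_integral hr0 (hsr n), rNorm]
  obtain ⟨sf, sf2, hsf, hsf2, hsf3, hsf4⟩ := happ f hf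
  obtain ⟨sg, sg2, hsg, hsg2, hsg3, hsg4⟩ := happ g hg
  refine le_of_tendsto_of_tendsto
    ((hsg3.inner ((T.continuous.tendsto f).comp hsf3)).norm)
    ((hsf4.mul hsg4).const_mul (A ^ (2 / r - 1))) (Eventually.of_forall fun n => ?_)
  exact norm_inner_simpleFunc_le T hT hA hT1 hr1 hr2 (sf n) (sg n) (hsf n) (hsg n) (sf2 n) (sg2 n)
    (hsf2 n) (hsg2 n)

end Interpolation

/-! ### Fractional integration on the line -/

theorem lintegral_Ioc_rpow_neg {q : ℝ} (hq : q < 1) {a : ℝ} (ha : 0 < a) :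
    ∫⁻ b in Ioc 0 a, ENNReal.ofReal (b ^ (-q)) = ENNReal.ofReal (a ^ (1 - q) / (1 - q)) := by
  have hint : IntervalIntegrable (fun b : ℝ => b ^ (-q)) volume 0 a :=
    intervalIntegral.intervalIntegrable_rpow' (by linarith)
  rw [← ofReal_integral_eq_lintegral_ofReal ((intervalIntegrable_iff_integrableOn_Ioc_of_le ha.le).1
    hint) ((ae_restrict_iff' measurableSet_Ioc).2 (Eventually.of_forall fun b hb =>
      Real.rpow_nonneg hb.1.le _)), ← intervalIntegral.integral_of_le ha.le,
    integral_rpow (Or.inl (by linarith)), Real.zero_rpow (by linarith), sub_zero,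
    show -q + 1 = 1 - q by ring]

/-- Among all sets of given measure, an interval centred at `τ` nearly maximizes the integral of
`|t - τ|^{-γ}`. -/
theorem setLIntegral_rpow_neg_le {γ : ℝ} (hγ0 : 0 < γ) (hγ1 : γ < 1) (E : Set ℝ)
    (τ : ℝ) :
    ∫⁻ t in E, ENNReal.ofReal (|t - τ| ^ (-γ)) ≤
      ENNReal.ofReal (1 + 2 / (1 - γ)) * volume E ^ (1 - γ) := by
  rcases eq_or_ne (volume E) ∞ with hE | hE
  · rw [hE, ENNReal.top_rpow_of_pos (by linarith), ENNReal.mul_top]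
    · exact le_top
    · have : 0 < 2 / (1 - γ) := div_pos two_pos (by linarith)
      simp; linarith
  rcases eq_or_ne (volume E) 0 with hE0 | hE0
  · rw [setLIntegral_measure_zero _ _ hE0]; exact zero_le
  set R := (volume E).toReal with hR
  have hRpos : 0 < R := ENNReal.toReal_pos hE0 hE
  have hvol : volume E = ENNReal.ofReal R := (ENNReal.ofReal_toReal hE).symm
  have hpt : ∀ t : ℝ, ENNReal.ofReal (|t - τ| ^ (-γ)) ≤
      (Icc (τ - R) (τ + R)).indicator (fun t => ENNReal.ofReal (|t - τ| ^ (-γ))) t +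
        ENNReal.ofReal (R ^ (-γ)) := by
    intro t
    by_cases ht : t ∈ Icc (τ - R) (τ + R)
    · rw [indicator_of_mem ht]; exact le_self_add
    · rw [indicator_of_notMem ht, zero_add]
      apply ENNReal.ofReal_le_ofReal
      apply Real.rpow_le_rpow_of_nonpos hRpos _ (by linarith)
      by_contra h
      push Not at h
      rw [abs_lt] at h
      exact ht ⟨by linarith [h.1], by linarith [h.2]⟩
  have hball : ∫⁻ t in Icc (τ - R) (τ + R), ENNReal.ofReal (|t - τ| ^ (-γ)) ≤
      ENNReal.ofReal (2 / (1 - γ) * R ^ (1 - γ)) := by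
    have hsub : Icc (τ - R) (τ + R) ⊆ {τ} ∪ (Ioc τ (τ + R) ∪ Ico (τ - R) τ) := by
      intro t ht
      rcases lt_trichotomy t τ with h | h | h
      · exact Or.inr (Or.inr ⟨ht.1, h⟩)
      · exact Or.inl h
      · exact Or.inr (Or.inl ⟨h, ht.2⟩)
    have h1 : ∫⁻ t in Ioc τ (τ + R), ENNReal.ofReal (|t - τ| ^ (-γ)) =
        ENNReal.ofReal (R ^ (1 - γ) / (1 - γ)) := by
      rw [← lintegral_Ioc_rpow_neg hγ1 hRpos, ← lintegral_indicator measurableSet_Ioc,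
        ← lintegral_indicator measurableSet_Ioc,
        ← lintegral_add_right_eq_self (fun t => (Ioc τ (τ + R)).indicator _ t) τ]
      refine lintegral_congr fun b => ?_
      by_cases hb : b ∈ Ioc 0 R
      · rw [indicator_of_mem hb, indicator_of_mem (show b + τ ∈ Ioc τ (τ + R) from
          ⟨by linarith [hb.1], by linarith [hb.2]⟩)]
        rw [add_sub_cancel_right, abs_of_pos hb.1]
      · rw [indicator_of_notMem hb, indicator_of_notMem]
        exact fun h => hb ⟨by linarith [h.1], by linarith [h.2]⟩
    have h2 : ∫⁻ t in Ico (τ - R) τ, ENNReal.ofReal (|t - τ| ^ (-γ)) =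
        ENNReal.ofReal (R ^ (1 - γ) / (1 - γ)) := by
      rw [← lintegral_Ioc_rpow_neg hγ1 hRpos, ← lintegral_indicator measurableSet_Ico,
        ← lintegral_indicator measurableSet_Ioc,
        ← lintegral_sub_left_eq_self (fun t => (Ico (τ - R) τ).indicator _ t) τ]
      refine lintegral_congr fun b => ?_
      by_cases hb : b ∈ Ioc 0 R
      · rw [indicator_of_mem hb, indicator_of_mem (show τ - b ∈ Ico (τ - R) τ from
          ⟨by linarith [hb.2], by linarith [hb.1]⟩)]
        rw [show τ - b - τ = -b by ring, abs_neg, abs_of_pos hb.1]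
      · rw [indicator_of_notMem hb, indicator_of_notMem]
        exact fun h => hb ⟨by linarith [h.2], by linarith [h.1]⟩
    calc _ ≤ ∫⁻ t in {τ} ∪ (Ioc τ (τ + R) ∪ Ico (τ - R) τ), ENNReal.ofReal (|t - τ| ^ (-γ)) :=
          lintegral_mono_set hsub
      _ ≤ (∫⁻ t in {τ}, ENNReal.ofReal (|t - τ| ^ (-γ))) +
          ((∫⁻ t in Ioc τ (τ + R), ENNReal.ofReal (|t - τ| ^ (-γ))) +
            ∫⁻ t in Ico (τ - R) τ, ENNReal.ofReal (|t - τ| ^ (-γ))) :=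
          (lintegral_union_le _ _ _).trans (add_le_add le_rfl (lintegral_union_le _ _ _))
      _ = _ := by
          rw [setLIntegral_measure_zero _ _ (by simp), zero_add, h1, h2,
            ← ENNReal.ofReal_add]
          · congr 1; ring
          · exact div_nonneg (Real.rpow_nonneg hRpos.le _) (by linarith)
          · exact div_nonneg (Real.rpow_nonneg hRpos.le _) (by linarith)
  calc ∫⁻ t in E, ENNReal.ofReal (|t - τ| ^ (-γ))
      ≤ ∫⁻ t in E, ((Icc (τ - R) (τ + R)).indicator
        (fun t => ENNReal.ofReal (|t - τ| ^ (-γ))) t + ENNReal.ofReal (R ^ (-γ))) :=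
        lintegral_mono hpt
    _ = (∫⁻ t in E, (Icc (τ - R) (τ + R)).indicator
        (fun t => ENNReal.ofReal (|t - τ| ^ (-γ))) t) + ENNReal.ofReal (R ^ (-γ)) * volume E := by
        rw [lintegral_add_right _ measurable_const, setLIntegral_const]
    _ ≤ ENNReal.ofReal (2 / (1 - γ) * R ^ (1 - γ)) + ENNReal.ofReal (R ^ (1 - γ)) := by
        refine add_le_add ?_ (le_of_eq ?_)
        · refine (setLIntegral_le_lintegral _ _).trans ?_
          rw [lintegral_indicator measurableSet_Icc]
          exact hball
        · rw [hvol, ← ENNReal.ofReal_mul (Real.rpow_nonneg hRpos.le _)]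
          congr 1
          nth_rewrite 2 [← Real.rpow_one R]
          rw [← Real.rpow_add hRpos]
          congr 1; ring
    _ = _ := by
        rw [hvol, ENNReal.ofReal_rpow_of_pos hRpos, ← ENNReal.ofReal_mul, ← ENNReal.ofReal_add]
        · congr 1; ring
        · exact mul_nonneg (div_nonneg two_pos.le (by linarith)) (Real.rpow_nonneg hRpos.le _)
        · exact Real.rpow_nonneg hRpos.le _
        · have : 0 < 2 / (1 - γ) := div_pos two_pos (by linarith)
          linarith

theorem lintegral_mul_eq_lintegral_setLIntegral {K : ℝ → ℝ≥0∞} (hK : Measurable K) {f : ℝ → ℝ}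
    (hf0 : ∀ t, 0 ≤ f t) (hf : Measurable f) :
    ∫⁻ t, ENNReal.ofReal (f t) * K t = ∫⁻ a in Ioi 0, ∫⁻ t in {t | a < f t}, K t := by
  have h := lintegral_eq_lintegral_meas_lt (volume.withDensity K) (Eventually.of_forall hf0)
    hf.aemeasurable
  rw [lintegral_withDensity_eq_lintegral_mul _ hK hf.ennreal_ofReal] at h
  simp only [Pi.mul_apply, mul_comm (K _)] at h
  rw [h]
  exact lintegral_congr fun a => withDensity_apply _ (measurableSet_lt measurable_const hf)

/-- The Hardy–Littlewood–Sobolev inequality on the line, for functions with norm at most one. -/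
theorem hardyLittlewoodSobolev_normalized {γ : ℝ} (hγ0 : 0 < γ) (hγ1 : γ < 1) {p : ℝ}
    (hp : p = 2 / (2 - γ)) {f g : ℝ → ℝ} (hf0 : ∀ t, 0 ≤ f t) (hg0 : ∀ t, 0 ≤ g t)
    (hf : Measurable f) (hg : Measurable g)
    (hf1 : ∫⁻ t, ENNReal.ofReal (f t ^ p) ≤ 1) (hg1 : ∫⁻ t, ENNReal.ofReal (g t ^ p) ≤ 1) :
    ∫⁻ t, ENNReal.ofReal (f t) *
      ∫⁻ τ, ENNReal.ofReal (g τ) * ENNReal.ofReal (|t - τ| ^ (-γ)) ≤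
      ENNReal.ofReal ((1 + 2 / (1 - γ)) * (2 / (p - 1))) := by
  have hp1 : 1 < p := by rw [hp, lt_div_iff₀ (by linarith)]; linarith
  have hp0 : 0 < p := by linarith
  have hpγ : p * (1 - γ) = 2 - p := by
    rw [hp]
    have : (2 - γ) ≠ 0 := by linarith
    field_simp; ring
  set C0 := ENNReal.ofReal (1 + 2 / (1 - γ)) with hC0
  set F : ℝ → ℝ≥0∞ := fun a => volume {t | a < f t} with hF
  set G : ℝ → ℝ≥0∞ := fun a => volume {t | a < g t} with hG
  have hk : Measurable fun z : ℝ × ℝ => ENNReal.ofReal (|z.1 - z.2| ^ (-γ)) := by fun_prop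
  have hlevel : ∀ {h : ℝ → ℝ}, (∀ t, 0 ≤ h t) → Measurable h → ∫⁻ t, ENNReal.ofReal (h t ^ p) ≤ 1 →
      (∀ a, 0 < a → volume {t | a < h t} ^ (1 - γ) ≤ ENNReal.ofReal (a ^ (-(2 - p)))) ∧
      ∫⁻ a in Ioi 0, volume {t | a < h t} * ENNReal.ofReal (a ^ (p - 1)) ≤ 1 := by
    intro h h0 hm h1
    constructor
    · intro a ha
      have h2 : ENNReal.ofReal (a ^ p) * volume {t | a < h t} ≤ 1 := by
        refine le_trans ?_ ((mul_meas_ge_le_lintegral (μ := volume)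
          (f := fun t => ENNReal.ofReal (h t ^ p)) (by fun_prop) (ENNReal.ofReal (a ^ p))).trans h1)
        gcongr
        intro ht
        exact ENNReal.ofReal_le_ofReal (Real.rpow_le_rpow ha.le (le_of_lt ht) hp0.le)
      have h3 : volume {t | a < h t} ≤ ENNReal.ofReal (a ^ (-p)) := by
        rw [Real.rpow_neg ha.le, ENNReal.ofReal_inv_of_pos (Real.rpow_pos_of_pos ha _)]
        rw [mul_comm] at h2
        exact ENNReal.le_inv_iff_mul_le.2 h2
      calc volume {t | a < h t} ^ (1 - γ) ≤ ENNReal.ofReal (a ^ (-p)) ^ (1 - γ) :=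
            ENNReal.rpow_le_rpow h3 (by linarith)
        _ = _ := by
            rw [ENNReal.ofReal_rpow_of_pos (Real.rpow_pos_of_pos ha _), ← Real.rpow_mul ha.le]
            congr 2; rw [← hpγ]; ring
    · have h2 := lintegral_rpow_eq_lintegral_meas_lt_mul (volume : Measure ℝ)
        (Eventually.of_forall h0) hm.aemeasurable hp0
      rw [h2] at h1
      refine le_trans ?_ h1
      refine le_mul_of_one_le_left zero_le ?_
      simpa using hp1.le
  obtain ⟨hF1, hF2⟩ := hlevel hf0 hf hf1
  obtain ⟨hG1, hG2⟩ := hlevel hg0 hg hg1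
  have hFm : Measurable F := Antitone.measurable fun a b hab =>
    measure_mono fun t (ht : b < f t) => lt_of_le_of_lt hab ht
  have hGm : Measurable G := Antitone.measurable fun a b hab =>
    measure_mono fun t (ht : b < g t) => lt_of_le_of_lt hab ht
  -- the form as a double integral over levels
  have hK : Measurable fun t => ∫⁻ τ, ENNReal.ofReal (g τ) * ENNReal.ofReal (|t - τ| ^ (-γ)) := by
    apply Measurable.lintegral_prod_right'
      (f := fun z : ℝ × ℝ => ENNReal.ofReal (g z.2) * ENNReal.ofReal (|z.1 - z.2| ^ (-γ)))
    fun_prop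
  rw [lintegral_mul_eq_lintegral_setLIntegral hK hf0 hf]
  have hJ : ∀ a, ∫⁻ t in {t | a < f t}, (∫⁻ τ, ENNReal.ofReal (g τ) *
      ENNReal.ofReal (|t - τ| ^ (-γ))) =
      ∫⁻ b in Ioi 0, ∫⁻ τ in {τ | b < g τ}, ∫⁻ t in {t | a < f t},
        ENNReal.ofReal (|t - τ| ^ (-γ)) := by
    intro a
    rw [lintegral_lintegral_swap (by fun_prop), ← lintegral_mul_eq_lintegral_setLIntegral _ hg0 hg]
    · refine lintegral_congr fun τ => ?_
      rw [lintegral_const_mul _ (by fun_prop)]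
    · apply Measurable.lintegral_prod_right'
        (f := fun z : ℝ × ℝ => ENNReal.ofReal (|z.2 - z.1| ^ (-γ)))
      fun_prop
  simp_rw [hJ]
  have hJle1 : ∀ a b, ∫⁻ τ in {τ | b < g τ}, ∫⁻ t in {t | a < f t},
      ENNReal.ofReal (|t - τ| ^ (-γ)) ≤ C0 * (G b * F a ^ (1 - γ)) := by
    intro a b
    calc _ ≤ ∫⁻ τ in {τ | b < g τ}, C0 * F a ^ (1 - γ) :=
          lintegral_mono fun τ => setLIntegral_rpow_neg_le hγ0 hγ1 _ τ
      _ = _ := by rw [setLIntegral_const]; ring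
  have hJle2 : ∀ a b, ∫⁻ τ in {τ | b < g τ}, ∫⁻ t in {t | a < f t},
      ENNReal.ofReal (|t - τ| ^ (-γ)) ≤ C0 * (F a * G b ^ (1 - γ)) := by
    intro a b
    rw [lintegral_lintegral_swap (by fun_prop)]
    calc _ ≤ ∫⁻ t in {t | a < f t}, C0 * G b ^ (1 - γ) := by
          refine lintegral_mono fun t => ?_
          simp_rw [abs_sub_comm t]
          exact setLIntegral_rpow_neg_le hγ0 hγ1 _ t
      _ = _ := by rw [setLIntegral_const]; ring
  have hpt : ∀ a ∈ Ioi (0 : ℝ), ∀ b ∈ Ioi (0 : ℝ), ∫⁻ τ in {τ | b < g τ}, ∫⁻ t in {t | a < f t},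
      ENNReal.ofReal (|t - τ| ^ (-γ)) ≤
      C0 * (F a * (Ioc 0 a).indicator (fun b => ENNReal.ofReal (b ^ (-(2 - p)))) b) +
      C0 * (G b * (Ioc 0 b).indicator (fun a => ENNReal.ofReal (a ^ (-(2 - p)))) a) := by
    intro a ha b hb
    rcases le_total b a with h | h
    · rw [indicator_of_mem (show b ∈ Ioc 0 a from ⟨hb, h⟩)]
      refine (hJle2 a b).trans (le_trans ?_ le_self_add)
      gcongr
      exact hG1 b hb
    · rw [indicator_of_mem (show a ∈ Ioc 0 b from ⟨ha, h⟩)]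
      refine (hJle1 a b).trans (le_trans ?_ le_add_self)
      gcongr
      exact hF1 a ha
  have hone : ∀ {Q : ℝ → ℝ≥0∞}, Measurable Q →
      ∫⁻ a in Ioi 0, Q a * ENNReal.ofReal (a ^ (p - 1)) ≤ 1 →
      ∫⁻ a in Ioi 0, ∫⁻ b in Ioi 0, C0 * (Q a * (Ioc 0 a).indicator
        (fun b => ENNReal.ofReal (b ^ (-(2 - p)))) b) ≤ C0 * ENNReal.ofReal (1 / (p - 1)) := by
    intro Q hQ hQ1
    have h1 : ∀ a ∈ Ioi (0 : ℝ), ∫⁻ b in Ioi 0, C0 * (Q a * (Ioc 0 a).indicator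
        (fun b => ENNReal.ofReal (b ^ (-(2 - p)))) b) =
        C0 * ENNReal.ofReal (1 / (p - 1)) * (Q a * ENNReal.ofReal (a ^ (p - 1))) := by
      intro a ha
      have hmi : Measurable ((Ioc 0 a).indicator fun b : ℝ => ENNReal.ofReal (b ^ (-(2 - p)))) :=
        Measurable.indicator (by fun_prop) measurableSet_Ioc
      rw [lintegral_const_mul _ (hmi.const_mul _), lintegral_const_mul _ hmi,
        lintegral_indicator measurableSet_Ioc,
        Measure.restrict_restrict measurableSet_Ioc,
        inter_eq_self_of_subset_left Ioc_subset_Ioi_self,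
        lintegral_Ioc_rpow_neg (by linarith) ha, show 1 - (2 - p) = p - 1 by ring,
        div_eq_mul_one_div, ENNReal.ofReal_mul (Real.rpow_nonneg (le_of_lt ha) _)]
      ring
    rw [setLIntegral_congr_fun measurableSet_Ioi h1, lintegral_const_mul _ (by fun_prop)]
    exact mul_le_of_le_one_right zero_le hQ1
  have hmeas : ∀ {Q : ℝ → ℝ≥0∞}, Measurable Q → Measurable fun z : ℝ × ℝ => C0 * (Q z.1 *
      (Ioc 0 z.1).indicator (fun b => ENNReal.ofReal (b ^ (-(2 - p)))) z.2) := by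
    intro Q hQ
    have h1 : MeasurableSet {z : ℝ × ℝ | z.2 ∈ Ioc 0 z.1} :=
      (measurableSet_lt measurable_const measurable_snd).inter
        (measurableSet_le measurable_snd measurable_fst)
    have h2 : Measurable fun z : ℝ × ℝ =>
        ({z : ℝ × ℝ | z.2 ∈ Ioc 0 z.1}.indicator fun z => ENNReal.ofReal (z.2 ^ (-(2 - p)))) z :=
      Measurable.indicator (by fun_prop) h1
    exact ((hQ.comp measurable_fst).mul h2).const_mul _
  calc _ ≤ ∫⁻ a in Ioi 0, ∫⁻ b in Ioi 0,
        (C0 * (F a * (Ioc 0 a).indicator (fun b => ENNReal.ofReal (b ^ (-(2 - p)))) b) +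
      C0 * (G b * (Ioc 0 b).indicator (fun a => ENNReal.ofReal (a ^ (-(2 - p)))) a)) :=
        setLIntegral_mono' measurableSet_Ioi fun a ha =>
          setLIntegral_mono' measurableSet_Ioi fun b hb => hpt a ha b hb
    _ = (∫⁻ a in Ioi 0, ∫⁻ b in Ioi 0,
        C0 * (F a * (Ioc 0 a).indicator (fun b => ENNReal.ofReal (b ^ (-(2 - p)))) b)) +
        ∫⁻ a in Ioi 0, ∫⁻ b in Ioi 0,
          C0 * (G b * (Ioc 0 b).indicator (fun a => ENNReal.ofReal (a ^ (-(2 - p)))) a) := by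
        rw [← lintegral_add_left (hmeas hFm).lintegral_prod_right']
        refine lintegral_congr fun a => ?_
        exact lintegral_add_left ((hmeas hFm).comp (measurable_prodMk_left (x := a))) _
    _ ≤ C0 * ENNReal.ofReal (1 / (p - 1)) + C0 * ENNReal.ofReal (1 / (p - 1)) := by
        refine add_le_add (hone hFm hF2) ?_
        rw [lintegral_lintegral_swap]
        · exact hone hGm hG2
        · exact ((hmeas hGm).comp measurable_swap).aemeasurable
    _ = _ := by
        have : 0 < 2 / (1 - γ) := div_pos two_pos (by linarith)
        have h1 : 0 < 1 / (p - 1) := div_pos one_pos (by linarith)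
        rw [hC0, ← ENNReal.ofReal_mul (by linarith), ← ENNReal.ofReal_add (by positivity)
          (by positivity)]
        congr 1; ring

/-- The constant of the Hardy–Littlewood–Sobolev inequality. -/
def hlsConst (γ : ℝ) : ℝ := (1 + 2 / (1 - γ)) * (2 / (2 / (2 - γ) - 1))

/-- The Hardy–Littlewood–Sobolev inequality on the line. -/
theorem hardyLittlewoodSobolev {γ : ℝ} (hγ0 : 0 < γ) (hγ1 : γ < 1) {p : ℝ}
    (hp : p = 2 / (2 - γ)) {f g : ℝ → ℝ} (hf0 : ∀ t, 0 ≤ f t) (hg0 : ∀ t, 0 ≤ g t)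
    (hf : Measurable f) (hg : Measurable g) {A B : ℝ} (hA : 0 < A) (hB : 0 < B)
    (hf1 : ∫⁻ t, ENNReal.ofReal (f t ^ p) ≤ ENNReal.ofReal (A ^ p))
    (hg1 : ∫⁻ t, ENNReal.ofReal (g t ^ p) ≤ ENNReal.ofReal (B ^ p)) :
    ∫⁻ t, ENNReal.ofReal (f t) *
      ∫⁻ τ, ENNReal.ofReal (g τ) * ENNReal.ofReal (|t - τ| ^ (-γ)) ≤
      ENNReal.ofReal (hlsConst γ * (A * B)) := by
  have hnorm : ∀ {h : ℝ → ℝ} {D : ℝ}, 0 < D → (∀ t, 0 ≤ h t) → Measurable h →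
      ∫⁻ t, ENNReal.ofReal (h t ^ p) ≤ ENNReal.ofReal (D ^ p) →
      ∫⁻ t, ENNReal.ofReal ((h t / D) ^ p) ≤ 1 := by
    intro h D hD h0 hm h1
    have h2 : ∀ t, ENNReal.ofReal ((h t / D) ^ p) =
        ENNReal.ofReal (h t ^ p) * (ENNReal.ofReal (D ^ p))⁻¹ := by
      intro t
      rw [Real.div_rpow (h0 t) hD.le, ENNReal.ofReal_div_of_pos (Real.rpow_pos_of_pos hD _),
        div_eq_mul_inv]
    simp_rw [h2]
    rw [lintegral_mul_const _ (by fun_prop), ← div_eq_mul_inv]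
    exact ENNReal.div_le_of_le_mul (by rwa [one_mul])
  have h := hardyLittlewoodSobolev_normalized hγ0 hγ1 hp (f := fun t => f t / A)
    (g := fun t => g t / B) (fun t => div_nonneg (hf0 t) hA.le) (fun t => div_nonneg (hg0 t) hB.le)
    (hf.div_const _) (hg.div_const _) (hnorm hA hf0 hf hf1) (hnorm hB hg0 hg hg1)
  have hC : ((1 + 2 / (1 - γ)) * (2 / (p - 1))) = hlsConst γ := by rw [hp]; rfl
  rw [hC] at h
  calc _ = ENNReal.ofReal (A * B) * ∫⁻ t, ENNReal.ofReal (f t / A) *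
      ∫⁻ τ, ENNReal.ofReal (g τ / B) * ENNReal.ofReal (|t - τ| ^ (-γ)) := by
        have hK : Measurable fun t => ∫⁻ τ, ENNReal.ofReal (g τ / B) *
            ENNReal.ofReal (|t - τ| ^ (-γ)) := by
          apply Measurable.lintegral_prod_right'
            (f := fun z : ℝ × ℝ => ENNReal.ofReal (g z.2 / B) * ENNReal.ofReal (|z.1 - z.2| ^ (-γ)))
          fun_prop
        rw [← lintegral_const_mul _ (by fun_prop)]
        refine lintegral_congr fun t => ?_
        have h1 : ENNReal.ofReal (f t) = ENNReal.ofReal A * ENNReal.ofReal (f t / A) := by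
          rw [← ENNReal.ofReal_mul hA.le]; congr 1; field_simp
        have h2 : ∀ τ, ENNReal.ofReal (g τ) = ENNReal.ofReal B * ENNReal.ofReal (g τ / B) := by
          intro τ
          rw [← ENNReal.ofReal_mul hB.le]; congr 1; field_simp
        simp_rw [h1, h2, mul_assoc]
        rw [lintegral_const_mul _ (by fun_prop), ENNReal.ofReal_mul hA.le]
        ring
    _ ≤ ENNReal.ofReal (A * B) * ENNReal.ofReal (hlsConst γ) := by gcongr
    _ = _ := by
        rw [← ENNReal.ofReal_mul (by positivity)]; congr 1; ring

/-! ### Functions representing tempered distributions -/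

theorem Represents.congr {f g : Space d → ℂ} {T : 𝓢'(Space d, ℂ)} (h : Represents f T)
    (hfg : f =ᵐ[volume] g) : Represents g T := by
  intro ψ
  have : (fun x => ψ x * f x) =ᵐ[volume] fun x => ψ x * g x := by
    filter_upwards [hfg] with x hx
    rw [hx]
  exact ⟨(h ψ).1.congr this, (h ψ).2.trans (integral_congr_ae this)⟩

theorem Represents.unique_right {f : Space d → ℂ} {T T' : 𝓢'(Space d, ℂ)} (h : Represents f T)
    (h' : Represents f T') : T = T' := by
  ext ψ
  rw [(h ψ).2, (h' ψ).2]

theorem Represents.sub {f g : Space d → ℂ} {T T' : 𝓢'(Space d, ℂ)} (h : Represents f T)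
    (h' : Represents g T') : Represents (f - g) (T - T') := by
  intro ψ
  have e : (fun x => ψ x * (f - g) x) = fun x => ψ x * f x - ψ x * g x := by
    funext x
    simp [mul_sub]
  rw [e]
  refine ⟨(h ψ).1.sub (h' ψ).1, ?_⟩
  rw [integral_sub (h ψ).1 (h' ψ).1, ← (h ψ).2, ← (h' ψ).2]
  rfl

theorem Represents.add {f g : Space d → ℂ} {T T' : 𝓢'(Space d, ℂ)} (h : Represents f T)
    (h' : Represents g T') : Represents (f + g) (T + T') := by
  intro ψ
  have e : (fun x => ψ x * (f + g) x) = fun x => ψ x * f x + ψ x * g x := by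
    funext x
    simp [mul_add]
  rw [e]
  refine ⟨(h ψ).1.add (h' ψ).1, ?_⟩
  rw [integral_add (h ψ).1 (h' ψ).1, ← (h ψ).2, ← (h' ψ).2]
  rfl

theorem Represents.smulLeft {f : Space d → ℂ} {T : 𝓢'(Space d, ℂ)} (h : Represents f T)
    {m : Space d → ℂ} (hm : m.HasTemperateGrowth) :
    Represents (fun x => m x * f x) (TemperedDistribution.smulLeftCLM ℂ m T) := by
  intro ψ
  have := h (SchwartzMap.smulLeftCLM ℂ m ψ)
  have e : (fun x => ψ x * (m x * f x)) = fun x => SchwartzMap.smulLeftCLM ℂ m ψ x * f x := by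
    funext x
    rw [SchwartzMap.smulLeftCLM_apply_apply hm]
    simp only [smul_eq_mul]
    ring
  rw [e]
  exact ⟨this.1, by rw [TemperedDistribution.smulLeftCLM_apply_apply, this.2]⟩

theorem Represents.locallyIntegrable {f : Space d → ℂ} {T : 𝓢'(Space d, ℂ)}
    (h : Represents f T) : LocallyIntegrable f := by
  intro x
  let b : ContDiffBump x := ⟨1, 2, by norm_num, by norm_num⟩
  have hg₁ : HasCompactSupport (Complex.ofRealCLM ∘ b) := b.hasCompactSupport.comp_left rfl
  have hg₂ : ContDiff ℝ (⊤ : ℕ∞) (Complex.ofRealCLM ∘ b) :=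
    Complex.ofRealCLM.contDiff.comp b.contDiff
  refine ⟨Metric.ball x 1, Metric.ball_mem_nhds x one_pos, ?_⟩
  refine ((h (hg₁.toSchwartzMap hg₂)).1.integrableOn (s := Metric.ball x 1)).congr ?_
  filter_upwards [ae_restrict_mem measurableSet_ball] with y hy
  have : b y = 1 := b.one_of_mem_closedBall (Metric.ball_subset_closedBall hy)
  simp [this]

theorem Represents.aestronglyMeasurable {f : Space d → ℂ} {T : 𝓢'(Space d, ℂ)}
    (h : Represents f T) : AEStronglyMeasurable f :=
  h.locallyIntegrable.aestronglyMeasurable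

theorem Represents.ae_eq {f g : Space d → ℂ} {T : 𝓢'(Space d, ℂ)} (h : Represents f T)
    (h' : Represents g T) : f =ᵐ[volume] g := by
  have h0 := h.sub h'
  have : f - g =ᵐ[volume] 0 := by
    refine ae_eq_zero_of_integral_contDiff_smul_eq_zero h0.locallyIntegrable ?_
    intro χ χ_smooth χ_cpt
    have hg₁ : HasCompactSupport (Complex.ofRealCLM ∘ χ) := χ_cpt.comp_left rfl
    have hg₂ : ContDiff ℝ (⊤ : ℕ∞) (Complex.ofRealCLM ∘ χ) :=
      Complex.ofRealCLM.contDiff.comp χ_smooth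
    have := (h0 (hg₁.toSchwartzMap hg₂)).2
    rw [sub_self] at this
    simpa using this.symm
  filter_upwards [this] with x hx
  simpa [sub_eq_zero] using hx

/-- The Hilbert space `L²(ℝ^d)`. -/
abbrev L2 (d : ℕ) := Lp ℂ 2 (volume : Measure (Space d))

theorem represents_L2 (f : L2 d) : Represents f (f : 𝓢'(Space d, ℂ)) := by
  intro ψ
  refine ⟨?_, by simp⟩
  exact (ψ.memLp 2 volume).integrable_mul (Lp.memLp f)

/-- On integrable functions, the `L²` Fourier transform is given by the Fourier integral. -/
theorem fourier_L2_ae_eq (f : L2 d) (hf : Integrable f) :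
    (𝓕 f : L2 d) =ᵐ[volume] 𝓕 (f : Space d → ℂ) := by
  have h1 : Represents (𝓕 f : L2 d) (𝓕 (f : 𝓢'(Space d, ℂ))) := by
    rw [Lp.fourier_toTemperedDistribution_eq]
    exact represents_L2 _
  refine h1.ae_eq fun ψ => ?_
  have hψ : Integrable (ψ : Space d → ℂ) := ψ.integrable
  refine ⟨integrable_mul_fourier hψ hf, ?_⟩
  rw [TemperedDistribution.fourier_apply, (represents_L2 f (𝓕 ψ)).2, SchwartzMap.fourier_coe,
    integral_fourier_mul_eq hψ hf]

/-! ### Fourier multipliers on `L²` -/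

/-- Multiplication by the bounded function `m` on `L²`; by convention it is `0` if `m` is not
essentially bounded. -/
def mulOp (m : Space d → ℂ) : L2 d →L[ℂ] L2 d :=
  open Classical in
  if hm : MemLp m ⊤ then (ContinuousLinearMap.mul ℂ ℂ).holderL volume ⊤ 2 2 (hm.toLp m) else 0

theorem memLp_top_of_bound' {m : Space d → ℂ} (hm : Measurable m) {C : ℝ}
    (hC : ∀ η, ‖m η‖ ≤ C) : MemLp m ⊤ :=
  memLp_top_of_bound hm.aestronglyMeasurable C (Eventually.of_forall hC)

theorem mulOp_ae_eq {m : Space d → ℂ} (hm : MemLp m ⊤) (f : L2 d) :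
    mulOp m f =ᵐ[volume] fun η => m η * f η := by
  rw [mulOp, dif_pos hm]
  have := (ContinuousLinearMap.mul ℂ ℂ).coeFn_holder (p := ⊤) (q := 2) (r := 2)
    (μ := (volume : Measure (Space d))) (hm.toLp m) f
  filter_upwards [this, hm.coeFn_toLp] with η h1 h2
  rw [← h2]
  exact h1

/-- The operator on `L²` with symbol `m` with respect to Mathlib's Fourier transform `𝓕`. -/
def fourierMulL (m : Space d → ℂ) : L2 d →L[ℂ] L2 d :=
  ((Lp.fourierTransformₗᵢ (Space d) ℂ).symm.toContinuousLinearEquiv : L2 d →L[ℂ] L2 d) ∘L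
    mulOp m ∘L ((Lp.fourierTransformₗᵢ (Space d) ℂ).toContinuousLinearEquiv : L2 d →L[ℂ] L2 d)

theorem fourier_fourierMulL (m : Space d → ℂ) (f : L2 d) :
    𝓕 (fourierMulL m f) = mulOp m (𝓕 f) :=
  (Lp.fourierTransformₗᵢ (Space d) ℂ).apply_symm_apply _

theorem fourier_injective : Function.Injective (fun f : L2 d => 𝓕 f) :=
  (Lp.fourierTransformₗᵢ (Space d) ℂ).injective

theorem fourierMulL_ae_eq {m : Space d → ℂ} (hm : MemLp m ⊤) (f : L2 d) :
    (𝓕 (fourierMulL m f) : L2 d) =ᵐ[volume] fun η => m η * (𝓕 f : L2 d) η := by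
  rw [fourier_fourierMulL]
  exact mulOp_ae_eq hm _

theorem eq_fourierMulL {m : Space d → ℂ} (hm : MemLp m ⊤) {f g : L2 d}
    (h : (𝓕 g : L2 d) =ᵐ[volume] fun η => m η * (𝓕 f : L2 d) η) : g = fourierMulL m f := by
  apply fourier_injective
  exact Lp.ext (h.trans (fourierMulL_ae_eq hm f).symm)

theorem norm_sq_eq_integral_fourier (f : L2 d) :
    ‖f‖ ^ 2 = ∫ η, ‖(𝓕 f : L2 d) η‖ ^ 2 := by
  rw [← norm_sq_eq_integral, Lp.norm_fourier_eq]

theorem norm_fourierMulL_le {m : Space d → ℂ} (hm : Measurable m) {C : ℝ} (hC : ∀ η, ‖m η‖ ≤ C)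
    (f : L2 d) : ‖fourierMulL m f‖ ≤ C * ‖f‖ := by
  have hC0 : 0 ≤ C := (norm_nonneg _).trans (hC 0)
  rw [← Lp.norm_fourier_eq, ← Lp.norm_fourier_eq f]
  refine Lp.norm_le_mul_norm_of_ae_le_mul ?_
  filter_upwards [fourierMulL_ae_eq (memLp_top_of_bound' hm hC) f] with η h
  rw [h, norm_mul]
  exact mul_le_mul_of_nonneg_right (hC η) (norm_nonneg _)

theorem inner_eq_integral_fourier (f g : L2 d) :
    inner ℂ f g = ∫ η, (𝓕 g : L2 d) η * (starRingEnd ℂ) ((𝓕 f : L2 d) η) := by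
  rw [← Lp.inner_fourier_eq, L2.inner_def]
  rfl

theorem inner_fourierMulL {m : Space d → ℂ} (hm : MemLp m ⊤) (f g : L2 d) :
    inner ℂ g (fourierMulL m f)
      = ∫ η, m η * ((𝓕 f : L2 d) η * (starRingEnd ℂ) ((𝓕 g : L2 d) η)) := by
  rw [inner_eq_integral_fourier]
  refine integral_congr_ae ?_
  filter_upwards [fourierMulL_ae_eq hm f] with η h
  rw [h, mul_assoc]

theorem inner_fourierMulL_left {m : Space d → ℂ} (hm : MemLp m ⊤) (f g : L2 d) :
    inner ℂ (fourierMulL m f) g = inner ℂ f (fourierMulL (fun η => (starRingEnd ℂ) (m η)) g) := by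
  have hm' : MemLp (fun η => (starRingEnd ℂ) (m η)) ⊤ := hm.star
  rw [inner_fourierMulL hm', inner_eq_integral_fourier]
  refine integral_congr_ae ?_
  filter_upwards [fourierMulL_ae_eq hm f] with η h
  rw [h, map_mul]
  ring

theorem fourierMulL_fourierMulL {m n : Space d → ℂ} (hm : MemLp m ⊤) (hn : MemLp n ⊤)
    (f : L2 d) : fourierMulL m (fourierMulL n f) = fourierMulL (fun η => m η * n η) f := by
  have hmn : MemLp (fun η => m η * n η) ⊤ := hn.mul' hm
  refine eq_fourierMulL hmn ?_
  filter_upwards [fourierMulL_ae_eq hm (fourierMulL n f), fourierMulL_ae_eq hn f] with η h1 h2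
  rw [h1, h2, mul_assoc]

theorem represents_fourier_multiplier {m : Space d → ℂ} (T : 𝓢'(Space d, ℂ)) :
    𝓕 (multiplier m T)
      = TemperedDistribution.smulLeftCLM ℂ (fun η => m ((2 * Real.pi) • η)) (𝓕 T) := by
  rw [multiplier, TemperedDistribution.fourierMultiplierCLM_apply, FourierTransform.fourier_fourierInv_eq]

/-- On `L²`, a multiplier of tempered distributions with a bounded symbol is `fourierMulL`. -/
theorem multiplier_L2 {m : Space d → ℂ}
    (hm : (fun η => m ((2 * Real.pi) • η)).HasTemperateGrowth)
    (hb : MemLp (fun η => m ((2 * Real.pi) • η)) ⊤) (f : L2 d) :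
    multiplier m (f : 𝓢'(Space d, ℂ))
      = (fourierMulL (fun η => m ((2 * Real.pi) • η)) f : L2 d) := by
  have h : 𝓕 (multiplier m (f : 𝓢'(Space d, ℂ)))
      = 𝓕 ((fourierMulL (fun η => m ((2 * Real.pi) • η)) f : L2 d) : 𝓢'(Space d, ℂ)) := by
    rw [represents_fourier_multiplier, Lp.fourier_toTemperedDistribution_eq,
      Lp.fourier_toTemperedDistribution_eq]
    refine ((represents_L2 (𝓕 f : L2 d)).smulLeft hm).unique_right ?_
    exact (represents_L2 _).congr (fourierMulL_ae_eq hb f)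
  have := congrArg (fun T => 𝓕⁻ T) h
  simpa only [FourierTransform.fourierInv_fourier_eq] using this

theorem norm_exp_I_mul_ofReal (y : ℝ) : ‖Complex.exp (Complex.I * (y : ℂ))‖ = 1 := by
  rw [mul_comm]
  exact Complex.norm_exp_ofReal_mul_I y

theorem hasTemperateGrowth_exp_I_mul :
    (fun x : ℝ => Complex.exp (Complex.I * (x : ℂ))).HasTemperateGrowth := by
  have hder : ∀ n : ℕ, iteratedDeriv n (fun x : ℝ => Complex.exp (Complex.I * (x : ℂ)))
      = fun x : ℝ => Complex.I ^ n * Complex.exp (Complex.I * (x : ℂ)) := by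
    intro n
    induction n with
    | zero => simp
    | succ n ih =>
      rw [iteratedDeriv_succ, ih]
      funext x
      have h1 : HasDerivAt (fun x : ℝ => Complex.I * (x : ℂ)) Complex.I x := by
        simpa using (Complex.ofRealCLM.hasDerivAt (x := x)).const_mul Complex.I
      rw [((h1.cexp).const_mul (Complex.I ^ n)).deriv]
      ring
  refine ⟨?_, fun n => ⟨0, 1, fun x => ?_⟩⟩
  · exact Complex.contDiff_exp.comp (contDiff_const.mul Complex.ofRealCLM.contDiff)
  · rw [norm_iteratedFDeriv_eq_norm_iteratedDeriv, hder]
    simp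

/-- The symbol of the free propagator with respect to Mathlib's Fourier transform. -/
def propSym (t : ℝ) (η : Space d) : ℂ :=
  Complex.exp (Complex.I * ((t * ‖(2 * Real.pi) • η‖ ^ 4 : ℝ) : ℂ))

theorem norm_propSym (t : ℝ) (η : Space d) : ‖propSym t η‖ = 1 := norm_exp_I_mul_ofReal _

theorem continuous_propSym (t : ℝ) : Continuous (propSym (d := d) t) := by
  unfold propSym
  fun_prop

theorem continuous_propSym_time (η : Space d) : Continuous fun t => propSym t η := by
  unfold propSym
  fun_prop

theorem memLp_propSym (t : ℝ) : MemLp (propSym (d := d) t) ⊤ :=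
  memLp_top_of_bound' (continuous_propSym t).measurable fun η => (norm_propSym t η).le

theorem propSym_mul (t s : ℝ) (η : Space d) : propSym t η * propSym s η = propSym (t + s) η := by
  unfold propSym
  rw [← Complex.exp_add]
  congr 1
  push_cast
  ring

theorem propSym_zero (η : Space d) : propSym 0 η = 1 := by
  simp [propSym]

theorem conj_propSym (t : ℝ) (η : Space d) :
    (starRingEnd ℂ) (propSym t η) = propSym (-t) η := by
  unfold propSym
  rw [← Complex.exp_conj, map_mul, Complex.conj_I, Complex.conj_ofReal]
  congr 1
  push_cast
  ring

theorem hasTemperateGrowth_propSym (t : ℝ) : (propSym (d := d) t).HasTemperateGrowth := by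
  have h2 : (fun η : Space d => t * ‖(2 * Real.pi) • η‖ ^ 4).HasTemperateGrowth := by
    have h := (Function.hasTemperateGrowth_norm_sq (H := Space d)).pow 2
    have := (Function.HasTemperateGrowth.const (E := Space d) (t * (2 * Real.pi) ^ 4)).mul h
    refine (iff_of_eq (congrArg _ ?_)).mp this
    funext η
    simp only [Pi.mul_apply, Pi.pow_apply, norm_smul, Real.norm_eq_abs]
    rw [abs_of_pos (by positivity)]
    ring
  exact hasTemperateGrowth_exp_I_mul.comp h2

/-- The free propagator `e^{itΔ²}` on `L²`. -/
def flow (t : ℝ) : L2 d →L[ℂ] L2 d := fourierMulL (propSym t)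

theorem flow_ae_eq (t : ℝ) (f : L2 d) :
    (𝓕 (flow t f) : L2 d) =ᵐ[volume] fun η => propSym t η * (𝓕 f : L2 d) η :=
  fourierMulL_ae_eq (memLp_propSym t) f

theorem propagator_L2 (t : ℝ) (f : L2 d) :
    propagator t (f : 𝓢'(Space d, ℂ)) = (flow t f : L2 d) :=
  multiplier_L2 (hasTemperateGrowth_propSym t) (memLp_propSym t) f

theorem flow_flow (t s : ℝ) (f : L2 d) : flow t (flow s f) = flow (t + s) f := by
  unfold flow
  rw [fourierMulL_fourierMulL (memLp_propSym t) (memLp_propSym s)]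
  simp only [propSym_mul]

theorem flow_zero (f : L2 d) : flow 0 f = f := by
  refine (eq_fourierMulL (memLp_propSym 0) ?_).symm
  simp only [propSym_zero, one_mul]
  rfl

theorem norm_flow_le (t : ℝ) (f : L2 d) : ‖flow t f‖ ≤ ‖f‖ := by
  have := norm_fourierMulL_le (continuous_propSym t).measurable
    (fun η => (norm_propSym t η).le) f
  rwa [one_mul] at this

theorem norm_flow (t : ℝ) (f : L2 d) : ‖flow t f‖ = ‖f‖ := by
  refine (norm_flow_le t f).antisymm ?_
  have := norm_flow_le (-t) (flow t f)
  rwa [flow_flow, neg_add_cancel, flow_zero] at this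

theorem inner_flow_left (t : ℝ) (f g : L2 d) :
    inner ℂ (flow t f) g = inner ℂ f (flow (-t) g) := by
  unfold flow
  rw [inner_fourierMulL_left (memLp_propSym t)]
  simp only [conj_propSym]

theorem inner_flow_flow (t s : ℝ) (f g : L2 d) :
    inner ℂ (flow t f) (flow s g) = inner ℂ f (flow (s - t) g) := by
  rw [inner_flow_left, flow_flow, neg_add_eq_sub]

theorem fourier_sub_L2 (f g : L2 d) : 𝓕 (f - g) = (𝓕 f : L2 d) - 𝓕 g :=
  (Lp.fourierTransformₗᵢ (Space d) ℂ).map_sub f g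

/-- Bounded pointwise convergence of symbols gives strong convergence of multipliers. -/
theorem tendsto_fourierMulL {ι : Type*} {l : Filter ι} [l.IsCountablyGenerated]
    {m : ι → Space d → ℂ} {n : Space d → ℂ} {C : ℝ} (hm : ∀ i, Measurable (m i))
    (hn : Measurable n) (hmC : ∀ i η, ‖m i η‖ ≤ C) (hnC : ∀ η, ‖n η‖ ≤ C)
    (h : ∀ η, Tendsto (fun i => m i η) l (𝓝 (n η))) (f : L2 d) :
    Tendsto (fun i => fourierMulL (m i) f) l (𝓝 (fourierMulL n f)) := by
  rw [tendsto_iff_norm_sub_tendsto_zero]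
  have hC0 : 0 ≤ C := (norm_nonneg _).trans (hnC 0)
  have key : ∀ i, ‖fourierMulL (m i) f - fourierMulL n f‖ ^ 2
      = ∫ η, ‖(m i η - n η) * (𝓕 f : L2 d) η‖ ^ 2 := by
    intro i
    rw [norm_sq_eq_integral_fourier, fourier_sub_L2]
    refine integral_congr_ae ?_
    filter_upwards [fourierMulL_ae_eq (memLp_top_of_bound' (hm i) (hmC i)) f,
      fourierMulL_ae_eq (memLp_top_of_bound' hn hnC) f,
      Lp.coeFn_sub (𝓕 (fourierMulL (m i) f) : L2 d) (𝓕 (fourierMulL n f))] with η h1 h2 h3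
    rw [h3, Pi.sub_apply, h1, h2, sub_mul]
  have hint : Integrable (fun η => (2 * C) ^ 2 * ‖(𝓕 f : L2 d) η‖ ^ 2) :=
    ((memLp_two_iff_integrable_sq_norm (Lp.memLp _).1).1 (Lp.memLp (𝓕 f : L2 d))).const_mul _
  have hlim : Tendsto (fun i => ∫ η, ‖(m i η - n η) * (𝓕 f : L2 d) η‖ ^ 2) l
      (𝓝 (∫ _ : Space d, (0 : ℝ))) := by
    refine tendsto_integral_filter_of_dominated_convergence _ (Eventually.of_forall fun i => ?_)
      (Eventually.of_forall fun i => Eventually.of_forall fun η => ?_) hint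
      (Eventually.of_forall fun η => ?_)
    · exact ((((hm i).sub hn).aestronglyMeasurable.mul
        (Lp.memLp (𝓕 f : L2 d)).1).norm.pow 2)
    · rw [norm_mul, mul_pow, Real.norm_of_nonneg (by positivity)]
      have : ‖m i η - n η‖ ≤ 2 * C := by
        refine (norm_sub_le _ _).trans ?_
        linarith [hmC i η, hnC η]
      gcongr
    · have := (((h η).sub_const (n η)).mul_const ((𝓕 f : L2 d) η)).norm.pow 2
      simpa using this
  rw [integral_zero] at hlim
  simp only [← key] at hlim
  have := hlim.sqrt
  simpa [Real.sqrt_sq] using this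

theorem continuous_flow_time (f : L2 d) : Continuous fun t => flow t f := by
  rw [continuous_iff_continuousAt]
  intro t
  exact tendsto_fourierMulL (C := 1) (fun s => (continuous_propSym s).measurable)
    (continuous_propSym t).measurable (fun s η => (norm_propSym s η).le)
    (fun η => (norm_propSym t η).le) (fun η => (continuous_propSym_time η).tendsto t) f

theorem continuous_flow : Continuous fun p : ℝ × L2 d => flow p.1 p.2 := by
  rw [continuous_iff_continuousAt]
  rintro ⟨t, f⟩
  rw [ContinuousAt, tendsto_iff_norm_sub_tendsto_zero]
  have h1 : Tendsto (fun p : ℝ × L2 d => ‖p.2 - f‖ + ‖flow p.1 f - flow t f‖) (𝓝 (t, f))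
      (𝓝 0) := by
    have : Continuous (fun p : ℝ × L2 d => ‖p.2 - f‖ + ‖flow p.1 f - flow t f‖) := by
      have := (continuous_flow_time f).comp (continuous_fst (X := ℝ) (Y := L2 d))
      simp only [Function.comp_def] at this
      fun_prop
    simpa using this.tendsto (t, f)
  refine squeeze_zero (fun _ => norm_nonneg _) (fun p => ?_) h1
  have e : flow p.1 p.2 - flow t f = flow p.1 (p.2 - f) + (flow p.1 f - flow t f) := by
    rw [map_sub]
    abel
  rw [e]
  refine (norm_add_le _ _).trans ?_
  rw [norm_flow]

/-! ### Pairings of the flow -/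

theorem integrable_fourier_mul_fourier (f g : L2 d) :
    Integrable fun η => (𝓕 f : L2 d) η * (starRingEnd ℂ) ((𝓕 g : L2 d) η) :=
  (Lp.memLp (𝓕 f : L2 d)).integrable_mul (Lp.memLp (𝓕 g : L2 d)).star

theorem fourier_conj_neg (g : Space d → ℂ) (ξ : Space d) :
    𝓕 (fun x => (starRingEnd ℂ) (g (-x))) ξ = (starRingEnd ℂ) (𝓕 g ξ) := by
  rw [Real.fourier_eq, Real.fourier_eq, ← integral_conj, ← integral_neg_eq_self]
  refine integral_congr_ae (Eventually.of_forall fun v => ?_)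
  simp only [Circle.smul_def, smul_eq_mul, map_mul, neg_neg, inner_neg_left]
  rw [← Circle.coe_inv_eq_conj, ← AddChar.map_neg_eq_inv, neg_neg]

theorem inner_fourierMulL_of_integrable {m : Space d → ℂ} (hm : MemLp m ⊤) {f g : L2 d}
    (hf : Integrable f) (hg : Integrable g) :
    inner ℂ g (fourierMulL m f) = ∫ η, m η *
      (𝓕 (f : Space d → ℂ) η * 𝓕 (fun x => (starRingEnd ℂ) (g (-x))) η) := by
  rw [inner_fourierMulL hm]
  refine integral_congr_ae ?_
  filter_upwards [fourier_L2_ae_eq f hf, fourier_L2_ae_eq g hg] with η h1 h2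
  rw [h1, h2, fourier_conj_neg]

theorem integrable_conj_neg {g : Space d → ℂ} (hg : Integrable g) :
    Integrable fun x => (starRingEnd ℂ) (g (-x)) :=
  memLp_one_iff_integrable.1 (memLp_one_iff_integrable.2 hg.comp_neg).star

theorem integral_norm_conj_neg (g : Space d → ℂ) :
    ∫ x, ‖(starRingEnd ℂ) (g (-x))‖ = ∫ x, ‖g x‖ := by
  simp only [RCLike.norm_conj]
  exact integral_neg_eq_self (fun x => ‖g x‖) volume

/-- Constant in the `L¹ → L^∞` estimate for the flow. -/
def flowConst (d : ℕ) : ℝ := dispersiveConst d * ((2 * Real.pi) ^ 4) ^ (-(d : ℝ) / 4) + 1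

theorem norm_inner_flow_le_of_integrable (hd : 3 ≤ d) {t : ℝ} (ht : t ≠ 0) {f g : L2 d}
    (hf : Integrable f) (hg : Integrable g) :
    ‖inner ℂ g (flow t f)‖
      ≤ flowConst d * |t| ^ (-(d : ℝ) / 4) * ((∫ x, ‖f x‖) * ∫ x, ‖g x‖) := by
  unfold flow
  rw [inner_fourierMulL_of_integrable (memLp_propSym t) hf hg]
  have hprod : Integrable fun η =>
      𝓕 (f : Space d → ℂ) η * 𝓕 (fun x => (starRingEnd ℂ) (g (-x))) η := by
    refine (integrable_fourier_mul_fourier f g).congr ?_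
    filter_upwards [fourier_L2_ae_eq f hf, fourier_L2_ae_eq g hg] with η h1 h2
    rw [h1, h2, fourier_conj_neg]
  have ht' : t * (2 * Real.pi) ^ 4 ≠ 0 := mul_ne_zero ht (by positivity)
  have := norm_integral_dispersive_le hd ht' hf (integrable_conj_neg hg) hprod
  rw [integral_norm_conj_neg, abs_mul, Real.mul_rpow (abs_nonneg _) (abs_nonneg _),
    abs_of_pos (by positivity : 0 < (2 * Real.pi) ^ 4)] at this
  have h2 : dispersiveConst d * (|t| ^ (-(d : ℝ) / 4) * ((2 * Real.pi) ^ 4) ^ (-(d : ℝ) / 4)) *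
      ((∫ x, ‖f x‖) * ∫ x, ‖g x‖)
      ≤ flowConst d * |t| ^ (-(d : ℝ) / 4) * ((∫ x, ‖f x‖) * ∫ x, ‖g x‖) := by
    have e : dispersiveConst d * (|t| ^ (-(d : ℝ) / 4) * ((2 * Real.pi) ^ 4) ^ (-(d : ℝ) / 4))
        = (flowConst d - 1) * |t| ^ (-(d : ℝ) / 4) := by
      unfold flowConst
      ring
    rw [e]
    gcongr
    linarith
  refine le_trans (le_of_eq ?_) (this.trans h2)
  congr 1
  refine integral_congr_ae (Eventually.of_forall fun η => ?_)
  simp only [propSym, norm_smul, Real.norm_eq_abs, abs_of_pos Real.two_pi_pos]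
  congr 4
  ring

theorem norm_inner_fourierMulL_le_of_integrable {m : Space d → ℂ} (hm : MemLp m ⊤)
    (hm1 : Integrable m) {f g : L2 d} (hf : Integrable f) (hg : Integrable g) :
    ‖inner ℂ g (fourierMulL m f)‖ ≤ (∫ η, ‖m η‖) * ((∫ x, ‖f x‖) * ∫ x, ‖g x‖) := by
  rw [inner_fourierMulL_of_integrable hm hf hg]
  have := norm_integral_symbol_mul_fourier_mul_fourier_le hm1 (f := f)
    (g := fun x => (starRingEnd ℂ) (g (-x))) hf (integrable_conj_neg hg)
  rw [integral_norm_conj_neg] at this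
  rw [← mul_assoc]
  exact this

theorem dispersiveConst_nonneg : 0 ≤ dispersiveConst d := by
  have h : 0 ≤ ∫ s : ℝ, (1 - Real.exp (-s ^ 2)) ^ d * |s| ^ (-(d : ℝ) / 2) := by
    refine integral_nonneg fun s => mul_nonneg (pow_nonneg ?_ _) (by positivity)
    rw [sub_nonneg, Real.exp_le_one_iff]
    nlinarith [sq_nonneg s]
  have h' : 0 ≤ ∫ ξ : Space d, Real.exp (-‖ξ‖ ^ 4) := integral_nonneg fun ξ => (Real.exp_pos _).le
  unfold dispersiveConst
  positivity

theorem flowConst_pos : 0 < flowConst d :=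
  add_pos_of_nonneg_of_pos (mul_nonneg dispersiveConst_nonneg (by positivity)) one_pos

/-- The dispersive estimate, interpolated with the conservation of the `L²` norm. -/
theorem norm_inner_flow_le (hd : 3 ≤ d) {t : ℝ} (ht : t ≠ 0) {r : ℝ} (hr1 : 1 < r) (hr2 : r < 2)
    {f g : L2 d} (hf : MemLp f (ENNReal.ofReal r)) (hg : MemLp g (ENNReal.ofReal r)) :
    ‖inner ℂ g (flow t f)‖ ≤ (flowConst d * |t| ^ (-(d : ℝ) / 4)) ^ (2 / r - 1) *
      (rNorm volume r f * rNorm volume r g) :=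
  norm_inner_le_of_interpolation (flow t) (norm_flow_le t)
    (mul_pos flowConst_pos (Real.rpow_pos_of_pos (abs_pos.2 ht) _))
    (fun _ _ hf hg => norm_inner_flow_le_of_integrable hd ht hf hg) hr1 hr2 f g hf hg

/-- Bernstein's inequality in bilinear form: a multiplier bounded by one, with integrable symbol,
maps `L^r` to its dual for `1 < r < 2`. -/
theorem norm_inner_fourierMulL_le {m : Space d → ℂ} (hm : Measurable m) (hm1 : ∀ η, ‖m η‖ ≤ 1)
    (hi : Integrable m) {A : ℝ} (hA : 0 < A) (hmA : ∫ η, ‖m η‖ ≤ A)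
    {r : ℝ} (hr1 : 1 < r) (hr2 : r < 2)
    {f g : L2 d} (hf : MemLp f (ENNReal.ofReal r)) (hg : MemLp g (ENNReal.ofReal r)) :
    ‖inner ℂ g (fourierMulL m f)‖ ≤ A ^ (2 / r - 1) *
      (rNorm volume r f * rNorm volume r g) := by
  refine norm_inner_le_of_interpolation (fourierMulL m)
    (fun f => by simpa using norm_fourierMulL_le hm hm1 f) hA (fun f g hf hg => ?_) hr1 hr2 f g hf hg
  refine (norm_inner_fourierMulL_le_of_integrable (memLp_top_of_bound' hm hm1) hi hf hg).trans ?_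
  gcongr

attribute [irreducible] flow

/-! ### Time slices of functions of space-time -/

theorem memLp_iff_lintegral_rpow {X : Type*} [MeasurableSpace X] {μ : Measure X} {f : X → ℂ}
    {p : ℝ} (hp : 0 < p) (hf : AEStronglyMeasurable f μ) :
    MemLp f (ENNReal.ofReal p) μ ↔ ∫⁻ x, ‖f x‖ₑ ^ p ∂μ < ∞ := by
  have h := eLpNorm_lt_top_iff_lintegral_rpow_enorm_lt_top (f := f) (μ := μ)
    (p := ENNReal.ofReal p) (by simpa using hp) (by simp)
  rw [ENNReal.toReal_ofReal hp.le] at h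
  rw [← h]
  exact ⟨fun h => h.2, fun h => ⟨hf, h⟩⟩

/-- The time slice `f(t, ·)` as an element of `L²`; it is `0` if the slice is not in `L²`. -/
def slice (f : ℝ × Space d → ℂ) (t : ℝ) : L2 d :=
  open Classical in if h : MemLp (fun x => f (t, x)) 2 then h.toLp _ else 0

theorem slice_ae_eq {f : ℝ × Space d → ℂ} {t : ℝ} (h : MemLp (fun x => f (t, x)) 2) :
    slice f t =ᵐ[volume] fun x => f (t, x) := by
  rw [slice, dif_pos h]
  exact h.coeFn_toLp

theorem measurable_slice_fun {f : ℝ × Space d → ℂ} (hf : Measurable f) (t : ℝ) :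
    Measurable fun x => f (t, x) := hf.comp measurable_prodMk_left

theorem memLp_slice_iff {f : ℝ × Space d → ℂ} (hf : Measurable f) (t : ℝ) :
    MemLp (fun x => f (t, x)) 2 ↔ ∫⁻ x, ‖f (t, x)‖ₑ ^ (2 : ℝ) < ∞ := by
  have := memLp_iff_lintegral_rpow (p := 2) two_pos
    (measurable_slice_fun hf t).aestronglyMeasurable (μ := volume)
  simpa using this

theorem measurable_lintegral_slice {f : ℝ × Space d → ℂ} (hf : Measurable f) (p : ℝ) :
    Measurable fun t => ∫⁻ x, ‖f (t, x)‖ₑ ^ p := by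
  refine Measurable.lintegral_prod_right' (f := fun z : ℝ × Space d => ‖f z‖ₑ ^ p) ?_
  exact hf.enorm.pow_const p

theorem measurable_of_measurable_edist {X : Type*} [MeasurableSpace X] {E : Type*}
    [PseudoEMetricSpace E] [SecondCountableTopology E] [MeasurableSpace E] [BorelSpace E]
    {f : X → E} (h : ∀ c, Measurable fun x => edist (f x) c) : Measurable f := by
  rcases isEmpty_or_nonempty E with hE | hE
  · have : IsEmpty X := ⟨fun x => hE.elim (f x)⟩
    exact measurable_of_empty f
  refine measurable_of_isOpen fun U hU => ?_
  let D := TopologicalSpace.denseSeq E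
  have e : f ⁻¹' U = ⋃ n : ℕ, ⋃ k : ℕ, ⋃ _ : Metric.eball (D n) ((k : ℝ≥0∞) + 1)⁻¹ ⊆ U,
      {x | edist (f x) (D n) < ((k : ℝ≥0∞) + 1)⁻¹} := by
    ext x
    simp only [mem_preimage, mem_iUnion, mem_ofPred_eq, exists_prop]
    constructor
    · intro hx
      obtain ⟨ε, hε, hεU⟩ := EMetric.isOpen_iff.1 hU (f x) hx
      obtain ⟨k, hk⟩ := ENNReal.exists_inv_nat_lt (ENNReal.half_pos hε.ne').ne'
      have hk' : ((k : ℝ≥0∞) + 1)⁻¹ < ε / 2 :=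
        lt_of_le_of_lt (ENNReal.inv_le_inv.2 le_self_add) hk
      have hkpos : (0 : ℝ≥0∞) < ((k : ℝ≥0∞) + 1)⁻¹ := by
        simp
      obtain ⟨n, hn⟩ := (TopologicalSpace.denseRange_denseSeq E).exists_mem_open
        (Metric.isOpen_eball (x := f x) (ε := ((k : ℝ≥0∞) + 1)⁻¹))
        ⟨f x, Metric.mem_eball_self hkpos⟩
      refine ⟨n, k, fun y hy => hεU ?_, ?_⟩
      · rw [Metric.mem_eball] at hy hn ⊢
        calc edist y (f x) ≤ edist y (D n) + edist (D n) (f x) := edist_triangle _ _ _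
          _ < ε / 2 + ε / 2 := ENNReal.add_lt_add (hy.trans hk') (hn.trans hk')
          _ = ε := ENNReal.add_halves ε
      · rwa [Metric.mem_eball, edist_comm] at hn
    · rintro ⟨n, k, hU', hx⟩
      exact hU' hx
  rw [e]
  refine MeasurableSet.iUnion fun n => MeasurableSet.iUnion fun k => MeasurableSet.iUnion fun _ => ?_
  exact measurableSet_lt (h _) measurable_const

theorem enorm_L2_eq (f : L2 d) : ‖f‖ₑ = (∫⁻ x, ‖f x‖ₑ ^ (2 : ℝ)) ^ (1 / 2 : ℝ) := by
  rw [Lp.enorm_def, eLpNorm_eq_lintegral_rpow_enorm_toReal (by simp) (by simp)]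
  simp

theorem enorm_slice_rpow {f : ℝ × Space d → ℂ} {t : ℝ} (h : MemLp (fun x => f (t, x)) 2) :
    ‖slice f t‖ₑ ^ (2 : ℝ) = ∫⁻ x, ‖f (t, x)‖ₑ ^ (2 : ℝ) := by
  rw [enorm_L2_eq, ← ENNReal.rpow_mul]
  norm_num
  refine lintegral_congr_ae ?_
  filter_upwards [slice_ae_eq h] with x hx
  rw [hx]

theorem enorm_slice_rpow_le (f : ℝ × Space d → ℂ) (t : ℝ) :
    ‖slice f t‖ₑ ^ (2 : ℝ) ≤ ∫⁻ x, ‖f (t, x)‖ₑ ^ (2 : ℝ) := by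
  by_cases h : MemLp (fun x => f (t, x)) 2
  · exact (enorm_slice_rpow h).le
  · rw [slice, dif_neg h]
    simp

theorem stronglyMeasurable_slice {f : ℝ × Space d → ℂ} (hf : Measurable f) :
    StronglyMeasurable (slice f) := by
  let : MeasurableSpace (L2 d) := borel _
  have : BorelSpace (L2 d) := ⟨rfl⟩
  have : Fact ((2 : ℝ≥0∞) ≠ ∞) := ⟨by simp⟩
  refine Measurable.stronglyMeasurable ?_
  refine measurable_of_measurable_edist fun c => ?_
  have hc : Measurable fun z : ℝ × Space d => f z - c z.2 :=
    hf.sub ((Lp.stronglyMeasurable c).measurable.comp measurable_snd)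
  have hset : MeasurableSet {t | ∫⁻ x, ‖f (t, x)‖ₑ ^ (2 : ℝ) < ∞} :=
    measurableSet_lt (measurable_lintegral_slice hf 2) measurable_const
  have e : (fun t => edist (slice f t) c) = fun t =>
      open Classical in
      if ∫⁻ x, ‖f (t, x)‖ₑ ^ (2 : ℝ) < ∞ then
        (∫⁻ x, ‖f (t, x) - c x‖ₑ ^ (2 : ℝ)) ^ (1 / 2 : ℝ) else ‖c‖ₑ := by
    funext t
    by_cases h : MemLp (fun x => f (t, x)) 2
    · have h' := (memLp_slice_iff hf t).1 h
      rw [if_pos h', edist_eq_enorm_sub, enorm_L2_eq]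
      congr 1
      refine lintegral_congr_ae ?_
      filter_upwards [slice_ae_eq h, Lp.coeFn_sub (slice f t) c] with x h1 h2
      rw [h2, Pi.sub_apply, h1]
    · have h' := fun h' => h ((memLp_slice_iff hf t).2 h')
      rw [if_neg h', slice, dif_neg h, edist_eq_enorm_sub, zero_sub, enorm_neg]
  rw [e]
  exact Measurable.ite hset ((measurable_lintegral_slice hc 2).pow_const _) measurable_const

/-- The space-time integral of `|f|^p`. -/
def mixed (p : ℝ) (f : ℝ × Space d → ℂ) : ℝ≥0∞ := ∫⁻ t, ∫⁻ x, ‖f (t, x)‖ₑ ^ p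

theorem ae_memLp_slice {f : ℝ × Space d → ℂ} (hf : Measurable f) {p : ℝ} (hp : 0 < p)
    (h : mixed p f < ∞) : ∀ᵐ t, MemLp (fun x => f (t, x)) (ENNReal.ofReal p) := by
  filter_upwards [ae_lt_top (measurable_lintegral_slice hf p) h.ne] with t ht
  exact (memLp_iff_lintegral_rpow hp (measurable_slice_fun hf t).aestronglyMeasurable).2 ht

theorem ae_memLp_two_slice {f : ℝ × Space d → ℂ} (hf : Measurable f)
    (h : mixed 2 f < ∞) : ∀ᵐ t, MemLp (fun x => f (t, x)) 2 := by
  simpa using ae_memLp_slice hf two_pos h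

theorem memLp_slice {f : ℝ × Space d → ℂ} (hf : Measurable f) (h : mixed 2 f < ∞) :
    MemLp (slice f) 2 := by
  refine ⟨(stronglyMeasurable_slice hf).aestronglyMeasurable, ?_⟩
  rw [eLpNorm_lt_top_iff_lintegral_rpow_enorm_lt_top (by simp) (by simp)]
  refine lt_of_le_of_lt (lintegral_mono fun t => ?_) h
  simpa using enorm_slice_rpow_le f t

theorem integrableOn_slice {f : ℝ × Space d → ℂ} (hf : Measurable f) (h : mixed 2 f < ∞)
    (a b : ℝ) : IntegrableOn (slice f) (Ioc a b) :=
  ((memLp_slice hf h).restrict (Ioc a b)).integrable (by norm_num)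

theorem aestronglyMeasurable_flow {G : ℝ → L2 d} {μ : Measure ℝ} (hG : AEStronglyMeasurable G μ)
    {θ : ℝ → ℝ} (hθ : Continuous θ) : AEStronglyMeasurable (fun τ => flow (θ τ) (G τ)) μ := by
  have h1 : AEStronglyMeasurable (fun τ => (θ τ, G τ)) μ :=
    hθ.aestronglyMeasurable.prodMk hG
  exact Continuous.comp_aestronglyMeasurable (g := fun p : ℝ × L2 d => flow p.1 p.2) continuous_flow h1

theorem integrableOn_flow {G : ℝ → L2 d} {s : Set ℝ} (hG : IntegrableOn G s) {θ : ℝ → ℝ}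
    (hθ : Continuous θ) : IntegrableOn (fun τ => flow (θ τ) (G τ)) s := by
  have h2 := aestronglyMeasurable_flow hG.aestronglyMeasurable hθ
  have h3 : Integrable (fun τ => ‖flow (θ τ) (G τ)‖) (volume.restrict s) := by
    simp only [norm_flow]
    exact hG.norm
  exact (integrable_norm_iff h2).1 h3

/-! ### Strichartz estimates -/

/-- The exponent dual to `2(d+4)/d`. -/
def dualExp (d : ℕ) : ℝ := 2 * ((d : ℝ) + 4) / (d + 8)

theorem one_lt_dualExp (hd : 3 ≤ d) : 1 < dualExp d := by
  have : (3 : ℝ) ≤ d := by exact_mod_cast hd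
  rw [dualExp, lt_div_iff₀ (by linarith)]
  linarith

theorem dualExp_lt_two : dualExp d < 2 := by
  have : (0 : ℝ) ≤ d := by positivity
  rw [dualExp, div_lt_iff₀ (by linarith)]
  linarith

/-- Constant in the bilinear Strichartz estimate. -/
def strichartzConst (d : ℕ) : ℝ :=
  flowConst d ^ (2 / dualExp d - 1) * hlsConst ((d : ℝ) / (d + 4))

theorem lintegral_inner_flow_le (hd : 3 ≤ d) {g φ : ℝ × Space d → ℂ} (hg : Measurable g)
    (hφ : Measurable φ) (hg2 : mixed 2 g < ∞) (hφ2 : mixed 2 φ < ∞) {A B : ℝ} (hA : 0 < A)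
    (hB : 0 < B) (hgA : mixed (dualExp d) g ≤ ENNReal.ofReal (A ^ dualExp d))
    (hφB : mixed (dualExp d) φ ≤ ENNReal.ofReal (B ^ dualExp d)) :
    ∫⁻ t, ∫⁻ τ, ‖inner ℂ (slice g t) (flow (t - τ) (slice φ τ))‖ₑ
      ≤ ENNReal.ofReal (strichartzConst d * (A * B)) := by
  have hd' : (3 : ℝ) ≤ d := by exact_mod_cast hd
  have hp1 := one_lt_dualExp hd
  have hp2 := dualExp_lt_two (d := d)
  set p := dualExp d with hp
  have hp0 : 0 < p := by linarith
  set γ : ℝ := (d : ℝ) / (d + 4) with hγ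
  have hγ0 : 0 < γ := by positivity
  have hγ1 : γ < 1 := by
    rw [hγ, div_lt_one (by linarith)]
    linarith
  have hpγ : p = 2 / (2 - γ) := by
    have h2 : 2 - γ = ((d : ℝ) + 8) / (d + 4) := by
      rw [hγ]
      field_simp
      ring
    rw [hp, h2, dualExp]
    field_simp
  have hexp : -(d : ℝ) / 4 * (2 / p - 1) = -γ := by
    rw [hp, hγ, dualExp]
    field_simp
    ring
  have hc0 := flowConst_pos (d := d)
  set c : ℝ := flowConst d ^ (2 / p - 1) with hc
  have hcpos : 0 < c := Real.rpow_pos_of_pos hc0 _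
  -- the `L^p` norms of the slices, as measurable functions of time
  set n : (ℝ × Space d → ℂ) → ℝ → ℝ := fun f t => ((∫⁻ x, ‖f (t, x)‖ₑ ^ p) ^ (1 / p)).toReal
  have hnm : ∀ f : ℝ × Space d → ℂ, Measurable f → Measurable (n f) := fun f hf =>
    ((measurable_lintegral_slice hf p).pow_const _).ennreal_toReal
  have hn0 : ∀ f t, 0 ≤ n f t := fun f t => ENNReal.toReal_nonneg
  have hnp : ∀ f t, ENNReal.ofReal (n f t ^ p) ≤ ∫⁻ x, ‖f (t, x)‖ₑ ^ p := by
    intro f t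
    rw [← ENNReal.ofReal_rpow_of_nonneg (hn0 f t) hp0.le]
    refine (ENNReal.rpow_le_rpow ENNReal.ofReal_toReal_le hp0.le).trans ?_
    rw [← ENNReal.rpow_mul, one_div, inv_mul_cancel₀ hp0.ne', ENNReal.rpow_one]
  have hnr : ∀ f : ℝ × Space d → ℂ, ∀ t, MemLp (fun x => f (t, x)) 2 →
      MemLp (fun x => f (t, x)) (ENNReal.ofReal p) →
      MemLp (slice f t) (ENNReal.ofReal p) ∧ rNorm volume p (slice f t) = n f t := by
    intro f t h2 hpp
    have e := slice_ae_eq h2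
    refine ⟨(memLp_congr_ae e).2 hpp, ?_⟩
    rw [rNorm, eLpNorm_congr_ae e, eLpNorm_eq_lintegral_rpow_enorm_toReal (by simpa using hp0)
      (by simp), ENNReal.toReal_ofReal hp0.le]
  have hls := hardyLittlewoodSobolev hγ0 hγ1 hpγ (hn0 g) (hn0 φ) (hnm g hg) (hnm φ hφ) hA hB
    ((lintegral_mono fun t => hnp g t).trans hgA) ((lintegral_mono fun t => hnp φ t).trans hφB)
  have hgp := ae_memLp_slice hg hp0 (hgA.trans_lt ENNReal.ofReal_lt_top)
  have hφp := ae_memLp_slice hφ hp0 (hφB.trans_lt ENNReal.ofReal_lt_top)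
  have step : ∫⁻ t, ∫⁻ τ, ‖inner ℂ (slice g t) (flow (t - τ) (slice φ τ))‖ₑ
      ≤ ∫⁻ t, ENNReal.ofReal c * (ENNReal.ofReal (n g t) *
        ∫⁻ τ, ENNReal.ofReal (n φ τ) * ENNReal.ofReal (|t - τ| ^ (-γ))) := by
    refine lintegral_mono_ae ?_
    filter_upwards [hgp, ae_memLp_two_slice hg hg2] with t ht1 ht2
    rw [← lintegral_const_mul' _ _ ENNReal.ofReal_ne_top,
      ← lintegral_const_mul' _ _ ENNReal.ofReal_ne_top]
    refine lintegral_mono_ae ?_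
    have hne : ∀ᵐ τ : ℝ, τ ≠ t := by simp [ae_iff]
    filter_upwards [hφp, ae_memLp_two_slice hφ hφ2, hne] with τ hτ1 hτ2 hτ
    obtain ⟨k1, k2⟩ := hnr g t ht2 ht1
    obtain ⟨k3, k4⟩ := hnr φ τ hτ2 hτ1
    have := norm_inner_flow_le hd (sub_ne_zero.2 hτ.symm) hp1 hp2 k3 k1
    rw [k2, k4, Real.mul_rpow hc0.le (Real.rpow_nonneg (abs_nonneg _) _),
      ← Real.rpow_mul (abs_nonneg _), hexp] at this
    rw [← ofReal_norm, ← ENNReal.ofReal_mul (hn0 _ _), ← ENNReal.ofReal_mul (hn0 _ _),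
      ← ENNReal.ofReal_mul hcpos.le]
    refine ENNReal.ofReal_le_ofReal (this.trans (le_of_eq ?_))
    rw [hc]
    ring
  refine step.trans ?_
  rw [lintegral_const_mul' _ _ ENNReal.ofReal_ne_top]
  refine (mul_le_mul_right hls _).trans (le_of_eq ?_)
  rw [← ENNReal.ofReal_mul hcpos.le, strichartzConst, hc, mul_assoc]

theorem norm_integral_flow_slice_sq_le (hd : 3 ≤ d) {g : ℝ × Space d → ℂ} (hg : Measurable g)
    (hg2 : mixed 2 g < ∞) {A : ℝ} (hA : 0 < A)
    (hgA : mixed (dualExp d) g ≤ ENNReal.ofReal (A ^ dualExp d)) (a b : ℝ) :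
    ENNReal.ofReal (‖∫ t in Ioc a b, flow (a - t) (slice g t)‖ ^ 2)
      ≤ ENNReal.ofReal (strichartzConst d * (A * A)) := by
  set y := ∫ t in Ioc a b, flow (a - t) (slice g t) with hy
  have hint := integrableOn_flow (integrableOn_slice hg hg2 a b) (θ := fun t => a - t)
    (by fun_prop)
  have e : ENNReal.ofReal (‖y‖ ^ 2) = ‖inner ℂ y y‖ₑ := by
    rw [inner_self_eq_norm_sq_to_K, ← ofReal_norm]
    congr 1
    simp
  rw [e]
  have h1 : ∀ v : L2 d, ‖inner ℂ v y‖ₑ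
      ≤ ∫⁻ t in Ioc a b, ‖inner ℂ v (flow (a - t) (slice g t))‖ₑ := by
    intro v
    rw [hy, ← integral_inner hint]
    exact enorm_integral_le_lintegral_enorm _
  have hsymm : ∀ v v' : L2 d, ‖inner ℂ v v'‖ₑ = ‖inner ℂ v' v‖ₑ := by
    intro v v'
    rw [← ofReal_norm, ← ofReal_norm, norm_inner_symm]
  calc ‖inner ℂ y y‖ₑ ≤ ∫⁻ t in Ioc a b, ‖inner ℂ y (flow (a - t) (slice g t))‖ₑ := h1 y
    _ ≤ ∫⁻ t in Ioc a b, ∫⁻ τ in Ioc a b,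
          ‖inner ℂ (flow (a - t) (slice g t)) (flow (a - τ) (slice g τ))‖ₑ := by
        refine lintegral_mono fun t => ?_
        rw [hsymm]
        exact h1 _
    _ ≤ ∫⁻ t, ∫⁻ τ, ‖inner ℂ (slice g t) (flow (t - τ) (slice g τ))‖ₑ := by
        refine (setLIntegral_le_lintegral _ _).trans (lintegral_mono fun t => ?_)
        refine (setLIntegral_le_lintegral _ _).trans (lintegral_mono fun τ => ?_)
        rw [inner_flow_flow]
        simp
    _ ≤ _ := lintegral_inner_flow_le hd hg hg hg2 hg2 hA hA hgA hgA

/-- The Strichartz estimate from `L²` data and a forcing in the dual space `L^p_{t,x}` to the dual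
of `L^p_{t,x}`, in weak form: the solution is tested against a function `g` of space-time. -/
theorem norm_integral_inner_le_strichartz (hd : 3 ≤ d) {g φ : ℝ × Space d → ℂ}
    (hg : Measurable g) (hφ : Measurable φ) (hg2 : mixed 2 g < ∞) (hφ2 : mixed 2 φ < ∞)
    {A B : ℝ} (hA : 0 < A) (hB : 0 < B)
    (hgA : mixed (dualExp d) g ≤ ENNReal.ofReal (A ^ dualExp d))
    (hφB : mixed (dualExp d) φ ≤ ENNReal.ofReal (B ^ dualExp d)) {a b : ℝ} {f : L2 d}
    {w : ℝ → L2 d} (hwc : Continuous w)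
    (hw : ∀ t ∈ Ioc a b, w t = flow (t - a) f +
      Complex.I • ∫ τ in Ioc a t, flow (t - τ) (slice φ τ)) :
    ‖∫ t in Ioc a b, inner ℂ (slice g t) (w t)‖
      ≤ (1 + |strichartzConst d|) * (A * (‖f‖ + B)) := by
  set K := strichartzConst d with hK
  have hgint := integrableOn_slice hg hg2 a b
  have hbdd : ∀ v : ℝ → L2 d, Continuous v →
      IntegrableOn (fun t => inner ℂ (slice g t) (v t)) (Ioc a b) := by
    intro v hv
    obtain ⟨M, hM⟩ := isCompact_Icc.exists_bound_of_continuousOn (s := Icc a b) hv.continuousOn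
    refine Integrable.mono' (hgint.norm.mul_const M)
      (hgint.aestronglyMeasurable.inner hv.aestronglyMeasurable) ?_
    filter_upwards [ae_restrict_mem measurableSet_Ioc] with t ht
    refine (norm_inner_le_norm _ _).trans ?_
    gcongr
    exact hM t (Ioc_subset_Icc_self ht)
  have hc1 : Continuous fun t => flow (t - a) f :=
    (continuous_flow_time f).comp (by fun_prop)
  have i1 := hbdd _ hc1
  have i2 := hbdd (fun t => w t - flow (t - a) f) (hwc.sub hc1)
  have hsplit : ∫ t in Ioc a b, inner ℂ (slice g t) (w t)
      = (∫ t in Ioc a b, inner ℂ (slice g t) (flow (t - a) f)) +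
        ∫ t in Ioc a b, inner ℂ (slice g t) (w t - flow (t - a) f) := by
    rw [← integral_add i1 i2]
    refine integral_congr_ae (Eventually.of_forall fun t => ?_)
    simp only [← inner_add_right, add_sub_cancel]
  -- the free evolution, by duality
  have hfree : ‖∫ t in Ioc a b, inner ℂ (slice g t) (flow (t - a) f)‖ ≤ (1 + |K|) * (A * ‖f‖) := by
    set y := ∫ t in Ioc a b, flow (a - t) (slice g t) with hy
    have hint := integrableOn_flow hgint (θ := fun t => a - t) (by fun_prop)
    have e : ∫ t in Ioc a b, inner ℂ (slice g t) (flow (t - a) f) = inner ℂ y f := by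
      rw [← inner_conj_symm, hy, ← integral_inner hint, ← integral_conj]
      refine integral_congr_ae (Eventually.of_forall fun t => ?_)
      simp only [inner_conj_symm, inner_flow_left, neg_sub]
    rw [e]
    have hy2 : ‖y‖ ^ 2 ≤ |K| * (A * A) := by
      have := (ENNReal.ofReal_le_ofReal_iff' .. ).1 (norm_integral_flow_slice_sq_le hd hg hg2 hA hgA a b)
      have hKA : K * (A * A) ≤ |K| * (A * A) := by
        gcongr
        exact le_abs_self K
      rcases this with h | h
      · exact h.trans hKA
      · exact h.trans (by positivity)
    have hy3 : ‖y‖ ≤ (1 + |K|) * A := by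
      refine abs_le_of_sq_le_sq' ?_ (by positivity) |>.2
      refine hy2.trans ?_
      nlinarith [sq_nonneg |K|, abs_nonneg K, mul_pos hA hA]
    refine (norm_inner_le_norm _ _).trans ?_
    rw [← mul_assoc]
    gcongr
  have hforced : ‖∫ t in Ioc a b, inner ℂ (slice g t) (w t - flow (t - a) f)‖
      ≤ (1 + |K|) * (A * B) := by
    have hb := lintegral_inner_flow_le hd hg hφ hg2 hφ2 hA hB hgA hφB
    have h1 : ‖∫ t in Ioc a b, inner ℂ (slice g t) (w t - flow (t - a) f)‖ₑ
        ≤ ENNReal.ofReal (K * (A * B)) := by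
      refine le_trans ?_ hb
      refine (enorm_integral_le_lintegral_enorm _).trans ?_
      refine le_trans ?_ (setLIntegral_le_lintegral (Ioc a b) _)
      refine setLIntegral_mono' measurableSet_Ioc fun t ht => ?_
      rw [hw t ht, add_sub_cancel_left, inner_smul_right]
      rw [← integral_inner (integrableOn_flow (integrableOn_slice hφ hφ2 a t)
        (θ := fun τ => t - τ) (by fun_prop))]
      rw [enorm_mul]
      have : ‖Complex.I‖ₑ = 1 := by
        rw [← ofReal_norm]
        simp
      rw [this, one_mul]
      exact (enorm_integral_le_lintegral_enorm _).trans (setLIntegral_le_lintegral _ _)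
    have h2 : ENNReal.ofReal (K * (A * B)) ≤ ENNReal.ofReal ((1 + |K|) * (A * B)) := by
      refine ENNReal.ofReal_le_ofReal ?_
      gcongr
      linarith [le_abs_self K]
    rw [← ofReal_norm] at h1
    exact (ENNReal.ofReal_le_ofReal_iff (by positivity)).1 (h1.trans h2)
  rw [hsplit]
  refine (norm_add_le _ _).trans ((add_le_add hfree hforced).trans (le_of_eq ?_))
  ring

/-! ### The Duhamel integral -/

/-- The Duhamel integral `∫_a^t e^{i(t-τ)Δ²} Ψ(τ) dτ` in `L²`. -/
def duhamelInt (Ψ : ℝ → L2 d) (a t : ℝ) : L2 d := ∫ τ in a..t, flow (t - τ) (Ψ τ)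

theorem intervalIntegrable_flow {Ψ : ℝ → L2 d} {a b : ℝ} (hΨ : IntervalIntegrable Ψ volume a b)
    {θ : ℝ → ℝ} (hθ : Continuous θ) :
    IntervalIntegrable (fun τ => flow (θ τ) (Ψ τ)) volume a b :=
  ⟨integrableOn_flow hΨ.1 hθ, integrableOn_flow hΨ.2 hθ⟩

theorem duhamelInt_eq (Ψ : ℝ → L2 d) (hΨ : ∀ a b, IntervalIntegrable Ψ volume a b) (a t : ℝ) :
    duhamelInt Ψ a t = flow t (∫ τ in a..t, flow (-τ) (Ψ τ)) := by
  rw [duhamelInt, ← ContinuousLinearMap.intervalIntegral_comp_comm _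
    (intervalIntegrable_flow (hΨ a t) continuous_neg)]
  simp only [flow_flow, sub_eq_add_neg]

theorem continuous_duhamelInt {Ψ : ℝ → L2 d} (hΨ : ∀ a b, IntervalIntegrable Ψ volume a b)
    (a : ℝ) : Continuous (duhamelInt Ψ a) := by
  have h1 : Continuous fun t => ∫ τ in a..t, flow (-τ) (Ψ τ) :=
    intervalIntegral.continuous_primitive
      (fun a b => intervalIntegrable_flow (hΨ a b) continuous_neg) a
  have h2 : duhamelInt Ψ a = fun t => flow t (∫ τ in a..t, flow (-τ) (Ψ τ)) :=
    funext fun t => duhamelInt_eq Ψ hΨ a t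
  rw [h2]
  exact continuous_flow.comp (continuous_id.prodMk h1)

theorem duhamelInt_trans {Ψ : ℝ → L2 d} (hΨ : ∀ a b, IntervalIntegrable Ψ volume a b)
    (a b t : ℝ) :
    duhamelInt Ψ a t = flow (t - b) (duhamelInt Ψ a b) + duhamelInt Ψ b t := by
  rw [duhamelInt_eq Ψ hΨ, duhamelInt_eq Ψ hΨ, duhamelInt_eq Ψ hΨ, flow_flow, sub_add_cancel,
    ← map_add, intervalIntegral.integral_add_adjacent_intervals]
  · exact intervalIntegrable_flow (hΨ a b) continuous_neg
  · exact intervalIntegrable_flow (hΨ b t) continuous_neg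

theorem duhamelInt_shift (Ψ : ℝ → L2 d) (a t h : ℝ) :
    duhamelInt Ψ (a + h) (t + h) = duhamelInt (fun τ => Ψ (τ + h)) a t := by
  rw [duhamelInt, duhamelInt,
    ← intervalIntegral.integral_comp_add_right (fun τ => flow (t + h - τ) (Ψ τ)) h]
  simp only [add_sub_add_right_eq_sub]

theorem duhamelInt_sub {Ψ Ψ' : ℝ → L2 d} (hΨ : ∀ a b, IntervalIntegrable Ψ volume a b)
    (hΨ' : ∀ a b, IntervalIntegrable Ψ' volume a b) (a t : ℝ) :
    duhamelInt (fun τ => Ψ τ - Ψ' τ) a t = duhamelInt Ψ a t - duhamelInt Ψ' a t := by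
  unfold duhamelInt
  rw [← intervalIntegral.integral_sub]
  · simp only [map_sub]
  · exact intervalIntegrable_flow (hΨ a t) (by fun_prop)
  · exact intervalIntegrable_flow (hΨ' a t) (by fun_prop)

theorem norm_duhamelInt_le (Ψ : ℝ → L2 d) {a t : ℝ} (h : a ≤ t) :
    ‖duhamelInt Ψ a t‖ ≤ ∫ τ in a..t, ‖Ψ τ‖ := by
  refine (intervalIntegral.norm_integral_le_integral_norm h).trans ?_
  simp only [norm_flow]
  exact le_rfl

/-- Pairing with a Schwartz function is a continuous functional on `L²`. -/
theorem exists_pairing (ψ : 𝓢(Space d, ℂ)) :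
    ∃ L : L2 d →L[ℂ] ℂ, ∀ f : L2 d, L f = (f : 𝓢'(Space d, ℂ)) ψ := by
  have hψ : MemLp (fun x => star (ψ x)) 2 (volume : Measure (Space d)) := (ψ.memLp 2 volume).star
  refine ⟨innerSL ℂ (hψ.toLp _), fun f => ?_⟩
  rw [innerSL_apply_apply, L2.inner_def, Lp.toTemperedDistribution_apply]
  refine integral_congr_ae ?_
  filter_upwards [hψ.coeFn_toLp] with x hx
  rw [hx]
  simp [mul_comm]

/-! ### Homogeneous Sobolev norms in terms of the Fourier transform -/

theorem lintegral_comp_smul_space {c : ℝ} (hc : 0 < c) (f : Space d → ℝ≥0∞) :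
    ∫⁻ ξ, f ξ = ENNReal.ofReal (c ^ d) * ∫⁻ η, f (c • η) := by
  have hemb : MeasurableEmbedding (fun η : Space d => c • η) :=
    (Homeomorph.smulOfNeZero c hc.ne').measurableEmbedding
  have h := hemb.lintegral_map (μ := volume) f
  rw [Measure.map_addHaar_smul volume hc.ne', lintegral_smul_measure] at h
  rw [← h, smul_eq_mul, ← mul_assoc, ← ENNReal.ofReal_mul (by positivity), finrank_euclideanSpace_fin,
    abs_of_pos (by positivity), mul_inv_cancel₀ (by positivity), ENNReal.ofReal_one, one_mul]

theorem enorm_rpow_half_sq (c : ℝ) (hc : 0 < c) (z : ℂ) :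
    ‖((c ^ ((d : ℝ) / 2) : ℝ) : ℂ) * z‖ₑ ^ 2 = ENNReal.ofReal (c ^ d) * ‖z‖ₑ ^ 2 := by
  rw [enorm_mul, mul_pow]
  congr 1
  rw [← ofReal_norm, Complex.norm_real, Real.norm_of_nonneg (by positivity),
    ← ENNReal.ofReal_pow (by positivity), ← Real.rpow_natCast, ← Real.rpow_mul hc.le]
  congr 1
  push_cast
  rw [div_mul_cancel₀ _ two_ne_zero, Real.rpow_natCast]

/-- The Sobolev norm in terms of Mathlib's Fourier transform; the Jacobian cancels the
normalization. -/
theorem hdotNorm_eq {f G : Space d → ℂ} {T : 𝓢'(Space d, ℂ)} (hf : Represents f T)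
    (hG : Represents G (𝓕 T)) (s : ℝ) :
    hdotNorm s f = (∫⁻ η, ENNReal.ofReal (‖(2 * Real.pi) • η‖ ^ (2 * s)) * ‖G η‖ₑ ^ 2)
      ^ (1 / 2 : ℝ) := by
  have hπ : (0 : ℝ) < 2 * Real.pi := Real.two_pi_pos
  have key : ∀ g : Space d → ℂ, HasFourier f g →
      ∫⁻ ξ, ENNReal.ofReal (‖ξ‖ ^ (2 * s)) * ‖g ξ‖ₑ ^ 2
        = ∫⁻ η, ENNReal.ofReal (‖(2 * Real.pi) • η‖ ^ (2 * s)) * ‖G η‖ₑ ^ 2 := by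
    rintro g ⟨T', hT', hg⟩
    rw [← hf.unique_right hT'] at hg
    rw [lintegral_comp_smul_space hπ, ← lintegral_const_mul' _ _ ENNReal.ofReal_ne_top]
    refine lintegral_congr_ae ?_
    filter_upwards [hG.ae_eq hg] with η hη
    rw [hη, enorm_rpow_half_sq _ hπ]
    ring
  have hne : HasFourier f (fun ξ => (((2 * Real.pi) ^ ((d : ℝ) / 2) : ℝ) : ℂ)⁻¹ *
      G ((2 * Real.pi)⁻¹ • ξ)) := by
    refine ⟨T, hf, hG.congr (Eventually.of_forall fun η => ?_)⟩
    have : (((2 * Real.pi) ^ ((d : ℝ) / 2) : ℝ) : ℂ) ≠ 0 := by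
      exact_mod_cast (Real.rpow_pos_of_pos hπ _).ne'
    simp only
    rw [smul_smul, inv_mul_cancel₀ hπ.ne', one_smul, mul_inv_cancel_left₀ this]
  unfold hdotNorm
  refine le_antisymm ((iInf₂_le _ hne).trans (key _ hne ▸ le_rfl)) (le_iInf₂ fun g hg => ?_)
  rw [key g hg]

/-- The symbol `|ξ|²` of `-Δ` with respect to Mathlib's Fourier transform. -/
def lapSym (η : Space d) : ℝ := ‖(2 * Real.pi) • η‖ ^ 2

theorem lapSym_nonneg (η : Space d) : 0 ≤ lapSym η := by
  unfold lapSym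
  positivity

theorem continuous_lapSym : Continuous (lapSym (d := d)) := by
  unfold lapSym
  fun_prop

theorem ae_lapSym_pos (hd : 1 ≤ d) : ∀ᵐ η : Space d, 0 < lapSym η := by
  have : Nonempty (Fin d) := ⟨⟨0, hd⟩⟩
  have : Nontrivial (Space d) := inferInstance
  have : ∀ᵐ η : Space d, η ≠ 0 := by simp [ae_iff]
  filter_upwards [this] with η hη
  have : (2 * Real.pi) • η ≠ 0 := smul_ne_zero Real.two_pi_pos.ne' hη
  unfold lapSym
  positivity

theorem propSym_eq (t : ℝ) (η : Space d) :
    propSym t η = Complex.exp (Complex.I * ((t * lapSym η ^ 2 : ℝ) : ℂ)) := by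
  unfold propSym lapSym
  congr 4
  ring

/-- The Sobolev norm of a function with `-Δf = D` in `L²`. -/
theorem hdotNorm_eq_of_laplacian (hd : 1 ≤ d) {f : Space d → ℂ} {T : 𝓢'(Space d, ℂ)} {D : L2 d}
    (hf : Represents f T)
    (hD : Represents (fun η => ((lapSym η : ℝ) : ℂ)⁻¹ * (𝓕 D : L2 d) η) (𝓕 T)) (s : ℝ) :
    hdotNorm s f = (∫⁻ η, ENNReal.ofReal (‖(2 * Real.pi) • η‖ ^ (2 * s - 4)) *
      ‖(𝓕 D : L2 d) η‖ₑ ^ 2) ^ (1 / 2 : ℝ) := by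
  rw [hdotNorm_eq hf hD]
  congr 1
  refine lintegral_congr_ae ?_
  filter_upwards [ae_lapSym_pos hd] with η hη
  have hpos : 0 < ‖(2 * Real.pi) • η‖ := by
    by_contra h
    have h0 : ‖(2 * Real.pi) • η‖ = 0 := le_antisymm (not_lt.1 h) (norm_nonneg _)
    rw [lapSym, h0] at hη
    norm_num at hη
  rw [enorm_mul, mul_pow, ← mul_assoc]
  congr 1
  rw [← ofReal_norm, norm_inv, Complex.norm_real, Real.norm_of_nonneg hη.le,
    ← ENNReal.ofReal_pow (by positivity), ← ENNReal.ofReal_mul (by positivity)]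
  congr 1
  rw [Real.rpow_sub hpos, lapSym, inv_pow, ← pow_mul, div_eq_mul_inv]
  norm_num

theorem hdotNorm_two_eq (hd : 1 ≤ d) {f : Space d → ℂ} {T : 𝓢'(Space d, ℂ)} {D : L2 d}
    (hf : Represents f T)
    (hD : Represents (fun η => ((lapSym η : ℝ) : ℂ)⁻¹ * (𝓕 D : L2 d) η) (𝓕 T)) :
    hdotNorm 2 f = ‖D‖ₑ := by
  rw [hdotNorm_eq_of_laplacian hd hf hD]
  have : ‖D‖ₑ = ‖(𝓕 D : L2 d)‖ₑ := by
    rw [← ofReal_norm, ← ofReal_norm, Lp.norm_fourier_eq]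
  rw [this, enorm_L2_eq]
  norm_num

theorem exists_laplacian (hd : 1 ≤ d) {f : Space d → ℂ} {T : 𝓢'(Space d, ℂ)} (hf : Represents f T)
    (h : hdotNorm 2 f < ∞) :
    ∃ D : L2 d, Represents (fun η => ((lapSym η : ℝ) : ℂ)⁻¹ * (𝓕 D : L2 d) η) (𝓕 T) := by
  obtain ⟨g, hg⟩ := iInf_lt_iff.1 h
  obtain ⟨⟨T', hT', hg⟩, hfin⟩ := iInf_lt_iff.1 hg
  rw [← hf.unique_right hT'] at hg
  set G : Space d → ℂ := fun η =>
    (((2 * Real.pi) ^ ((d : ℝ) / 2) : ℝ) : ℂ) * g ((2 * Real.pi) • η) with hG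
  have hfin2 : hdotNorm 2 f < ∞ := h
  rw [hdotNorm_eq hf hg] at hfin2
  have hmem : MemLp (fun η => ((lapSym η : ℝ) : ℂ) * G η) 2 := by
    refine ⟨(Complex.continuous_ofReal.comp continuous_lapSym).aestronglyMeasurable.mul
      hg.aestronglyMeasurable, ?_⟩
    rw [eLpNorm_lt_top_iff_lintegral_rpow_enorm_lt_top (by simp) (by simp)]
    have h3 := (ENNReal.rpow_lt_top_iff_of_pos (by norm_num : (0 : ℝ) < 1 / 2)).1 hfin2
    refine lt_of_le_of_lt (lintegral_mono fun η => le_of_eq ?_) h3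
    rw [enorm_mul, ENNReal.toReal_ofNat, ENNReal.mul_rpow_of_nonneg _ _ two_pos.le,
      ENNReal.rpow_two, ENNReal.rpow_two]
    congr 1
    rw [← ofReal_norm, Complex.norm_real, Real.norm_of_nonneg (lapSym_nonneg η),
      ← ENNReal.ofReal_pow (lapSym_nonneg η), lapSym, ← pow_mul]
    norm_num
  refine ⟨𝓕⁻ (hmem.toLp _), hg.congr ?_⟩
  have e : (𝓕 (𝓕⁻ (hmem.toLp _)) : L2 d) = hmem.toLp _ :=
    (Lp.fourierTransformₗᵢ (Space d) ℂ).apply_symm_apply _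
  rw [e]
  filter_upwards [hmem.coeFn_toLp, ae_lapSym_pos hd] with η h1 h2
  have : ((lapSym η : ℝ) : ℂ) ≠ 0 := by exact_mod_cast h2.ne'
  rw [h1, inv_mul_cancel_left₀ this]

/-! ### The solution in terms of `L²`-valued functions of time -/

/-- The space-time exponent `2(d+4)/(d-4)`. -/
def stExp (d : ℕ) : ℝ := 2 * ((d : ℝ) + 4) / ((d : ℝ) - 4)

theorem stExp_pos (hd : 9 ≤ d) : 0 < stExp d := by
  have : (9 : ℝ) ≤ d := by exact_mod_cast hd
  unfold stExp
  have : 0 < (d : ℝ) - 4 := by linarith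
  positivity

theorem measurable_nonlin : Measurable (nonlin d) := by
  unfold nonlin
  have : Measurable fun z : ℂ => ‖z‖ ^ (8 / ((d : ℝ) - 4)) := measurable_norm.pow_const _
  exact (Complex.measurable_ofReal.comp this).mul measurable_id

theorem norm_nonlin (hd : 9 ≤ d) (z : ℂ) : ‖nonlin d z‖ = ‖z‖ ^ (stExp d / 2) := by
  have hd' : (9 : ℝ) ≤ d := by exact_mod_cast hd
  have h4 : 0 < (d : ℝ) - 4 := by linarith
  have e : stExp d / 2 = 8 / ((d : ℝ) - 4) + 1 := by
    unfold stExp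
    field_simp
    ring
  rw [nonlin, norm_mul, Complex.norm_real, Real.norm_of_nonneg (by positivity), e]
  rcases eq_or_ne z 0 with rfl | hz
  · rw [norm_zero, mul_zero, Real.zero_rpow (by positivity)]
  · rw [Real.rpow_add_one (norm_ne_zero_iff.2 hz)]

theorem enorm_nonlin_rpow (hd : 9 ≤ d) (z : ℂ) : ‖nonlin d z‖ₑ ^ (2 : ℝ) = ‖z‖ₑ ^ stExp d := by
  have := stExp_pos hd
  rw [← ofReal_norm, ← ofReal_norm, norm_nonlin hd,
    ENNReal.ofReal_rpow_of_nonneg (by positivity) (by norm_num),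
    ENNReal.ofReal_rpow_of_nonneg (by positivity) this.le, ← Real.rpow_mul (norm_nonneg _)]
  congr 2
  ring

/-- The nonlinearity `F(v(t))` as an `L²`-valued function of time. -/
def forcing (v : ℝ × Space d → ℂ) : ℝ → L2 d := slice fun z => nonlin d (v z)

theorem ae_lintegral_stExp_lt_top {v : ℝ × Space d → ℂ} (hv : Measurable v)
    (hlq : ∀ a b, ∫⁻ t in Ioc a b, ∫⁻ x, ‖v (t, x)‖ₑ ^ stExp d < ∞) :
    ∀ᵐ t, ∫⁻ x, ‖v (t, x)‖ₑ ^ stExp d < ∞ := by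
  have h1 : ∀ n : ℕ, ∀ᵐ t, t ∈ Ioc (-(n : ℝ)) n → ∫⁻ x, ‖v (t, x)‖ₑ ^ stExp d < ∞ := by
    intro n
    rw [← ae_restrict_iff' measurableSet_Ioc]
    exact ae_lt_top (measurable_lintegral_slice hv _) (hlq _ _).ne
  filter_upwards [ae_all_iff.2 h1] with t ht
  obtain ⟨n, hn⟩ := exists_nat_gt |t|
  exact ht n ⟨by linarith [neg_abs_le t], by linarith [le_abs_self t]⟩

theorem forcing_ae_eq (hd : 9 ≤ d) {v : ℝ × Space d → ℂ} (hv : Measurable v) {t : ℝ}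
    (ht : ∫⁻ x, ‖v (t, x)‖ₑ ^ stExp d < ∞) :
    forcing v t =ᵐ[volume] fun x => nonlin d (v (t, x)) := by
  refine slice_ae_eq (f := fun z => nonlin d (v z)) ?_
  refine (memLp_slice_iff (f := fun z => nonlin d (v z)) (measurable_nonlin.comp hv) t).2 ?_
  simpa only [enorm_nonlin_rpow hd] using ht

theorem enorm_forcing_rpow_le (hd : 9 ≤ d) (v : ℝ × Space d → ℂ) (t : ℝ) :
    ‖forcing v t‖ₑ ^ (2 : ℝ) ≤ ∫⁻ x, ‖v (t, x)‖ₑ ^ stExp d := by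
  have := enorm_slice_rpow_le (fun z => nonlin d (v z)) t
  simp only [enorm_nonlin_rpow hd] at this
  exact this

theorem memLp_forcing (hd : 9 ≤ d) {v : ℝ × Space d → ℂ} (hv : Measurable v)
    (hlq : ∀ a b, ∫⁻ t in Ioc a b, ∫⁻ x, ‖v (t, x)‖ₑ ^ stExp d < ∞) (a b : ℝ) :
    MemLp (forcing v) 2 (volume.restrict (Ioc a b)) := by
  refine ⟨(stronglyMeasurable_slice (measurable_nonlin.comp hv)).aestronglyMeasurable, ?_⟩
  rw [eLpNorm_lt_top_iff_lintegral_rpow_enorm_lt_top (by simp) (by simp), ENNReal.toReal_ofNat]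
  exact lt_of_le_of_lt (lintegral_mono fun t => enorm_forcing_rpow_le hd v t) (hlq a b)

theorem intervalIntegrable_forcing (hd : 9 ≤ d) {v : ℝ × Space d → ℂ} (hv : Measurable v)
    (hlq : ∀ a b, ∫⁻ t in Ioc a b, ∫⁻ x, ‖v (t, x)‖ₑ ^ stExp d < ∞) (a b : ℝ) :
    IntervalIntegrable (forcing v) volume a b :=
  ⟨(memLp_forcing hd hv hlq a b).integrable (by norm_num),
    (memLp_forcing hd hv hlq b a).integrable (by norm_num)⟩

/-- A solution `u` with `U(t)` the distribution `u(t)`, with a jointly measurable version `v` of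
`u`, and with `D(t) = -Δu(t)` in `L²`. Here the Duhamel formula is written on the Fourier side, for
all pairs of times. -/
structure IsL2Solution (u : ℝ → Space d → ℂ) (v : ℝ × Space d → ℂ) (U : ℝ → 𝓢'(Space d, ℂ))
    (D : ℝ → L2 d) : Prop where
  represents : ∀ t, Represents (u t) (U t)
  measurable : Measurable v
  ae_eq : ∀ᵐ t, u t =ᵐ[volume] fun x => v (t, x)
  lq : ∀ a b, ∫⁻ t in Ioc a b, ∫⁻ x, ‖v (t, x)‖ₑ ^ stExp d < ∞
  continuous : Continuous D
  fourier : ∀ t, Represents (fun η => ((lapSym η : ℝ) : ℂ)⁻¹ * (𝓕 (D t) : L2 d) η) (𝓕 (U t))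
  duhamel : ∀ a t, (𝓕 (D t) : L2 d) =ᵐ[volume] fun η => propSym (t - a) η * (𝓕 (D a) : L2 d) η +
    Complex.I * ((lapSym η : ℝ) : ℂ) * (𝓕 (duhamelInt (forcing v) a t) : L2 d) η

theorem fourier_add_L2 (f g : L2 d) : 𝓕 (f + g) = (𝓕 f : L2 d) + 𝓕 g :=
  (Lp.fourierTransformₗᵢ (Space d) ℂ).map_add f g

theorem fourier_smul_L2 (c : ℂ) (f : L2 d) : 𝓕 (c • f) = c • (𝓕 f : L2 d) :=
  (Lp.fourierTransformₗᵢ (Space d) ℂ).map_smul c f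

theorem represents_fourier_L2 (f : L2 d) :
    Represents (𝓕 f : L2 d) (𝓕 (f : 𝓢'(Space d, ℂ))) := by
  rw [Lp.fourier_toTemperedDistribution_eq]
  exact represents_L2 _

theorem exists_measurable_version {u : ℝ → Space d → ℂ} {q : ℝ≥0∞}
    (hu : ∀ K : Set ℝ, IsCompact K → MemLp (Function.uncurry u) q
      ((volume : Measure (ℝ × Space d)).restrict (K ×ˢ univ))) :
    ∃ v : ℝ × Space d → ℂ, Measurable v ∧ Function.uncurry u =ᵐ[volume] v ∧
      ∀ᵐ t, u t =ᵐ[volume] fun x => v (t, x) := by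
  have h1 : AEStronglyMeasurable (Function.uncurry u) (volume : Measure (ℝ × Space d)) := by
    have h2 : (⋃ n : ℕ, Icc (-(n : ℝ)) n ×ˢ (univ : Set (Space d))) = univ := by
      refine eq_univ_of_forall fun z => mem_iUnion.2 ?_
      obtain ⟨n, hn⟩ := exists_nat_gt |z.1|
      exact ⟨n, ⟨by linarith [neg_abs_le z.1], by linarith [le_abs_self z.1]⟩, mem_univ _⟩
    rw [← Measure.restrict_univ (μ := (volume : Measure (ℝ × Space d))), ← h2]
    exact aestronglyMeasurable_iUnion_iff.2 fun n => (hu _ isCompact_Icc).1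
  refine ⟨h1.mk _, h1.stronglyMeasurable_mk.measurable, h1.ae_eq_mk, ?_⟩
  have h3 : Function.uncurry u =ᵐ[(volume : Measure ℝ).prod volume] h1.mk _ := h1.ae_eq_mk
  exact Measure.ae_ae_of_ae_prod h3

theorem exists_isL2Solution (hd : 9 ≤ d) {t₀ : ℝ} {u : ℝ → Space d → ℂ}
    (hu : IsGlobalSolution t₀ u) : ∃ v U D, IsL2Solution u v U D := by
  have hd1 : 1 ≤ d := by omega
  obtain ⟨U, V, hU, hV, hduh⟩ := hu.duhamel
  obtain ⟨v, hv, huv', huv⟩ := exists_measurable_version hu.memLp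
  have hlq : ∀ a b, ∫⁻ t in Ioc a b, ∫⁻ x, ‖v (t, x)‖ₑ ^ stExp d < ∞ := by
    intro a b
    have h1 := (memLp_iff_lintegral_rpow (stExp_pos hd) (hu.memLp (Icc a b) isCompact_Icc).1).1
      (hu.memLp (Icc a b) isCompact_Icc)
    have h2 : ∫⁻ z in Icc a b ×ˢ univ, ‖v z‖ₑ ^ stExp d < ∞ := by
      refine lt_of_le_of_lt (le_of_eq ?_) h1
      refine lintegral_congr_ae ?_
      filter_upwards [ae_restrict_of_ae huv'] with z hz
      rw [hz]
    rw [Measure.volume_eq_prod, ← Measure.prod_restrict, Measure.restrict_univ,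
      lintegral_prod _ (hv.enorm.pow_const _).aemeasurable] at h2
    exact lt_of_le_of_lt (lintegral_mono_set Ioc_subset_Icc_self) h2
  choose D hD using fun t => exists_laplacian hd1 (hU t) (hu.mem_hdot t)
  have hΦ := intervalIntegrable_forcing hd hv hlq
  -- `V` is given by the forcing, for almost all times
  have hVΦ : ∀ᵐ t, V t = (forcing v t : 𝓢'(Space d, ℂ)) := by
    filter_upwards [huv, ae_lintegral_stExp_lt_top hv hlq] with t h1 h2
    refine (hV t).unique_right ((represents_L2 (forcing v t)).congr ?_)
    filter_upwards [h1, forcing_ae_eq hd hv h2] with x h3 h4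
    rw [h4, h3]
  have hUeq : ∀ t, U t = propagator (t - t₀) (U t₀) +
      ((Complex.I • duhamelInt (forcing v) t₀ t : L2 d) : 𝓢'(Space d, ℂ)) := by
    intro t
    ext ψ
    obtain ⟨L, hL⟩ := exists_pairing ψ
    rw [(hduh t ψ).2]
    change _ = propagator (t - t₀) (U t₀) ψ +
      ((Complex.I • duhamelInt (forcing v) t₀ t : L2 d) : 𝓢'(Space d, ℂ)) ψ
    rw [← hL, map_smul, smul_eq_mul, duhamelInt, ← L.intervalIntegral_comp_comm
      (intervalIntegrable_flow (hΦ t₀ t) (by fun_prop))]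
    congr 2
    refine intervalIntegral.integral_congr_ae ?_
    filter_upwards [hVΦ] with τ hτ _
    rw [hτ, propagator_L2, hL]
  -- the Duhamel formula from the initial time
  have hduh0 : ∀ t, (𝓕 (D t) : L2 d) =ᵐ[volume] fun η =>
      propSym (t - t₀) η * (𝓕 (D t₀) : L2 d) η +
      Complex.I * ((lapSym η : ℝ) : ℂ) * (𝓕 (duhamelInt (forcing v) t₀ t) : L2 d) η := by
    intro t
    have h1 : Represents (fun η => propSym (t - t₀) η *
        (((lapSym η : ℝ) : ℂ)⁻¹ * (𝓕 (D t₀) : L2 d) η)) (𝓕 (propagator (t - t₀) (U t₀))) := by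
      rw [propagator, represents_fourier_multiplier]
      exact (hD t₀).smulLeft (hasTemperateGrowth_propSym (t - t₀))
    have h2 := h1.add (represents_fourier_L2 (Complex.I • duhamelInt (forcing v) t₀ t))
    have h3 := hD t
    rw [hUeq t, FourierTransform.fourier_add] at h3
    rw [fourier_smul_L2] at h2
    filter_upwards [h3.ae_eq h2, ae_lapSym_pos hd1,
      Lp.coeFn_smul Complex.I (𝓕 (duhamelInt (forcing v) t₀ t) : L2 d)] with η h4 h5 h6
    have : ((lapSym η : ℝ) : ℂ) ≠ 0 := by exact_mod_cast h5.ne'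
    rw [Pi.add_apply, h6, Pi.smul_apply, smul_eq_mul] at h4
    have h7 := congrArg (fun z => ((lapSym η : ℝ) : ℂ) * z) h4
    simp only [mul_inv_cancel_left₀ this] at h7
    rw [h7]
    field_simp
  refine ⟨v, U, D, hU, hv, huv, hlq, ?_, hD, ?_⟩
  · rw [continuous_iff_continuousAt]
    intro t
    have h1 : ∀ t', hdotNorm 2 (u t' - u t) = ‖D t' - D t‖ₑ := by
      intro t'
      refine hdotNorm_two_eq hd1 ((hU t').sub (hU t)) ?_
      have e : 𝓕 (U t' - U t) = 𝓕 (U t') - 𝓕 (U t) :=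
        map_sub (FourierTransform.fourierCLM ℂ 𝓢'(Space d, ℂ)) _ _
      rw [e]
      refine ((hD t').sub (hD t)).congr ?_
      rw [fourier_sub_L2]
      filter_upwards [Lp.coeFn_sub (𝓕 (D t') : L2 d) (𝓕 (D t))] with η h
      rw [h]
      simp [mul_sub]
    have h2 := hu.continuous_hdot t
    simp only [h1] at h2
    rw [ContinuousAt, tendsto_iff_edist_tendsto_0]
    simpa only [edist_eq_enorm_sub] using h2
  · intro a t
    have h1 : (𝓕 (duhamelInt (forcing v) t₀ t) : L2 d) =ᵐ[volume] fun η =>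
        propSym (t - a) η * (𝓕 (duhamelInt (forcing v) t₀ a) : L2 d) η +
          (𝓕 (duhamelInt (forcing v) a t) : L2 d) η := by
      rw [duhamelInt_trans hΦ t₀ a t, fourier_add_L2]
      filter_upwards [flow_ae_eq (t - a) (duhamelInt (forcing v) t₀ a),
        Lp.coeFn_add (𝓕 (flow (t - a) (duhamelInt (forcing v) t₀ a)) : L2 d)
          (𝓕 (duhamelInt (forcing v) a t))] with η h2 h3
      rw [h3, Pi.add_apply, h2]
    filter_upwards [hduh0 t, hduh0 a, h1] with η h2 h3 h4
    have h5 := propSym_mul (t - a) (a - t₀) η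
    rw [sub_add_sub_cancel] at h5
    rw [h2, h3, h4, ← h5]
    ring

/-! ### Increments of the solution -/

theorem norm_exp_I_mul_sub_one_le (y : ℝ) : ‖Complex.exp (Complex.I * (y : ℂ)) - 1‖ ≤ |y| := by
  have := Real.norm_exp_I_mul_ofReal_sub_one_le (x := y)
  simpa using this

theorem norm_exp_I_mul_sub_one_le_sqrt (y : ℝ) :
    ‖Complex.exp (Complex.I * (y : ℂ)) - 1‖ ≤ 2 * √|y| := by
  have h1 := norm_exp_I_mul_sub_one_le y
  have h2 : ‖Complex.exp (Complex.I * (y : ℂ)) - 1‖ ≤ 2 := by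
    refine (norm_sub_le _ _).trans ?_
    rw [norm_exp_I_mul_ofReal, norm_one]
    norm_num
  rcases le_total |y| 1 with h | h
  · have : |y| ≤ √|y| := Real.le_sqrt_of_sq_le (by nlinarith [abs_nonneg y])
    linarith [Real.sqrt_nonneg |y|]
  · have : 1 ≤ √|y| := Real.one_le_sqrt.2 h
    linarith

/-- The symbol `(e^{ih|ξ|⁴} - 1) / |ξ|²`. -/
def kick (h : ℝ) (η : Space d) : ℂ := (propSym h η - 1) * ((lapSym η : ℝ) : ℂ)⁻¹

theorem norm_propSym_sub_one_le (h : ℝ) (η : Space d) :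
    ‖propSym h η - 1‖ ≤ |h| * lapSym η ^ 2 := by
  rw [propSym_eq]
  refine (norm_exp_I_mul_sub_one_le _).trans (le_of_eq ?_)
  rw [abs_mul, abs_of_nonneg (by positivity : 0 ≤ lapSym η ^ 2)]

theorem norm_kick_le (h : ℝ) (η : Space d) : ‖kick h η‖ ≤ 2 * √|h| := by
  unfold kick
  rcases (lapSym_nonneg η).eq_or_lt with h0 | h0
  · rw [← h0]
    simp
  rw [norm_mul, norm_inv, Complex.norm_real, Real.norm_of_nonneg h0.le, ← div_eq_mul_inv,
    div_le_iff₀ h0, propSym_eq]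
  refine (norm_exp_I_mul_sub_one_le_sqrt _).trans (le_of_eq ?_)
  rw [abs_mul, abs_of_nonneg (by positivity : 0 ≤ lapSym η ^ 2), Real.sqrt_mul (abs_nonneg _),
    Real.sqrt_sq h0.le]
  ring

theorem norm_kick_le' (h : ℝ) (η : Space d) : ‖kick h η‖ ≤ |h| * lapSym η := by
  unfold kick
  rcases (lapSym_nonneg η).eq_or_lt with h0 | h0
  · rw [← h0]
    simp
  rw [norm_mul, norm_inv, Complex.norm_real, Real.norm_of_nonneg h0.le, ← div_eq_mul_inv,
    div_le_iff₀ h0]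
  refine (norm_propSym_sub_one_le h η).trans (le_of_eq (by ring))

theorem measurable_kick (h : ℝ) : Measurable (kick (d := d) h) :=
  ((continuous_propSym h).measurable.sub measurable_const).mul
    (Complex.measurable_ofReal.comp continuous_lapSym.measurable).inv

theorem memLp_kick (h : ℝ) : MemLp (kick (d := d) h) ⊤ :=
  memLp_top_of_bound' (measurable_kick h) (norm_kick_le h)

/-- The increment `u(t) - u(a)` of a solution as an element of `L²`, by the Duhamel formula. -/
def incr (v : ℝ × Space d → ℂ) (D : ℝ → L2 d) (a t : ℝ) : L2 d :=
  fourierMulL (kick (t - a)) (D a) + Complex.I • duhamelInt (forcing v) a t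

theorem fourier_sub_ae (f g : L2 d) :
    (𝓕 (f - g) : L2 d) =ᵐ[volume] fun η => (𝓕 f : L2 d) η - (𝓕 g : L2 d) η := by
  rw [fourier_sub_L2]
  exact Lp.coeFn_sub _ _

theorem fourier_add_ae (f g : L2 d) :
    (𝓕 (f + g) : L2 d) =ᵐ[volume] fun η => (𝓕 f : L2 d) η + (𝓕 g : L2 d) η := by
  rw [fourier_add_L2]
  exact Lp.coeFn_add _ _

theorem fourier_smul_ae (c : ℂ) (f : L2 d) :
    (𝓕 (c • f) : L2 d) =ᵐ[volume] fun η => c * (𝓕 f : L2 d) η := by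
  rw [fourier_smul_L2]
  exact Lp.coeFn_smul _ _

theorem L2_ext_fourier {f g : L2 d} (h : (𝓕 f : L2 d) =ᵐ[volume] (𝓕 g : L2 d)) : f = g :=
  fourier_injective (Lp.ext h)

theorem sq_intervalIntegral_le {f : ℝ → ℝ} {a b : ℝ} (hab : a ≤ b)
    (hf : IntervalIntegrable f volume a b)
    (hf2 : IntervalIntegrable (fun t => f t ^ 2) volume a b) :
    (∫ t in a..b, f t) ^ 2 ≤ (b - a) * ∫ t in a..b, f t ^ 2 := by
  rcases hab.eq_or_lt with rfl | hlt
  · simp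
  set m := (∫ t in a..b, f t) / (b - a) with hm
  have hpos : 0 < b - a := sub_pos.2 hlt
  have h0 : 0 ≤ ∫ t in a..b, (f t - m) ^ 2 :=
    intervalIntegral.integral_nonneg hab fun t _ => sq_nonneg _
  have e : (fun t => (f t - m) ^ 2) = fun t => f t ^ 2 - 2 * m * f t + m ^ 2 := by
    funext t
    ring
  rw [e, intervalIntegral.integral_add (hf2.sub (hf.const_mul _)) intervalIntegrable_const,
    intervalIntegral.integral_sub hf2 (hf.const_mul _), intervalIntegral.integral_const_mul,
    intervalIntegral.integral_const, smul_eq_mul] at h0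
  have hm' : ∫ t in a..b, f t = m * (b - a) := by
    rw [hm]
    field_simp
  rw [hm'] at h0 ⊢
  nlinarith

namespace IsL2Solution

variable {u : ℝ → Space d → ℂ} {v : ℝ × Space d → ℂ} {U : ℝ → 𝓢'(Space d, ℂ)} {D : ℝ → L2 d}

theorem intervalIntegrable (hs : IsL2Solution u v U D) (hd : 9 ≤ d) (a b : ℝ) :
    IntervalIntegrable (forcing v) volume a b :=
  intervalIntegrable_forcing hd hs.measurable hs.lq a b

theorem fourier_incr (hs : IsL2Solution u v U D) (hd : 9 ≤ d) (a t : ℝ) :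
    (𝓕 (incr v D a t) : L2 d) =ᵐ[volume]
      fun η => ((lapSym η : ℝ) : ℂ)⁻¹ * ((𝓕 (D t) : L2 d) η - (𝓕 (D a) : L2 d) η) := by
  unfold incr
  filter_upwards [fourier_add_ae (fourierMulL (kick (t - a)) (D a))
    (Complex.I • duhamelInt (forcing v) a t), fourierMulL_ae_eq (memLp_kick (t - a)) (D a),
    fourier_smul_ae Complex.I (duhamelInt (forcing v) a t), hs.duhamel a t,
    ae_lapSym_pos (by omega : 1 ≤ d)] with η h1 h2 h3 h4 h5
  have : ((lapSym η : ℝ) : ℂ) ≠ 0 := by exact_mod_cast h5.ne'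
  rw [h1, h2, h3, h4, kick]
  field_simp
  ring

theorem incr_ae_eq (hs : IsL2Solution u v U D) (hd : 9 ≤ d) (a t : ℝ) :
    incr v D a t =ᵐ[volume] fun x => u t x - u a x := by
  have e : 𝓕 (U t - U a) = 𝓕 (U t) - 𝓕 (U a) :=
    map_sub (FourierTransform.fourierCLM ℂ 𝓢'(Space d, ℂ)) _ _
  have h1 : Represents (𝓕 (incr v D a t) : L2 d) (𝓕 (U t - U a)) := by
    rw [e]
    refine ((hs.fourier t).sub (hs.fourier a)).congr ?_
    filter_upwards [hs.fourier_incr hd a t] with η h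
    rw [h]
    simp [mul_sub]
  have h2 := congrArg (fun T => 𝓕⁻ T) (h1.unique_right (represents_fourier_L2 (incr v D a t)))
  simp only [FourierTransform.fourierInv_fourier_eq] at h2
  have h3 := (hs.represents t).sub (hs.represents a)
  rw [h2] at h3
  exact (represents_L2 _).ae_eq h3

theorem incr_shift (hs : IsL2Solution u v U D) (hd : 9 ≤ d) (a t h : ℝ) :
    incr v D t (t + h) = flow (t - a) (incr v D a (a + h)) +
      Complex.I • duhamelInt (fun τ => forcing v (τ + h) - forcing v τ) a t := by
  have hi := hs.intervalIntegrable hd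
  have hi' : ∀ a b, IntervalIntegrable (fun τ => forcing v (τ + h)) volume a b := by
    intro a b
    have := (hi (a + h) (b + h)).comp_add_right h
    simpa using this
  rw [duhamelInt_sub hi' hi, ← duhamelInt_shift]
  apply L2_ext_fourier
  have h6 := hs.duhamel (a + h) (t + h)
  rw [add_sub_add_right_eq_sub] at h6
  filter_upwards [hs.fourier_incr hd t (t + h), hs.fourier_incr hd a (a + h),
    fourier_add_ae (flow (t - a) (incr v D a (a + h)))
      (Complex.I • (duhamelInt (forcing v) (a + h) (t + h) - duhamelInt (forcing v) a t)),
    flow_ae_eq (t - a) (incr v D a (a + h)),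
    fourier_smul_ae Complex.I
      (duhamelInt (forcing v) (a + h) (t + h) - duhamelInt (forcing v) a t),
    fourier_sub_ae (duhamelInt (forcing v) (a + h) (t + h)) (duhamelInt (forcing v) a t),
    h6, hs.duhamel a t, ae_lapSym_pos (by omega : 1 ≤ d)] with η h1 h2 h3 h4 h5 h7 h8 h9 h10
  have : ((lapSym η : ℝ) : ℂ) ≠ 0 := by exact_mod_cast h10.ne'
  rw [h1, h3, h4, h2, h5, h7, h8, h9]
  field_simp
  ring

theorem continuous_incr_shift (hs : IsL2Solution u v U D) (hd : 9 ≤ d) (h : ℝ) :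
    Continuous fun t => incr v D t (t + h) := by
  have hi := hs.intervalIntegrable hd
  have hi' : ∀ a b, IntervalIntegrable (fun τ => forcing v (τ + h)) volume a b := by
    intro a b
    have := (hi (a + h) (b + h)).comp_add_right h
    simpa using this
  have e : (fun t => incr v D t (t + h)) = fun t => flow (t - 0) (incr v D 0 (0 + h)) +
      Complex.I • duhamelInt (fun τ => forcing v (τ + h) - forcing v τ) 0 t :=
    funext fun t => hs.incr_shift hd 0 t h
  rw [e]
  refine Continuous.add ?_ ?_
  · exact (continuous_flow_time _).comp (by fun_prop)
  · exact (continuous_duhamelInt (fun a b => (hi' a b).sub (hi a b)) 0).const_smul Complex.I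

theorem tendsto_norm_incr_div (hs : IsL2Solution u v U D) (hd : 9 ≤ d) (a : ℝ) :
    Tendsto (fun h => ‖incr v D a (a + h)‖ / √h) (𝓝[>] 0) (𝓝 0) := by
  have h1 : Tendsto (fun h : ℝ => fourierMulL
      (fun η => ((√h : ℝ) : ℂ)⁻¹ * kick h η) (D a)) (𝓝[>] 0)
      (𝓝 (fourierMulL (fun _ => 0) (D a))) := by
    refine tendsto_fourierMulL (C := 2) (fun h => (measurable_kick h).const_mul _)
      measurable_const (fun h η => ?_) (fun η => by simp) (fun η => ?_) (D a)
    · rw [norm_mul, norm_inv, Complex.norm_real, Real.norm_of_nonneg (Real.sqrt_nonneg _)]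
      rcases le_or_gt h 0 with h0 | h0
      · rw [Real.sqrt_eq_zero_of_nonpos h0]
        simp
      · have hs : 0 < √h := Real.sqrt_pos.2 h0
        rw [inv_mul_le_iff₀ hs]
        have := norm_kick_le h η
        rw [abs_of_pos h0] at this
        linarith
    · have hb : Tendsto (fun h : ℝ => √h * lapSym η) (𝓝[>] 0) (𝓝 0) := by
        have : Continuous fun h : ℝ => √h * lapSym η := by fun_prop
        simpa using (this.tendsto 0).mono_left nhdsWithin_le_nhds
      refine squeeze_zero_norm' ?_ hb
      filter_upwards [self_mem_nhdsWithin] with h h0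
      have h0 : 0 < h := h0
      have hs : 0 < √h := Real.sqrt_pos.2 h0
      rw [norm_mul, norm_inv, Complex.norm_real, Real.norm_of_nonneg (Real.sqrt_nonneg _),
        inv_mul_le_iff₀ hs, ← mul_assoc, Real.mul_self_sqrt h0.le]
      simpa [abs_of_pos h0] using norm_kick_le' h η
  have hz : fourierMulL (fun _ => 0) (D a) = 0 := by
    have := norm_fourierMulL_le (m := fun _ : Space d => (0 : ℂ)) measurable_const (C := 0)
      (fun η => by simp) (D a)
    rw [zero_mul] at this
    exact norm_le_zero_iff.1 this
  rw [hz] at h1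
  -- the Duhamel term, by Cauchy–Schwarz in time
  have hΦ2 : ∀ b, IntervalIntegrable (fun τ => ‖forcing v τ‖ ^ 2) volume a b := fun b =>
    ⟨(memLp_forcing hd hs.measurable hs.lq a b).integrable_norm_pow (by norm_num),
      (memLp_forcing hd hs.measurable hs.lq b a).integrable_norm_pow (by norm_num)⟩
  have h2 : Tendsto (fun h : ℝ => √(∫ τ in a..a + h, ‖forcing v τ‖ ^ 2)) (𝓝[>] 0) (𝓝 0) := by
    have hc : Continuous fun t => ∫ τ in a..t, ‖forcing v τ‖ ^ 2 := by
      refine intervalIntegral.continuous_primitive (fun b c => ?_) a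
      exact (hΦ2 b).symm.trans (hΦ2 c)
    have hc2 : Continuous fun h : ℝ => √(∫ τ in a..a + h, ‖forcing v τ‖ ^ 2) :=
      (hc.comp (continuous_const.add continuous_id)).sqrt
    simpa using (hc2.tendsto 0).mono_left nhdsWithin_le_nhds
  have h3 := (h1.norm).add h2
  simp only [norm_zero, add_zero] at h3
  refine squeeze_zero' ?_ ?_ h3
  · filter_upwards with h
    positivity
  · filter_upwards [self_mem_nhdsWithin] with h h0
    have h0 : 0 < h := h0
    have hsq : 0 < √h := Real.sqrt_pos.2 h0
    have hm : fourierMulL (fun η => ((√h : ℝ) : ℂ)⁻¹ * kick h η) (D a)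
        = ((√h : ℝ) : ℂ)⁻¹ • fourierMulL (kick h) (D a) := by
      have hm : MemLp (fun η : Space d => ((√h : ℝ) : ℂ)⁻¹ * kick h η) ⊤ :=
        (memLp_kick h).const_mul _
      refine (eq_fourierMulL hm ?_).symm
      filter_upwards [fourier_smul_ae ((√h : ℝ) : ℂ)⁻¹ (fourierMulL (kick h) (D a)),
        fourierMulL_ae_eq (memLp_kick h) (D a)] with η k1 k2
      rw [k1, k2, mul_assoc]
    rw [hm, norm_smul, norm_inv, Complex.norm_real, Real.norm_of_nonneg hsq.le]
    have hle : a ≤ a + h := by linarith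
    have hcs : ‖duhamelInt (forcing v) a (a + h)‖
        ≤ √h * √(∫ τ in a..a + h, ‖forcing v τ‖ ^ 2) := by
      refine (norm_duhamelInt_le _ hle).trans ?_
      rw [← Real.sqrt_mul h0.le]
      refine Real.le_sqrt_of_sq_le ?_
      have := sq_intervalIntegral_le hle ((hs.intervalIntegrable hd a (a + h)).norm) (hΦ2 (a + h))
      simpa using this
    rw [incr, add_sub_cancel_left, div_le_iff₀ hsq, add_mul, mul_right_comm,
      inv_mul_cancel₀ hsq.ne', one_mul]
    refine (norm_add_le _ _).trans ?_
    rw [norm_smul, Complex.norm_I, one_mul]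
    linarith

end IsL2Solution

/-! ### The equation for time averages and the energy identity -/

/-- The indicator function of `|ξ|² ≤ R` on the Fourier side. -/
def lowPass (R : ℝ) (η : Space d) : ℂ := open Classical in if lapSym η ≤ R then 1 else 0

theorem measurable_lowPass (R : ℝ) : Measurable (lowPass (d := d) R) :=
  Measurable.ite (measurableSet_le continuous_lapSym.measurable measurable_const)
    measurable_const measurable_const

theorem norm_lowPass_mul_le {R C : ℝ} {m : Space d → ℂ} (hC : 0 ≤ C)
    (h : ∀ η, lapSym η ≤ R → ‖m η‖ ≤ C) (η : Space d) : ‖lowPass R η * m η‖ ≤ C := by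
  unfold lowPass
  by_cases hη : lapSym η ≤ R
  · rw [if_pos hη, one_mul]
    exact h η hη
  · rw [if_neg hη, zero_mul, norm_zero]
    exact hC

theorem lowPass_of_le {R : ℝ} {η : Space d} (h : lapSym η ≤ R) : lowPass R η = 1 :=
  if_pos h

theorem measurable_lapSym_pow (k : ℕ) : Measurable fun η : Space d => ((lapSym η ^ k : ℝ) : ℂ) :=
  Complex.measurable_ofReal.comp (continuous_lapSym.pow k).measurable

/-- The symbol `|ξ|^{2k}` restricted to `|ξ|² ≤ R`. -/
def lowLap (R : ℝ) (k : ℕ) (η : Space d) : ℂ := lowPass R η * ((lapSym η ^ k : ℝ) : ℂ)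

theorem measurable_lowLap (R : ℝ) (k : ℕ) : Measurable (lowLap (d := d) R k) :=
  (measurable_lowPass R).mul (measurable_lapSym_pow k)

theorem norm_lowLap_le {R : ℝ} (hR : 0 ≤ R) (k : ℕ) (η : Space d) : ‖lowLap R k η‖ ≤ R ^ k := by
  refine norm_lowPass_mul_le (m := fun η => ((lapSym η ^ k : ℝ) : ℂ)) (pow_nonneg hR k)
    (fun η h => ?_) η
  rw [Complex.norm_real, Real.norm_of_nonneg (by have := lapSym_nonneg η; positivity)]
  exact pow_le_pow_left₀ (lapSym_nonneg η) h k

theorem memLp_lowLap {R : ℝ} (hR : 0 ≤ R) (k : ℕ) : MemLp (lowLap (d := d) R k) ⊤ :=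
  memLp_top_of_bound' (measurable_lowLap R k) (norm_lowLap_le hR k)

/-- On bounded frequencies the propagator is Lipschitz in time. -/
theorem norm_lowLap_flow_sub_le {R : ℝ} (hR : 0 ≤ R) (k : ℕ) (s : ℝ) (f : L2 d) :
    ‖fourierMulL (lowLap R k) (flow s f - f)‖ ≤ |s| * R ^ (k + 2) * ‖f‖ := by
  have hm : Measurable fun η : Space d => lowLap R k η * (propSym s η - 1) :=
    (measurable_lowLap R k).mul ((continuous_propSym s).measurable.sub measurable_const)
  have hb : ∀ η : Space d, ‖lowLap R k η * (propSym s η - 1)‖ ≤ |s| * R ^ (k + 2) := by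
    intro η
    unfold lowLap
    rw [mul_assoc]
    refine norm_lowPass_mul_le (m := fun η => ((lapSym η ^ k : ℝ) : ℂ) * (propSym s η - 1))
      (mul_nonneg (abs_nonneg s) (pow_nonneg hR _)) (fun η h => ?_) η
    have h0 := lapSym_nonneg η
    rw [norm_mul, Complex.norm_real, Real.norm_of_nonneg (by positivity)]
    calc lapSym η ^ k * ‖propSym s η - 1‖ ≤ lapSym η ^ k * (|s| * lapSym η ^ 2) := by
          gcongr
          exact norm_propSym_sub_one_le s η
      _ = |s| * lapSym η ^ (k + 2) := by ring
      _ ≤ |s| * R ^ (k + 2) := by gcongr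
  have e : fourierMulL (lowLap R k) (flow s f - f)
      = fourierMulL (fun η => lowLap R k η * (propSym s η - 1)) f := by
    refine eq_fourierMulL (memLp_top_of_bound' hm hb) ?_
    filter_upwards [fourierMulL_ae_eq (memLp_lowLap hR k) (flow s f - f), fourier_sub_ae (flow s f) f,
      flow_ae_eq s f] with η h1 h2 h3
    rw [h1, h2, h3]
    ring
  rw [e]
  exact norm_fourierMulL_le hm hb f

theorem tendsto_lowLap_flow_div {R : ℝ} (hR : 0 ≤ R) (f : L2 d) :
    Tendsto (fun s : ℝ => ((s : ℝ) : ℂ)⁻¹ • fourierMulL (lowLap R 0) (flow s f - f)) (𝓝[>] 0)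
      (𝓝 (Complex.I • fourierMulL (lowLap R 2) f)) := by
  have hm : ∀ s : ℝ, Measurable fun η : Space d =>
      ((s : ℝ) : ℂ)⁻¹ * (lowLap R 0 η * (propSym s η - 1)) := fun s =>
    (((measurable_lowLap R 0).mul
      ((continuous_propSym s).measurable.sub measurable_const))).const_mul _
  have hb : ∀ (s : ℝ) (η : Space d),
      ‖((s : ℝ) : ℂ)⁻¹ * (lowLap R 0 η * (propSym s η - 1))‖ ≤ R ^ 2 := by
    intro s η
    rw [mul_left_comm, lowLap, pow_zero, Complex.ofReal_one, mul_one]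
    refine norm_lowPass_mul_le (m := fun η => ((s : ℝ) : ℂ)⁻¹ * (propSym s η - 1))
      (pow_nonneg hR 2) (fun η h => ?_) η
    have h0 := lapSym_nonneg η
    rw [norm_mul, norm_inv, Complex.norm_real, Real.norm_eq_abs]
    rcases eq_or_ne s 0 with rfl | hs
    · simp
      positivity
    · rw [inv_mul_le_iff₀ (abs_pos.2 hs)]
      refine (norm_propSym_sub_one_le s η).trans ?_
      gcongr
  have hm2 : Measurable fun η : Space d => Complex.I * lowLap R 2 η :=
    (measurable_lowLap R 2).const_mul _
  have hb2 : ∀ η : Space d, ‖Complex.I * lowLap R 2 η‖ ≤ R ^ 2 := fun η => by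
    rw [norm_mul, Complex.norm_I, one_mul]
    exact norm_lowLap_le hR 2 η
  have key := tendsto_fourierMulL (l := 𝓝[>] (0 : ℝ)) hm hm2 hb hb2 (fun η => ?_) f
  · have e1 : ∀ s : ℝ, ((s : ℝ) : ℂ)⁻¹ • fourierMulL (lowLap R 0) (flow s f - f)
        = fourierMulL (fun η => ((s : ℝ) : ℂ)⁻¹ * (lowLap R 0 η * (propSym s η - 1))) f := by
      intro s
      refine eq_fourierMulL (memLp_top_of_bound' (hm s) (hb s)) ?_
      filter_upwards [fourier_smul_ae ((s : ℝ) : ℂ)⁻¹ (fourierMulL (lowLap R 0) (flow s f - f)),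
        fourierMulL_ae_eq (memLp_lowLap hR 0) (flow s f - f), fourier_sub_ae (flow s f) f,
        flow_ae_eq s f] with η h1 h2 h3 h4
      rw [h1, h2, h3, h4]
      ring
    have e2 : Complex.I • fourierMulL (lowLap R 2) f
        = fourierMulL (fun η => Complex.I * lowLap R 2 η) f := by
      refine eq_fourierMulL (memLp_top_of_bound' hm2 hb2) ?_
      filter_upwards [fourier_smul_ae Complex.I (fourierMulL (lowLap R 2) f),
        fourierMulL_ae_eq (memLp_lowLap hR 2) f] with η h1 h2
      rw [h1, h2]
      ring
    simp only [e1, e2]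
    exact key
  · have hder : HasDerivAt (fun s : ℝ => Complex.exp (Complex.I * ((s * lapSym η ^ 2 : ℝ) : ℂ)))
        (Complex.I * ((lapSym η ^ 2 : ℝ) : ℂ)) 0 := by
      have h1 : HasDerivAt (fun s : ℝ => Complex.I * ((s * lapSym η ^ 2 : ℝ) : ℂ))
          (Complex.I * ((lapSym η ^ 2 : ℝ) : ℂ)) 0 := by
        have := (((hasDerivAt_id (0 : ℝ)).mul_const (lapSym η ^ 2)).ofReal_comp).const_mul Complex.I
        simpa using this
      simpa using h1.cexp
    have h2 := (hasDerivAt_iff_tendsto_slope_zero.1 hder).mono_left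
      (nhdsWithin_mono 0 (fun x (hx : 0 < x) => hx.ne') : 𝓝[>] (0 : ℝ) ≤ 𝓝[≠] 0)
    have h3 := h2.const_mul (lowLap R 0 η)
    have e3 : lowLap R 0 η * (Complex.I * ((lapSym η ^ 2 : ℝ) : ℂ)) = Complex.I * lowLap R 2 η := by
      unfold lowLap
      push_cast
      ring
    rw [e3] at h3
    refine h3.congr fun s => ?_
    rw [propSym_eq, zero_add, zero_mul, Complex.ofReal_zero, mul_zero, Complex.exp_zero,
      Complex.real_smul, Complex.ofReal_inv]
    ring

namespace IsL2Solution

variable {u : ℝ → Space d → ℂ} {v : ℝ × Space d → ℂ} {U : ℝ → 𝓢'(Space d, ℂ)} {D : ℝ → L2 d}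

theorem lowLap_duhamel (hs : IsL2Solution u v U D) {R : ℝ} (hR : 0 ≤ R) (a t : ℝ) :
    fourierMulL (lowLap R 0) (D t) = fourierMulL (lowLap R 0) (flow (t - a) (D a)) +
      Complex.I • fourierMulL (lowLap R 1) (duhamelInt (forcing v) a t) := by
  apply L2_ext_fourier
  filter_upwards [fourierMulL_ae_eq (memLp_lowLap hR 0) (D t), hs.duhamel a t,
    fourier_add_ae (fourierMulL (lowLap R 0) (flow (t - a) (D a)))
      (Complex.I • fourierMulL (lowLap R 1) (duhamelInt (forcing v) a t)),
    fourierMulL_ae_eq (memLp_lowLap hR 0) (flow (t - a) (D a)), flow_ae_eq (t - a) (D a),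
    fourier_smul_ae Complex.I (fourierMulL (lowLap R 1) (duhamelInt (forcing v) a t)),
    fourierMulL_ae_eq (memLp_lowLap hR 1) (duhamelInt (forcing v) a t)]
    with η h1 h2 h3 h4 h5 h6 h7
  rw [h1, h2, h3, h4, h5, h6, h7]
  unfold lowLap
  push_cast
  ring

/-- The equation on bounded frequencies, integrated in time. -/
theorem lowLap_sub_eq (hs : IsL2Solution u v U D) (hd : 9 ≤ d) {R : ℝ} (hR : 0 ≤ R) {a b : ℝ}
    (hab : a ≤ b) :
    fourierMulL (lowLap R 0) (D b) - fourierMulL (lowLap R 0) (D a)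
      = Complex.I • fourierMulL (lowLap R 1) (∫ τ in a..b, forcing v τ) +
        Complex.I • fourierMulL (lowLap R 2) (∫ τ in a..b, D τ) := by
  have hi := hs.intervalIntegrable hd
  set Z : ℝ → L2 d := fun t => fourierMulL (lowLap R 0) (D t) -
    Complex.I • fourierMulL (lowLap R 1) (∫ τ in a..t, forcing v τ) with hZ
  have hprim : Continuous fun t => ∫ τ in a..t, forcing v τ :=
    intervalIntegral.continuous_primitive hi a
  have hZc : Continuous Z :=
    ((fourierMulL (lowLap R 0)).continuous.comp hs.continuous).sub
      (((fourierMulL (lowLap R 1)).continuous.comp hprim).const_smul Complex.I)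
  have hder : ∀ t, HasDerivWithinAt Z (Complex.I • fourierMulL (lowLap R 2) (D t)) (Ioi t) t := by
    intro t
    rw [hasDerivWithinAt_iff_tendsto_slope' self_notMem_Ioi]
    have hmap : Tendsto (fun y => y - t) (𝓝[>] t) (𝓝[>] 0) := by
      refine tendsto_nhdsWithin_iff.2 ⟨?_, ?_⟩
      · have : Continuous fun y : ℝ => y - t := by fun_prop
        simpa using (this.tendsto t).mono_left nhdsWithin_le_nhds
      · filter_upwards [self_mem_nhdsWithin] with y hy
        exact sub_pos.2 (mem_Ioi.1 hy)
    have hmain := (tendsto_lowLap_flow_div hR (D t)).comp hmap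
    -- the forcing contributes the propagator minus the identity on short time intervals
    have herr : ∀ y, t < y → fourierMulL (lowLap R 1)
        (duhamelInt (forcing v) t y - ∫ τ in t..y, forcing v τ)
        = ∫ τ in t..y, fourierMulL (lowLap R 1) (flow (y - τ) (forcing v τ) - forcing v τ) := by
      intro y hy
      have i1 := intervalIntegrable_flow (hi t y) (θ := fun τ => y - τ) (by fun_prop)
      rw [ContinuousLinearMap.intervalIntegral_comp_comm _ (i1.sub (hi t y)),
        intervalIntegral.integral_sub i1 (hi t y)]
      rfl
    have hbound : ∀ y, t < y → ‖fourierMulL (lowLap R 1)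
        (duhamelInt (forcing v) t y - ∫ τ in t..y, forcing v τ)‖
        ≤ (y - t) * R ^ 3 * ∫ τ in t..y, ‖forcing v τ‖ := by
      intro y hy
      rw [herr y hy, ← intervalIntegral.integral_const_mul]
      refine intervalIntegral.norm_integral_le_of_norm_le hy.le ?_ ((hi t y).norm.const_mul _)
      filter_upwards with τ hτ
      refine (norm_lowLap_flow_sub_le hR 1 (y - τ) (forcing v τ)).trans ?_
      have : |y - τ| ≤ y - t := by
        rw [abs_of_nonneg (sub_nonneg.2 hτ.2)]
        linarith [hτ.1]
      gcongr
    have hsmall : Tendsto (fun y => ((y - t)⁻¹ : ℝ) • (Complex.I • fourierMulL (lowLap R 1)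
        (duhamelInt (forcing v) t y - ∫ τ in t..y, forcing v τ))) (𝓝[>] t) (𝓝 0) := by
      have hc : Continuous fun y => R ^ 3 * ∫ τ in t..y, ‖forcing v τ‖ :=
        continuous_const.mul (intervalIntegral.continuous_primitive (fun b c => (hi b c).norm) t)
      have hc0 : Tendsto (fun y => R ^ 3 * ∫ τ in t..y, ‖forcing v τ‖) (𝓝[>] t) (𝓝 0) := by
        simpa using (hc.tendsto t).mono_left nhdsWithin_le_nhds
      refine squeeze_zero_norm' ?_ hc0
      filter_upwards [self_mem_nhdsWithin] with y hy
      have hy' : 0 < y - t := sub_pos.2 (mem_Ioi.1 hy)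
      rw [norm_smul, norm_smul, Complex.norm_I, one_mul, norm_inv, Real.norm_of_nonneg hy'.le,
        inv_mul_le_iff₀ hy', ← mul_assoc]
      exact hbound y hy
    have hsum := hmain.add hsmall
    rw [add_zero] at hsum
    refine hsum.congr' ?_
    filter_upwards [self_mem_nhdsWithin] with y hy
    have e1 : ∫ τ in a..y, forcing v τ = (∫ τ in a..t, forcing v τ) + ∫ τ in t..y, forcing v τ :=
      (intervalIntegral.integral_add_adjacent_intervals (hi a t) (hi t y)).symm
    have e2 : Z y - Z t = fourierMulL (lowLap R 0) (flow (y - t) (D t) - D t) +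
        Complex.I • fourierMulL (lowLap R 1)
          (duhamelInt (forcing v) t y - ∫ τ in t..y, forcing v τ) := by
      simp only [hZ]
      rw [e1, hs.lowLap_duhamel hR t y]
      simp only [map_sub, map_add, smul_add, smul_sub]
      abel
    rw [slope_def_module, e2, smul_add]
    congr 1
    simp only [Function.comp_apply]
    rw [← Complex.ofReal_inv, Complex.coe_smul]
    rfl
  have hcont : Continuous fun t => Complex.I • fourierMulL (lowLap R 2) (D t) :=
    ((fourierMulL (lowLap R 2)).continuous.comp hs.continuous).const_smul Complex.I
  have hftc := intervalIntegral.integral_eq_sub_of_hasDeriv_right_of_le hab hZc.continuousOn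
    (fun t _ => hder t) (hcont.intervalIntegrable a b)
  rw [intervalIntegral.integral_smul, ContinuousLinearMap.intervalIntegral_comp_comm _
    (hs.continuous.intervalIntegrable a b)] at hftc
  rw [hftc]
  simp only [hZ, intervalIntegral.integral_same, map_zero, smul_zero, sub_zero]
  abel

/-- The equation integrated in time: `Δ² ∫ u = -i (u(b) - u(a)) - ∫ F(u)`. -/
theorem fourier_integral_eq (hs : IsL2Solution u v U D) (hd : 9 ≤ d) {a b : ℝ} (hab : a ≤ b) :
    ∀ᵐ η, ((lapSym η : ℝ) : ℂ) * (𝓕 (∫ τ in a..b, D τ) : L2 d) η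
      = -Complex.I * (𝓕 (incr v D a b) : L2 d) η - (𝓕 (∫ τ in a..b, forcing v τ) : L2 d) η := by
  have h1 : ∀ n : ℕ, ∀ᵐ η : Space d, lapSym η ≤ n →
      ((lapSym η : ℝ) : ℂ) * (𝓕 (∫ τ in a..b, D τ) : L2 d) η
      = -Complex.I * (𝓕 (incr v D a b) : L2 d) η - (𝓕 (∫ τ in a..b, forcing v τ) : L2 d) η := by
    intro n
    have hR : (0 : ℝ) ≤ n := by positivity
    have heq := congrArg (fun f : L2 d => (𝓕 f : L2 d)) (hs.lowLap_sub_eq hd hR hab)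
    have heq' := Lp.ext_iff.1 heq
    filter_upwards [heq', fourier_sub_ae (fourierMulL (lowLap n 0) (D b))
        (fourierMulL (lowLap n 0) (D a)), fourierMulL_ae_eq (memLp_lowLap hR 0) (D b),
      fourierMulL_ae_eq (memLp_lowLap hR 0) (D a),
      fourier_add_ae (Complex.I • fourierMulL (lowLap n 1) (∫ τ in a..b, forcing v τ))
        (Complex.I • fourierMulL (lowLap n 2) (∫ τ in a..b, D τ)),
      fourier_smul_ae Complex.I (fourierMulL (lowLap n 1) (∫ τ in a..b, forcing v τ)),
      fourier_smul_ae Complex.I (fourierMulL (lowLap n 2) (∫ τ in a..b, D τ)),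
      fourierMulL_ae_eq (memLp_lowLap hR 1) (∫ τ in a..b, forcing v τ),
      fourierMulL_ae_eq (memLp_lowLap hR 2) (∫ τ in a..b, D τ),
      hs.fourier_incr hd a b, ae_lapSym_pos (by omega : 1 ≤ d)]
      with η k0 k1 k2 k3 k4 k5 k6 k7 k8 k9 k10 hη
    have hne : ((lapSym η : ℝ) : ℂ) ≠ 0 := by exact_mod_cast k10.ne'
    rw [k1, k2, k3, k4, k5, k6, k7, k8] at k0
    simp only [lowLap, lowPass_of_le hη, one_mul, pow_zero, Complex.ofReal_one, pow_one] at k0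
    rw [k9, k0]
    push_cast
    field_simp
    ring_nf
    rw [Complex.I_sq]
    ring
  filter_upwards [ae_all_iff.2 h1] with η h
  obtain ⟨n, hn⟩ := exists_nat_ge (lapSym η)
  exact h n hn

theorem re_inner_integral_eq (hs : IsL2Solution u v U D) (hd : 9 ≤ d) {a b : ℝ} (hab : a ≤ b) :
    (inner ℂ (∫ τ in a..b, D τ) (D b - D a)).re
      = -(inner ℂ (∫ τ in a..b, forcing v τ) (incr v D a b)).re := by
  have e : inner ℂ (∫ τ in a..b, D τ) (D b - D a)
      = inner ℂ (-Complex.I • incr v D a b - ∫ τ in a..b, forcing v τ) (incr v D a b) := by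
    rw [inner_eq_integral_fourier, inner_eq_integral_fourier]
    refine integral_congr_ae ?_
    filter_upwards [hs.fourier_integral_eq hd hab, hs.fourier_incr hd a b,
      fourier_sub_ae (D b) (D a),
      fourier_sub_ae (-Complex.I • incr v D a b) (∫ τ in a..b, forcing v τ),
      fourier_smul_ae (-Complex.I) (incr v D a b), ae_lapSym_pos (by omega : 1 ≤ d)]
      with η h1 h2 h3 h4 h5 h6
    have hne : ((lapSym η : ℝ) : ℂ) ≠ 0 := by exact_mod_cast h6.ne'
    rw [h3, h4, h5, ← h1, h2, map_mul, Complex.conj_ofReal]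
    field_simp
  rw [e, inner_sub_left, inner_smul_left, inner_self_eq_norm_sq_to_K]
  simp [← Complex.ofReal_pow]

/-- The energy identity for time averages of the solution. -/
theorem energy_identity (hs : IsL2Solution u v U D) (hd : 9 ≤ d) {h : ℝ} (hh : 0 ≤ h) (a b : ℝ) :
    ‖∫ τ in b..b + h, D τ‖ ^ 2 / 2 - ‖∫ τ in a..a + h, D τ‖ ^ 2 / 2
      = -∫ t in a..b, (inner ℂ (∫ τ in t..t + h, forcing v τ) (incr v D t (t + h))).re := by
  have hi := hs.intervalIntegrable hd
  have hD : ∀ t, HasDerivAt (fun t => ∫ τ in t..t + h, D τ) (D (t + h) - D t) t := by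
    intro t
    have e : (fun t => ∫ τ in t..t + h, D τ)
        = fun t => (∫ τ in (0 : ℝ)..t + h, D τ) - ∫ τ in (0 : ℝ)..t, D τ := by
      funext t
      rw [intervalIntegral.integral_interval_sub_left] <;>
        exact hs.continuous.intervalIntegrable _ _
    rw [e]
    have h1 : ∀ s, HasDerivAt (fun s => ∫ τ in (0 : ℝ)..s, D τ) (D s) s := fun s =>
      intervalIntegral.integral_hasDerivAt_right (hs.continuous.intervalIntegrable _ _)
        (hs.continuous.stronglyMeasurableAtFilter _ _) hs.continuous.continuousAt
    exact ((h1 (t + h)).comp_add_const t h).sub (h1 t)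
  have hder : ∀ t, HasDerivAt (fun t => ‖∫ τ in t..t + h, D τ‖ ^ 2 / 2)
      (-(inner ℂ (∫ τ in t..t + h, forcing v τ) (incr v D t (t + h))).re) t := by
    intro t
    rw [← hs.re_inner_integral_eq hd (by linarith : t ≤ t + h)]
    have h1 := (hD t).inner ℂ (hD t)
    have h2 := Complex.reCLM.hasFDerivAt.comp_hasDerivAt t h1
    have h3 := h2.div_const 2
    refine (h3.congr_of_eventuallyEq (Eventually.of_forall fun s => ?_)).congr_deriv ?_
    · simp only [Function.comp_apply, Complex.reCLM_apply]
      rw [inner_self_eq_norm_sq_to_K]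
      simp [← Complex.ofReal_pow]
    · simp only [Complex.reCLM_apply, Complex.add_re]
      rw [← inner_conj_symm (D (t + h) - D t), Complex.conj_re]
      ring
  have hcont : Continuous fun t => -(inner ℂ (∫ τ in t..t + h, forcing v τ)
      (incr v D t (t + h))).re := by
    have h1 : Continuous fun t => ∫ τ in t..t + h, forcing v τ := by
      have e : (fun t => ∫ τ in t..t + h, forcing v τ)
          = fun t => (∫ τ in (0 : ℝ)..t + h, forcing v τ) - ∫ τ in (0 : ℝ)..t, forcing v τ := by
        funext t
        rw [intervalIntegral.integral_interval_sub_left (hi _ _) (hi _ _)]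
      rw [e]
      have := intervalIntegral.continuous_primitive hi 0
      exact (this.comp (continuous_id.add continuous_const)).sub this
    exact (Complex.continuous_re.comp (h1.inner (hs.continuous_incr_shift hd h))).neg
  rw [← intervalIntegral.integral_neg]
  exact (intervalIntegral.integral_eq_sub_of_hasDerivAt (fun t _ => hder t)
    (hcont.intervalIntegrable a b)).symm

end IsL2Solution

/-! ### Pointwise estimates for the nonlinearity -/

/-- The exponent `8/(d-4)` of the nonlinearity. -/
def nlExp (d : ℕ) : ℝ := 8 / ((d : ℝ) - 4)

theorem nlExp_pos (hd : 9 ≤ d) : 0 < nlExp d := by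
  have : (9 : ℝ) ≤ d := by exact_mod_cast hd
  have : 0 < (d : ℝ) - 4 := by linarith
  unfold nlExp
  positivity

theorem mul_rpow_sub_rpow_le {α A B : ℝ} (hα : 0 < α) (hB : 0 ≤ B) (hAB : B ≤ A) :
    B * (A ^ α - B ^ α) ≤ (α + 1) * A ^ α * (A - B) := by
  rcases (hB.trans hAB).eq_or_lt with hA | hA
  · have : B = 0 := le_antisymm (hA ▸ hAB) hB
    rw [this, ← hA]
    simp
  have h1 : 1 + (α + 1) * (B / A - 1) ≤ (1 + (B / A - 1)) ^ (α + 1) :=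
    one_add_mul_self_le_rpow_one_add (by have : 0 ≤ B / A := by positivity
                                         linarith) (by linarith)
  rw [add_sub_cancel, Real.div_rpow hB hA.le, Real.rpow_add_one hA.ne',
    Real.rpow_add_one' hB (by positivity)] at h1
  have hAα : 0 < A ^ α := Real.rpow_pos_of_pos hA α
  rw [le_div_iff₀ (by positivity)] at h1
  have h2 : (1 + (α + 1) * (B / A - 1)) * (A ^ α * A) = A ^ α * (A + (α + 1) * (B - A)) := by
    field_simp
  rw [h2] at h1
  have h3 : B * A ^ α ≤ A ^ α * A := by
    rw [mul_comm]
    gcongr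
  nlinarith

theorem norm_nonlin_sub_le (hd : 9 ≤ d) (a b : ℂ) :
    ‖nonlin d a - nonlin d b‖ ≤ (nlExp d + 2) * ((‖a‖ + ‖b‖) ^ nlExp d * ‖a - b‖) := by
  have hα := nlExp_pos hd
  wlog hab : ‖b‖ ≤ ‖a‖ generalizing a b
  · have := this b a (le_of_not_ge hab)
    rwa [norm_sub_rev, norm_sub_rev b a, add_comm ‖b‖] at this
  set α := nlExp d with hαd
  have hF : ∀ z : ℂ, nonlin d z = ((‖z‖ ^ α : ℝ) : ℂ) * z := fun z => rfl
  have e : nonlin d a - nonlin d b = ((‖a‖ ^ α : ℝ) : ℂ) * (a - b) +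
      ((‖a‖ ^ α - ‖b‖ ^ α : ℝ) : ℂ) * b := by
    rw [hF, hF]
    push_cast
    ring
  have hmono : ‖b‖ ^ α ≤ ‖a‖ ^ α := Real.rpow_le_rpow (norm_nonneg _) hab hα.le
  have h1 := mul_rpow_sub_rpow_le hα (norm_nonneg b) hab
  have h2 : ‖a‖ - ‖b‖ ≤ ‖a - b‖ := norm_sub_norm_le a b
  have h0 : 0 ≤ ‖a‖ ^ α := Real.rpow_nonneg (norm_nonneg _) _
  have h3 : ‖a‖ ^ α ≤ (‖a‖ + ‖b‖) ^ α :=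
    Real.rpow_le_rpow (norm_nonneg _) (by linarith [norm_nonneg b]) hα.le
  calc ‖nonlin d a - nonlin d b‖ ≤ ‖a‖ ^ α * ‖a - b‖ + (‖a‖ ^ α - ‖b‖ ^ α) * ‖b‖ := by
        rw [e]
        refine (norm_add_le _ _).trans (le_of_eq ?_)
        rw [norm_mul, norm_mul, Complex.norm_real, Complex.norm_real, Real.norm_of_nonneg h0,
          Real.norm_of_nonneg (sub_nonneg.2 hmono)]
    _ ≤ ‖a‖ ^ α * ‖a - b‖ + (α + 1) * ‖a‖ ^ α * ‖a - b‖ := by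
        have h4 : (α + 1) * ‖a‖ ^ α * (‖a‖ - ‖b‖) ≤ (α + 1) * ‖a‖ ^ α * ‖a - b‖ := by gcongr
        nlinarith
    _ = (α + 2) * (‖a‖ ^ α * ‖a - b‖) := by ring
    _ ≤ _ := by gcongr

/-- The exponent `2d/(d-4)` of the potential energy. -/
def potExp (d : ℕ) : ℝ := 2 * (d : ℝ) / ((d : ℝ) - 4)

theorem potExp_eq (hd : 9 ≤ d) : potExp d = nlExp d + 2 := by
  have : (9 : ℝ) ≤ d := by exact_mod_cast hd
  have : 0 < (d : ℝ) - 4 := by linarith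
  unfold potExp nlExp
  field_simp
  ring

theorem two_lt_potExp (hd : 9 ≤ d) : 2 < potExp d := by
  rw [potExp_eq hd]
  linarith [nlExp_pos hd]

theorem potExp_lt_stExp (hd : 9 ≤ d) : potExp d < stExp d := by
  have : (9 : ℝ) ≤ d := by exact_mod_cast hd
  have : 0 < (d : ℝ) - 4 := by linarith
  unfold potExp stExp
  gcongr
  linarith

/-- The density `|z|^{2d/(d-4)} / (2d/(d-4))` of the potential energy. -/
def pot (d : ℕ) (z : ℂ) : ℝ := ‖z‖ ^ potExp d / potExp d

theorem pot_nonneg (hd : 9 ≤ d) (z : ℂ) : 0 ≤ pot d z := by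
  have := two_lt_potExp hd
  unfold pot
  positivity

theorem continuous_pot (hd : 9 ≤ d) : Continuous (pot d) := by
  have := two_lt_potExp hd
  unfold pot
  exact (continuous_norm.rpow_const fun _ => Or.inr (by linarith)).div_const _

/-- Convexity of the potential energy density, whose gradient is `F`. -/
theorem pot_add_le (hd : 9 ≤ d) (a b : ℂ) :
    pot d b + (inner ℂ (nonlin d b) (a - b)).re ≤ pot d a := by
  have hp := two_lt_potExp hd
  have hα := nlExp_pos hd
  have hpα := potExp_eq hd
  set α := nlExp d with hαd
  set p := potExp d with hpd
  have hp0 : 0 < p := by linarith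
  have hF : nonlin d b = ((‖b‖ ^ α : ℝ) : ℂ) * b := rfl
  have h1 : (inner ℂ (nonlin d b) (a - b)).re ≤ ‖b‖ ^ (p - 1) * ‖a‖ - ‖b‖ ^ p := by
    rw [inner_sub_right, Complex.sub_re]
    have h2 : (inner ℂ (nonlin d b) b).re = ‖b‖ ^ p := by
      rw [hF, ← smul_eq_mul, inner_smul_left, inner_self_eq_norm_sq_to_K, Complex.conj_ofReal]
      have : ((‖b‖ ^ α : ℝ) : ℂ) * ((‖b‖ : ℂ)) ^ 2 = ((‖b‖ ^ α * ‖b‖ ^ 2 : ℝ) : ℂ) := by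
        push_cast
        ring
      change (((‖b‖ ^ α : ℝ) : ℂ) * ((‖b‖ : ℂ)) ^ 2).re = _
      rw [this, Complex.ofReal_re, hpα, Real.rpow_add' (norm_nonneg b) (by linarith),
        Real.rpow_two]
    have h3 : (inner ℂ (nonlin d b) a).re ≤ ‖b‖ ^ (p - 1) * ‖a‖ := by
      refine (Complex.re_le_norm _).trans ((norm_inner_le_norm _ _).trans (le_of_eq ?_))
      rw [hF, norm_mul, Complex.norm_real, Real.norm_of_nonneg (by positivity), hpα,
        show α + 2 - 1 = α + 1 by ring, Real.rpow_add_one' (norm_nonneg b) (by linarith)]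
    rw [h2]
    linarith
  have hpq : Real.HolderConjugate (p / (p - 1)) p :=
    (Real.HolderConjugate.conjExponent (by linarith : 1 < p)).symm
  have h4 := Real.young_inequality_of_nonneg (Real.rpow_nonneg (norm_nonneg b) (p - 1))
    (norm_nonneg a) hpq
  rw [← Real.rpow_mul (norm_nonneg b), mul_div_cancel₀ _ (by linarith : p - 1 ≠ 0)] at h4
  unfold pot
  rw [← hpd]
  have h5 : ‖b‖ ^ p / (p / (p - 1)) = ‖b‖ ^ p - ‖b‖ ^ p / p := by
    have : p - 1 ≠ 0 := by linarith
    field_simp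
  linarith

theorem abs_inner_nonlin_sub_pot_le (hd : 9 ≤ d) (a b c : ℂ) :
    |(inner ℂ (nonlin d c) (b - a)).re - (pot d b - pot d a)|
      ≤ (‖nonlin d c - nonlin d a‖ + ‖nonlin d c - nonlin d b‖) * ‖b - a‖ := by
  have h1 := pot_add_le hd b a
  have h2 := pot_add_le hd a b
  have h3 : ∀ z, |(inner ℂ (nonlin d c) (b - a)).re - (inner ℂ (nonlin d z) (b - a)).re|
      ≤ ‖nonlin d c - nonlin d z‖ * ‖b - a‖ := by
    intro z
    rw [← Complex.sub_re, ← inner_sub_left]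
    exact (Complex.abs_re_le_norm _).trans (norm_inner_le_norm _ _)
  have h4 : (inner ℂ (nonlin d b) (a - b)).re = -(inner ℂ (nonlin d b) (b - a)).re := by
    rw [← neg_sub, inner_neg_right, Complex.neg_re]
  rw [h4] at h2
  have h5 := abs_le.1 (h3 a)
  have h6 := abs_le.1 (h3 b)
  have h7 := mul_nonneg (norm_nonneg (nonlin d c - nonlin d a)) (norm_nonneg (b - a))
  have h8 := mul_nonneg (norm_nonneg (nonlin d c - nonlin d b)) (norm_nonneg (b - a))
  rw [add_mul, abs_le]
  constructor <;> linarith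

/-- Constant in `abs_inner_nonlin_sub_pot_le'`. -/
def errConst (d : ℕ) : ℝ := 2 * (nlExp d + 2)

theorem errConst_pos (hd : 9 ≤ d) : 0 < errConst d := by
  have := nlExp_pos hd
  unfold errConst
  positivity

/-- The error of replacing `⟨F(c), b - a⟩` by the increment of the potential energy is of second
order. -/
theorem abs_inner_nonlin_sub_pot_le' (hd : 9 ≤ d) (a b c : ℂ) :
    |(inner ℂ (nonlin d c) (b - a)).re - (pot d b - pot d a)|
      ≤ 2 * errConst d * ((‖a‖ + ‖b‖ + ‖c‖) ^ nlExp d * (‖c - a‖ ^ 2 + ‖b - a‖ ^ 2)) := by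
  have hα := nlExp_pos hd
  have hC := errConst_pos hd
  set m := (‖a‖ + ‖b‖ + ‖c‖) ^ nlExp d with hm
  have hm0 : 0 ≤ m := by positivity
  have hle : ∀ z, ‖z‖ + ‖c‖ ≤ ‖a‖ + ‖b‖ + ‖c‖ →
      ‖nonlin d c - nonlin d z‖ ≤ (nlExp d + 2) * (m * ‖c - z‖) := by
    intro z hz
    refine (norm_nonlin_sub_le hd c z).trans ?_
    rw [add_comm ‖c‖]
    have : (‖z‖ + ‖c‖) ^ nlExp d ≤ m := Real.rpow_le_rpow (by positivity) hz hα.le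
    gcongr
  have h1 := hle a (by linarith [norm_nonneg b])
  have h2 := hle b (by linarith [norm_nonneg a])
  have h3 : ‖c - b‖ ≤ ‖c - a‖ + ‖b - a‖ := by
    rw [← norm_sub_rev a b]
    exact norm_sub_le_norm_sub_add_norm_sub c a b
  refine (abs_inner_nonlin_sub_pot_le hd a b c).trans ?_
  have h4 : ‖nonlin d c - nonlin d a‖ + ‖nonlin d c - nonlin d b‖
      ≤ errConst d * (m * (‖c - a‖ + ‖b - a‖)) := by
    have h5 : (nlExp d + 2) * (m * ‖c - b‖) ≤ (nlExp d + 2) * (m * (‖c - a‖ + ‖b - a‖)) := by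
      gcongr
    have h6 : (nlExp d + 2) * (m * ‖c - a‖) ≤ (nlExp d + 2) * (m * (‖c - a‖ + ‖b - a‖)) := by
      gcongr
      linarith [norm_nonneg (b - a)]
    unfold errConst
    linarith
  calc (‖nonlin d c - nonlin d a‖ + ‖nonlin d c - nonlin d b‖) * ‖b - a‖
      ≤ errConst d * (m * (‖c - a‖ + ‖b - a‖)) * ‖b - a‖ := by gcongr
    _ = errConst d * m * ((‖c - a‖ + ‖b - a‖) * ‖b - a‖) := by ring
    _ ≤ errConst d * m * (2 * (‖c - a‖ ^ 2 + ‖b - a‖ ^ 2)) := by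
        refine mul_le_mul_of_nonneg_left ?_ (by positivity)
        nlinarith [sq_nonneg (‖c - a‖ - ‖b - a‖), sq_nonneg ‖c - a‖]
    _ = _ := by ring

/-! ### Integrals over slabs of space-time -/

/-- Lebesgue measure on `s × ℝ^d`. -/
def slab (s : Set ℝ) : Measure (ℝ × Space d) := (volume.restrict s).prod volume

theorem lintegral_slab {f : ℝ × Space d → ℝ≥0∞} (hf : Measurable f) (s : Set ℝ) :
    ∫⁻ z, f z ∂slab s = ∫⁻ t in s, ∫⁻ x, f (t, x) :=
  lintegral_prod _ hf.aemeasurable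

theorem slab_mono {s t : Set ℝ} (h : s ⊆ t) : slab (d := d) s ≤ slab t :=
  Measure.prod_mono (Measure.restrict_mono h le_rfl) le_rfl

theorem lintegral_slab_mono {s t : Set ℝ} (h : s ⊆ t) (f : ℝ × Space d → ℝ≥0∞) :
    ∫⁻ z, f z ∂slab s ≤ ∫⁻ z, f z ∂slab t :=
  lintegral_mono' (slab_mono h) le_rfl

/-- Translation in time. -/
def timeShift (h : ℝ) (z : ℝ × Space d) : ℝ × Space d := (z.1 + h, z.2)

theorem measurable_timeShift (h : ℝ) : Measurable (timeShift (d := d) h) := by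
  unfold timeShift
  fun_prop

theorem lintegral_slab_timeShift {f : ℝ × Space d → ℝ≥0∞} (hf : Measurable f) (a b h : ℝ) :
    ∫⁻ z, f (timeShift h z) ∂slab (Ioc a b) = ∫⁻ z, f z ∂slab (Ioc (a + h) (b + h)) := by
  have hc : Measurable fun z => f (timeShift h z) := hf.comp (measurable_timeShift h)
  rw [lintegral_slab hc, lintegral_slab hf]
  have hmp : MeasurePreserving (fun t : ℝ => t + h) volume volume :=
    measurePreserving_add_right volume h
  have := hmp.setLIntegral_comp_preimage (s := Ioc (a + h) (b + h)) measurableSet_Ioc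
    (hf.lintegral_prod_right' (ν := (volume : Measure (Space d))))
  rw [← this]
  simp [timeShift]

theorem ae_add_right {P : ℝ → Prop} (hP : ∀ᵐ t, P t) (h : ℝ) : ∀ᵐ t, P (t + h) :=
  (measurePreserving_add_right volume h).quasiMeasurePreserving.ae hP

theorem mixed_indicator {p : ℝ} (hp : 0 < p) {s : Set ℝ} (hs : MeasurableSet s)
    {f : ℝ × Space d → ℂ} (hf : Measurable f) :
    mixed p ((s ×ˢ univ).indicator f) = ∫⁻ z, ‖f z‖ₑ ^ p ∂slab s := by
  rw [lintegral_slab (hf.enorm.pow_const p), ← lintegral_indicator hs, mixed]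
  refine lintegral_congr fun t => ?_
  by_cases ht : t ∈ s
  · rw [indicator_of_mem ht]
    refine lintegral_congr fun x => ?_
    have hmem : (t, x) ∈ s ×ˢ (univ : Set (Space d)) := ⟨ht, mem_univ _⟩
    rw [indicator_of_mem hmem]
  · rw [indicator_of_notMem ht]
    refine (lintegral_congr fun x => ?_).trans lintegral_zero
    have hmem : (t, x) ∉ s ×ˢ (univ : Set (Space d)) := fun h => ht h.1
    rw [indicator_of_notMem hmem, enorm_zero, ENNReal.zero_rpow_of_pos hp]

/-- Hölder's inequality in the form used for products of `|u|^α` with an increment. -/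
theorem lintegral_mul_rpow_le {X : Type*} [MeasurableSpace X] {μ : Measure X} {m w : X → ℝ≥0∞}
    (hm : Measurable m) (hw : Measurable w) {k e q r : ℝ} (hq : 0 < q) (hr : 0 < r) (hk : 0 ≤ k)
    (he : 0 ≤ e) (hsum : k / q + e / r = 1) :
    ∫⁻ x, m x ^ k * w x ^ e ∂μ ≤ (∫⁻ x, m x ^ q ∂μ) ^ (k / q) * (∫⁻ x, w x ^ r ∂μ) ^ (e / r) := by
  have := ENNReal.lintegral_mul_norm_pow_le (μ := μ) (hm.pow_const q).aemeasurable
    (hw.pow_const r).aemeasurable (p := k / q) (q := e / r) (by positivity) (by positivity) hsum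
  refine le_trans (le_of_eq (lintegral_congr fun x => ?_)) this
  rw [← ENNReal.rpow_mul, ← ENNReal.rpow_mul, mul_div_cancel₀ _ hq.ne', mul_div_cancel₀ _ hr.ne']

theorem ennreal_rpow_le_add {e q : ℝ} (h2 : 2 ≤ e) (hq : e ≤ q) (y : ℝ≥0∞) :
    y ^ e ≤ y ^ (2 : ℝ) + y ^ q := by
  rcases le_total y 1 with h | h
  · exact (ENNReal.rpow_le_rpow_of_exponent_ge h h2).trans le_self_add
  · exact (ENNReal.rpow_le_rpow_of_exponent_le h hq).trans le_add_self

/-! ### Strichartz bounds for the increments -/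

/-- The Strichartz exponent `2(d+4)/d`. -/
def strExp (d : ℕ) : ℝ := 2 * ((d : ℝ) + 4) / d

/-- A positive constant for the Strichartz estimate in dimension `d`. -/
def strC (d : ℕ) : ℝ := 1 + |strichartzConst d|

theorem strC_pos : 0 < strC d := by
  unfold strC
  positivity

theorem strExp_facts (hd : 9 ≤ d) : 2 < strExp d ∧ 2 * (strExp d - 1) ≤ stExp d ∧
    strExp d ≤ stExp d ∧ 1 / dualExp d + 1 / strExp d = 1 ∧
    (strExp d - 1) * dualExp d = strExp d ∧ nlExp d = stExp d * (4 / ((d : ℝ) + 4)) ∧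
    1 / dualExp d = 4 / ((d : ℝ) + 4) + 1 / strExp d ∧
    4 / ((d : ℝ) + 4) + 2 / strExp d = 1 := by
  have h9 : (9 : ℝ) ≤ d := by exact_mod_cast hd
  have h4 : 0 < (d : ℝ) - 4 := by linarith
  have h0 : 0 < (d : ℝ) := by linarith
  unfold strExp stExp dualExp nlExp
  refine ⟨?_, ?_, ?_, ?_, ?_, ?_, ?_, ?_⟩
  · rw [lt_div_iff₀ h0]
    linarith
  · have e : 2 * (2 * ((d : ℝ) + 4) / d - 1) = 2 * ((d : ℝ) + 8) / d := by
      field_simp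
      ring
    rw [e, div_le_div_iff₀ h0 h4]
    nlinarith
  · gcongr
    linarith
  · field_simp
    ring
  · field_simp
    ring
  · field_simp
    ring
  · field_simp
    ring
  · field_simp
    ring

theorem dualExp_pos' (hd : 9 ≤ d) : 0 < dualExp d := by
  linarith [one_lt_dualExp (by omega : 3 ≤ d)]

/-- The increment `v(t + h, x) - v(t, x)`. -/
def diffFn (v : ℝ × Space d → ℂ) (h : ℝ) (z : ℝ × Space d) : ℂ := v (timeShift h z) - v z

theorem measurable_diffFn {v : ℝ × Space d → ℂ} (hv : Measurable v) (h : ℝ) :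
    Measurable (diffFn v h) := (hv.comp (measurable_timeShift h)).sub hv

namespace IsL2Solution

variable {u : ℝ → Space d → ℂ} {v : ℝ × Space d → ℂ} {U : ℝ → 𝓢'(Space d, ℂ)} {D : ℝ → L2 d}

theorem lintegral_slab_lt_top (hs : IsL2Solution u v U D) (a b : ℝ) :
    ∫⁻ z, ‖v z‖ₑ ^ stExp d ∂slab (Ioc a b) < ∞ := by
  rw [lintegral_slab (hs.measurable.enorm.pow_const _)]
  exact hs.lq a b

theorem incr_ae_eq_diffFn (hs : IsL2Solution u v U D) (hd : 9 ≤ d) (h : ℝ) :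
    ∀ᵐ t, incr v D t (t + h) =ᵐ[volume] fun x => diffFn v h (t, x) := by
  filter_upwards [hs.ae_eq, ae_add_right hs.ae_eq h] with t h1 h2
  filter_upwards [hs.incr_ae_eq hd t (t + h), h1, h2] with x h3 h4 h5
  rw [h3, h4, h5]
  rfl

theorem lintegral_diffFn_stExp_lt_top (hs : IsL2Solution u v U D) (hd : 9 ≤ d) (h a b : ℝ) :
    ∫⁻ z, ‖diffFn v h z‖ₑ ^ stExp d ∂slab (Ioc a b) < ∞ := by
  have hq := stExp_pos hd
  have hq1 : 1 ≤ stExp d := by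
    obtain ⟨h1, -, h3, -⟩ := strExp_facts hd
    linarith
  have hm := hs.measurable.enorm.pow_const (stExp d)
  have h1 : ∫⁻ z, ‖diffFn v h z‖ₑ ^ stExp d ∂slab (Ioc a b)
      ≤ ∫⁻ z, 2 ^ (stExp d - 1) * (‖v (timeShift h z)‖ₑ ^ stExp d + ‖v z‖ₑ ^ stExp d)
        ∂slab (Ioc a b) := by
    refine lintegral_mono fun z => ?_
    refine (ENNReal.rpow_le_rpow enorm_sub_le hq.le).trans ?_
    exact ENNReal.rpow_add_le_mul_rpow_add_rpow _ _ hq1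
  refine h1.trans_lt ?_
  have hms : Measurable fun z => ‖v (timeShift h z)‖ₑ ^ stExp d :=
    hm.comp (measurable_timeShift h)
  rw [lintegral_const_mul _ (show Measurable fun z => _ + _ from hms.add hm),
    lintegral_add_right _ hm, lintegral_slab_timeShift hm]
  refine ENNReal.mul_lt_top ?_ (ENNReal.add_lt_top.2
    ⟨hs.lintegral_slab_lt_top _ _, hs.lintegral_slab_lt_top _ _⟩)
  exact ENNReal.rpow_lt_top_of_nonneg (by linarith) (by simp)

theorem lintegral_diffFn_two_lt_top (hs : IsL2Solution u v U D) (hd : 9 ≤ d) (h a b : ℝ) :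
    ∫⁻ z, ‖diffFn v h z‖ₑ ^ (2 : ℝ) ∂slab (Ioc a b) < ∞ := by
  rw [lintegral_slab ((measurable_diffFn hs.measurable h).enorm.pow_const _)]
  obtain ⟨M, hM⟩ := isCompact_Icc.exists_bound_of_continuousOn (s := Icc a b)
    (hs.continuous_incr_shift hd h).continuousOn
  have h1 : ∫⁻ t in Ioc a b, ∫⁻ x, ‖diffFn v h (t, x)‖ₑ ^ (2 : ℝ)
      ≤ ∫⁻ _ in Ioc a b, ENNReal.ofReal M ^ (2 : ℝ) := by
    refine lintegral_mono_ae ?_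
    filter_upwards [ae_restrict_mem measurableSet_Ioc,
      ae_restrict_of_ae (hs.incr_ae_eq_diffFn hd h)] with t ht h2
    have h3 : ∫⁻ x, ‖diffFn v h (t, x)‖ₑ ^ (2 : ℝ) = ‖incr v D t (t + h)‖ₑ ^ (2 : ℝ) := by
      rw [enorm_L2_eq, ← ENNReal.rpow_mul]
      norm_num
      refine lintegral_congr_ae ?_
      filter_upwards [h2] with x hx
      rw [hx]
    rw [h3, ← ofReal_norm]
    gcongr
    exact hM t (Ioc_subset_Icc_self ht)
  refine h1.trans_lt ?_
  rw [lintegral_const]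
  refine ENNReal.mul_lt_top (ENNReal.rpow_lt_top_of_nonneg (by norm_num) ENNReal.ofReal_ne_top) ?_
  simp

theorem lintegral_diffFn_lt_top (hs : IsL2Solution u v U D) (hd : 9 ≤ d) (h a b : ℝ) {e : ℝ}
    (h2 : 2 ≤ e) (hq : e ≤ stExp d) : ∫⁻ z, ‖diffFn v h z‖ₑ ^ e ∂slab (Ioc a b) < ∞ := by
  have hm := (measurable_diffFn hs.measurable h).enorm
  refine (lintegral_mono fun z => ennreal_rpow_le_add h2 hq _).trans_lt ?_
  rw [lintegral_add_right _ (hm.pow_const _)]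
  exact ENNReal.add_lt_top.2 ⟨hs.lintegral_diffFn_two_lt_top hd h a b,
    hs.lintegral_diffFn_stExp_lt_top hd h a b⟩

/-- On time intervals on which the space-time norm of the solution is small, the Strichartz norm of
an increment is controlled by its initial value: the nonlinear term is absorbed. -/
theorem lintegral_diffFn_le (hs : IsL2Solution u v U D) (hd : 9 ≤ d) {a b h : ℝ}
    (hsmall : ENNReal.ofReal (nlExp d + 2) * (∫⁻ z, (‖v (timeShift h z)‖ₑ + ‖v z‖ₑ) ^ stExp d
      ∂slab (Ioc a b)) ^ (4 / ((d : ℝ) + 4)) ≤ ENNReal.ofReal (1 / (2 * strC d))) :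
    ∫⁻ z, ‖diffFn v h z‖ₑ ^ strExp d ∂slab (Ioc a b)
      ≤ ENNReal.ofReal ((2 * strC d * ‖incr v D a (a + h)‖) ^ strExp d) := by
  obtain ⟨f1, f2, f3, f4, f5, f6, f7, -⟩ := strExp_facts hd
  have hv := hs.measurable
  have hp := dualExp_pos' hd
  have hα := nlExp_pos hd
  have hq := stExp_pos hd
  have hK := strC_pos (d := d)
  set K := strC d with hKd
  set p := dualExp d with hpd
  set e := strExp d with hed
  have he : 0 < e := by linarith
  set w := diffFn v h with hwd
  have hwm : Measurable w := measurable_diffFn hv h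
  set X := ∫⁻ z, ‖w z‖ₑ ^ e ∂slab (Ioc a b) with hX
  have hXfin : X < ∞ := hs.lintegral_diffFn_lt_top hd h a b f1.le f3
  rcases eq_or_ne X 0 with hX0 | hX0
  · rw [hX0]
    exact zero_le
  have hXr : 0 < X.toReal := ENNReal.toReal_pos hX0 hXfin.ne
  set Y := X.toReal ^ (1 / e) with hY
  have hYpos : 0 < Y := Real.rpow_pos_of_pos hXr _
  set A := X.toReal ^ (1 / p) with hA
  have hApos : 0 < A := Real.rpow_pos_of_pos hXr _
  have hAp : ENNReal.ofReal (A ^ p) = X := by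
    rw [hA, ← Real.rpow_mul hXr.le, one_div, inv_mul_cancel₀ hp.ne', Real.rpow_one,
      ENNReal.ofReal_toReal hXfin.ne]
  have hYe : ENNReal.ofReal (Y ^ e) = X := by
    rw [hY, ← Real.rpow_mul hXr.le, one_div, inv_mul_cancel₀ he.ne', Real.rpow_one,
      ENNReal.ofReal_toReal hXfin.ne]
  have hAY : A * Y = X.toReal := by
    rw [hA, hY, ← Real.rpow_add hXr, f4, Real.rpow_one]
  set B := Y / (2 * K) with hB
  have hBpos : 0 < B := by positivity
  -- the test function dual to the increment, and the increment of the nonlinearity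
  set g₀ : ℝ × Space d → ℂ := fun z => ((‖w z‖ ^ (e - 2) : ℝ) : ℂ) * w z with hg₀
  have hg₀m : Measurable g₀ :=
    (Complex.measurable_ofReal.comp (hwm.norm.pow_const _)).mul hwm
  have hg₀n : ∀ z, ‖g₀ z‖ₑ = ‖w z‖ₑ ^ (e - 1) := by
    intro z
    rw [← ofReal_norm, ← ofReal_norm, ENNReal.ofReal_rpow_of_nonneg (norm_nonneg _) (by linarith),
      hg₀, norm_mul, Complex.norm_real, Real.norm_of_nonneg (by positivity),
      show e - 1 = (e - 2) + 1 by ring, Real.rpow_add_one' (norm_nonneg _) (by linarith)]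
  set φ₀ : ℝ × Space d → ℂ := fun z => nonlin d (v (timeShift h z)) - nonlin d (v z) with hφ₀
  have hFm : Measurable fun z => nonlin d (v z) := measurable_nonlin.comp hv
  have hφ₀m : Measurable φ₀ := (hFm.comp (measurable_timeShift h)).sub hFm
  have hI : MeasurableSet (Ioc a b) := measurableSet_Ioc
  have hIu : MeasurableSet (Ioc a b ×ˢ (univ : Set (Space d))) := hI.prod MeasurableSet.univ
  set g := (Ioc a b ×ˢ univ).indicator g₀ with hg
  set φ := (Ioc a b ×ˢ univ).indicator φ₀ with hφ
  have hgm : Measurable g := hg₀m.indicator hIu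
  have hφm : Measurable φ := hφ₀m.indicator hIu
  have hgp : mixed p g ≤ ENNReal.ofReal (A ^ p) := by
    rw [hg, mixed_indicator hp hI hg₀m, hAp, hX]
    refine le_of_eq (lintegral_congr fun z => ?_)
    rw [hg₀n, ← ENNReal.rpow_mul, f5]
  have hg2 : mixed 2 g < ∞ := by
    rw [hg, mixed_indicator two_pos hI hg₀m]
    have : ∀ z, ‖g₀ z‖ₑ ^ (2 : ℝ) = ‖w z‖ₑ ^ (2 * (e - 1)) := fun z => by
      rw [hg₀n, ← ENNReal.rpow_mul, mul_comm]
    simp only [this]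
    exact hs.lintegral_diffFn_lt_top hd h a b (by linarith) f2
  have hφ2 : mixed 2 φ < ∞ := by
    rw [hφ, mixed_indicator two_pos hI hφ₀m]
    have hm := hs.measurable.enorm.pow_const (stExp d)
    have h1 : ∀ z, ‖φ₀ z‖ₑ ^ (2 : ℝ)
        ≤ 2 ^ ((2 : ℝ) - 1) * (‖v (timeShift h z)‖ₑ ^ stExp d + ‖v z‖ₑ ^ stExp d) := by
      intro z
      rw [← enorm_nonlin_rpow hd, ← enorm_nonlin_rpow hd]
      refine (ENNReal.rpow_le_rpow enorm_sub_le two_pos.le).trans ?_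
      exact ENNReal.rpow_add_le_mul_rpow_add_rpow _ _ one_le_two
    refine (lintegral_mono h1).trans_lt ?_
    have hms : Measurable fun z => ‖v (timeShift h z)‖ₑ ^ stExp d :=
      hm.comp (measurable_timeShift h)
    rw [lintegral_const_mul _ (show Measurable fun z => _ + _ from hms.add hm),
      lintegral_add_right _ hm, lintegral_slab_timeShift hm]
    refine ENNReal.mul_lt_top ?_ (ENNReal.add_lt_top.2
      ⟨hs.lintegral_slab_lt_top _ _, hs.lintegral_slab_lt_top _ _⟩)
    exact ENNReal.rpow_lt_top_of_nonneg (by norm_num) (by simp)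
  have hφp : mixed p φ ≤ ENNReal.ofReal (B ^ p) := by
    rw [hφ, mixed_indicator hp hI hφ₀m]
    set m : ℝ × Space d → ℝ≥0∞ := fun z => ‖v (timeShift h z)‖ₑ + ‖v z‖ₑ with hm
    have hmm : Measurable m := (hv.comp (measurable_timeShift h)).enorm.add hv.enorm
    set c := ENNReal.ofReal (nlExp d + 2) with hc
    have h1 : ∀ z, ‖φ₀ z‖ₑ ^ p ≤ c ^ p * (m z ^ (nlExp d * p) * ‖w z‖ₑ ^ p) := by
      intro z
      have h2 : ‖φ₀ z‖ₑ ≤ c * (m z ^ nlExp d * ‖w z‖ₑ) := by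
        have := ENNReal.ofReal_le_ofReal (norm_nonlin_sub_le hd (v (timeShift h z)) (v z))
        rw [ofReal_norm, ENNReal.ofReal_mul (by linarith), ENNReal.ofReal_mul (by positivity),
          ← ENNReal.ofReal_rpow_of_nonneg (by positivity) hα.le,
          ENNReal.ofReal_add (norm_nonneg _) (norm_nonneg _), ofReal_norm, ofReal_norm,
          ofReal_norm] at this
        exact this
      refine (ENNReal.rpow_le_rpow h2 hp.le).trans (le_of_eq ?_)
      rw [ENNReal.mul_rpow_of_nonneg _ _ hp.le, ENNReal.mul_rpow_of_nonneg _ _ hp.le,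
        ← ENNReal.rpow_mul]
    have hk : nlExp d * p / stExp d = 4 / ((d : ℝ) + 4) * p := by
      rw [f6]
      field_simp
    have hsum : nlExp d * p / stExp d + p / e = 1 := by
      rw [hk]
      have := congrArg (fun y => y * p) f7
      simp only [one_div, inv_mul_cancel₀ hp.ne'] at this
      rw [this, div_eq_mul_inv p e]
      ring
    refine (lintegral_mono h1).trans ?_
    have hmw : Measurable fun z => m z ^ (nlExp d * p) * ‖w z‖ₑ ^ p :=
      (hmm.pow_const _).mul (hwm.enorm.pow_const _)
    rw [lintegral_const_mul _ hmw]
    refine (mul_le_mul_right (lintegral_mul_rpow_le hmm hwm.enorm hq he (by positivity) hp.le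
      hsum) _).trans ?_
    rw [← hX, hk, ENNReal.rpow_mul, show p / e = 1 / e * p by ring, ENNReal.rpow_mul,
      ← ENNReal.mul_rpow_of_nonneg _ _ hp.le, ← ENNReal.mul_rpow_of_nonneg _ _ hp.le,
      ← ENNReal.ofReal_rpow_of_nonneg hBpos.le hp.le]
    refine ENNReal.rpow_le_rpow ?_ hp.le
    rw [← mul_assoc]
    have hXY : X ^ (1 / e) = ENNReal.ofReal Y := by
      rw [hY, ← ENNReal.ofReal_rpow_of_nonneg hXr.le (by positivity),
        ENNReal.ofReal_toReal hXfin.ne]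
    rw [hXY, hB, show Y / (2 * K) = 1 / (2 * K) * Y by ring, ENNReal.ofReal_mul (by positivity)]
    gcongr
  -- the equation for the increment
  have hslice : ∀ᵐ τ, slice φ₀ τ = forcing v (τ + h) - forcing v τ := by
    have hae := ae_lintegral_stExp_lt_top hv hs.lq
    filter_upwards [hae, ae_add_right hae h] with τ h1 h2
    have k1 := forcing_ae_eq hd hv h1
    have k2 := forcing_ae_eq hd hv h2
    have k3 : (fun x => φ₀ (τ, x)) =ᵐ[volume]
        ((forcing v (τ + h) - forcing v τ : L2 d) : Space d → ℂ) := by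
      filter_upwards [k1, k2, Lp.coeFn_sub (forcing v (τ + h)) (forcing v τ)] with x j1 j2 j3
      rw [j3, Pi.sub_apply, j1, j2]
      rfl
    have k4 : MemLp (fun x => φ₀ (τ, x)) 2 :=
      (memLp_congr_ae k3).2 (Lp.memLp (forcing v (τ + h) - forcing v τ))
    exact Lp.ext ((slice_ae_eq k4).trans k3)
  have hind : ∀ (f : ℝ × Space d → ℂ) t, t ∈ Ioc a b →
      slice ((Ioc a b ×ˢ univ).indicator f) t = slice f t := by
    intro f t ht
    have : (fun x => (Ioc a b ×ˢ univ).indicator f (t, x)) = fun x => f (t, x) :=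
      funext fun x => by
        have hmem : (t, x) ∈ Ioc a b ×ˢ (univ : Set (Space d)) := ⟨ht, mem_univ _⟩
        rw [indicator_of_mem hmem]
    unfold slice
    rw [this]
  have heq : ∀ t ∈ Ioc a b, incr v D t (t + h) = flow (t - a) (incr v D a (a + h)) +
      Complex.I • ∫ τ in Ioc a t, flow (t - τ) (slice φ τ) := by
    intro t ht
    rw [hs.incr_shift hd a t h, duhamelInt, intervalIntegral.integral_of_le ht.1.le]
    congr 2
    refine integral_congr_ae ?_
    filter_upwards [ae_restrict_mem measurableSet_Ioc, ae_restrict_of_ae hslice] with τ h1 h2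
    rw [hφ, hind φ₀ τ ⟨h1.1, h1.2.trans ht.2⟩, h2]
  have hstr := norm_integral_inner_le_strichartz (by omega : 3 ≤ d) hgm hφm hg2 hφ2 hApos hBpos
    hgp hφp (hs.continuous_incr_shift hd h) heq
  -- the left-hand side is the Strichartz norm itself
  have hlhs : ∫ t in Ioc a b, inner ℂ (slice g t) (incr v D t (t + h)) = ((X.toReal : ℝ) : ℂ) := by
    have hXi : X = ∫⁻ t in Ioc a b, ∫⁻ x, ‖w (t, x)‖ₑ ^ e := lintegral_slab (hwm.enorm.pow_const _) _
    have hmeas := measurable_lintegral_slice hwm e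
    have hfin : ∀ᵐ t ∂volume.restrict (Ioc a b), ∫⁻ x, ‖w (t, x)‖ₑ ^ e < ∞ :=
      ae_lt_top hmeas (hXi ▸ hXfin.ne)
    have h1 : ∀ᵐ t ∂volume.restrict (Ioc a b), inner ℂ (slice g t) (incr v D t (t + h))
        = (((∫⁻ x, ‖w (t, x)‖ₑ ^ e).toReal : ℝ) : ℂ) := by
      filter_upwards [ae_restrict_mem measurableSet_Ioc,
        ae_restrict_of_ae (hs.incr_ae_eq_diffFn hd h),
        ae_restrict_of_ae (ae_memLp_two_slice hgm hg2)] with t ht h2 h3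
      have h4 : ∀ᵐ x, inner ℂ (slice g t x) (incr v D t (t + h) x)
          = ((‖w (t, x)‖ ^ e : ℝ) : ℂ) := by
        filter_upwards [slice_ae_eq h3, h2] with x h5 h6
        have hmem : (t, x) ∈ Ioc a b ×ˢ (univ : Set (Space d)) := ⟨ht, mem_univ _⟩
        rw [h5, h6, hg, indicator_of_mem hmem, hg₀, ← hwd]
        simp only [RCLike.inner_apply, map_mul, Complex.conj_ofReal]
        have h7 : ‖w (t, x)‖ ^ e = ‖w (t, x)‖ ^ (e - 2) * ‖w (t, x)‖ ^ 2 := by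
          rw [← Real.rpow_natCast, ← Real.rpow_add' (norm_nonneg _) (by push_cast; linarith)]
          congr 1
          push_cast
          ring
        rw [h7, mul_comm, mul_assoc, Complex.conj_mul']
        push_cast
        ring
      have hwt : Measurable fun x => w (t, x) := hwm.comp measurable_prodMk_left
      have hwe : AEStronglyMeasurable (fun x => ‖w (t, x)‖ ^ e) volume :=
        (hwt.norm.pow_const e).aestronglyMeasurable
      rw [L2.inner_def, integral_congr_ae h4, integral_complex_ofReal,
        integral_eq_lintegral_of_nonneg_ae (ae_of_all _ fun x => by positivity) hwe]
      refine congrArg (fun y : ℝ≥0∞ => ((y.toReal : ℝ) : ℂ)) (lintegral_congr fun x => ?_)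
      rw [← ENNReal.ofReal_rpow_of_nonneg (norm_nonneg _) he.le, ofReal_norm]
    rw [integral_congr_ae h1, integral_complex_ofReal, integral_toReal hmeas.aemeasurable hfin, ← hXi]
  rw [hlhs, Complex.norm_real, Real.norm_of_nonneg hXr.le, ← hAY] at hstr
  have h5 : Y ≤ K * (‖incr v D a (a + h)‖ + B) := by
    refine le_of_mul_le_mul_left ?_ hApos
    refine hstr.trans (le_of_eq ?_)
    rw [hKd, strC]
    ring
  have h6 : K * B = Y / 2 := by
    rw [hB]
    field_simp
  have h7 : Y ≤ 2 * K * ‖incr v D a (a + h)‖ := by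
    rw [mul_add, h6] at h5
    linarith
  rw [← hYe]
  exact ENNReal.ofReal_le_ofReal (Real.rpow_le_rpow hYpos.le h7 he.le)

theorem lintegral_add_timeShift_le (hs : IsL2Solution u v U D) (hd : 9 ≤ d) {a b h c e : ℝ}
    (hh : 0 ≤ h) (hca : c ≤ a) (hbe : b + h ≤ e) :
    ∫⁻ z, (‖v (timeShift h z)‖ₑ + ‖v z‖ₑ) ^ stExp d ∂slab (Ioc a b)
      ≤ 2 ^ (stExp d - 1) * (2 * ∫⁻ t in Ioc c e, ∫⁻ x, ‖v (t, x)‖ₑ ^ stExp d) := by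
  have hq1 : 1 ≤ stExp d := by
    obtain ⟨h1, -, h3, -⟩ := strExp_facts hd
    linarith
  have hm := hs.measurable.enorm.pow_const (stExp d)
  refine (lintegral_mono fun z => ENNReal.rpow_add_le_mul_rpow_add_rpow _ _ hq1).trans ?_
  have hms : Measurable fun z => ‖v (timeShift h z)‖ₑ ^ stExp d :=
    hm.comp (measurable_timeShift h)
  rw [lintegral_const_mul _ (show Measurable fun z => _ + _ from hms.add hm),
    lintegral_add_right _ hm, lintegral_slab_timeShift hm, ← lintegral_slab hm, two_mul]
  gcongr
  · exact slab_mono (Ioc_subset_Ioc (by linarith) hbe)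
  · exact slab_mono (Ioc_subset_Ioc hca (by linarith))

theorem exists_lintegral_diffFn_le (hs : IsL2Solution u v U D) (hd : 9 ≤ d) (t : ℝ) :
    ∃ δ > 0, ∀ h ∈ Ioo 0 δ, ∫⁻ z, ‖diffFn v h z‖ₑ ^ strExp d ∂slab (Ioc (t - δ) (t + δ))
      ≤ ENNReal.ofReal ((2 * strC d * ‖incr v D (t - δ) (t - δ + h)‖) ^ strExp d) := by
  have hK := strC_pos (d := d)
  have h9 : (9 : ℝ) ≤ d := by exact_mod_cast hd
  have hq1 : 1 ≤ stExp d := by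
    obtain ⟨h1, -, h3, -⟩ := strExp_facts hd
    linarith
  set f : ℝ → ℝ≥0∞ := fun τ => ∫⁻ x, ‖v (τ, x)‖ₑ ^ stExp d with hf
  set μ := volume.restrict (Ioc (t - 1) (t + 2)) with hμ
  have h1 : Tendsto (fun δ : ℝ => ∫⁻ τ in Ioc (t - δ) (t + 2 * δ), f τ ∂μ) (𝓝[>] 0) (𝓝 0) := by
    refine tendsto_setLIntegral_zero (hs.lq _ _).ne ?_
    have h2 : Tendsto (fun δ : ℝ => ENNReal.ofReal (3 * δ)) (𝓝[>] 0) (𝓝 0) := by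
      have : Tendsto (fun δ : ℝ => ENNReal.ofReal (3 * δ)) (𝓝 0) (𝓝 (ENNReal.ofReal (3 * 0))) :=
        (ENNReal.continuous_ofReal.comp (continuous_const.mul continuous_id)).tendsto 0
      simp only [mul_zero, ENNReal.ofReal_zero] at this
      exact this.mono_left nhdsWithin_le_nhds
    refine tendsto_of_tendsto_of_tendsto_of_le_of_le tendsto_const_nhds h2 (fun _ => zero_le)
      fun δ => ?_
    refine (Measure.restrict_apply_le _ _).trans (le_of_eq ?_)
    rw [Real.volume_Ioc]
    congr 1
    ring
  have h3 : Tendsto (fun y : ℝ≥0∞ => ENNReal.ofReal (nlExp d + 2) *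
      (2 ^ (stExp d - 1) * (2 * y)) ^ (4 / ((d : ℝ) + 4))) (𝓝 0) (𝓝 0) := by
    have h4 : Tendsto (fun y : ℝ≥0∞ => 2 ^ (stExp d - 1) * (2 * y)) (𝓝 0) (𝓝 0) := by
      have := ENNReal.Tendsto.const_mul (a := 2 ^ (stExp d - 1))
        (ENNReal.Tendsto.const_mul (a := 2) (tendsto_id (x := 𝓝 (0 : ℝ≥0∞))) (Or.inr (by simp)))
        (Or.inr (ENNReal.rpow_ne_top_of_nonneg (by linarith) (by simp)))
      simpa using this
    have h5 := (ENNReal.continuous_rpow_const (y := 4 / ((d : ℝ) + 4))).tendsto 0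
    rw [ENNReal.zero_rpow_of_pos (by positivity)] at h5
    have := ENNReal.Tendsto.const_mul (a := ENNReal.ofReal (nlExp d + 2)) (h5.comp h4)
      (Or.inr ENNReal.ofReal_ne_top)
    simpa using this
  have h6 := (h3.comp h1).eventually (ge_mem_nhds
    (show (0 : ℝ≥0∞) < ENNReal.ofReal (1 / (2 * strC d)) by
      rw [ENNReal.ofReal_pos]
      positivity))
  have h7 : ∀ᶠ δ : ℝ in 𝓝[>] 0, δ ∈ Ioo (0 : ℝ) 1 := Ioo_mem_nhdsGT one_pos
  obtain ⟨δ, h8, h9', h10⟩ := (h6.and h7).exists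
  refine ⟨δ, h9', fun h hh => hs.lintegral_diffFn_le hd (le_trans ?_ h8)⟩
  simp only [Function.comp_apply]
  rw [hμ, Measure.restrict_restrict measurableSet_Ioc,
    inter_eq_left.2 (Ioc_subset_Ioc (by linarith) (by linarith))]
  gcongr
  exact hs.lintegral_add_timeShift_le hd hh.1.le le_rfl (by linarith [hh.2])

/-- The Strichartz norm of the increment over a time step `h` is `o(√h)` on compact time
intervals. -/
theorem eventually_lintegral_diffFn_le (hs : IsL2Solution u v U D) (hd : 9 ≤ d) (a b : ℝ) :
    ∀ ε > 0, ∀ᶠ h : ℝ in 𝓝[>] 0, ∫⁻ z, ‖diffFn v h z‖ₑ ^ strExp d ∂slab (Icc a b)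
      ≤ ENNReal.ofReal (ε * √h ^ strExp d) := by
  have hK := strC_pos (d := d)
  have he : 0 < strExp d := by linarith [(strExp_facts hd).1]
  have hmeas : ∀ h, Measurable fun z => ‖diffFn v h z‖ₑ ^ strExp d := fun h =>
    (measurable_diffFn hs.measurable h).enorm.pow_const _
  refine isCompact_Icc.induction_on (p := fun s : Set ℝ => ∀ ε > 0, ∀ᶠ h : ℝ in 𝓝[>] 0,
    ∫⁻ z, ‖diffFn v h z‖ₑ ^ strExp d ∂slab s ≤ ENNReal.ofReal (ε * √h ^ strExp d)) ?_ ?_ ?_ ?_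
  · intro ε _
    refine Eventually.of_forall fun h => ?_
    simp [slab]
  · intro s t hst ht ε hε
    filter_upwards [ht ε hε] with h hh
    exact (lintegral_slab_mono hst _).trans hh
  · intro s t h1 h2 ε hε
    filter_upwards [h1 (ε / 2) (half_pos hε), h2 (ε / 2) (half_pos hε)] with h k1 k2
    rw [lintegral_slab (hmeas h)] at k1 k2 ⊢
    refine (lintegral_union_le _ _ _).trans ((add_le_add k1 k2).trans (le_of_eq ?_))
    rw [← ENNReal.ofReal_add (by positivity) (by positivity)]
    congr 1
    ring
  · intro t _
    obtain ⟨δ, hδ, h1⟩ := hs.exists_lintegral_diffFn_le hd t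
    refine ⟨Ioc (t - δ) (t + δ), mem_nhdsWithin_of_mem_nhds
      (Ioc_mem_nhds (by linarith) (by linarith)), fun ε hε => ?_⟩
    have h2 : 0 < ε ^ (1 / strExp d) / (2 * strC d) := by positivity
    filter_upwards [Ioo_mem_nhdsGT hδ,
      (hs.tendsto_norm_incr_div hd (t - δ)).eventually (ge_mem_nhds h2)] with h hh h3
    refine (h1 h hh).trans (ENNReal.ofReal_le_ofReal ?_)
    have hsq : 0 < √h := Real.sqrt_pos.2 hh.1
    rw [div_le_div_iff₀ hsq (by positivity)] at h3
    have h4 : 2 * strC d * ‖incr v D (t - δ) (t - δ + h)‖ ≤ ε ^ (1 / strExp d) * √h := by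
      linarith
    refine (Real.rpow_le_rpow (by positivity) h4 he.le).trans (le_of_eq ?_)
    rw [Real.mul_rpow (by positivity) hsq.le, ← Real.rpow_mul hε.le, one_div,
      inv_mul_cancel₀ he.ne', Real.rpow_one]

end IsL2Solution

/-! ### Boundedness of the energy -/

theorem ennreal_rpow_le_split {p q : ℝ} (hp : 2 ≤ p) (hpq : p ≤ q) {y a w : ℝ≥0∞}
    (h : y ≤ a + w) : y ^ p ≤ 2 ^ p * a ^ p + (y ^ q + 4 * w ^ (2 : ℝ)) := by
  rcases le_total w a with h1 | h1
  · refine le_trans ?_ le_self_add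
    rw [← ENNReal.mul_rpow_of_nonneg _ _ (by linarith)]
    refine ENNReal.rpow_le_rpow (h.trans ?_) (by linarith)
    rw [two_mul]
    gcongr
  · refine le_trans ?_ le_add_self
    have h2 : y ≤ 2 * w := h.trans (by rw [two_mul]; gcongr)
    refine (ennreal_rpow_le_add hp hpq y).trans ?_
    rw [add_comm]
    gcongr
    refine (ENNReal.rpow_le_rpow h2 two_pos.le).trans (le_of_eq ?_)
    rw [ENNReal.mul_rpow_of_nonneg _ _ two_pos.le]
    norm_num

theorem ennreal_add_three_rpow_le {q : ℝ} (hq : 0 ≤ q) (x y z : ℝ≥0∞) :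
    (x + y + z) ^ q ≤ 3 ^ q * (x ^ q + y ^ q + z ^ q) := by
  have key : ∀ m : ℝ≥0∞, x ≤ m → y ≤ m → z ≤ m → (x + y + z) ^ q ≤ 3 ^ q * m ^ q := by
    intro m h1 h2 h3
    rw [← ENNReal.mul_rpow_of_nonneg _ _ hq]
    refine ENNReal.rpow_le_rpow ?_ hq
    calc x + y + z ≤ m + m + m := by gcongr
      _ = 3 * m := by ring
  rcases le_total x y with h1 | h1
  · rcases le_total y z with h2 | h2
    · exact (key z (h1.trans h2) h2 le_rfl).trans (by gcongr; exact le_add_self)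
    · exact (key y h1 le_rfl h2).trans (by gcongr; exact le_add_self.trans le_self_add)
  · rcases le_total x z with h2 | h2
    · exact (key z h2 (h1.trans h2) le_rfl).trans (by gcongr; exact le_add_self)
    · exact (key x le_rfl h1 h2).trans
        (by gcongr; exact le_self_add.trans le_self_add)

/-- The potential energy `∫ |v(t)|^{2d/(d-4)} (d-4)/(2d)`. -/
def potEnergy (v : ℝ × Space d → ℂ) (t : ℝ) : ℝ := ∫ x, pot d (v (t, x))

theorem potEnergy_nonneg (hd : 9 ≤ d) (v : ℝ × Space d → ℂ) (t : ℝ) : 0 ≤ potEnergy v t :=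
  integral_nonneg fun _ => pot_nonneg hd _

namespace IsL2Solution

variable {u : ℝ → Space d → ℂ} {v : ℝ × Space d → ℂ} {U : ℝ → 𝓢'(Space d, ℂ)} {D : ℝ → L2 d}

theorem exists_norm_incr_le (hs : IsL2Solution u v U D) (hd : 9 ≤ d) (t₀ a b : ℝ) :
    ∃ M, ∀ t ∈ Icc a b, ‖incr v D t₀ t‖ ≤ M := by
  have hc : Continuous fun t : ℝ =>
      2 * √|t - t₀| * ‖D t₀‖ + ‖duhamelInt (forcing v) t₀ t‖ := by
    have := continuous_duhamelInt (hs.intervalIntegrable hd) t₀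
    fun_prop
  obtain ⟨M, hM⟩ := isCompact_Icc.exists_bound_of_continuousOn (s := Icc a b) hc.continuousOn
  refine ⟨M, fun t ht => le_trans ?_ ((le_abs_self _).trans (hM t ht))⟩
  unfold incr
  refine (norm_add_le _ _).trans ?_
  rw [norm_smul, Complex.norm_I, one_mul]
  gcongr
  exact norm_fourierMulL_le (measurable_kick _) (norm_kick_le _) _

theorem lintegral_potExp_lt_top (hs : IsL2Solution u v U D) (hd : 9 ≤ d) {t₀ : ℝ}
    (h0 : ∫⁻ x, ‖u t₀ x‖ₑ ^ potExp d < ∞) (a b : ℝ) :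
    ∫⁻ z, ‖v z‖ₑ ^ potExp d ∂slab (Ioc a b) < ∞ := by
  rw [lintegral_slab (hs.measurable.enorm.pow_const _)]
  obtain ⟨M, hM⟩ := hs.exists_norm_incr_le hd t₀ a b
  have hp := two_lt_potExp hd
  have h1 : ∀ᵐ t ∂volume.restrict (Ioc a b), ∫⁻ x, ‖v (t, x)‖ₑ ^ potExp d
      ≤ (2 ^ potExp d * ∫⁻ x, ‖u t₀ x‖ₑ ^ potExp d) + 4 * ENNReal.ofReal M ^ (2 : ℝ)
        + ∫⁻ x, ‖v (t, x)‖ₑ ^ stExp d := by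
    filter_upwards [ae_restrict_mem measurableSet_Ioc, ae_restrict_of_ae hs.ae_eq] with t ht h2
    have h3 : ∀ᵐ x, ‖v (t, x)‖ₑ ^ potExp d ≤ 2 ^ potExp d * ‖u t₀ x‖ₑ ^ potExp d
        + (‖v (t, x)‖ₑ ^ stExp d + 4 * ‖incr v D t₀ t x‖ₑ ^ (2 : ℝ)) := by
      filter_upwards [h2, hs.incr_ae_eq hd t₀ t] with x h4 h5
      refine ennreal_rpow_le_split hp.le (potExp_lt_stExp hd).le ?_
      rw [← h4, h5]
      calc ‖u t x‖ₑ = ‖u t₀ x + (u t x - u t₀ x)‖ₑ := by ring_nf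
        _ ≤ _ := enorm_add_le _ _
    refine (lintegral_mono_ae h3).trans ?_
    have m1 : Measurable fun x => ‖v (t, x)‖ₑ ^ stExp d :=
      (measurable_slice_fun hs.measurable t).enorm.pow_const _
    have m2 : AEMeasurable (fun x => 4 * ‖incr v D t₀ t x‖ₑ ^ (2 : ℝ)) volume :=
      ((Lp.aestronglyMeasurable (incr v D t₀ t)).enorm.pow_const _).const_mul _
    rw [lintegral_add_right' _ (show AEMeasurable (fun x => _ + _) volume from
      m1.aemeasurable.add m2), lintegral_add_left m1,
      lintegral_const_mul' (4 : ℝ≥0∞) _ (by simp), lintegral_const_mul' (2 ^ potExp d : ℝ≥0∞) _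
        (ENNReal.rpow_ne_top_of_nonneg (by linarith) (by simp))]
    have h6 : ∫⁻ x, ‖incr v D t₀ t x‖ₑ ^ (2 : ℝ) ≤ ENNReal.ofReal M ^ (2 : ℝ) := by
      have h7 : ∫⁻ x, ‖incr v D t₀ t x‖ₑ ^ (2 : ℝ) = ‖incr v D t₀ t‖ₑ ^ (2 : ℝ) := by
        rw [enorm_L2_eq, ← ENNReal.rpow_mul]
        norm_num
      rw [h7, ← ofReal_norm]
      gcongr
      exact hM t (Ioc_subset_Icc_self ht)
    rw [add_comm (∫⁻ x, ‖v (t, x)‖ₑ ^ stExp d), ← add_assoc]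
    gcongr
  refine (lintegral_mono_ae h1).trans_lt ?_
  rw [lintegral_add_left measurable_const, lintegral_const]
  refine ENNReal.add_lt_top.2 ⟨ENNReal.mul_lt_top (ENNReal.add_lt_top.2 ⟨?_, ?_⟩) (by simp),
    hs.lq a b⟩
  · exact ENNReal.mul_lt_top (ENNReal.rpow_lt_top_of_nonneg (by linarith) (by simp)) h0
  · exact ENNReal.mul_lt_top (by simp)
      (ENNReal.rpow_lt_top_of_nonneg (by norm_num) ENNReal.ofReal_ne_top)

theorem integrable_pot (hs : IsL2Solution u v U D) (hd : 9 ≤ d) {t₀ : ℝ}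
    (h0 : ∫⁻ x, ‖u t₀ x‖ₑ ^ potExp d < ∞) (a b : ℝ) :
    Integrable (fun z => pot d (v z)) (slab (Ioc a b)) := by
  have hp := two_lt_potExp hd
  refine Integrable.div_const ⟨(hs.measurable.norm.pow_const _).aestronglyMeasurable, ?_⟩ _
  refine lt_of_le_of_lt (le_of_eq (lintegral_congr fun z => ?_))
    (hs.lintegral_potExp_lt_top hd h0 a b)
  rw [← ofReal_norm, ← ofReal_norm, ENNReal.ofReal_rpow_of_nonneg (norm_nonneg _) (by linarith),
    Real.norm_of_nonneg (by positivity)]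

theorem integrable_pot_timeShift (hs : IsL2Solution u v U D) (hd : 9 ≤ d) {t₀ : ℝ}
    (h0 : ∫⁻ x, ‖u t₀ x‖ₑ ^ potExp d < ∞) (a b h : ℝ) :
    Integrable (fun z => pot d (v (timeShift h z))) (slab (Ioc a b)) := by
  have hm : Measurable fun z => pot d (v z) := (continuous_pot hd).measurable.comp hs.measurable
  refine ⟨(hm.comp (measurable_timeShift h)).aestronglyMeasurable, ?_⟩
  have := lintegral_slab_timeShift hm.enorm a b h
  unfold HasFiniteIntegral
  rw [this]
  exact (hs.integrable_pot hd h0 (a + h) (b + h)).2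

theorem intervalIntegrable_potEnergy (hs : IsL2Solution u v U D) (hd : 9 ≤ d) {t₀ : ℝ}
    (h0 : ∫⁻ x, ‖u t₀ x‖ₑ ^ potExp d < ∞) (a b : ℝ) :
    IntervalIntegrable (potEnergy v) volume a b :=
  ⟨(hs.integrable_pot hd h0 a b).integral_prod_left, (hs.integrable_pot hd h0 b a).integral_prod_left⟩

theorem integral_pot_sub (hs : IsL2Solution u v U D) (hd : 9 ≤ d) {t₀ : ℝ}
    (h0 : ∫⁻ x, ‖u t₀ x‖ₑ ^ potExp d < ∞) {a b : ℝ} (hab : a ≤ b) (h : ℝ) :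
    ∫ z, (pot d (v (timeShift h z)) - pot d (v z)) ∂slab (Ioc a b)
      = (∫ t in b..b + h, potEnergy v t) - ∫ t in a..a + h, potEnergy v t := by
  have hi := hs.intervalIntegrable_potEnergy hd h0
  have e1 : ∫ z, pot d (v (timeShift h z)) ∂slab (Ioc a b) = ∫ t in a + h..b + h, potEnergy v t := by
    rw [← intervalIntegral.integral_comp_add_right (potEnergy v) h,
      intervalIntegral.integral_of_le hab]
    exact integral_prod _ (hs.integrable_pot_timeShift hd h0 a b h)
  have e2 : ∫ z, pot d (v z) ∂slab (Ioc a b) = ∫ t in a..b, potEnergy v t := by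
    rw [intervalIntegral.integral_of_le hab]
    exact integral_prod _ (hs.integrable_pot hd h0 a b)
  rw [integral_sub (hs.integrable_pot_timeShift hd h0 a b h) (hs.integrable_pot hd h0 a b), e1, e2,
    ← intervalIntegral.integral_add_adjacent_intervals (hi (a + h) b) (hi b (b + h)),
    ← intervalIntegral.integral_add_adjacent_intervals (hi a (a + h)) (hi (a + h) b)]
  ring

/-- The density of the work done by the nonlinearity between `t` and `t + h` differs from the
increment of the potential energy density by `o(h)` in `L¹` of a slab. -/
theorem eventually_lintegral_work_le (hs : IsL2Solution u v U D) (hd : 9 ≤ d) (a b : ℝ) {ε : ℝ}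
    (hε : 0 < ε) : ∀ᶠ h : ℝ in 𝓝[>] 0, ∀ σ ∈ Ioc 0 h,
    ∫⁻ z, ‖(inner ℂ (nonlin d (v (timeShift σ z))) (diffFn v h z)).re
      - (pot d (v (timeShift h z)) - pot d (v z))‖ₑ ∂slab (Ioc a b) ≤ ENNReal.ofReal (ε * h) := by
  obtain ⟨f1, -, -, -, -, f6, -, f8⟩ := strExp_facts hd
  have he : 0 < strExp d := by linarith
  have hq := stExp_pos hd
  have hα := nlExp_pos hd
  have hC := errConst_pos hd
  have hv := hs.measurable
  set I : ℝ≥0∞ := 3 ^ stExp d * (3 * ∫⁻ z, ‖v z‖ₑ ^ stExp d ∂slab (Ioc a (b + 1))) with hI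
  have hIfin : I < ∞ := ENNReal.mul_lt_top (ENNReal.rpow_lt_top_of_nonneg hq.le (by simp))
    (ENNReal.mul_lt_top (by simp) (hs.lintegral_slab_lt_top _ _))
  set M : ℝ≥0∞ := I ^ (4 / ((d : ℝ) + 4)) with hM
  have hMfin : M < ∞ := ENNReal.rpow_lt_top_of_nonneg (by positivity) hIfin.ne
  set η : ℝ := ε / (4 * errConst d * (M.toReal + 1)) with hη
  have hηpos : 0 < η := by positivity
  have hev := hs.eventually_lintegral_diffFn_le hd a b (η ^ (strExp d / 2)) (by positivity)
  obtain ⟨δ, hδ, hδs⟩ := mem_nhdsGT_iff_exists_Ioo_subset.1 hev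
  have hX : ∀ h ∈ Ioo 0 δ, (∫⁻ z, ‖diffFn v h z‖ₑ ^ strExp d ∂slab (Ioc a b)) ^ (2 / strExp d)
      ≤ ENNReal.ofReal (η * h) := by
    intro h hh
    have h1 := (lintegral_slab_mono Ioc_subset_Icc_self _).trans (hδs hh)
    refine (ENNReal.rpow_le_rpow h1 (by positivity)).trans (le_of_eq ?_)
    rw [ENNReal.ofReal_rpow_of_nonneg (by positivity) (by positivity),
      Real.mul_rpow (by positivity) (by positivity), ← Real.rpow_mul hηpos.le,
      ← Real.rpow_mul (Real.sqrt_nonneg _), show strExp d / 2 * (2 / strExp d) = 1 by field_simp,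
      show strExp d * (2 / strExp d) = 2 by field_simp, Real.rpow_one, Real.rpow_two,
      Real.sq_sqrt hh.1.le]
  have hδ' : (0 : ℝ) < min δ 1 := lt_min hδ one_pos
  filter_upwards [Ioo_mem_nhdsGT hδ'] with h hh σ hσ
  have hh1 : h < δ := hh.2.trans_le (min_le_left _ _)
  have hh2 : h < 1 := hh.2.trans_le (min_le_right _ _)
  set m : ℝ × Space d → ℝ≥0∞ :=
    fun z => ‖v z‖ₑ + ‖v (timeShift h z)‖ₑ + ‖v (timeShift σ z)‖ₑ with hm
  have hsh : ∀ s : ℝ, Measurable fun z => ‖v (timeShift s z)‖ₑ := fun s =>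
    (hv.comp (measurable_timeShift s)).enorm
  have hmm : Measurable m := (hv.enorm.add (hsh h)).add (hsh σ)
  have hmI : ∫⁻ z, m z ^ stExp d ∂slab (Ioc a b) ≤ I := by
    refine (lintegral_mono fun z => ennreal_add_three_rpow_le hq.le _ _ _).trans ?_
    have m1 : ∀ s : ℝ, Measurable fun z => ‖v (timeShift s z)‖ₑ ^ stExp d := fun s =>
      (hsh s).pow_const _
    have m0 := hv.enorm.pow_const (stExp d)
    have hle : ∀ s : ℝ, 0 ≤ s → s ≤ 1 → ∫⁻ z, ‖v (timeShift s z)‖ₑ ^ stExp d ∂slab (Ioc a b)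
        ≤ ∫⁻ z, ‖v z‖ₑ ^ stExp d ∂slab (Ioc a (b + 1)) := by
      intro s h1 h2
      rw [lintegral_slab_timeShift m0]
      exact lintegral_slab_mono (Ioc_subset_Ioc (by linarith) (by linarith)) _
    rw [lintegral_const_mul _ (show Measurable fun z => _ + _ + _ from (m0.add (m1 h)).add (m1 σ)),
      lintegral_add_right _ (m1 σ), lintegral_add_right _ (m1 h), hI]
    refine mul_le_mul_right ?_ _
    calc _ ≤ ∫⁻ z, ‖v z‖ₑ ^ stExp d ∂slab (Ioc a (b + 1)) +
          ∫⁻ z, ‖v z‖ₑ ^ stExp d ∂slab (Ioc a (b + 1)) +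
          ∫⁻ z, ‖v z‖ₑ ^ stExp d ∂slab (Ioc a (b + 1)) := by
          gcongr ?_ + ?_ + ?_
          · exact lintegral_slab_mono (Ioc_subset_Ioc le_rfl (by linarith)) _
          · exact hle h hh.1.le hh2.le
          · exact hle σ hσ.1.le (hσ.2.trans hh2.le)
      _ = _ := by ring
  have hH : ∀ s ∈ Ioc 0 h, ∫⁻ z, m z ^ nlExp d * ‖diffFn v s z‖ₑ ^ (2 : ℝ) ∂slab (Ioc a b)
      ≤ M * ENNReal.ofReal (η * h) := by
    intro s hs'
    have hk : nlExp d / stExp d = 4 / ((d : ℝ) + 4) := by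
      rw [f6]
      field_simp
    refine (lintegral_mul_rpow_le hmm (measurable_diffFn hv s).enorm hq he hα.le two_pos.le
      (by rw [hk, f8])).trans ?_
    rw [hk, hM]
    gcongr
    refine (hX s ⟨hs'.1, hs'.2.trans_lt hh1⟩).trans (ENNReal.ofReal_le_ofReal ?_)
    exact mul_le_mul_of_nonneg_left hs'.2 hηpos.le
  have hpt : ∀ z, ‖(inner ℂ (nonlin d (v (timeShift σ z))) (diffFn v h z)).re
      - (pot d (v (timeShift h z)) - pot d (v z))‖ₑ ≤ ENNReal.ofReal (2 * errConst d) *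
      (m z ^ nlExp d * ‖diffFn v σ z‖ₑ ^ (2 : ℝ) + m z ^ nlExp d * ‖diffFn v h z‖ₑ ^ (2 : ℝ)) := by
    intro z
    have := ENNReal.ofReal_le_ofReal (abs_inner_nonlin_sub_pot_le' hd (v z) (v (timeShift h z))
      (v (timeShift σ z)))
    rw [ENNReal.ofReal_mul (p := 2 * errConst d) (by positivity),
      ENNReal.ofReal_mul (p := (‖v z‖ + ‖v (timeShift h z)‖ + ‖v (timeShift σ z)‖) ^ nlExp d)
        (by positivity), ← ENNReal.ofReal_rpow_of_nonneg (by positivity) hα.le,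
      ENNReal.ofReal_add (by positivity) (by positivity),
      ENNReal.ofReal_add (by positivity) (by positivity),
      ENNReal.ofReal_add (by positivity) (by positivity), ← Real.rpow_two, ← Real.rpow_two,
      ← ENNReal.ofReal_rpow_of_nonneg (by positivity) two_pos.le,
      ← ENNReal.ofReal_rpow_of_nonneg (by positivity) two_pos.le] at this
    simp only [ofReal_norm] at this
    rw [← ofReal_norm, Real.norm_eq_abs, ← mul_add]
    exact this
  refine (lintegral_mono hpt).trans ?_
  have m2 : ∀ s : ℝ, Measurable fun z => m z ^ nlExp d * ‖diffFn v s z‖ₑ ^ (2 : ℝ) := fun s =>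
    (hmm.pow_const _).mul ((measurable_diffFn hv s).enorm.pow_const _)
  rw [lintegral_const_mul _ (show Measurable fun z => _ + _ from (m2 σ).add (m2 h)),
    lintegral_add_right _ (m2 h)]
  refine (mul_le_mul_right (add_le_add (hH σ hσ) (hH h ⟨hh.1, le_rfl⟩)) _).trans ?_
  rw [← ENNReal.ofReal_toReal hMfin.ne, ← ENNReal.ofReal_mul (by positivity),
    ← ENNReal.ofReal_add (by have := hh.1; positivity) (by have := hh.1; positivity),
    ← ENNReal.ofReal_mul (by positivity)]
  refine ENNReal.ofReal_le_ofReal ?_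
  have h3 : 4 * errConst d * (M.toReal + 1) * η = ε := by
    rw [hη]
    field_simp
  have h4 : 0 ≤ 4 * errConst d * η * h := by
    have := hh.1
    positivity
  nlinarith [h3, h4, hh.1]

end IsL2Solution

theorem memLp_two_iff_lintegral {X : Type*} [MeasurableSpace X] {μ : Measure X} {f : X → ℂ}
    (hf : AEStronglyMeasurable f μ) : MemLp f 2 μ ↔ ∫⁻ x, ‖f x‖ₑ ^ (2 : ℝ) ∂μ < ∞ := by
  simpa using memLp_iff_lintegral_rpow two_pos hf

namespace IsL2Solution

variable {u : ℝ → Space d → ℂ} {v : ℝ × Space d → ℂ} {U : ℝ → 𝓢'(Space d, ℂ)} {D : ℝ → L2 d}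

theorem integrable_work (hs : IsL2Solution u v U D) (hd : 9 ≤ d) (a b σ h : ℝ) :
    Integrable (fun z => inner ℂ (nonlin d (v (timeShift σ z))) (diffFn v h z))
      (slab (Ioc a b)) := by
  have hv := hs.measurable
  have hF : Measurable fun z => nonlin d (v (timeShift σ z)) :=
    measurable_nonlin.comp (hv.comp (measurable_timeShift σ))
  have hw := measurable_diffFn hv h
  have h1 : MemLp (fun z => nonlin d (v (timeShift σ z))) 2 (slab (Ioc a b)) := by
    rw [memLp_two_iff_lintegral hF.aestronglyMeasurable]
    simp only [enorm_nonlin_rpow hd]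
    rw [lintegral_slab_timeShift (hv.enorm.pow_const (stExp d))]
    exact hs.lintegral_slab_lt_top _ _
  have h2 : MemLp (diffFn v h) 2 (slab (Ioc a b)) := by
    rw [memLp_two_iff_lintegral hw.aestronglyMeasurable]
    exact hs.lintegral_diffFn_two_lt_top hd h a b
  have h3 := h2.integrable_mul h1.star
  refine h3.congr (ae_of_all _ fun z => ?_)
  simp [RCLike.inner_apply]

theorem integral_inner_forcing (hs : IsL2Solution u v U D) (hd : 9 ≤ d) (a b σ h : ℝ) :
    ∫ t in Ioc a b, (inner ℂ (forcing v (t + σ)) (incr v D t (t + h))).re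
      = ∫ z, (inner ℂ (nonlin d (v (timeShift σ z))) (diffFn v h z)).re ∂slab (Ioc a b) := by
  have hi := hs.integrable_work hd a b σ h
  have e1 : ∫ z, (inner ℂ (nonlin d (v (timeShift σ z))) (diffFn v h z)).re ∂slab (Ioc a b)
      = ∫ t in Ioc a b, ∫ x, (inner ℂ (nonlin d (v (t + σ, x))) (diffFn v h (t, x))).re :=
    integral_prod _ hi.re
  rw [e1]
  have h1 : ∀ᵐ t ∂volume.restrict (Ioc a b), Integrable
      (fun x => inner ℂ (nonlin d (v (t + σ, x))) (diffFn v h (t, x))) := hi.prod_right_ae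
  refine integral_congr_ae ?_
  filter_upwards [h1, ae_restrict_of_ae (hs.incr_ae_eq_diffFn hd h),
    ae_restrict_of_ae (ae_add_right (ae_lintegral_stExp_lt_top hs.measurable hs.lq) σ)]
    with t h2 h3 h4
  rw [L2.inner_def]
  have h5 : (fun x => inner ℂ (forcing v (t + σ) x) (incr v D t (t + h) x)) =ᵐ[volume]
      fun x => inner ℂ (nonlin d (v (t + σ, x))) (diffFn v h (t, x)) := by
    filter_upwards [forcing_ae_eq hd hs.measurable h4, h3] with x h6 h7
    rw [h6, h7]
  rw [integral_congr_ae h5]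
  exact (integral_re h2).symm

theorem re_inner_integral {X : Type*} [MeasurableSpace X] {μ : Measure X} {H : Type*}
    [NormedAddCommGroup H] [InnerProductSpace ℂ H] [NormedSpace ℝ H]
    [CompleteSpace H] {G : X → H}
    (hG : Integrable G μ) (w : H) :
    (inner ℂ (∫ x, G x ∂μ) w).re = ∫ x, (inner ℂ (G x) w).re ∂μ := by
  have h1 : Integrable (fun x => inner ℂ (G x) w) μ := hG.inner_const w
  rw [← inner_conj_symm, ← integral_inner hG, ← integral_conj]
  simp only [inner_conj_symm]
  exact (integral_re h1).symm

theorem integrable_re_inner {X : Type*} [MeasurableSpace X] {μ : Measure X} {H : Type*}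
    [NormedAddCommGroup H] [InnerProductSpace ℂ H] {G : X → H}
    (hG : Integrable G μ) (w : H) : Integrable (fun x => (inner ℂ (G x) w).re) μ :=
  (Integrable.inner_const (𝕜 := ℂ) hG w).re

theorem integral_work_eq (hs : IsL2Solution u v U D) (hd : 9 ≤ d) {a b h : ℝ} (hab : a ≤ b)
    (hh : 0 ≤ h) :
    Integrable (fun σ => ∫ t in Ioc a b, (inner ℂ (forcing v (t + σ)) (incr v D t (t + h))).re)
      (volume.restrict (Ioc 0 h)) ∧
    ∫ t in a..b, (inner ℂ (∫ τ in t..t + h, forcing v τ) (incr v D t (t + h))).re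
      = ∫ σ in Ioc 0 h, ∫ t in Ioc a b,
        (inner ℂ (forcing v (t + σ)) (incr v D t (t + h))).re := by
  have hΦ := hs.intervalIntegrable hd
  have hc := hs.continuous_incr_shift hd h
  have hFm : StronglyMeasurable (forcing v) :=
    stronglyMeasurable_slice (measurable_nonlin.comp hs.measurable)
  obtain ⟨W, hW⟩ := isCompact_Icc.exists_bound_of_continuousOn (s := Icc a b) hc.continuousOn
  set f : ℝ × ℝ → ℝ := fun p => (inner ℂ (forcing v (p.1 + p.2)) (incr v D p.1 (p.1 + h))).re with hf
  have hadd : Measurable fun p : ℝ × ℝ => p.1 + p.2 := by fun_prop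
  have hfm : StronglyMeasurable f := by
    have h1 : StronglyMeasurable fun p : ℝ × ℝ => forcing v (p.1 + p.2) :=
      hFm.comp_measurable hadd
    have h2 : StronglyMeasurable fun p : ℝ × ℝ => incr v D p.1 (p.1 + h) :=
      hc.stronglyMeasurable.comp_measurable measurable_fst
    exact Complex.continuous_re.comp_stronglyMeasurable (h1.inner h2)
  have hshift : ∀ t, ∫ σ in Ioc 0 h, ‖forcing v (t + σ)‖ = ∫ τ in t..t + h, ‖forcing v τ‖ := by
    intro t
    rw [← intervalIntegral.integral_of_le hh,
      intervalIntegral.integral_comp_add_left (fun τ => ‖forcing v τ‖) t, add_zero]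
  have hii : ∀ t, Integrable (fun σ => forcing v (t + σ)) (volume.restrict (Ioc 0 h)) := by
    intro t
    have := (hΦ t (t + h)).comp_add_left t
    simp only [sub_self, add_sub_cancel_left] at this
    exact (intervalIntegrable_iff_integrableOn_Ioc_of_le hh).1 this
  have hfi : Integrable f ((volume.restrict (Ioc a b)).prod (volume.restrict (Ioc 0 h))) := by
    rw [integrable_prod_iff hfm.aestronglyMeasurable]
    constructor
    · refine ae_of_all _ fun t => ?_
      exact integrable_re_inner (hii t) (incr v D t (t + h))
    · refine Integrable.mono' (g := fun _ => (∫ τ in a..b + h, ‖forcing v τ‖) * W)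
        (integrable_const _) ?_ ?_
      · exact (hfm.norm.integral_prod_right).aestronglyMeasurable
      · filter_upwards [ae_restrict_mem measurableSet_Ioc] with t ht
        rw [Real.norm_of_nonneg (integral_nonneg fun _ => norm_nonneg _)]
        have hw := hW t (Ioc_subset_Icc_self ht)
        calc ∫ σ in Ioc 0 h, ‖f (t, σ)‖ ≤ ∫ σ in Ioc 0 h, ‖forcing v (t + σ)‖ * W := by
              refine integral_mono_of_nonneg (ae_of_all _ fun _ => norm_nonneg _)
                ((hii t).norm.mul_const W) (ae_of_all _ fun σ => ?_)
              refine (Complex.abs_re_le_norm _).trans ((norm_inner_le_norm _ _).trans ?_)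
              exact mul_le_mul_of_nonneg_left hw (norm_nonneg _)
          _ = (∫ τ in t..t + h, ‖forcing v τ‖) * W := by
              rw [integral_mul_const, hshift]
          _ ≤ _ := by
              refine mul_le_mul_of_nonneg_right ?_ ((norm_nonneg _).trans hw)
              exact intervalIntegral.integral_mono_interval ht.1.le (by linarith)
                (by linarith [ht.2]) (ae_of_all _ fun _ => norm_nonneg _) (hΦ a (b + h)).norm
  refine ⟨hfi.integral_prod_right, ?_⟩
  rw [intervalIntegral.integral_of_le hab]
  refine Eq.trans ?_ (integral_integral_swap hfi)
  refine integral_congr_ae (ae_of_all _ fun t => ?_)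
  have e : ∫ τ in t..t + h, forcing v τ = ∫ σ in Ioc 0 h, forcing v (t + σ) := by
    rw [← intervalIntegral.integral_of_le hh,
      intervalIntegral.integral_comp_add_left (forcing v) t, add_zero]
  show (inner ℂ (∫ τ in t..t + h, forcing v τ) (incr v D t (t + h))).re = _
  rw [e, re_inner_integral (hii t)]

/-- Over a short time step `h`, the work done by the nonlinearity is the increment of the averaged
potential energy, up to `o(h²)`. -/
theorem eventually_abs_work_sub_le (hs : IsL2Solution u v U D) (hd : 9 ≤ d) {t₀ : ℝ}
    (h0 : ∫⁻ x, ‖u t₀ x‖ₑ ^ potExp d < ∞) (A B : ℝ) {ε : ℝ} (hε : 0 < ε) :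
    ∀ᶠ h : ℝ in 𝓝[>] 0, ∀ a ∈ Icc A B, ∀ b ∈ Icc A B,
      |(∫ t in a..b, (inner ℂ (∫ τ in t..t + h, forcing v τ) (incr v D t (t + h))).re)
        - h * ((∫ t in b..b + h, potEnergy v t) - ∫ t in a..a + h, potEnergy v t)| ≤ ε * h ^ 2 := by
  filter_upwards [hs.eventually_lintegral_work_le hd A B hε, self_mem_nhdsWithin] with h hh hpos
  have hpos : 0 < h := hpos
  have key : ∀ a ∈ Icc A B, ∀ b ∈ Icc A B, a ≤ b →
      |(∫ t in a..b, (inner ℂ (∫ τ in t..t + h, forcing v τ) (incr v D t (t + h))).re)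
        - h * ((∫ t in b..b + h, potEnergy v t) - ∫ t in a..a + h, potEnergy v t)|
        ≤ ε * h ^ 2 := by
    intro a ha b hb hab
    obtain ⟨h1, h2⟩ := hs.integral_work_eq hd hab hpos.le
    set Q := ∫ z, (pot d (v (timeShift h z)) - pot d (v z)) ∂slab (Ioc a b) with hQ
    have h3 : h * Q = ∫ _ in Ioc 0 h, Q := by
      simp [hpos.le]
    rw [← hs.integral_pot_sub hd h0 hab, ← hQ, h2, h3, ← integral_sub h1 (integrable_const _),
      ← Real.norm_eq_abs]
    have h4 := norm_setIntegral_le_of_norm_le_const (μ := volume) (s := Ioc 0 h) (C := ε * h)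
      (f := fun σ => (∫ t in Ioc a b, (inner ℂ (forcing v (t + σ)) (incr v D t (t + h))).re) - Q)
      (by simp) ?_
    · refine h4.trans (le_of_eq ?_)
      simp [Measure.real, hpos.le]
      ring
    · intro σ hσ
      have i1 : Integrable (fun z => (inner ℂ (nonlin d (v (timeShift σ z))) (diffFn v h z)).re)
        (slab (Ioc a b)) := (hs.integrable_work hd a b σ h).re
      have i2 : Integrable (fun z => pot d (v (timeShift h z)) - pot d (v z)) (slab (Ioc a b)) :=
        (hs.integrable_pot_timeShift hd h0 a b h).sub (hs.integrable_pot hd h0 a b)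
      rw [hs.integral_inner_forcing hd, hQ, ← integral_sub i1 i2]
      refine (ENNReal.ofReal_le_ofReal_iff (by positivity)).1 ?_
      rw [ofReal_norm]
      refine (enorm_integral_le_lintegral_enorm _).trans (le_trans ?_ (hh σ hσ))
      exact lintegral_slab_mono (Ioc_subset_Ioc ha.1 hb.2) _
  intro a ha b hb
  rcases le_total a b with hab | hab
  · exact key a ha b hb hab
  · have := key b hb a ha hab
    rw [intervalIntegral.integral_symm, ← abs_neg] at this
    convert this using 2
    ring

/-- The Laplacian of a solution with finite potential energy at one time is bounded in `L²`,
uniformly in time. -/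
theorem exists_norm_le (hs : IsL2Solution u v U D) (hd : 9 ≤ d) {t₀ : ℝ}
    (h0 : ∫⁻ x, ‖u t₀ x‖ₑ ^ potExp d < ∞) : ∃ M, ∀ t, ‖D t‖ ≤ M := by
  have hV := hs.intervalIntegrable_potEnergy hd h0
  obtain ⟨M₀, hM₀⟩ := isCompact_Icc.exists_bound_of_continuousOn (s := Icc (0 : ℝ) 2)
    hs.continuous.continuousOn
  have hM₀' : 0 ≤ M₀ := (norm_nonneg _).trans (hM₀ 0 (by simp))
  set P := ∫ t in (0 : ℝ)..1, potEnergy v t with hP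
  have hP0 : 0 ≤ P := intervalIntegral.integral_nonneg zero_le_one fun t _ => potEnergy_nonneg hd v t
  refine ⟨√(M₀ ^ 2 + 2 * P + 2), fun T => ?_⟩
  refine Real.le_sqrt_of_sq_le ?_
  have hstep : Tendsto (fun n : ℕ => ((n : ℝ) + 1)⁻¹) atTop (𝓝[>] 0) := by
    refine tendsto_nhdsWithin_iff.2 ⟨?_, Eventually.of_forall fun n => ?_⟩
    · simpa only [one_div] using tendsto_one_div_add_atTop_nhds_zero_nat (𝕜 := ℝ)
    · show (0 : ℝ) < _
      positivity
  have hlim : Tendsto (fun n : ℕ => ‖((n : ℝ) + 1)⁻¹⁻¹ • ∫ τ in T..T + ((n : ℝ) + 1)⁻¹, D τ‖ ^ 2)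
      atTop (𝓝 (‖D T‖ ^ 2)) := by
    have h1 : HasDerivAt (fun s => ∫ τ in T..s, D τ) (D T) T :=
      intervalIntegral.integral_hasDerivAt_right (hs.continuous.intervalIntegrable _ _)
        (hs.continuous.stronglyMeasurableAtFilter _ _) hs.continuous.continuousAt
    have h2 := h1.tendsto_slope_zero_right
    simp only [intervalIntegral.integral_same, sub_zero] at h2
    exact ((h2.comp hstep).norm.pow 2)
  refine le_of_tendsto hlim ?_
  filter_upwards [hstep.eventually (hs.eventually_abs_work_sub_le hd h0 (min 0 T) (max 1 T)
    one_pos)] with n hn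
  set h : ℝ := ((n : ℝ) + 1)⁻¹ with hh
  have hpos : 0 < h := by positivity
  have hnh : ((n : ℝ) + 1) * h = 1 := by
    rw [hh]
    field_simp
  -- an initial time in `[0, 1]` with an average amount of potential energy
  obtain ⟨k, hk, hkle⟩ : ∃ k ∈ Finset.range (n + 1),
      ∫ t in (k : ℝ) * h..(k + 1 : ℕ) * h, potEnergy v t ≤ h * P := by
    refine Finset.exists_le_of_sum_le (by simp) ?_
    rw [intervalIntegral.sum_integral_adjacent_intervals (a := fun k : ℕ => (k : ℝ) * h)
      fun k _ => hV _ _]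
    simp only [Nat.cast_zero, zero_mul, Finset.sum_const, Finset.card_range, nsmul_eq_mul]
    push_cast
    rw [hnh, ← mul_assoc, hnh, one_mul]
  set a := (k : ℝ) * h with ha
  have hkn : (k : ℝ) ≤ n := by
    have := Finset.mem_range.1 hk
    exact_mod_cast Nat.lt_succ_iff.1 this
  have ha0 : 0 ≤ a := by positivity
  have ha1 : a + h ≤ 1 := by
    rw [← hnh, ha]
    nlinarith
  have e1 : ((k + 1 : ℕ) : ℝ) * h = a + h := by
    rw [ha]
    push_cast
    ring
  rw [e1] at hkle
  have hw := hn a ⟨(min_le_left _ _).trans ha0, le_trans (by linarith) (le_max_left _ _)⟩ T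
    ⟨min_le_right _ _, le_max_right _ _⟩
  have hE := hs.energy_identity hd hpos.le a T
  have hVT : 0 ≤ ∫ t in T..T + h, potEnergy v t :=
    intervalIntegral.integral_nonneg (by linarith) fun t _ => potEnergy_nonneg hd v t
  have hDa : ‖∫ τ in a..a + h, D τ‖ ≤ M₀ * h := by
    have := intervalIntegral.norm_integral_le_of_norm_le_const (a := a) (b := a + h) (f := D)
      (C := M₀) fun t ht => by
        rw [uIoc_of_le (by linarith)] at ht
        exact hM₀ t ⟨by linarith [ht.1], by linarith [ht.2]⟩
    rwa [add_sub_cancel_left, abs_of_pos hpos] at this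
  have hDa2 : ‖∫ τ in a..a + h, D τ‖ ^ 2 ≤ (M₀ * h) ^ 2 :=
    pow_le_pow_left₀ (norm_nonneg _) hDa 2
  have hle := (abs_le.1 hw).1
  have hVT' : 0 ≤ h * ∫ t in T..T + h, potEnergy v t := mul_nonneg hpos.le hVT
  have hka := mul_le_mul_of_nonneg_left hkle hpos.le
  have hfin : ‖∫ τ in T..T + h, D τ‖ ^ 2 ≤ (M₀ ^ 2 + 2 * P + 2) * h ^ 2 := by
    rw [mul_sub] at hle
    nlinarith
  rw [norm_smul, mul_pow, Real.norm_of_nonneg (by positivity)]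
  calc h⁻¹ ^ 2 * ‖∫ τ in T..T + h, D τ‖ ^ 2 ≤ h⁻¹ ^ 2 * ((M₀ ^ 2 + 2 * P + 2) * h ^ 2) := by
        gcongr
    _ = _ := by field_simp

end IsL2Solution

/-! ### Weak decay along almost periodic solutions -/

theorem Represents.real_smul {f : Space d → ℂ} {T : 𝓢'(Space d, ℂ)} (h : Represents f T) (c : ℝ) :
    Represents (fun x => (c : ℂ) * f x) (c • T) := by
  intro ψ
  have e : (fun x => ψ x * ((c : ℂ) * f x)) = fun x => (c : ℂ) * (ψ x * f x) := by
    funext x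
    ring
  rw [e]
  refine ⟨(h ψ).1.const_mul _, ?_⟩
  rw [integral_const_mul, ← (h ψ).2]
  exact Complex.real_smul

theorem represents_neg_of_laplacian (hd : 1 ≤ d) {T : 𝓢'(Space d, ℂ)} {D : L2 d}
    (hD : Represents (fun η => ((lapSym η : ℝ) : ℂ)⁻¹ * (𝓕 D : L2 d) η) (𝓕 T))
    {g : Space d → ℂ} (hg : Represents g (Δ T)) : g =ᵐ[volume] fun x => -D x := by
  have h1 : Represents (fun η => (-(𝓕 D : L2 d)) η) (𝓕 (Δ T)) := by
    rw [TemperedDistribution.laplacian_eq_fourierMultiplierCLM]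
    have e : 𝓕 (-(2 * Real.pi) ^ 2 • TemperedDistribution.fourierMultiplierCLM ℂ
        (fun x : Space d => Complex.ofReal (‖x‖ ^ 2)) T)
        = -(2 * Real.pi) ^ 2 • TemperedDistribution.smulLeftCLM ℂ
          (fun x : Space d => Complex.ofReal (‖x‖ ^ 2)) (𝓕 T) := by
      have h0 : 𝓕 (TemperedDistribution.fourierMultiplierCLM ℂ
          (fun x : Space d => Complex.ofReal (‖x‖ ^ 2)) T) = TemperedDistribution.smulLeftCLM ℂ
          (fun x : Space d => Complex.ofReal (‖x‖ ^ 2)) (𝓕 T) := by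
        rw [TemperedDistribution.fourierMultiplierCLM_apply, FourierTransform.fourier_fourierInv_eq]
      rw [← h0]
      exact ContinuousLinearMap.map_smul_of_tower (FourierTransform.fourierCLM ℂ 𝓢'(Space d, ℂ)) _ _
    rw [e]
    refine ((hD.smulLeft (m := fun x : Space d => Complex.ofReal (‖x‖ ^ 2))
      (by fun_prop)).real_smul _).congr ?_
    filter_upwards [Lp.coeFn_neg (𝓕 D : L2 d), ae_lapSym_pos hd] with η h2 h3
    have h4 : ((lapSym η : ℝ) : ℂ) ≠ 0 := by exact_mod_cast h3.ne'
    have h5 : ((lapSym η : ℝ) : ℂ) = (2 * Real.pi) ^ 2 * (‖η‖ : ℂ) ^ 2 := by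
      rw [lapSym, norm_smul, Real.norm_of_nonneg Real.two_pi_pos.le]
      push_cast
      ring
    rw [h2, Pi.neg_apply]
    have h6 : (‖η‖ : ℂ) ≠ 0 := fun h => by
      rw [h5, h] at h4
      simp at h4
    rw [h5]
    push_cast
    field_simp
  have h2 : 𝓕 (-D) = -(𝓕 D : L2 d) := map_neg (Lp.fourierTransformₗᵢ (Space d) ℂ) D
  rw [← h2] at h1
  have h3 := congrArg (fun T => 𝓕⁻ T) (h1.unique_right (represents_fourier_L2 (-D)))
  simp only [FourierTransform.fourierInv_fourier_eq] at h3
  rw [h3] at hg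
  filter_upwards [hg.ae_eq (represents_L2 (-D)), Lp.coeFn_neg D] with x h4 h5
  rw [h4, h5, Pi.neg_apply]

theorem exists_integrable_norm_sub_le (χ : L2 d) {ε : ℝ} (hε : 0 < ε) :
    ∃ χ₀ : L2 d, Integrable χ₀ ∧ ‖χ - χ₀‖ ≤ ε := by
  obtain ⟨g, hg1, hg2, hg3, hg4⟩ := (Lp.memLp χ).exists_hasCompactSupport_eLpNorm_sub_le
    (by simp) (ε := ENNReal.ofReal ε) (by simpa using hε)
  refine ⟨hg4.toLp g, ?_, ?_⟩
  · exact (hg3.integrable_of_hasCompactSupport hg1).congr hg4.coeFn_toLp.symm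
  · rw [Lp.norm_def]
    refine ENNReal.toReal_le_of_le_ofReal hε.le (le_trans (le_of_eq (eLpNorm_congr_ae ?_)) hg2)
    filter_upwards [Lp.coeFn_sub χ (hg4.toLp g), hg4.coeFn_toLp] with x h1 h2
    rw [h1, Pi.sub_apply, h2, Pi.sub_apply]

/-- A bounded trajectory in `L²` whose mass stays, up to `η`, in balls of radius independent of
time, converges weakly to zero in the interaction representation. -/
theorem tendsto_inner_flow (hd : 3 ≤ d) {D : ℝ → L2 d} {M : ℝ} (hM : ∀ t, ‖D t‖ ≤ M)
    (x : ℝ → Space d)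
    (hloc : ∀ η : ℝ, 0 < η → ∃ R : ℝ, ∀ t, ∫⁻ y in {y | R ≤ ‖y - x t‖}, ‖D t y‖ₑ ^ 2
      ≤ ENNReal.ofReal η) (χ : L2 d) :
    Tendsto (fun T => inner ℂ (flow T χ) (D T)) (cocompact ℝ) (𝓝 0) := by
  have hM0 : 0 ≤ M := (norm_nonneg _).trans (hM 0)
  rw [tendsto_zero_iff_norm_tendsto_zero]
  refine tendsto_order.2 ⟨fun a ha => Eventually.of_forall fun T => ha.trans_le (norm_nonneg _),
    fun ε hε => ?_⟩
  obtain ⟨χ₀, hχi, hχ⟩ := exists_integrable_norm_sub_le χ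
    (ε := ε / (4 * (M + 1))) (by positivity)
  set η : ℝ := (ε / (4 * (‖χ₀‖ + 1))) ^ 2 with hη
  obtain ⟨R, hR⟩ := hloc η (by positivity)
  set V : ℝ≥0∞ := volume (Metric.ball (0 : Space d) R) with hV
  have hVfin : V ≠ ∞ := measure_ball_lt_top.ne
  have hlim : Tendsto (fun T : ℝ => flowConst d * |T| ^ (-(d : ℝ) / 4) *
      (√V.toReal * M * ∫ x, ‖χ₀ x‖)) (cocompact ℝ) (𝓝 0) := by
    have h1 : Tendsto (fun T : ℝ => |T| ^ (-((d : ℝ) / 4))) (cocompact ℝ) (𝓝 0) := by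
      have hdp : 0 < (d : ℝ) / 4 := by
        have : (3 : ℝ) ≤ d := by exact_mod_cast hd
        positivity
      exact (tendsto_rpow_neg_atTop hdp).comp tendsto_norm_cocompact_atTop
    have h2 := (h1.const_mul (flowConst d)).mul_const (√V.toReal * M * ∫ x, ‖χ₀ x‖)
    simp only [mul_zero, zero_mul] at h2
    refine h2.congr fun T => ?_
    rw [neg_div]
  have hne : ∀ᶠ T : ℝ in cocompact ℝ, T ≠ 0 := by
    have := isCompact_singleton (x := (0 : ℝ)).compl_mem_cocompact
    filter_upwards [this] with T hT
    exact hT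
  filter_upwards [hlim.eventually_lt_const (show (0 : ℝ) < ε / 4 by positivity), hne] with T h1 hT
  set s : Set (Space d) := {y | R ≤ ‖y - x T‖} with hs
  have hsm : MeasurableSet s := measurableSet_le measurable_const (by fun_prop)
  have hsc : sᶜ = Metric.ball (x T) R := by
    ext y
    simp [hs, dist_eq_norm]
  have m1 : MemLp (s.indicator (D T)) 2 := (Lp.memLp (D T)).indicator hsm
  have m2 : MemLp (sᶜ.indicator (D T)) 2 := (Lp.memLp (D T)).indicator hsm.compl
  set Do : L2 d := m1.toLp _ with hDo
  set Di : L2 d := m2.toLp _ with hDi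
  have hsplit : D T = Do + Di := by
    refine Lp.ext ?_
    filter_upwards [Lp.coeFn_add Do Di, m1.coeFn_toLp, m2.coeFn_toLp] with y h2 h3 h4
    rw [h2, Pi.add_apply, h3, h4]
    exact (congrFun (Set.indicator_self_add_compl s (D T)) y).symm
  have hDo_le : ‖Do‖ ≤ ε / (4 * (‖χ₀‖ + 1)) := by
    refine le_of_sq_le_sq ?_ (by positivity)
    rw [← hη]
    refine (ENNReal.ofReal_le_ofReal_iff (by positivity)).1 (le_trans (le_of_eq ?_) (hR T))
    rw [ENNReal.ofReal_pow (norm_nonneg _), ofReal_norm, enorm_L2_eq, ← ENNReal.rpow_natCast,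
      ← ENNReal.rpow_mul, ← lintegral_indicator hsm]
    norm_num
    refine lintegral_congr_ae ?_
    filter_upwards [m1.coeFn_toLp] with y h2
    rw [h2]
    by_cases hy : y ∈ s
    · simp [hy]
    · simp [hy]
  have hDi_int : Integrable Di ∧ ∫ y, ‖Di y‖ ≤ √V.toReal * M := by
    have hμ : (volume.restrict sᶜ) univ = V := by
      rw [Measure.restrict_apply_univ, hsc, hV, Measure.addHaar_ball_center]
    have b1 : eLpNorm Di 1 volume ≤ ENNReal.ofReal (√V.toReal * M) := by
      rw [eLpNorm_congr_ae m2.coeFn_toLp, eLpNorm_indicator_eq_eLpNorm_restrict hsm.compl]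
      refine (eLpNorm_le_eLpNorm_mul_rpow_measure_univ (p := 1) (q := 2) one_le_two
        (Lp.aestronglyMeasurable (D T)).restrict).trans ?_
      rw [hμ, mul_comm, ENNReal.ofReal_mul (Real.sqrt_nonneg _)]
      gcongr
      · rw [Real.sqrt_eq_rpow, ← ENNReal.ofReal_rpow_of_nonneg ENNReal.toReal_nonneg (by norm_num),
          ENNReal.ofReal_toReal hVfin]
        norm_num
      · refine (eLpNorm_restrict_le _ _ _ _).trans ?_
        rw [← Lp.enorm_def, ← ofReal_norm]
        exact ENNReal.ofReal_le_ofReal (hM T)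
    have b2 : MemLp Di 1 := ⟨Lp.aestronglyMeasurable Di, b1.trans_lt ENNReal.ofReal_lt_top⟩
    have b3 := memLp_one_iff_integrable.1 b2
    refine ⟨b3, ?_⟩
    rw [integral_norm_eq_lintegral_enorm b3.1, ← eLpNorm_one_eq_lintegral_enorm]
    exact ENNReal.toReal_le_of_le_ofReal (by positivity) b1
  have k1 : ‖inner ℂ (flow T χ₀) Di‖ ≤ flowConst d * |T| ^ (-(d : ℝ) / 4) *
      (√V.toReal * M * ∫ x, ‖χ₀ x‖) := by
    rw [norm_inner_symm]
    refine (norm_inner_flow_le_of_integrable hd hT hχi hDi_int.1).trans ?_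
    rw [mul_comm (∫ x, ‖χ₀ x‖)]
    have := flowConst_pos (d := d)
    gcongr
    exact hDi_int.2
  have k2 : ‖inner ℂ (flow T χ₀) Do‖ ≤ ‖χ₀‖ * (ε / (4 * (‖χ₀‖ + 1))) := by
    refine (norm_inner_le_norm _ _).trans ?_
    rw [norm_flow]
    gcongr
  have k3 : ‖inner ℂ (flow T (χ - χ₀)) (D T)‖ ≤ ε / (4 * (M + 1)) * M := by
    refine (norm_inner_le_norm _ _).trans ?_
    rw [norm_flow]
    gcongr
    exact hM T
  have e : inner ℂ (flow T χ) (D T) = inner ℂ (flow T (χ - χ₀)) (D T) +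
      (inner ℂ (flow T χ₀) Do + inner ℂ (flow T χ₀) Di) := by
    rw [← inner_add_right, ← hsplit, ← inner_add_left, ← map_add, sub_add_cancel]
  have k4 : ‖χ₀‖ * (ε / (4 * (‖χ₀‖ + 1))) ≤ ε / 4 := by
    rw [mul_div_assoc', div_le_div_iff₀ (by positivity) (by positivity)]
    nlinarith [norm_nonneg χ₀]
  have k5 : ε / (4 * (M + 1)) * M ≤ ε / 4 := by
    rw [div_mul_eq_mul_div, div_le_div_iff₀ (by positivity) (by positivity)]
    nlinarith
  rw [e]
  refine (norm_add_le _ _).trans_lt ?_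
  have := norm_add_le (inner ℂ (flow T χ₀) Do) (inner ℂ (flow T χ₀) Di)
  linarith

/-! ### The double Duhamel argument -/

theorem integral_one_add_mul_rpow_le {p l L : ℝ} (hp : 1 < p) (hl : 0 < l) (hL : 0 ≤ L) :
    ∫ a in (0 : ℝ)..L, (1 + l * a) ^ (-p) ≤ l⁻¹ / (p - 1) := by
  rw [intervalIntegral.integral_comp_add_mul (fun x : ℝ => x ^ (-p)) hl.ne' 1]
  have h1 : (1 : ℝ) ≤ 1 + l * L := by nlinarith
  rw [mul_zero, add_zero, integral_rpow (Or.inr ⟨by linarith, fun h => by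
    rw [uIcc_of_le h1] at h
    linarith [h.1]⟩), Real.one_rpow, smul_eq_mul, div_eq_mul_inv l⁻¹]
  refine mul_le_mul_of_nonneg_left ?_ (by positivity)
  have h2 : 0 ≤ (1 + l * L) ^ (-p + 1) := by positivity
  rw [← neg_div_neg_eq, ← one_div]
  rw [show -(-p + 1) = p - 1 by ring]
  gcongr
  linarith

/-- A kernel bounded by `P σ^{-γ}` and by `Q l^γ` is dominated, at `σ = a + b`, by a product of
functions of `a` and of `b`. -/
theorem le_mul_rpow_of_le {q P Q l a b γ : ℝ} (hP : 0 ≤ P) (hl : 0 < l) (ha : 0 ≤ a)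
    (hb : 0 ≤ b) (hab : 0 < a + b) (hγ : 0 < γ) (h1 : q ≤ P * (a + b) ^ (-γ))
    (h2 : q ≤ Q * l ^ γ) :
    q ≤ max P Q * 2 ^ γ * l ^ γ * ((1 + l * a) ^ (-(γ / 2)) * (1 + l * b) ^ (-(γ / 2))) := by
  have hm : 0 ≤ max P Q := hP.trans (le_max_left _ _)
  have ha1 : 0 < 1 + l * a := by positivity
  have hb1 : 0 < 1 + l * b := by positivity
  have hs1 : 0 < 1 + l * (a + b) := by positivity
  have k1 : (1 + l * (a + b)) ^ (-γ) ≤ (1 + l * a) ^ (-(γ / 2)) * (1 + l * b) ^ (-(γ / 2)) := by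
    rw [← Real.mul_rpow ha1.le hb1.le, show -γ = 2 * (-(γ / 2)) by ring, Real.rpow_mul hs1.le]
    refine Real.rpow_le_rpow_of_nonpos (by positivity) ?_ (by linarith)
    rw [Real.rpow_two]
    have : 0 ≤ l * a := by positivity
    have : 0 ≤ l * b := by positivity
    nlinarith
  have k2 : q ≤ max P Q * 2 ^ γ * l ^ γ * (1 + l * (a + b)) ^ (-γ) := by
    rcases le_total (l * (a + b)) 1 with h | h
    · refine h2.trans ?_
      have : (2 : ℝ) ^ (-γ) ≤ (1 + l * (a + b)) ^ (-γ) :=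
        Real.rpow_le_rpow_of_nonpos hs1 (by linarith) (by linarith)
      calc Q * l ^ γ ≤ max P Q * l ^ γ := by gcongr; exact le_max_right _ _
        _ = max P Q * 2 ^ γ * l ^ γ * 2 ^ (-γ) := by
            rw [Real.rpow_neg two_pos.le]
            field_simp
        _ ≤ _ := by gcongr
    · refine h1.trans ?_
      have : (2 * (l * (a + b))) ^ (-γ) ≤ (1 + l * (a + b)) ^ (-γ) :=
        Real.rpow_le_rpow_of_nonpos hs1 (by linarith) (by linarith)
      calc P * (a + b) ^ (-γ) ≤ max P Q * (a + b) ^ (-γ) := by gcongr; exact le_max_left _ _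
        _ = max P Q * 2 ^ γ * l ^ γ * (2 * (l * (a + b))) ^ (-γ) := by
            rw [Real.mul_rpow two_pos.le (by positivity), Real.mul_rpow hl.le hab.le,
              Real.rpow_neg two_pos.le, Real.rpow_neg hl.le]
            field_simp
        _ ≤ _ := by gcongr
  refine k2.trans ?_
  gcongr

theorem norm_inner_integral_le {a b : ℝ} (hab : a ≤ b) {f : ℝ → L2 d} {w : L2 d} {g : ℝ → ℝ}
    (hf : IntervalIntegrable f volume a b) (hg : IntervalIntegrable g volume a b)
    (h : ∀ᵐ τ ∂volume.restrict (Ioc a b), ‖inner ℂ w (f τ)‖ ≤ g τ) :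
    ‖inner ℂ w (∫ τ in a..b, f τ)‖ ≤ ∫ τ in a..b, g τ := by
  rw [intervalIntegral.integral_of_le hab, intervalIntegral.integral_of_le hab,
    ← integral_inner hf.1]
  exact norm_integral_le_of_norm_le hg.1 h

/-- If the Duhamel integrals from time `T` converge weakly to `X` as `|T| → ∞`, then `‖X‖²` is a
limit of pairings of Duhamel integrals from the past and from the future; it is bounded as soon as
the integrand of these pairings decays. -/
theorem norm_le_of_tendsto_duhamelInt {Ψ : ℝ → L2 d} (hΨ : ∀ a b, IntervalIntegrable Ψ volume a b)
    {t : ℝ} {X : L2 d} (hX : ∀ χ : L2 d,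
      Tendsto (fun T => inner ℂ χ (duhamelInt Ψ T t)) (cocompact ℝ) (𝓝 (inner ℂ χ X)))
    {k : ℝ → ℝ} (hk : ContinuousOn k (Ici 0)) (hk0 : ∀ a, 0 ≤ a → 0 ≤ k a) {J : ℝ}
    (hJ : ∀ L, 0 ≤ L → ∫ a in (0 : ℝ)..L, k a ≤ J)
    (hle : ∀ᵐ τ', ∀ᵐ τ, τ < t → t < τ' →
      ‖inner ℂ (Ψ τ') (flow (τ' - τ) (Ψ τ))‖ ≤ k (τ' - t) * k (t - τ)) : ‖X‖ ≤ J := by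
  have hJ0 : 0 ≤ J := by simpa using hJ 0 le_rfl
  have hfl : ∀ a b, IntervalIntegrable (fun τ => flow (t - τ) (Ψ τ)) volume a b := fun a b =>
    intervalIntegrable_flow (hΨ a b) (by fun_prop)
  have hki : ∀ L, 0 ≤ L → IntervalIntegrable k volume 0 L := fun L hL =>
    (hk.mono (by rw [uIcc_of_le hL]; exact Icc_subset_Ici_self)).intervalIntegrable
  have key : ∀ T T', T ≤ t → t ≤ T' →
      ‖inner ℂ (duhamelInt Ψ T' t) (duhamelInt Ψ T t)‖ ≤ J * J := by
    intro T T' hT hT'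
    have e' : duhamelInt Ψ T' t = -∫ τ in t..T', flow (t - τ) (Ψ τ) :=
      intervalIntegral.integral_symm _ _
    set Y := duhamelInt Ψ T t with hY
    have i1 : IntervalIntegrable (fun τ => k (τ - t)) volume t T' := by
      have := (hki (T' - t) (by linarith)).comp_sub_right t
      simpa using this
    have i2 : IntervalIntegrable (fun τ => k (t - τ)) volume T t := by
      have := (hki (t - T) (by linarith)).comp_sub_left t
      simpa using this.symm
    have j1 : ∫ τ in t..T', k (τ - t) ≤ J := by
      rw [intervalIntegral.integral_comp_sub_right k t, sub_self]
      exact hJ _ (by linarith)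
    have j2 : ∫ τ in T..t, k (t - τ) ≤ J := by
      rw [intervalIntegral.integral_comp_sub_left k t, sub_self]
      exact hJ _ (by linarith)
    rw [e', inner_neg_left, norm_neg, norm_inner_symm]
    refine (norm_inner_integral_le hT' (hfl t T') (i1.mul_const J) ?_).trans ?_
    · filter_upwards [ae_restrict_of_ae hle, ae_restrict_mem measurableSet_Ioc] with τ' h1 h2
      rw [norm_inner_symm]
      refine (norm_inner_integral_le hT (hfl T t) (i2.const_mul (k (τ' - t))) ?_).trans ?_
      · have hne : ∀ᵐ τ : ℝ, τ ≠ t := by simp [ae_iff]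
        filter_upwards [ae_restrict_of_ae h1, ae_restrict_mem measurableSet_Ioc,
          ae_restrict_of_ae hne] with τ h3 h4 h5
        rw [inner_flow_flow, sub_sub_sub_cancel_left]
        exact h3 (lt_of_le_of_ne h4.2 h5) h2.1
      · rw [intervalIntegral.integral_const_mul]
        exact mul_le_mul_of_nonneg_left j2 (hk0 _ (by linarith [h2.1]))
    · rw [intervalIntegral.integral_mul_const]
      exact mul_le_mul_of_nonneg_right j1 hJ0
  have key2 : ∀ T, T ≤ t → ‖inner ℂ X (duhamelInt Ψ T t)‖ ≤ J * J := by
    intro T hT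
    rw [norm_inner_symm]
    refine le_of_tendsto ((hX (duhamelInt Ψ T t)).norm.mono_left atTop_le_cocompact) ?_
    filter_upwards [eventually_ge_atTop t] with T' hT'
    rw [norm_inner_symm]
    exact key T T' hT hT'
  have key3 : ‖inner ℂ X X‖ ≤ J * J := by
    refine le_of_tendsto ((hX X).norm.mono_left atBot_le_cocompact) ?_
    filter_upwards [eventually_le_atBot t] with T hT
    exact key2 T hT
  rw [inner_self_eq_norm_sq_to_K, norm_pow, RCLike.norm_ofReal, abs_norm] at key3
  nlinarith [norm_nonneg X]

theorem flow_fourierMulL {m : Space d → ℂ} (hm : MemLp m ⊤) (t : ℝ) (f : L2 d) :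
    flow t (fourierMulL m f) = fourierMulL m (flow t f) := by
  rw [flow, fourierMulL_fourierMulL (memLp_propSym t) hm, fourierMulL_fourierMulL hm
    (memLp_propSym t)]
  simp only [mul_comm]

theorem inner_smul_sub_flow {n : Space d → ℂ} (hn : MemLp n ⊤) (χ X f : L2 d) (t T : ℝ) :
    inner ℂ χ (-Complex.I • (X - flow (t - T) (fourierMulL n f))) = inner ℂ χ (-Complex.I • X) +
      Complex.I * inner ℂ (flow T (flow (-t) (fourierMulL (fun η => (starRingEnd ℂ) (n η)) χ)))
        f := by
  have h1 : inner ℂ (flow T (flow (-t) (fourierMulL (fun η => (starRingEnd ℂ) (n η)) χ))) f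
      = inner ℂ χ (flow (t - T) (fourierMulL n f)) := by
    have hnc : MemLp (fun η => (starRingEnd ℂ) (n η)) ⊤ := hn.star
    rw [flow_flow, inner_flow_left, inner_fourierMulL_left hnc]
    simp only [Complex.conj_conj]
    rw [flow_fourierMulL hn]
    congr 3
    ring
  rw [h1, inner_smul_right, inner_smul_right, inner_sub_right]
  ring

namespace IsL2Solution

variable {u : ℝ → Space d → ℂ} {v : ℝ × Space d → ℂ} {U : ℝ → 𝓢'(Space d, ℂ)} {D : ℝ → L2 d}

theorem fourierMulL_duhamel (hs : IsL2Solution u v U D) (hd : 9 ≤ d) {m : Space d → ℂ}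
    (hm : MemLp m ⊤) (hml : MemLp (fun η => m η * ((lapSym η : ℝ) : ℂ)⁻¹) ⊤) (T t : ℝ) :
    duhamelInt (fun τ => fourierMulL m (forcing v τ)) T t
      = -Complex.I • (fourierMulL (fun η => m η * ((lapSym η : ℝ) : ℂ)⁻¹) (D t) -
        flow (t - T) (fourierMulL (fun η => m η * ((lapSym η : ℝ) : ℂ)⁻¹) (D T))) := by
  have e : duhamelInt (fun τ => fourierMulL m (forcing v τ)) T t
      = fourierMulL m (duhamelInt (forcing v) T t) := by
    unfold duhamelInt
    rw [← ContinuousLinearMap.intervalIntegral_comp_comm _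
      (intervalIntegrable_flow (hs.intervalIntegrable hd T t) (by fun_prop))]
    simp only [flow_fourierMulL hm]
  rw [e]
  set n : Space d → ℂ := fun η => m η * ((lapSym η : ℝ) : ℂ)⁻¹ with hn
  refine L2_ext_fourier ?_
  rw [fourier_smul_L2, fourier_sub_L2]
  filter_upwards [fourierMulL_ae_eq hm (duhamelInt (forcing v) T t), fourierMulL_ae_eq hml (D t),
    fourierMulL_ae_eq hml (D T), flow_ae_eq (t - T) (fourierMulL n (D T)),
    Lp.coeFn_smul (-Complex.I) ((𝓕 (fourierMulL n (D t)) : L2 d) - 𝓕 (flow (t - T)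
      (fourierMulL n (D T)))), Lp.coeFn_sub (𝓕 (fourierMulL n (D t)) : L2 d) (𝓕 (flow (t - T)
      (fourierMulL n (D T)))), hs.duhamel T t, ae_lapSym_pos (by omega : 1 ≤ d)]
    with η h1 h2 h3 h4 h5 h6 h7 h8
  have h9 : ((lapSym η : ℝ) : ℂ) ≠ 0 := by exact_mod_cast h8.ne'
  rw [h5, Pi.smul_apply, h6, Pi.sub_apply, h1, h2, h4, h3, h7, hn, smul_eq_mul]
  field_simp
  ring_nf
  rw [Complex.I_sq]
  ring

theorem tendsto_inner_duhamelInt (hs : IsL2Solution u v U D) (hd : 9 ≤ d) {m : Space d → ℂ}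
    (hm : MemLp m ⊤) (hml : MemLp (fun η => m η * ((lapSym η : ℝ) : ℂ)⁻¹) ⊤)
    (hw : ∀ χ : L2 d, Tendsto (fun T => inner ℂ (flow T χ) (D T)) (cocompact ℝ) (𝓝 0))
    (t : ℝ) (χ : L2 d) :
    Tendsto (fun T => inner ℂ χ (duhamelInt (fun τ => fourierMulL m (forcing v τ)) T t))
      (cocompact ℝ) (𝓝 (inner ℂ χ (-Complex.I •
        fourierMulL (fun η => m η * ((lapSym η : ℝ) : ℂ)⁻¹) (D t)))) := by
  simp only [hs.fourierMulL_duhamel hd hm hml, inner_smul_sub_flow hml]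
  have := ((hw (flow (-t) (fourierMulL (fun η => (starRingEnd ℂ)
    (m η * ((lapSym η : ℝ) : ℂ)⁻¹)) χ))).const_mul Complex.I).const_add (inner ℂ χ (-Complex.I •
      fourierMulL (fun η => m η * ((lapSym η : ℝ) : ℂ)⁻¹) (D t)))
  simpa only [mul_zero, add_zero] using this

end IsL2Solution

/-- The measure of `{η : |2πη| ≤ 2}`. -/
def bandConst (d : ℕ) : ℝ := (Real.pi ^ d)⁻¹ * (volume (Metric.ball (0 : Space d) 1)).toReal

theorem bandConst_pos : 0 < bandConst d := by
  unfold bandConst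
  have := ENNReal.toReal_pos (Metric.measure_ball_pos volume (0 : Space d) one_pos).ne'
    measure_ball_lt_top.ne
  positivity

/-- The symbol of the propagator, cut off to frequencies `|ξ| ≤ 2N`. -/
def bandPropSym (N t : ℝ) : Space d → ℂ :=
  {η : Space d | ‖(2 * Real.pi) • η‖ ≤ 2 * N}.indicator (propSym t)

theorem measurableSet_band (N : ℝ) : MeasurableSet {η : Space d | ‖(2 * Real.pi) • η‖ ≤ 2 * N} :=
  measurableSet_le (by fun_prop) measurable_const

theorem measurable_bandPropSym (N t : ℝ) : Measurable (bandPropSym (d := d) N t) :=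
  (continuous_propSym t).measurable.indicator (measurableSet_band N)

theorem norm_bandPropSym (N t : ℝ) (η : Space d) : ‖bandPropSym N t η‖
    = {η : Space d | ‖(2 * Real.pi) • η‖ ≤ 2 * N}.indicator (fun _ => (1 : ℝ)) η := by
  unfold bandPropSym
  rw [norm_indicator_eq_indicator_norm]
  simp only [norm_propSym]

theorem norm_bandPropSym_le (N t : ℝ) (η : Space d) : ‖bandPropSym N t η‖ ≤ 1 := by
  rw [norm_bandPropSym]
  exact indicator_le_self' (fun _ _ => zero_le_one) η

theorem band_eq (N : ℝ) : {η : Space d | ‖(2 * Real.pi) • η‖ ≤ 2 * N}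
    = Metric.closedBall 0 (N / Real.pi) := by
  ext η
  have := Real.pi_pos
  rw [mem_ofPred_eq, mem_closedBall_zero_iff, norm_smul, Real.norm_of_nonneg Real.two_pi_pos.le,
    le_div_iff₀ this]
  constructor <;> intro h <;> linarith

theorem volume_band {N : ℝ} (hN : 0 < N) :
    volume {η : Space d | ‖(2 * Real.pi) • η‖ ≤ 2 * N}
      = ENNReal.ofReal ((N / Real.pi) ^ d) * volume (Metric.ball (0 : Space d) 1) := by
  have := Real.pi_pos
  rw [band_eq, Measure.addHaar_closedBall _ _ (by positivity), finrank_euclideanSpace_fin]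

theorem integrable_bandPropSym {N : ℝ} (hN : 0 < N) (t : ℝ) :
    Integrable (bandPropSym (d := d) N t) := by
  have hfin : volume {η : Space d | ‖(2 * Real.pi) • η‖ ≤ 2 * N} ≠ ∞ := by
    rw [volume_band hN]
    exact ENNReal.mul_ne_top ENNReal.ofReal_ne_top measure_ball_lt_top.ne
  refine Integrable.mono' (g := {η : Space d | ‖(2 * Real.pi) • η‖ ≤ 2 * N}.indicator
    fun _ => (1 : ℝ)) ?_ (measurable_bandPropSym N t).aestronglyMeasurable
    (ae_of_all _ fun η => (norm_bandPropSym N t η).le)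
  exact (integrable_indicator_iff (measurableSet_band N)).2 (integrableOn_const hfin)

theorem integral_norm_bandPropSym {N : ℝ} (hN : 0 < N) (t : ℝ) :
    ∫ η : Space d, ‖bandPropSym N t η‖ = bandConst d * N ^ d := by
  have := Real.pi_pos
  simp only [norm_bandPropSym]
  rw [integral_indicator (measurableSet_band N), setIntegral_const, Measure.real, volume_band hN,
    ENNReal.toReal_mul, ENNReal.toReal_ofReal (by positivity), bandConst, smul_eq_mul, div_pow]
  field_simp

theorem flow_fourierMulL_eq_band {m : Space d → ℂ} (hm : MemLp m ⊤) {N : ℝ}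
    (hsupp : ∀ η, m η ≠ 0 → ‖(2 * Real.pi) • η‖ ≤ 2 * N) (t : ℝ) (f : L2 d) :
    flow t (fourierMulL m f) = fourierMulL (bandPropSym N t) (fourierMulL m f) := by
  rw [flow, fourierMulL_fourierMulL (memLp_propSym t) hm, fourierMulL_fourierMulL
    (memLp_top_of_bound' (measurable_bandPropSym N t) (norm_bandPropSym_le N t)) hm]
  congr 2
  funext η
  by_cases h : m η = 0
  · rw [h, mul_zero, mul_zero]
  · have hmem : η ∈ {η : Space d | ‖(2 * Real.pi) • η‖ ≤ 2 * N} := hsupp η h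
    rw [bandPropSym, indicator_of_mem hmem]

/-- The decay exponent `(d/4)(2/r - 1)` of the propagator from `L^r` to its dual. -/
def decayExp (d : ℕ) (r : ℝ) : ℝ := (d : ℝ) / 4 * (2 / r - 1)

/-- Constant in `IsL2Solution.norm_fourierMulL_le`. -/
def decayConst (d : ℕ) (r : ℝ) : ℝ :=
  √(max (flowConst d ^ (2 / r - 1)) (bandConst d ^ (2 / r - 1)) * 2 ^ decayExp d r) *
    (decayExp d r / 2 - 1)⁻¹

/-- Two bounds for the propagator on functions localized to frequencies `|ξ| ~ N`: dispersive decay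
for long times, Bernstein's inequality for short times. -/
theorem norm_inner_flow_fourierMulL_le (hd : 3 ≤ d) {r : ℝ} (hr1 : 1 < r) (hr2 : r < 2)
    {m : Space d → ℂ} (hm : MemLp m ⊤) {N : ℝ} (hN : 0 < N)
    (hsupp : ∀ η, m η ≠ 0 → ‖(2 * Real.pi) • η‖ ≤ 2 * N) {f g : L2 d} {β : ℝ} (hβ : 0 ≤ β)
    (hf : MemLp (fourierMulL m f) (ENNReal.ofReal r)) (hg : MemLp g (ENNReal.ofReal r))
    (hfβ : rNorm volume r (fourierMulL m f) ≤ β) (hgβ : rNorm volume r g ≤ β) {a b : ℝ}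
    (ha : 0 ≤ a) (hb : 0 ≤ b) (hab : 0 < a + b) :
    ‖inner ℂ g (flow (a + b) (fourierMulL m f))‖
      ≤ (max (flowConst d ^ (2 / r - 1)) (bandConst d ^ (2 / r - 1)) * 2 ^ decayExp d r *
        (N ^ 4) ^ decayExp d r * ((1 + N ^ 4 * a) ^ (-(decayExp d r / 2)) *
        (1 + N ^ 4 * b) ^ (-(decayExp d r / 2)))) * (β * β) := by
  have hθ : 0 < 2 / r - 1 := by
    rw [sub_pos, lt_div_iff₀ (by linarith)]
    linarith
  have hγ : 0 < decayExp d r := by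
    have : (3 : ℝ) ≤ d := by exact_mod_cast hd
    unfold decayExp
    positivity
  have hrr : rNorm volume r (fourierMulL m f) * rNorm volume r g ≤ β * β :=
    mul_le_mul hfβ hgβ (rNorm_nonneg _ _) hβ
  have hfc := flowConst_pos (d := d)
  have hbc := bandConst_pos (d := d)
  have h1 : ‖inner ℂ g (flow (a + b) (fourierMulL m f))‖
      ≤ (flowConst d ^ (2 / r - 1) * (a + b) ^ (-decayExp d r)) * (β * β) := by
    refine (norm_inner_flow_le hd hab.ne' hr1 hr2 hf hg).trans ?_
    rw [abs_of_pos hab, Real.mul_rpow hfc.le (by positivity), ← Real.rpow_mul hab.le,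
      show -(d : ℝ) / 4 * (2 / r - 1) = -decayExp d r by
        unfold decayExp
        ring]
    gcongr
  have h2 : ‖inner ℂ g (flow (a + b) (fourierMulL m f))‖
      ≤ (bandConst d ^ (2 / r - 1) * (N ^ 4) ^ decayExp d r) * (β * β) := by
    rw [flow_fourierMulL_eq_band hm hsupp]
    refine (norm_inner_fourierMulL_le (measurable_bandPropSym N _) (norm_bandPropSym_le N _)
      (integrable_bandPropSym hN _) (by positivity) (integral_norm_bandPropSym hN _).le hr1 hr2
      hf hg).trans ?_
    rw [Real.mul_rpow hbc.le (by positivity), ← Real.rpow_natCast N d, ← Real.rpow_natCast N 4,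
      ← Real.rpow_mul hN.le, ← Real.rpow_mul hN.le,
      show ((4 : ℕ) : ℝ) * decayExp d r = d * (2 / r - 1) by
        unfold decayExp
        push_cast
        ring]
    gcongr
  rcases hβ.eq_or_lt with h0 | h0
  · rw [← h0] at h1 ⊢
    simpa using h1
  · have hβ2 : 0 < β * β := by positivity
    rw [← div_le_iff₀ hβ2] at h1 h2 ⊢
    exact le_mul_rpow_of_le (by positivity) (by positivity) ha hb hab hγ h1 h2

namespace IsL2Solution

variable {u : ℝ → Space d → ℂ} {v : ℝ × Space d → ℂ} {U : ℝ → 𝓢'(Space d, ℂ)} {D : ℝ → L2 d}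

/-- Frequency-localized decay: if the localized nonlinearity is bounded by `β` in `L^r`, uniformly in
time, then the localized solution is `O(N^{s₀} β)` in `L²`, with `s₀ = d/r - (d+8)/2`. -/
theorem norm_fourierMulL_le (hs : IsL2Solution u v U D) (hd : 9 ≤ d)
    (hw : ∀ χ : L2 d, Tendsto (fun T => inner ℂ (flow T χ) (D T)) (cocompact ℝ) (𝓝 0))
    {r : ℝ} (hr1 : 1 < r) (hr2 : r < 2 * (d : ℝ) / (d + 8)) {m : Space d → ℂ} (hm : MemLp m ⊤)
    (hml : MemLp (fun η => m η * ((lapSym η : ℝ) : ℂ)⁻¹) ⊤) {N : ℝ} (hN : 0 < N)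
    (hsupp : ∀ η, m η ≠ 0 → ‖(2 * Real.pi) • η‖ ≤ 2 * N) {β : ℝ} (hβ : 0 ≤ β)
    (hΨ : ∀ᵐ τ, MemLp (fourierMulL m (forcing v τ)) (ENNReal.ofReal r) ∧
      rNorm volume r (fourierMulL m (forcing v τ)) ≤ β) (t : ℝ) :
    ‖fourierMulL (fun η => m η * ((lapSym η : ℝ) : ℂ)⁻¹) (D t)‖
      ≤ decayConst d r * N ^ ((d : ℝ) / r - ((d : ℝ) + 8) / 2) * β := by
  have h9 : (9 : ℝ) ≤ d := by exact_mod_cast hd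
  have hr0 : 0 < r := by linarith
  have hr2' : r < 2 := by
    refine hr2.trans_le ?_
    rw [div_le_iff₀ (by linarith)]
    linarith
  set γ := decayExp d r with hγ
  have hγ2 : 2 < γ := by
    rw [hγ, decayExp]
    rw [lt_div_iff₀ (by linarith)] at hr2
    have : (d : ℝ) / 4 * (2 / r - 1) - 2 = (2 * d - r * (d + 8)) / (4 * r) := by
      field_simp
      ring
    have h2 : 0 < (2 * d - r * (d + 8)) / (4 * r) := div_pos (by linarith) (by linarith)
    linarith
  set l : ℝ := N ^ 4 with hl
  have hl0 : 0 < l := by positivity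
  set M := max (flowConst d ^ (2 / r - 1)) (bandConst d ^ (2 / r - 1)) * 2 ^ γ with hM
  have hfc := flowConst_pos (d := d)
  have hM0 : 0 ≤ M := by
    have : 0 ≤ max (flowConst d ^ (2 / r - 1)) (bandConst d ^ (2 / r - 1)) :=
      le_max_of_le_left (by positivity)
    positivity
  set κ := √M * l ^ (γ / 2) * β with hκ
  have hκ0 : 0 ≤ κ := by positivity
  have hκ2 : κ * κ = M * l ^ γ * (β * β) := by
    have e1 : √M * √M = M := Real.mul_self_sqrt hM0
    have e2 : l ^ (γ / 2) * l ^ (γ / 2) = l ^ γ := by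
      rw [← Real.rpow_add hl0, add_halves]
    calc κ * κ = (√M * √M) * (l ^ (γ / 2) * l ^ (γ / 2)) * (β * β) := by
          rw [hκ]
          ring
      _ = _ := by rw [e1, e2]
  have hi : ∀ a b, IntervalIntegrable (fun τ => fourierMulL m (forcing v τ)) volume a b :=
    fun a b => ⟨(fourierMulL m).integrable_comp (hs.intervalIntegrable hd a b).1,
      (fourierMulL m).integrable_comp (hs.intervalIntegrable hd a b).2⟩
  have hmain := norm_le_of_tendsto_duhamelInt hi (hs.tendsto_inner_duhamelInt hd hm hml hw t)
    (k := fun a => κ * (1 + l * a) ^ (-(γ / 2))) (J := κ * (l⁻¹ / (γ / 2 - 1))) ?_ ?_ ?_ ?_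
  · rw [norm_smul, norm_neg, Complex.norm_I, one_mul] at hmain
    refine hmain.trans (le_of_eq ?_)
    have e3 : N ^ ((d : ℝ) / r - ((d : ℝ) + 8) / 2) = l ^ (γ / 2) * l⁻¹ := by
      rw [← Real.rpow_neg_one, ← Real.rpow_add hl0, hl, ← Real.rpow_natCast N 4,
        ← Real.rpow_mul hN.le]
      congr 1
      rw [hγ, decayExp]
      push_cast
      field_simp
      ring
    rw [e3, hκ, decayConst, ← hγ, ← hM]
    ring
  · refine continuousOn_const.mul (ContinuousOn.rpow_const (by fun_prop) fun a ha => Or.inl ?_)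
    have : 0 ≤ l * a := mul_nonneg hl0.le ha
    positivity
  · intro a ha
    positivity
  · intro L hL
    rw [intervalIntegral.integral_const_mul]
    exact mul_le_mul_of_nonneg_left (integral_one_add_mul_rpow_le (by linarith) hl0 hL) hκ0
  · filter_upwards [hΨ] with τ' h1
    filter_upwards [hΨ] with τ h2 h3 h4
    have := norm_inner_flow_fourierMulL_le (by omega : 3 ≤ d) hr1 hr2' hm hN hsupp hβ h2.1 h1.1
      h2.2 h1.2 (sub_nonneg.2 h4.le) (sub_nonneg.2 h3.le) (by linarith : 0 < τ' - t + (t - τ))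
    rw [sub_add_sub_cancel] at this
    refine this.trans (le_of_eq ?_)
    rw [← hγ, ← hl, ← hM]
    linear_combination -((1 + l * (τ' - t)) ^ (-(γ / 2)) * (1 + l * (t - τ)) ^ (-(γ / 2))) * hκ2

end IsL2Solution

/-! ### Littlewood–Paley decomposition -/

/-- The symbol of `lpProj φ N`, in the frequency variable of Mathlib's Fourier transform. -/
def lpSym (φ : Space d → ℝ) (N : ℝ) (η : Space d) : ℂ :=
  ((φ (N⁻¹ • (2 * Real.pi) • η) - φ ((2 / N) • (2 * Real.pi) • η) : ℝ) : ℂ)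

namespace IsBump

variable {φ : Space d → ℝ}

theorem hasCompactSupport (hφ : IsBump φ) : HasCompactSupport φ :=
  HasCompactSupport.intro (isCompact_closedBall (0 : Space d) (11 / 10)) fun ξ hξ =>
    hφ.support ξ (by simpa using hξ)

theorem exists_bound (hφ : IsBump φ) : ∃ C, 0 ≤ C ∧ ∀ ξ, |φ ξ| ≤ C := by
  obtain ⟨C, hC⟩ := hφ.hasCompactSupport.exists_bound_of_continuous hφ.smooth.continuous
  exact ⟨C, (norm_nonneg _).trans (hC 0), hC⟩

theorem continuous_lpSym (hφ : IsBump φ) (N : ℝ) : Continuous (lpSym φ N) := by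
  have := hφ.smooth.continuous
  unfold lpSym
  fun_prop

theorem hasTemperateGrowth_lpSym (hφ : IsBump φ) {N : ℝ} (hN : 0 < N) :
    (lpSym φ N).HasTemperateGrowth := by
  have key : ∀ c : ℝ, c ≠ 0 →
      (fun η : Space d => φ (c • (2 * Real.pi) • η)).HasTemperateGrowth := by
    intro c hc
    have hne : c * (2 * Real.pi) ≠ 0 := mul_ne_zero hc Real.two_pi_pos.ne'
    simp only [smul_smul]
    refine HasCompactSupport.hasTemperateGrowth
      (hφ.hasCompactSupport.comp_smul hne) (hφ.smooth.comp (contDiff_const_smul _))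
  have h1 := (key N⁻¹ (inv_ne_zero hN.ne')).sub (key (2 / N) (by positivity))
  exact Function.HasTemperateGrowth.comp (g := Complex.ofReal) (by fun_prop) h1

theorem lpSym_eq_zero_of_lt (hφ : IsBump φ) {N : ℝ} (hN : 0 < N) {η : Space d}
    (h : 11 / 10 * N < ‖(2 * Real.pi) • η‖) : lpSym φ N η = 0 := by
  unfold lpSym
  rw [hφ.support, hφ.support]
  · simp
  · rw [norm_smul, Real.norm_of_nonneg (by positivity), div_mul_eq_mul_div, lt_div_iff₀ hN]
    linarith [norm_nonneg ((2 * Real.pi) • η)]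
  · rw [norm_smul, Real.norm_of_nonneg (by positivity), inv_mul_eq_div, lt_div_iff₀ hN]
    linarith

theorem lpSym_eq_zero_of_le (hφ : IsBump φ) {N : ℝ} (hN : 0 < N) {η : Space d}
    (h : ‖(2 * Real.pi) • η‖ ≤ N / 2) : lpSym φ N η = 0 := by
  unfold lpSym
  rw [hφ.one, hφ.one]
  · simp
  · rw [norm_smul, Real.norm_of_nonneg (by positivity), div_mul_eq_mul_div, div_le_iff₀ hN]
    linarith [norm_nonneg ((2 * Real.pi) • η)]
  · rw [norm_smul, Real.norm_of_nonneg (by positivity), inv_mul_eq_div, div_le_iff₀ hN]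
    linarith [norm_nonneg ((2 * Real.pi) • η)]

/-- The symbols at two neighbouring scales add up to one on a dyadic shell. -/
theorem lpSym_add_lpSym (hφ : IsBump φ) {N : ℝ} (hN : 0 < N) {η : Space d}
    (h1 : N < ‖(2 * Real.pi) • η‖) (h2 : ‖(2 * Real.pi) • η‖ ≤ 2 * N) :
    lpSym φ N η + lpSym φ (2 * N) η = 1 := by
  unfold lpSym
  have e1 : (2 / (2 * N)) = N⁻¹ := by field_simp
  rw [e1, hφ.support ((2 / N) • _), hφ.one ((2 * N)⁻¹ • _)]
  · push_cast
    ring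
  · rw [norm_smul, Real.norm_of_nonneg (by positivity), inv_mul_eq_div, div_le_iff₀ (by positivity)]
    linarith
  · rw [norm_smul, Real.norm_of_nonneg (by positivity), div_mul_eq_mul_div, lt_div_iff₀ hN]
    linarith

theorem memLp_lpSym (hφ : IsBump φ) (N : ℝ) : MemLp (lpSym φ N) ⊤ := by
  obtain ⟨C, -, hC⟩ := hφ.exists_bound
  refine memLp_top_of_bound' (hφ.continuous_lpSym N).measurable (C := C + C) fun η => ?_
  rw [lpSym, Complex.norm_real]
  exact (norm_sub_le _ _).trans (add_le_add (hC _) (hC _))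

theorem memLp_lpSym_mul_inv (hφ : IsBump φ) {N : ℝ} (hN : 0 < N) :
    MemLp (fun η => lpSym φ N η * ((lapSym η : ℝ) : ℂ)⁻¹) ⊤ := by
  obtain ⟨C, hC0, hC⟩ := hφ.exists_bound
  refine memLp_top_of_bound' (C := (C + C) * (N / 2) ^ (-2 : ℤ)) ?_ fun η => ?_
  · exact (hφ.continuous_lpSym N).measurable.mul
      (Complex.measurable_ofReal.comp continuous_lapSym.measurable).inv
  · rcases le_or_gt ‖(2 * Real.pi) • η‖ (N / 2) with h | h
    · rw [hφ.lpSym_eq_zero_of_le hN h, zero_mul, norm_zero]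
      positivity
    · rw [norm_mul, norm_inv, Complex.norm_real, Real.norm_of_nonneg (lapSym_nonneg η)]
      have h1 : ‖lpSym φ N η‖ ≤ C + C := by
        rw [lpSym, Complex.norm_real]
        exact (norm_sub_le _ _).trans (add_le_add (hC _) (hC _))
      have h2 : (lapSym η)⁻¹ ≤ (N / 2) ^ (-2 : ℤ) := by
        rw [zpow_neg, lapSym]
        norm_cast
        gcongr
      gcongr
      have := lapSym_nonneg η
      positivity

end IsBump

theorem eLpNorm_fourierMulL_le_opNorm {m : Space d → ℂ}
    (hm : (fun η => m ((2 * Real.pi) • η)).HasTemperateGrowth)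
    (hb : MemLp (fun η => m ((2 * Real.pi) • η)) ⊤) {f : L2 d} {g : Space d → ℂ}
    (hg : g =ᵐ[volume] f) (r : ℝ≥0∞) :
    eLpNorm (fourierMulL (fun η => m ((2 * Real.pi) • η)) f) r volume
      ≤ opNorm (multiplier m) r g := by
  refine le_iInf₂ ?_
  rintro w ⟨T, hT, hw⟩
  have e : T = (f : 𝓢'(Space d, ℂ)) := (hT.congr hg).unique_right (represents_L2 f)
  rw [e, multiplier_L2 hm hb] at hw
  exact (eLpNorm_congr_ae ((represents_L2 _).ae_eq hw)).le

/-- Fourier transforms of functions in `L²`, localized to a dyadic shell, in terms of the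
Littlewood–Paley pieces at two neighbouring scales. -/
theorem lintegral_shell_le {φ : Space d → ℝ} (hφ : IsBump φ) (D : L2 d) (σ : ℝ) {N : ℝ}
    (hN : 0 < N) :
    ∫⁻ η in {η : Space d | N < ‖(2 * Real.pi) • η‖ ∧ ‖(2 * Real.pi) • η‖ ≤ 2 * N},
      ENNReal.ofReal (‖(2 * Real.pi) • η‖ ^ (2 * σ - 4)) * ‖(𝓕 D : L2 d) η‖ₑ ^ 2
      ≤ ENNReal.ofReal (2 * 2 ^ (2 * |σ|) * N ^ (2 * σ)) *
        (‖fourierMulL (fun η => lpSym φ N η * ((lapSym η : ℝ) : ℂ)⁻¹) D‖ₑ ^ 2 +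
        ‖fourierMulL (fun η => lpSym φ (2 * N) η * ((lapSym η : ℝ) : ℂ)⁻¹) D‖ₑ ^ 2) := by
  have hsq : ∀ f : L2 d, ‖f‖ₑ ^ 2 = ∫⁻ η, ‖(𝓕 f : L2 d) η‖ₑ ^ 2 := by
    intro f
    have : ‖f‖ₑ = ‖(𝓕 f : L2 d)‖ₑ := by
      rw [← ofReal_norm, ← ofReal_norm, Lp.norm_fourier_eq]
    rw [this, enorm_L2_eq, ← ENNReal.rpow_natCast, ← ENNReal.rpow_mul]
    norm_num
  have hmeas : ∀ f : L2 d, AEMeasurable (fun η => ‖(𝓕 f : L2 d) η‖ₑ ^ 2) volume := fun f =>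
    (Lp.aestronglyMeasurable (𝓕 f : L2 d)).enorm.pow_const 2
  set X := fourierMulL (fun η => lpSym φ N η * ((lapSym η : ℝ) : ℂ)⁻¹) D with hX
  set Y := fourierMulL (fun η => lpSym φ (2 * N) η * ((lapSym η : ℝ) : ℂ)⁻¹) D with hY
  rw [hsq X, hsq Y, ← lintegral_add_left' (hmeas X), ← lintegral_const_mul' _ _
    ENNReal.ofReal_ne_top]
  refine le_trans (lintegral_mono_ae ?_) (setLIntegral_le_lintegral
    {η : Space d | N < ‖(2 * Real.pi) • η‖ ∧ ‖(2 * Real.pi) • η‖ ≤ 2 * N} _)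
  have hms : MeasurableSet
      {η : Space d | N < ‖(2 * Real.pi) • η‖ ∧ ‖(2 * Real.pi) • η‖ ≤ 2 * N} :=
    MeasurableSet.inter (s₁ := {η : Space d | N < ‖(2 * Real.pi) • η‖})
      (s₂ := {η : Space d | ‖(2 * Real.pi) • η‖ ≤ 2 * N})
      (measurableSet_lt measurable_const (by fun_prop))
      (measurableSet_le (by fun_prop) measurable_const)
  filter_upwards [ae_restrict_mem hms,
    ae_restrict_of_ae (fourierMulL_ae_eq (hφ.memLp_lpSym_mul_inv hN) D),
    ae_restrict_of_ae (fourierMulL_ae_eq (hφ.memLp_lpSym_mul_inv (by positivity : 0 < 2 * N)) D)]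
    with η h1 h2 h3
  rw [hX, hY, h2, h3]
  obtain ⟨h4, h5⟩ := h1
  set ρ := ‖(2 * Real.pi) • η‖ with hρ
  have hρ0 : 0 < ρ := hN.trans h4
  set p := lpSym φ N η with hp
  set q := lpSym φ (2 * N) η with hq
  have hpq : p + q = 1 := hφ.lpSym_add_lpSym hN h4 h5
  have hpq2 : 1 ≤ 2 * (‖p‖ ^ 2 + ‖q‖ ^ 2) := by
    have h6 : (1 : ℝ) ≤ ‖p‖ + ‖q‖ := by
      calc (1 : ℝ) = ‖p + q‖ := by rw [hpq, norm_one]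
        _ ≤ _ := norm_add_le _ _
    nlinarith [sq_nonneg (‖p‖ - ‖q‖)]
  have hρσ : ρ ^ (2 * σ) ≤ 2 ^ (2 * |σ|) * N ^ (2 * σ) := by
    have h6 : 1 ≤ ρ / N := by
      rw [le_div_iff₀ hN]
      linarith
    have h7 : ρ / N ≤ 2 := by
      rwa [div_le_iff₀ hN]
    have h8 : (ρ / N) ^ (2 * σ) ≤ 2 ^ (2 * |σ|) :=
      (Real.rpow_le_rpow_of_exponent_le h6 (by linarith [le_abs_self σ])).trans
        (Real.rpow_le_rpow (by positivity) h7 (by positivity))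
    rw [Real.div_rpow hρ0.le hN.le, div_le_iff₀ (by positivity)] at h8
    exact h8
  set a := (𝓕 D : L2 d) η with ha
  have hl : ‖((lapSym η : ℝ) : ℂ)⁻¹‖ ^ 2 = ρ ^ (-4 : ℝ) := by
    rw [norm_inv, Complex.norm_real, Real.norm_of_nonneg (lapSym_nonneg η), lapSym, ← hρ,
      Real.rpow_neg hρ0.le]
    norm_cast
    rw [inv_pow, ← pow_mul]
  rw [← ofReal_norm, ← ofReal_norm, ← ofReal_norm, ← ENNReal.ofReal_pow (norm_nonneg _),
    ← ENNReal.ofReal_pow (norm_nonneg _), ← ENNReal.ofReal_pow (norm_nonneg _),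
    ← ENNReal.ofReal_add (by positivity) (by positivity), ← ENNReal.ofReal_mul (by positivity),
    ← ENNReal.ofReal_mul (by positivity)]
  refine ENNReal.ofReal_le_ofReal ?_
  rw [norm_mul, norm_mul, norm_mul, norm_mul, mul_pow, mul_pow, mul_pow, mul_pow, hl,
    sub_eq_add_neg, Real.rpow_add hρ0]
  calc ρ ^ (2 * σ) * ρ ^ (-4 : ℝ) * ‖a‖ ^ 2
      ≤ (2 ^ (2 * |σ|) * N ^ (2 * σ)) * ρ ^ (-4 : ℝ) * ‖a‖ ^ 2 * 1 := by
        rw [mul_one]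
        gcongr
    _ ≤ (2 ^ (2 * |σ|) * N ^ (2 * σ)) * ρ ^ (-4 : ℝ) * ‖a‖ ^ 2 *
        (2 * (‖p‖ ^ 2 + ‖q‖ ^ 2)) := by gcongr
    _ = _ := by ring

/-- Summation of bounds on Littlewood–Paley pieces over low frequencies. -/
theorem exists_hdot_bound {φ : Space d → ℝ} (hφ : IsBump φ) (hd : 1 ≤ d) {σ κ ε M K : ℝ}
    (hσ : σ ≤ 2) (hε : 0 < ε) (hκ : σ + κ = ε) :
    ∃ B : ℝ≥0∞, B < ∞ ∧ ∀ D : L2 d, ‖D‖ ≤ M → (∀ k : ℤ,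
      ‖fourierMulL (fun η => lpSym φ ((2 : ℝ) ^ k) η * ((lapSym η : ℝ) : ℂ)⁻¹) D‖
        ≤ K * ((2 : ℝ) ^ k) ^ κ) →
      (∫⁻ η, ENNReal.ofReal (‖(2 * Real.pi) • η‖ ^ (2 * σ - 4)) * ‖(𝓕 D : L2 d) η‖ₑ ^ 2)
        ^ (1 / 2 : ℝ) ≤ B := by
  set c : ℝ := 2 * 2 ^ (2 * |σ|) * (K ^ 2 * (1 + 2 ^ (2 * κ))) with hc
  have hc0 : 0 ≤ c := by positivity
  set ρ : ℝ := 2 ^ (-(2 * ε)) with hρ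
  have hρ0 : 0 < ρ := by positivity
  have hρ1 : ρ < 1 := Real.rpow_lt_one_of_one_lt_of_neg one_lt_two (by linarith)
  set S : ℝ≥0∞ := ENNReal.ofReal M ^ 2 + ∑' n : ℕ, ENNReal.ofReal (c * ρ ^ (n + 1)) with hS
  have hSfin : S < ∞ := by
    refine ENNReal.add_lt_top.2 ⟨by simp, ?_⟩
    have hsum : Summable fun n : ℕ => c * ρ ^ (n + 1) :=
      ((summable_nat_add_iff 1).2 (summable_geometric_of_lt_one hρ0.le hρ1)).mul_left c
    rw [← ENNReal.ofReal_tsum_of_nonneg (fun n => by positivity) hsum]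
    exact ENNReal.ofReal_lt_top
  refine ⟨S ^ (1 / 2 : ℝ), ENNReal.rpow_lt_top_of_nonneg (by norm_num) hSfin.ne, fun D hD hk => ?_⟩
  refine ENNReal.rpow_le_rpow ?_ (by norm_num)
  set f : Space d → ℝ≥0∞ := fun η =>
    ENNReal.ofReal (‖(2 * Real.pi) • η‖ ^ (2 * σ - 4)) * ‖(𝓕 D : L2 d) η‖ₑ ^ 2 with hf
  set A : Set (Space d) := {η | 1 ≤ ‖(2 * Real.pi) • η‖} with hA
  have hAm : MeasurableSet A := measurableSet_le measurable_const (by fun_prop)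
  set s : ℕ → Set (Space d) := fun n => {η | (2 : ℝ) ^ (-((n : ℤ) + 1)) < ‖(2 * Real.pi) • η‖ ∧
    ‖(2 * Real.pi) • η‖ ≤ 2 * (2 : ℝ) ^ (-((n : ℤ) + 1))} with hs
  -- high frequencies
  have h1 : ∫⁻ η in A, f η ≤ ENNReal.ofReal M ^ 2 := by
    have h2 : ‖D‖ₑ ^ 2 = ∫⁻ η, ‖(𝓕 D : L2 d) η‖ₑ ^ 2 := by
      have : ‖D‖ₑ = ‖(𝓕 D : L2 d)‖ₑ := by
        rw [← ofReal_norm, ← ofReal_norm, Lp.norm_fourier_eq]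
      rw [this, enorm_L2_eq, ← ENNReal.rpow_natCast, ← ENNReal.rpow_mul]
      norm_num
    calc ∫⁻ η in A, f η ≤ ∫⁻ η in A, ‖(𝓕 D : L2 d) η‖ₑ ^ 2 := by
          refine setLIntegral_mono_ae' hAm (ae_of_all _ fun η hη => ?_)
          refine mul_le_of_le_one_left' ?_
          rw [ENNReal.ofReal_le_one]
          exact Real.rpow_le_one_of_one_le_of_nonpos hη (by linarith)
      _ ≤ ∫⁻ η, ‖(𝓕 D : L2 d) η‖ₑ ^ 2 := setLIntegral_le_lintegral _ _
      _ ≤ ENNReal.ofReal M ^ 2 := by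
          rw [← h2, ← ofReal_norm]
          gcongr
  -- each low-frequency shell
  have h3 : ∀ n, ∫⁻ η in s n, f η ≤ ENNReal.ofReal (c * ρ ^ (n + 1)) := by
    intro n
    set k : ℤ := -((n : ℤ) + 1) with hkn
    have hN : (0 : ℝ) < (2 : ℝ) ^ k := by positivity
    refine (lintegral_shell_le hφ D σ hN).trans ?_
    have e1 : (2 : ℝ) * (2 : ℝ) ^ k = (2 : ℝ) ^ (k + 1) := by
      rw [zpow_add_one₀ two_ne_zero, mul_comm]
    have k1 := hk k
    have k2 := hk (k + 1)
    rw [← e1] at k2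
    rw [← ofReal_norm, ← ofReal_norm, ← ENNReal.ofReal_pow (norm_nonneg _),
      ← ENNReal.ofReal_pow (norm_nonneg _), ← ENNReal.ofReal_add (by positivity) (by positivity),
      ← ENNReal.ofReal_mul (by positivity)]
    refine ENNReal.ofReal_le_ofReal ?_
    have e2 : ρ ^ (n + 1) = ((2 : ℝ) ^ k) ^ (2 * σ) * (((2 : ℝ) ^ k) ^ κ) ^ 2 := by
      rw [← Real.rpow_natCast (((2 : ℝ) ^ k) ^ κ) 2, ← Real.rpow_mul hN.le, ← Real.rpow_add hN,
        ← Real.rpow_intCast 2 k, ← Real.rpow_mul two_pos.le, hρ, ← Real.rpow_natCast,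
        ← Real.rpow_mul two_pos.le]
      congr 1
      rw [hkn, ← hκ]
      push_cast
      ring
    have e3 : ((2 * (2 : ℝ) ^ k) ^ κ) ^ 2 = 2 ^ (2 * κ) * (((2 : ℝ) ^ k) ^ κ) ^ 2 := by
      rw [Real.mul_rpow two_pos.le hN.le, mul_pow, ← Real.rpow_natCast ((2 : ℝ) ^ κ) 2,
        ← Real.rpow_mul two_pos.le]
      push_cast
      rw [mul_comm κ]
    have k1' := pow_le_pow_left₀ (norm_nonneg _) k1 2
    have k2' := pow_le_pow_left₀ (norm_nonneg _) k2 2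
    rw [mul_pow] at k1' k2'
    rw [e3] at k2'
    calc _ ≤ 2 * 2 ^ (2 * |σ|) * ((2 : ℝ) ^ k) ^ (2 * σ) * (K ^ 2 * (((2 : ℝ) ^ k) ^ κ) ^ 2 +
          K ^ 2 * (2 ^ (2 * κ) * (((2 : ℝ) ^ k) ^ κ) ^ 2)) := by gcongr
      _ = c * ρ ^ (n + 1) := by
          rw [e2, hc]
          ring
  have hcover : ∀ᵐ η : Space d, η ∈ A ∪ ⋃ n, s n := by
    filter_upwards [ae_lapSym_pos hd] with η hη
    by_cases hη1 : 1 ≤ ‖(2 * Real.pi) • η‖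
    · exact Or.inl hη1
    · right
      have hpos : 0 < ‖(2 * Real.pi) • η‖ := by
        unfold lapSym at hη
        exact lt_of_le_of_ne (norm_nonneg _) (sq_pos_iff.1 hη).symm
      obtain ⟨k, hk1, hk2⟩ := exists_mem_Ioc_zpow hpos one_lt_two
      have hk0 : k < 0 := by
        by_contra h
        exact hη1 ((one_le_zpow₀ one_le_two (not_lt.1 h)).trans hk1.le)
      obtain ⟨n, hn⟩ : ∃ n : ℕ, k = -((n : ℤ) + 1) := ⟨(-k - 1).toNat, by omega⟩
      refine mem_iUnion.2 ⟨n, ?_⟩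
      rw [hs, mem_ofPred_eq, ← hn]
      refine ⟨hk1, hk2.trans (le_of_eq ?_)⟩
      rw [zpow_add_one₀ two_ne_zero, mul_comm]
  calc ∫⁻ η, f η = ∫⁻ η in A ∪ ⋃ n, s n, f η := by
        rw [Measure.restrict_eq_self_of_ae_mem hcover]
    _ ≤ (∫⁻ η in A, f η) + ∫⁻ η in ⋃ n, s n, f η := lintegral_union_le _ _ _
    _ ≤ (∫⁻ η in A, f η) + ∑' n, ∫⁻ η in s n, f η := by
        gcongr
        exact lintegral_iUnion_le _ _
    _ ≤ S := by
        rw [hS]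
        gcongr
        exact h3 _

/-! ### Negative regularity -/

theorem lintegral_potExp_lt_top_of_energy (hd : 9 ≤ d) {f : Space d → ℂ} (hE : energy f < ∞) :
    ∫⁻ x, ‖f x‖ₑ ^ potExp d < ∞ := by
  have h9 : (9 : ℝ) ≤ d := by exact_mod_cast hd
  have h1 := (ENNReal.add_lt_top.1 hE).2
  by_contra h
  rw [not_lt, top_le_iff] at h
  refine h1.ne ?_
  have h2 : ENNReal.ofReal (((d : ℝ) - 4) / (2 * d)) ≠ 0 := by
    rw [ENNReal.ofReal_ne_zero_iff]
    exact div_pos (by linarith) (by linarith)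
  unfold potExp at h
  rw [h, ENNReal.mul_top h2]

namespace IsL2Solution

variable {u : ℝ → Space d → ℂ} {v : ℝ × Space d → ℂ} {U : ℝ → 𝓢'(Space d, ℂ)} {D : ℝ → L2 d}

/-- Almost periodicity with frequency scale bounded below localizes `Δu(t)` to balls whose radius
does not depend on time. -/
theorem exists_radius (hs : IsL2Solution u v U D) (hd : 9 ≤ d) {N : ℝ → ℝ} {x : ℝ → Space d}
    {C : ℝ → ℝ} (hap : IsAlmostPeriodic u N x C) (hN : ∀ t, 1 ≤ N t) (η : ℝ) (hη : 0 < η) :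
    ∃ R : ℝ, ∀ t, ∫⁻ y in {y | R ≤ ‖y - x t‖}, ‖D t y‖ₑ ^ 2 ≤ ENNReal.ofReal η := by
  refine ⟨C η, fun t => ?_⟩
  obtain ⟨w, w', ⟨T, hT, hw⟩, hw', h⟩ := hap.compactness t
  rw [hT.unique_right (hs.represents t)] at hw
  have h1 := represents_neg_of_laplacian (by omega) (hs.fourier t) hw
  refine le_trans ?_ (h η hη).1
  calc ∫⁻ y in {y | C η ≤ ‖y - x t‖}, ‖D t y‖ₑ ^ 2
      = ∫⁻ y in {y | C η ≤ ‖y - x t‖}, ‖w y‖ₑ ^ 2 := by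
        refine lintegral_congr_ae ?_
        filter_upwards [ae_restrict_of_ae h1] with y hy
        rw [hy, enorm_neg]
    _ ≤ _ := lintegral_mono_set fun y hy =>
        (div_le_self (hap.modulus_pos η hη).le (hN t)).trans hy

theorem ae_rNorm_lpSym_le (hs : IsL2Solution u v U D) (hd : 9 ≤ d) {φ : Space d → ℝ}
    (hφ : IsBump φ) {r s : ℝ} {B : ℝ≥0∞} (hB : B < ∞)
    (hF : ∀ᵐ t : ℝ, besovNorm φ s r (fun y => nonlin d (u t y)) ≤ B) (k : ℤ) :
    ∀ᵐ t, MemLp (fourierMulL (lpSym φ ((2 : ℝ) ^ k)) (forcing v t)) (ENNReal.ofReal r) ∧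
      rNorm volume r (fourierMulL (lpSym φ ((2 : ℝ) ^ k)) (forcing v t))
        ≤ B.toReal * ((2 : ℝ) ^ k) ^ (-s) := by
  filter_upwards [hF, hs.ae_eq, ae_lintegral_stExp_lt_top hs.measurable hs.lq] with t h1 h2 h3
  have hN : (0 : ℝ) < (2 : ℝ) ^ k := by positivity
  have h4 : (fun y => nonlin d (u t y)) =ᵐ[volume] forcing v t := by
    filter_upwards [h2, forcing_ae_eq hd hs.measurable h3] with y h5 h6
    rw [h5, h6]
  have h5 : ENNReal.ofReal (((2 : ℝ) ^ k) ^ s) * eLpNorm (fourierMulL (lpSym φ ((2 : ℝ) ^ k))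
      (forcing v t)) (ENNReal.ofReal r) volume ≤ B := by
    refine le_trans ?_ ((le_iSup (fun k : ℤ => ENNReal.ofReal (((2 : ℝ) ^ k) ^ s) *
      opNorm (lpProj φ ((2 : ℝ) ^ k)) (ENNReal.ofReal r) (fun y => nonlin d (u t y))) k).trans h1)
    gcongr
    exact eLpNorm_fourierMulL_le_opNorm
      (m := fun ξ => ((φ (((2 : ℝ) ^ k)⁻¹ • ξ) - φ ((2 / (2 : ℝ) ^ k) • ξ) : ℝ) : ℂ))
      (hφ.hasTemperateGrowth_lpSym hN) (hφ.memLp_lpSym _) h4 _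
  have h6 : eLpNorm (fourierMulL (lpSym φ ((2 : ℝ) ^ k)) (forcing v t)) (ENNReal.ofReal r) volume
      ≤ ENNReal.ofReal (B.toReal * ((2 : ℝ) ^ k) ^ (-s)) := by
    rw [ENNReal.ofReal_mul ENNReal.toReal_nonneg, ENNReal.ofReal_toReal hB.ne,
      Real.rpow_neg hN.le, ENNReal.ofReal_inv_of_pos (by positivity), ← div_eq_mul_inv,
      ENNReal.le_div_iff_mul_le (Or.inl (by
        rw [ENNReal.ofReal_ne_zero_iff]
        positivity)) (Or.inl ENNReal.ofReal_ne_top), mul_comm]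
    exact h5
  exact ⟨⟨Lp.aestronglyMeasurable _, h6.trans_lt ENNReal.ofReal_lt_top⟩,
    ENNReal.toReal_le_of_le_ofReal (by positivity) h6⟩

end IsL2Solution

theorem one_lt_of_lower_bound (hd : 9 ≤ d) {r : ℝ}
    (hr : 2 * (d : ℝ) * (d + 4) * (d - 4) / ((d : ℝ) ^ 3 + 8 * d ^ 2 - 16 * d - 64) ≤ r) :
    1 < r := by
  have h9 : (9 : ℝ) ≤ d := by exact_mod_cast hd
  refine lt_of_lt_of_le ?_ hr
  have h1 : 0 ≤ (d : ℝ) ^ 2 * ((d : ℝ) - 9) := by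
    have : 0 ≤ (d : ℝ) - 9 := by linarith
    positivity
  rw [lt_div_iff₀ (by nlinarith)]
  nlinarith

end

end FourthOrderNLS

theorem proposition5p4 (d : ℕ) (hd : 9 ≤ d)
    (φ : FourthOrderNLS.Space d → ℝ) (hφ : FourthOrderNLS.IsBump φ)
    (t₀ : ℝ) (u : ℝ → FourthOrderNLS.Space d → ℂ)
    (hu : FourthOrderNLS.IsGlobalSolution t₀ u)
    (N : ℝ → ℝ) (x : ℝ → FourthOrderNLS.Space d) (C : ℝ → ℝ)
    (hap : FourthOrderNLS.IsAlmostPeriodic u N x C)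
    (hE : FourthOrderNLS.energy (u t₀) < ∞)
    (hN : ∀ t, 1 ≤ N t)
    (r s : ℝ)
    (hr₁ : 2 * (d : ℝ) * (d + 4) * (d - 4) / ((d : ℝ) ^ 3 + 8 * d ^ 2 - 16 * d - 64) ≤ r)
    (hr₂ : r < 2 * (d : ℝ) / (d + 8))
    (hs₀ : 0 ≤ s) (hs₂ : s ≤ 2)
    (hF : ∃ B : ℝ≥0∞, B < ∞ ∧
      ∀ᵐ t : ℝ, FourthOrderNLS.besovNorm φ s r (fun y => FourthOrderNLS.nonlin d (u t y)) ≤ B) :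
    ∃ s₀ : ℝ, s₀ = (d : ℝ) / r - ((d : ℝ) + 8) / 2 ∧ 0 < s₀ ∧
      ∀ ε : ℝ, 0 < ε → s - s₀ + ε ≤ 2 →
        ∃ B : ℝ≥0∞, B < ∞ ∧ ∀ t : ℝ, FourthOrderNLS.hdotNorm (s - s₀ + ε) (u t) ≤ B := by
  have h9 : (9 : ℝ) ≤ d := by exact_mod_cast hd
  have hd1 : 1 ≤ d := by omega
  have hr1 : 1 < r := FourthOrderNLS.one_lt_of_lower_bound hd hr₁
  refine ⟨_, rfl, ?_, fun ε hε hσ => ?_⟩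
  · rw [lt_div_iff₀ (by linarith)] at hr₂
    have e : (d : ℝ) / r - ((d : ℝ) + 8) / 2 = (2 * d - r * (d + 8)) / (2 * r) := by
      field_simp
    rw [e]
    exact div_pos (by linarith) (by linarith)
  obtain ⟨v, U, D, hs⟩ := FourthOrderNLS.exists_isL2Solution hd hu
  obtain ⟨B, hB, hF⟩ := hF
  obtain ⟨M, hM⟩ := hs.exists_norm_le hd (FourthOrderNLS.lintegral_potExp_lt_top_of_energy hd hE)
  have hw := FourthOrderNLS.tendsto_inner_flow (by omega : 3 ≤ d) hM x (hs.exists_radius hd hap hN)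
  set s₀ : ℝ := (d : ℝ) / r - ((d : ℝ) + 8) / 2 with hs0
  obtain ⟨B', hB', hbound⟩ := FourthOrderNLS.exists_hdot_bound hφ hd1 (σ := s - s₀ + ε)
    (κ := s₀ - s) (ε := ε) (M := M) (K := FourthOrderNLS.decayConst d r * B.toReal) hσ hε (by ring)
  refine ⟨B', hB', fun t => ?_⟩
  rw [FourthOrderNLS.hdotNorm_eq_of_laplacian hd1 (hs.represents t) (hs.fourier t)]
  refine hbound (D t) (hM t) fun k => ?_
  have hN0 : (0 : ℝ) < (2 : ℝ) ^ k := by positivity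
  have hsupp : ∀ η : FourthOrderNLS.Space d, FourthOrderNLS.lpSym φ ((2 : ℝ) ^ k) η ≠ 0 →
      ‖(2 * Real.pi) • η‖ ≤ 2 * (2 : ℝ) ^ k := by
    intro η hη
    by_contra h
    exact hη (hφ.lpSym_eq_zero_of_lt hN0 (by linarith))
  refine (hs.norm_fourierMulL_le hd hw hr1 hr₂ (hφ.memLp_lpSym _) (hφ.memLp_lpSym_mul_inv hN0) hN0
    hsupp (by positivity) (hs.ae_rNorm_lpSym_le hd hφ hB hF k) t).trans (le_of_eq ?_)
  rw [sub_eq_add_neg s₀ s, Real.rpow_add hN0]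
  ring
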